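/- Let $n\ge 2$ and let $J=(J_{ik})$ be a real skew-symmetric $n\times n$ matrix. Write $e[t]=e^{2\pi i t}$, $\bar e[t]=e^{-2\pi i t}$, $\beta(x,y)=x\cdot y$ on $\mathbb R^n$, and, for $y\in\mathbb R^n$, write $\mathbf J(y)=\sum_{i,k}J_{ik}y_k\mathbf x_i\in\mathbb R^n$ (the vector with $i$-th coordinate $\sum_k J_{ik}y_k$). Let $H/Z=\mathbb R^n\times\mathbb R^n$ (additive group, elements $(x,y)$; the Heisenberg group modulo its centre) and $G_1=\mathbb R$ (elements $r$), with Lebesgue measures. Let $\gamma$ be the trivial action of $H/Z$ on $G_1$, and let $\alpha$ be the action of $G_1$ on $H/Z$ given by $\alpha_r(x,y)=(x+r\mathbf J(y),y)$. For $r\in G_1$ let $$\sigma^r\bigl((x,y),(x',y')\bigr)=\bar e\Bigl[\tfrac{r^2}{2}\sum_{i,k}J_{ik}y_ky'_i\Bigr]\,\bar e\bigl[r\beta(x,y')\bigr],$$ a continuous field of $\mathbb T$-valued normalized 2-cocycles on $H/Z$. Crossed products are the full (twisted) crossed products, that is, the completions of $C_c(G,C_0(X))$ in the supremum of the norms given by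 all covariant representations. Let $\mathcal H=L^2(H/Z\times G_1)$. Define unitary operators $Z$ on $\mathcal H$, $X$ on $L^2(G_1\times G_1)$ and $Y$ on $L^2(H/Z\times H/Z)$ by $$Z\xi(x,y;r)=\xi(x+r\mathbf J(y),y;r),\quad X\xi(r;r')=\xi(r+r';r'),\quad Y\zeta(x,y;x',y')=\zeta(x,y;x'-x,y'-y).$$ (1) Let $V=(Z_{12}X_{24}Z_{12}^*)Y_{13}\in\mathcal B(\mathcal H\otimes\mathcal H)=\mathcal B\bigl(L^2(H/Z\times G_1\times H/Z\times G_1)\bigr)$ (leg notation). Then $V$ is a multiplicative unitary, i.e. it is unitary and $V_{12}V_{13}V_{23}=V_{23}V_{12}$. The norm closures $$A_V=\overline{\{(\omega\otimes\mathrm{id})(V):\omega\in\mathcal B(\mathcal H)_*\}},\qquad \hat A_V=\overline{\{(\mathrm{id}\otimes\omega)(V):\omega\in\mathcal B(\mathcal H)_*\}}$$ are $C^*$-algebras, nondegenerate on $\mathcal H$, and $$A_V\cong C_0(G_1)\rtimes_\gamma(H/Z),\qquad \hat A_V\cong C_0(H/Z)\rtimes_\alpha G_1 .$$ With $\Delta_V(a)=V(a\otimes1)V^*$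 and $\hat\Delta_V(b)=V^*(1\otimes b)V$ they are $C^*$-bialgebras (the comultiplication $\Delta$ is a nondegenerate coassociative $*$-homomorphism from the algebra $A$ to $M(A\otimes A)$, with the spatial tensor product). They are mutually dual: the pairing $\langle(\omega\otimes\mathrm{id})(V),(\mathrm{id}\otimes\omega')(V)\rangle=(\omega\otimes\omega')(V)$ turns the product of each of them into the comultiplication of the other. (2) Let $\Theta$ be the unitary operator on $\mathcal H\otimes\mathcal H$ of multiplication by the function $$\Theta(x,y,r;x',y',r')=\bar e\bigl[r'\beta(x,y')\bigr]\,\bar e\Bigl[\tfrac{r'^2}{2}\sum_{i,k}J_{ik}y_ky'_i\Bigr].$$ Then $\Theta$ is a cocycle for $V$, i.e. $$(V_{13}V_{23})^*\Theta_{12}(V_{13}V_{23})\cdot V_{23}^*\Theta_{13}V_{23}\cdot\Theta_{23}=V_{12}^*\Theta_{23}V_{12}\cdot\Theta_{12},$$ and $V_\Theta=V\Theta$ is a multiplicative unitary. Specifically, for $\xi\in\mathcal H\otimes\mathcal H$ and almost all arguments, $$V_\Theta\xi(x,y,r;x',y',r')=e\Bigl[\tfrac{r'^2}{2}\sum_{i,k}J_{ik}y_k(y'_i-y_i)\Bigr]\,\bar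 e\bigl[r'\beta(x,y'-y)\bigr]\;\xi\bigl(x-r'\mathbf J(y),\,y,\,r+r';\;x'-x+r'\mathbf J(y),\,y'-y,\,r'\bigr).$$ The norm closures $S$ and $\hat S$ of $\{(\omega\otimes\mathrm{id})(V_\Theta):\omega\in\mathcal B(\mathcal H)_*\}$ and $\{(\mathrm{id}\otimes\omega)(V_\Theta):\omega\in\mathcal B(\mathcal H)_*\}$ are $C^*$-algebras, nondegenerate on $\mathcal H$, with $$S\cong C_0(G_1)\rtimes^\sigma_\gamma(H/Z),\qquad \hat S\cong C_0(H/Z)\rtimes_\alpha G_1,$$ and they are $C^*$-bialgebras with $\Delta(a)=V_\Theta(a\otimes1)V_\Theta^*$ for $a\in S$ and $\hat\Delta(b)=V_\Theta^*(1\otimes b)V_\Theta$ for $b\in\hat S$. -/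

import Mathlib

open MeasureTheory Topology ZeroAtInfty CompactlySupported
open scoped ENNReal InnerProductSpace

noncomputable section

namespace QG

/-- The Hilbert space `L²(X)`. -/
abbrev L2 (X : Type) [MeasureSpace X] : Type := Lp ℂ 2 (volume : Measure X)

/-- The bounded operators on `L²(X)`. -/
abbrev B (X : Type) [MeasureSpace X] : Type := L2 X →L[ℂ] L2 X

section Tensor

variable {X Y : Type} [MeasureSpace X] [MeasureSpace Y]
  [SigmaFinite (volume : Measure X)] [SigmaFinite (volume : Measure Y)]

set_option linter.unusedSectionVars false in
theorem memLp_tmul (ξ : L2 X) (ζ : L2 Y) :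
    MemLp (fun p : X × Y => ξ p.1 * ζ p.2) 2 (volume : Measure (X × Y)) := by
  have h1 := (memLp_two_iff_integrable_sq_norm (Lp.aestronglyMeasurable ξ)).1 (Lp.memLp ξ)
  have h2 := (memLp_two_iff_integrable_sq_norm (Lp.aestronglyMeasurable ζ)).1 (Lp.memLp ζ)
  have hm : AEStronglyMeasurable (fun p : X × Y => ξ p.1 * ζ p.2)
      (volume : Measure (X × Y)) :=
    (Lp.aestronglyMeasurable ξ).comp_fst.mul (Lp.aestronglyMeasurable ζ).comp_snd
  rw [memLp_two_iff_integrable_sq_norm hm]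
  refine (h1.mul_prod h2).congr (Filter.Eventually.of_forall fun p => ?_)
  simp [mul_pow]

/-- The vector `ξ ⊗ ζ` of `L²(X × Y) = L²(X) ⊗ L²(Y)`, that is `(ξ ⊗ ζ)(x, y) = ξ(x) ζ(y)`. -/
def tmulFun (ξ : L2 X) (ζ : L2 Y) : L2 (X × Y) := (memLp_tmul ξ ζ).toLp _

theorem tmulFun_coe (ξ : L2 X) (ζ : L2 Y) :
    (tmulFun ξ ζ : X × Y → ℂ) =ᵐ[volume] fun p => ξ p.1 * ζ p.2 :=
  MemLp.coeFn_toLp _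

theorem inner_tmulFun (ξ ξ' : L2 X) (ζ ζ' : L2 Y) :
    ⟪tmulFun ξ ζ, tmulFun ξ' ζ'⟫_ℂ = ⟪ξ, ξ'⟫_ℂ * ⟪ζ, ζ'⟫_ℂ := by
  rw [L2.inner_def, L2.inner_def, L2.inner_def]
  have : ∫ p, ⟪tmulFun ξ ζ p, tmulFun ξ' ζ' p⟫_ℂ ∂(volume : Measure (X × Y)) =
      ∫ p : X × Y, ⟪ξ p.1, ξ' p.1⟫_ℂ * ⟪ζ p.2, ζ' p.2⟫_ℂ
        ∂((volume : Measure X).prod (volume : Measure Y)) := by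
    refine integral_congr_ae ?_
    filter_upwards [tmulFun_coe ξ ζ, tmulFun_coe ξ' ζ'] with p h1 h2
    rw [h1, h2]
    simp [mul_comm, mul_assoc, mul_left_comm]
  rw [this, integral_prod_mul (fun x => ⟪ξ x, ξ' x⟫_ℂ) (fun y => ⟪ζ y, ζ' y⟫_ℂ)]

theorem norm_tmulFun (ξ : L2 X) (ζ : L2 Y) : ‖tmulFun ξ ζ‖ = ‖ξ‖ * ‖ζ‖ := by
  have h := inner_tmulFun ξ ξ ζ ζ
  rw [inner_self_eq_norm_sq_to_K, inner_self_eq_norm_sq_to_K, inner_self_eq_norm_sq_to_K,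
    ← mul_pow] at h
  have h' : ‖tmulFun ξ ζ‖ ^ 2 = (‖ξ‖ * ‖ζ‖) ^ 2 := by exact_mod_cast h
  exact (pow_left_inj₀ (norm_nonneg _) (by positivity) two_ne_zero).1 h'

/-- The bilinear map `(ξ, ζ) ↦ ξ ⊗ ζ`. -/
def tmul : L2 X →L[ℂ] L2 Y →L[ℂ] L2 (X × Y) :=
  LinearMap.mkContinuous₂
    (LinearMap.mk₂ ℂ tmulFun
      (fun ξ ξ' ζ => by
        apply Lp.ext
        have := (Measure.quasiMeasurePreserving_fst (μ := (volume : Measure X))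
          (ν := (volume : Measure Y))).ae_eq_comp (Lp.coeFn_add ξ ξ')
        filter_upwards [tmulFun_coe (ξ + ξ') ζ, tmulFun_coe ξ ζ, tmulFun_coe ξ' ζ,
          Lp.coeFn_add (tmulFun ξ ζ) (tmulFun ξ' ζ), this] with p h1 h2 h3 h4 h5
        simp only [Function.comp_apply, Pi.add_apply] at h5
        rw [h1, h4, Pi.add_apply, h2, h3, h5, add_mul])
      (fun c ξ ζ => by
        apply Lp.ext
        have := (Measure.quasiMeasurePreserving_fst (μ := (volume : Measure X))
          (ν := (volume : Measure Y))).ae_eq_comp (Lp.coeFn_smul c ξ)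
        filter_upwards [tmulFun_coe (c • ξ) ζ, tmulFun_coe ξ ζ,
          Lp.coeFn_smul c (tmulFun ξ ζ), this] with p h1 h2 h4 h5
        simp only [Function.comp_apply, Pi.smul_apply, smul_eq_mul] at h5
        rw [h1, h4, Pi.smul_apply, h2, h5, smul_eq_mul, mul_assoc])
      (fun ξ ζ ζ' => by
        apply Lp.ext
        have := (Measure.quasiMeasurePreserving_snd (μ := (volume : Measure X))
          (ν := (volume : Measure Y))).ae_eq_comp (Lp.coeFn_add ζ ζ')
        filter_upwards [tmulFun_coe ξ (ζ + ζ'), tmulFun_coe ξ ζ, tmulFun_coe ξ ζ',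
          Lp.coeFn_add (tmulFun ξ ζ) (tmulFun ξ ζ'), this] with p h1 h2 h3 h4 h5
        simp only [Function.comp_apply, Pi.add_apply] at h5
        rw [h1, h4, Pi.add_apply, h2, h3, h5, mul_add])
      (fun c ξ ζ => by
        apply Lp.ext
        have := (Measure.quasiMeasurePreserving_snd (μ := (volume : Measure X))
          (ν := (volume : Measure Y))).ae_eq_comp (Lp.coeFn_smul c ζ)
        filter_upwards [tmulFun_coe ξ (c • ζ), tmulFun_coe ξ ζ,
          Lp.coeFn_smul c (tmulFun ξ ζ), this] with p h1 h2 h4 h5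
        simp only [Function.comp_apply, Pi.smul_apply, smul_eq_mul] at h5
        rw [h1, h4, Pi.smul_apply, h2, h5, smul_eq_mul, mul_left_comm]))
    1 (fun ξ ζ => by simp [norm_tmulFun])

theorem tmul_apply (ξ : L2 X) (ζ : L2 Y) : tmul ξ ζ = tmulFun ξ ζ := rfl

/-- The simple tensors are total in `L²(X × Y)`. -/
theorem eq_zero_of_inner_tmul (F : L2 (X × Y)) (hF : ∀ ξ ζ, ⟪tmul ξ ζ, F⟫_ℂ = 0) : F = 0 := by
  have key : ∀ (S : Set X) (T : Set Y), MeasurableSet S → MeasurableSet T →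
      volume S < ∞ → volume T < ∞ → ∫ p in S ×ˢ T, F p = 0 := by
    intro S T hS hT hS' hT'
    have h := hF (indicatorConstLp 2 hS hS'.ne 1) (indicatorConstLp 2 hT hT'.ne 1)
    rw [L2.inner_def] at h
    rw [← integral_indicator (hS.prod hT), ← h]
    refine integral_congr_ae ?_
    have e1 := (Measure.quasiMeasurePreserving_fst (μ := (volume : Measure X))
          (ν := (volume : Measure Y))).ae_eq_comp
          (indicatorConstLp_coeFn (p := 2) (hs := hS) (hμs := hS'.ne) (c := (1 : ℂ)))
    have e2 := (Measure.quasiMeasurePreserving_snd (μ := (volume : Measure X))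
          (ν := (volume : Measure Y))).ae_eq_comp
          (indicatorConstLp_coeFn (p := 2) (hs := hT) (hμs := hT'.ne) (c := (1 : ℂ)))
    filter_upwards [tmulFun_coe (indicatorConstLp 2 hS hS'.ne (1 : ℂ))
      (indicatorConstLp 2 hT hT'.ne (1 : ℂ)), e1, e2] with p h1 h2 h3
    simp only [Function.comp_apply] at h2 h3
    rw [tmul_apply, h1, h2, h3]
    by_cases hp1 : p.1 ∈ S <;> by_cases hp2 : p.2 ∈ T <;>
      simp [Set.indicator, hp1, hp2]
  have hint : ∀ s : Set (X × Y), MeasurableSet s → volume s < ∞ → IntegrableOn F s := by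
    intro s hs hs'
    exact integrableOn_Lp_of_measure_ne_top F (by norm_num) hs'.ne
  have key2 : ∀ (S : Set X) (T : Set Y), MeasurableSet S → MeasurableSet T →
      volume S < ∞ → volume T < ∞ → ∀ s : Set (X × Y), MeasurableSet s →
      ∫ p in s ∩ S ×ˢ T, F p = 0 := by
    intro S T hS hT hS' hT' s hs
    have hR : MeasurableSet (S ×ˢ T) := hS.prod hT
    have hRf : volume (S ×ˢ T) < ∞ := by
      rw [Measure.volume_eq_prod, Measure.prod_prod]
      exact ENNReal.mul_lt_top hS' hT'
    have hI : IntegrableOn F (S ×ˢ T) := hint _ hR hRf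
    induction s, hs using MeasurableSpace.induction_on_inter generateFrom_prod.symm
      isPiSystem_prod with
    | empty => simp
    | basic t ht =>
      obtain ⟨S₁, hS₁, T₁, hT₁, rfl⟩ := ht
      rw [Set.prod_inter_prod]
      exact key _ _ (hS₁.inter hS) (hT₁.inter hT)
        ((measure_mono Set.inter_subset_right).trans_lt hS')
        ((measure_mono Set.inter_subset_right).trans_lt hT')
    | compl t ht ih =>
      have h1 := integral_inter_add_sdiff (f := F) (s := S ×ˢ T) (t := t) ht hI
      rw [Set.inter_comm, ih, zero_add, key S T hS hT hS' hT'] at h1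
      rw [Set.inter_comm, ← Set.sdiff_eq]
      exact h1
    | iUnion f hd hm ih =>
      rw [Set.iUnion_inter, integral_iUnion (fun i => (hm i).inter hR)
        (fun i j hij => (hd hij).mono Set.inter_subset_left Set.inter_subset_left)
        (hI.mono_set (Set.iUnion_subset fun i => Set.inter_subset_right))]
      simp [ih]
  refine (Lp.eq_zero_iff_ae_eq_zero).2 ?_
  refine Lp.ae_eq_zero_of_forall_setIntegral_eq_zero F (by norm_num) (by norm_num)
    (fun s hs hs' => hint s hs hs') (fun s hs hs' => ?_)
  let S : ℕ → Set X := spanningSets (volume : Measure X)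
  let T : ℕ → Set Y := spanningSets (volume : Measure Y)
  have hU : (⋃ i, s ∩ S i ×ˢ T i) = s := by
    rw [← Set.inter_iUnion, Set.iUnion_prod_of_monotone (monotone_spanningSets _)
      (monotone_spanningSets _), iUnion_spanningSets, iUnion_spanningSets]
    simp
  have hlim := tendsto_setIntegral_of_monotone (μ := (volume : Measure (X × Y))) (f := F)
    (s := fun i => s ∩ S i ×ˢ T i)
    (fun i => hs.inter ((measurableSet_spanningSets _ i).prod (measurableSet_spanningSets _ i)))
    (fun i j hij => Set.inter_subset_inter_right _
      (Set.prod_mono (monotone_spanningSets _ hij) (monotone_spanningSets _ hij)))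
    (by rw [hU]; exact hint s hs hs')
  rw [hU] at hlim
  refine tendsto_nhds_unique hlim ?_
  have : (fun i => ∫ p in s ∩ S i ×ˢ T i, F p) = fun _ => (0 : ℂ) := by
    funext i
    exact key2 _ _ (measurableSet_spanningSets _ i) (measurableSet_spanningSets _ i)
      (measure_spanningSets_lt_top _ i) (measure_spanningSets_lt_top _ i) s hs
  rw [this]
  exact tendsto_const_nhds

theorem ext_tmul {E : Type*} [NormedAddCommGroup E] [NormedSpace ℂ E]
    {S T : L2 (X × Y) →L[ℂ] E} (h : ∀ ξ ζ, S (tmul ξ ζ) = T (tmul ξ ζ)) : S = T := by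
  let D : Submodule ℂ (L2 (X × Y)) := Submodule.span ℂ {v | ∃ ξ ζ, v = tmul ξ ζ}
  have hD : Dᗮ = ⊥ := by
    rw [Submodule.eq_bot_iff]
    intro F hF
    refine eq_zero_of_inner_tmul F fun ξ ζ => ?_
    exact (Submodule.mem_orthogonal _ _).1 hF _ (Submodule.subset_span ⟨ξ, ζ, rfl⟩)
  have hd : Dense (D : Set (L2 (X × Y))) :=
    Submodule.dense_iff_topologicalClosure_eq_top.2
      (Submodule.topologicalClosure_eq_top_iff.2 hD)
  refine ContinuousLinearMap.ext_on hd ?_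
  rintro v ⟨ξ, ζ, rfl⟩
  exact h ξ ζ

/-- `ξ ↦ ξ ⊗ ζ` for a unit vector `ζ`. -/
def tmulIsom (ζ : L2 Y) (hζ : ‖ζ‖ = 1) : L2 X →ₗᵢ[ℂ] L2 (X × Y) where
  toLinearMap := ((tmul (X := X) (Y := Y)).flip ζ).toLinearMap
  norm_map' ξ := by
    change ‖tmulFun ξ ζ‖ = ‖ξ‖
    rw [norm_tmulFun, hζ, mul_one]

theorem exists_ampl (T : B X) :
    ∃ T' : B (X × Y), ∀ ξ ζ, T' (tmul ξ ζ) = tmul (T ξ) ζ := by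
  classical
  obtain ⟨w, b, -⟩ := exists_hilbertBasis ℂ (L2 Y)
  let V : w → (L2 X →ₗᵢ[ℂ] L2 (X × Y)) := fun i => tmulIsom (b i) (b.orthonormal.1 i)
  have hV : OrthogonalFamily ℂ (fun _ : w => L2 X) V := by
    intro i j hij ξ ξ'
    change ⟪tmulFun ξ (b i), tmulFun ξ' (b j)⟫_ℂ = 0
    rw [inner_tmulFun, b.orthonormal.2 hij, mul_zero]
  let I : lp (fun _ : w => L2 X) 2 →L[ℂ] L2 (X × Y) := hV.linearIsometry.toContinuousLinearMap
  let T₂ : lp (fun _ : w => L2 X) 2 →L[ℂ] lp (fun _ : w => L2 X) 2 :=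
    lp.mapCLM 2 (fun _ => T) (norm_nonneg T) (fun _ => le_rfl)
  refine ⟨I ∘L T₂ ∘L ContinuousLinearMap.adjoint I, fun ξ ζ => ?_⟩
  have hI : ∀ x, ContinuousLinearMap.adjoint I (I x) = x := by
    intro x
    refine ext_inner_left ℂ fun y => ?_
    rw [ContinuousLinearMap.adjoint_inner_right]
    exact hV.linearIsometry.inner_map_map y x
  have hs : ∀ i (η : L2 X), I (lp.single 2 i η) = tmul η (b i) := fun i η =>
    hV.linearIsometry_apply_single η
  have hT : ∀ i (η : L2 X), T₂ (lp.single 2 i η) = lp.single 2 i (T η) := by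
    intro i η
    ext j : 2
    simp only [T₂, lp.mapCLM_apply_coe]
    by_cases h : j = i
    · subst h; simp
    · simp [h]
  have : (I ∘L T₂ ∘L ContinuousLinearMap.adjoint I) ∘L (tmul ξ) = tmul (T ξ) := by
    refine ContinuousLinearMap.ext_on
      (Submodule.dense_iff_topologicalClosure_eq_top.2 b.dense_span) ?_
    rintro _ ⟨i, rfl⟩
    change I (T₂ (ContinuousLinearMap.adjoint I (tmul ξ (b i)))) = tmul (T ξ) (b i)
    rw [← hs, hI, hT, hs]
  exact DFunLike.congr_fun this ζ

/-- For `T ∈ B(L²(X))`, the operator `T ⊗ 1` on `L²(X × Y) = L²(X) ⊗ L²(Y)`. -/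
def ampl (T : B X) : B (X × Y) := (exists_ampl T).choose

theorem ampl_tmul (T : B X) (ξ : L2 X) (ζ : L2 Y) :
    ampl T (tmul ξ ζ) = tmul (T ξ) ζ := (exists_ampl T).choose_spec ξ ζ

/-- `T ⊗ 1` is characterised by its values on simple tensors. -/
theorem ampl_unique (T : B X) (T' : B (X × Y)) (h : ∀ ξ ζ, T' (tmul ξ ζ) = tmul (T ξ) ζ) :
    T' = ampl T := ext_tmul fun ξ ζ => by rw [h, ampl_tmul]

/-- The operator `ξ ↦ ξ ∘ φ` for a measure preserving map `φ`. -/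
def compOp (φ : X → Y) (hφ : MeasurePreserving φ) : L2 Y →L[ℂ] L2 X :=
  (Lp.compMeasurePreservingₗᵢ ℂ φ hφ).toContinuousLinearMap

end Tensor

section Legs

variable {X Y Z : Type} [MeasureSpace X] [MeasureSpace Y] [MeasureSpace Z]
  [SigmaFinite (volume : Measure X)] [SigmaFinite (volume : Measure Y)]

/-- Leg numbering.  A measure preserving identification `e : Z ≃ X × Y` singles out the
coordinates `X` of `Z`; `leg e he T` is the operator `T ∈ B(L²(X))` acting on these coordinates
of a function in `L²(Z)`, and trivially on the remaining coordinates `Y`. -/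
def leg (e : Z ≃ᵐ X × Y) (he : MeasurePreserving e) (T : B X) : B Z :=
  compOp e he ∘L ampl T ∘L compOp e.symm (he.symm e)

theorem leg_tmul (e : Z ≃ᵐ X × Y) (he : MeasurePreserving e) (T : B X) (ξ : L2 X) (ζ : L2 Y) :
    leg e he T (compOp e he (tmul ξ ζ)) = compOp e he (tmul (T ξ) ζ) := by
  have h : compOp e.symm (he.symm e) (compOp e he (tmul ξ ζ)) = tmul ξ ζ := by
    apply Lp.ext
    have h1 := Lp.coeFn_compMeasurePreserving (compOp e he (tmul ξ ζ)) (he.symm e)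
    have h2 := (he.symm e).quasiMeasurePreserving.ae_eq_comp
      (Lp.coeFn_compMeasurePreserving (tmul ξ ζ) he)
    filter_upwards [h1, h2] with p h1 h2
    refine h1.trans (h2.trans ?_)
    simp
  change compOp e he (ampl T (compOp e.symm (he.symm e) (compOp e he (tmul ξ ζ)))) = _
  rw [h, ampl_tmul]

/-- `T ⊗ 1` on `L²(X × Y)`. -/
def legFst (T : B X) : B (X × Y) := leg (MeasurableEquiv.refl (X × Y)) (.id _) T

/-- `1 ⊗ T` on `L²(X × Y)`. -/
def legSnd (T : B Y) : B (X × Y) :=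
  leg (X := Y) (Y := X) MeasurableEquiv.prodComm Measure.measurePreserving_swap T

/-- The identification `(a, b, c) ↦ ((a, b), c)`. -/
def e12 (X : Type) [MeasureSpace X] : X × X × X ≃ᵐ (X × X) × X := MeasurableEquiv.prodAssoc.symm

/-- The identification `(a, b, c) ↦ ((b, c), a)`. -/
def e23 (X : Type) [MeasureSpace X] : X × X × X ≃ᵐ (X × X) × X := MeasurableEquiv.prodComm

/-- The identification `(a, b, c) ↦ ((a, c), b)`. -/
def e13 (X : Type) [MeasureSpace X] : X × X × X ≃ᵐ (X × X) × X :=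
  ((MeasurableEquiv.refl X).prodCongr MeasurableEquiv.prodComm).trans
    MeasurableEquiv.prodAssoc.symm

theorem mp_e12 : MeasurePreserving (e12 X) :=
  (measurePreserving_prodAssoc volume volume volume).symm _

theorem mp_e23 : MeasurePreserving (e23 X) := Measure.measurePreserving_swap

theorem mp_e13 : MeasurePreserving (e13 X) :=
  ((measurePreserving_prodAssoc volume volume volume).symm _).comp
    ((MeasurePreserving.id _).prod Measure.measurePreserving_swap)

/-- `T₁₂` on `L²(X × X × X)` for `T ∈ B(L²(X × X))`. -/
def leg12 (T : B (X × X)) : B (X × X × X) := leg (e12 X) mp_e12 T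

/-- `T₁₃` on `L²(X × X × X)` for `T ∈ B(L²(X × X))`. -/
def leg13 (T : B (X × X)) : B (X × X × X) := leg (e13 X) mp_e13 T

/-- `T₂₃` on `L²(X × X × X)` for `T ∈ B(L²(X × X))`. -/
def leg23 (T : B (X × X)) : B (X × X × X) := leg (e23 X) mp_e23 T

/-- `W` is a multiplicative unitary: a unitary satisfying the pentagon equation
`W₁₂ W₁₃ W₂₃ = W₂₃ W₁₂`. -/
def IsMultiplicativeUnitary (W : B (X × X)) : Prop :=
  W ∈ unitary (B (X × X)) ∧ leg12 W * leg13 W * leg23 W = leg23 W * leg12 W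

/-- The unitary `Θ` is a (2-)cocycle for the multiplicative unitary `V`:
`(V₁₃V₂₃)* Θ₁₂ (V₁₃V₂₃) · V₂₃* Θ₁₃ V₂₃ · Θ₂₃ = V₁₂* Θ₂₃ V₁₂ · Θ₁₂`. -/
def IsCocycleFor (V Θ : B (X × X)) : Prop :=
  Θ ∈ unitary (B (X × X)) ∧
  star (leg13 V * leg23 V) * leg12 Θ * (leg13 V * leg23 V) *
      (star (leg23 V) * leg13 Θ * leg23 V) * leg23 Θ =
    star (leg12 V) * leg23 Θ * leg12 V * leg12 Θ

end Legs

section Slices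

variable {X : Type} [MeasureSpace X] [SigmaFinite (volume : Measure X)]

/-- `ω ∈ B(L²(X))_*`: the functional `ω` is normal, that is of the form
`T ↦ ∑ᵢ ⟨T ξᵢ, ηᵢ⟩` with `∑ᵢ ‖ξᵢ‖² < ∞` and `∑ᵢ ‖ηᵢ‖² < ∞`. -/
def IsNormal (ω : B X →L[ℂ] ℂ) : Prop :=
  ∃ ξ η : ℕ → L2 X, Summable (fun i => ‖ξ i‖ ^ 2) ∧ Summable (fun i => ‖η i‖ ^ 2) ∧
    ∀ T : B X, HasSum (fun i => ⟪η i, T (ξ i)⟫_ℂ) (ω T)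

/-- The operator `ξ ↦ ξ ⊗ ζ`. -/
def tensRight (ζ : L2 X) : L2 X →L[ℂ] L2 (X × X) := (tmul (X := X) (Y := X)).flip ζ

/-- The operator `ξ ↦ ζ ⊗ ξ`. -/
def tensLeft (ζ : L2 X) : L2 X →L[ℂ] L2 (X × X) := tmul ζ

theorem norm_tensRight_le (ζ : L2 X) : ‖tensRight ζ‖ ≤ ‖ζ‖ :=
  ContinuousLinearMap.opNorm_le_bound _ (norm_nonneg _) fun ξ => by
    change ‖tmulFun ξ ζ‖ ≤ _
    rw [norm_tmulFun, mul_comm]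

theorem norm_tensLeft_le (ζ : L2 X) : ‖tensLeft ζ‖ ≤ ‖ζ‖ :=
  ContinuousLinearMap.opNorm_le_bound _ (norm_nonneg _) fun ξ => by
    change ‖tmulFun ζ ξ‖ ≤ _
    rw [norm_tmulFun]

theorem tensRight_add (ζ ζ' : L2 X) : tensRight (ζ + ζ') = tensRight ζ + tensRight ζ' := by
  simp [tensRight]
theorem tensRight_smul (c : ℂ) (ζ : L2 X) : tensRight (c • ζ) = c • tensRight ζ := by
  simp [tensRight]
theorem tensLeft_add (ζ ζ' : L2 X) : tensLeft (ζ + ζ') = tensLeft ζ + tensLeft ζ' := by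
  simp [tensLeft]
theorem tensLeft_smul (c : ℂ) (ζ : L2 X) : tensLeft (c • ζ) = c • tensLeft ζ := by
  simp [tensLeft]

set_option linter.unusedSectionVars false in
theorem slice_bound (ω : B X →L[ℂ] ℂ) (W : B (X × X)) (P Q : L2 X →L[ℂ] L2 (X × X)) (p q : ℝ)
    (hP : ‖P‖ ≤ p) (hQ : ‖Q‖ ≤ q) :
    ‖ω (ContinuousLinearMap.adjoint P ∘L W ∘L Q)‖ ≤ ‖ω‖ * ‖W‖ * p * q := by
  have hp : 0 ≤ p := (norm_nonneg _).trans hP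
  have h1 : ‖ContinuousLinearMap.adjoint P ∘L W ∘L Q‖ ≤ p * (‖W‖ * q) := by
    refine (ContinuousLinearMap.opNorm_comp_le _ _).trans ?_
    refine mul_le_mul (by rwa [LinearIsometryEquiv.norm_map]) ?_ (norm_nonneg _) hp
    exact (ContinuousLinearMap.opNorm_comp_le _ _).trans
      (mul_le_mul_of_nonneg_left hQ (norm_nonneg _))
  calc _ ≤ ‖ω‖ * (p * (‖W‖ * q)) := ω.le_opNorm_of_le h1
    _ = _ := by ring

/-- The sesquilinear form `(v, w) ↦ ω((id ⊗ ω_{w,v})(W))`. -/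
def formLeft (ω : B X →L[ℂ] ℂ) (W : B (X × X)) : L2 X →L⋆[ℂ] L2 X →L[ℂ] ℂ :=
  LinearMap.mkContinuous₂
    (LinearMap.mk₂'ₛₗ (starRingEnd ℂ) (RingHom.id ℂ)
      (fun v w => ω (ContinuousLinearMap.adjoint (tensRight v) ∘L W ∘L tensRight w))
      (fun v v' w => by simp [tensRight_add])
      (fun c v w => by
        rw [tensRight_smul, map_smulₛₗ ContinuousLinearMap.adjoint,
          ContinuousLinearMap.smul_comp, map_smul])
      (fun v w w' => by simp [tensRight_add])
      (fun c v w => by simp [tensRight_smul]))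
    (‖ω‖ * ‖W‖) (fun v w => slice_bound ω W _ _ _ _ (norm_tensRight_le v) (norm_tensRight_le w))

/-- The sesquilinear form `(v, w) ↦ ω((ω_{w,v} ⊗ id)(W))`. -/
def formRight (ω : B X →L[ℂ] ℂ) (W : B (X × X)) : L2 X →L⋆[ℂ] L2 X →L[ℂ] ℂ :=
  LinearMap.mkContinuous₂
    (LinearMap.mk₂'ₛₗ (starRingEnd ℂ) (RingHom.id ℂ)
      (fun v w => ω (ContinuousLinearMap.adjoint (tensLeft v) ∘L W ∘L tensLeft w))
      (fun v v' w => by simp [tensLeft_add])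
      (fun c v w => by
        rw [tensLeft_smul, map_smulₛₗ ContinuousLinearMap.adjoint,
          ContinuousLinearMap.smul_comp, map_smul])
      (fun v w w' => by simp [tensLeft_add])
      (fun c v w => by simp [tensLeft_smul]))
    (‖ω‖ * ‖W‖) (fun v w => slice_bound ω W _ _ _ _ (norm_tensLeft_le v) (norm_tensLeft_le w))

/-- The slice `(ω ⊗ id)(W)`. -/
def leftSlice (ω : B X →L[ℂ] ℂ) (W : B (X × X)) : B X :=
  ContinuousLinearMap.adjoint (InnerProductSpace.continuousLinearMapOfBilin (formLeft ω W))

/-- The slice `(id ⊗ ω)(W)`. -/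
def rightSlice (ω : B X →L[ℂ] ℂ) (W : B (X × X)) : B X :=
  ContinuousLinearMap.adjoint (InnerProductSpace.continuousLinearMapOfBilin (formRight ω W))

theorem inner_leftSlice (ω : B X →L[ℂ] ℂ) (W : B (X × X)) (v w : L2 X) :
    ⟪v, leftSlice ω W w⟫_ℂ =
      ω (ContinuousLinearMap.adjoint (tensRight v) ∘L W ∘L tensRight w) := by
  rw [leftSlice, ContinuousLinearMap.adjoint_inner_right,
    InnerProductSpace.continuousLinearMapOfBilin_apply]
  rfl

theorem inner_rightSlice (ω : B X →L[ℂ] ℂ) (W : B (X × X)) (v w : L2 X) :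
    ⟪v, rightSlice ω W w⟫_ℂ =
      ω (ContinuousLinearMap.adjoint (tensLeft v) ∘L W ∘L tensLeft w) := by
  rw [rightSlice, ContinuousLinearMap.adjoint_inner_right,
    InnerProductSpace.continuousLinearMapOfBilin_apply]
  rfl

/-- The norm closure of `{(ω ⊗ id)(W) : ω ∈ B(L²(X))_*}`. -/
def leftAlg (W : B (X × X)) : Set (B X) := closure {a | ∃ ω, IsNormal ω ∧ a = leftSlice ω W}

/-- The norm closure of `{(id ⊗ ω)(W) : ω ∈ B(L²(X))_*}`. -/
def rightAlg (W : B (X × X)) : Set (B X) := closure {a | ∃ ω, IsNormal ω ∧ a = rightSlice ω W}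

end Slices

/-- The `C*`-algebras `A` and `A'` are isomorphic (as `*`-algebras, hence isometrically). -/
def StarIsomorphic {E F : Type*} [NonUnitalNonAssocSemiring E] [Module ℂ E] [Star E]
    [NonUnitalNonAssocSemiring F] [Module ℂ F] [Star F]
    (A : NonUnitalStarSubalgebra ℂ E) (A' : NonUnitalStarSubalgebra ℂ F) : Prop :=
  Nonempty (A ≃⋆ₐ[ℂ] A')

section Bialgebra

variable {X : Type} [MeasureSpace X] [SigmaFinite (volume : Measure X)]

/-- The (spatial) tensor product `A ⊗ A ⊆ B(L²(X × X))`: the closed `*`-algebra generated by the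
operators `a ⊗ b` with `a, b ∈ A`. -/
def tensorAlg (A : NonUnitalStarSubalgebra ℂ (B X)) : NonUnitalStarSubalgebra ℂ (B (X × X)) :=
  (NonUnitalStarAlgebra.adjoin ℂ
    {t : B (X × X) | ∃ a ∈ A, ∃ b ∈ A, t = legFst a * legSnd b}).topologicalClosure

/-- The multiplier algebra `M(D)` of a nondegenerate algebra `D` of operators: all operators `m`
with `m D ⊆ D` and `D m ⊆ D`. -/
def multiplierAlg {Y : Type} [MeasureSpace Y] (D : NonUnitalStarSubalgebra ℂ (B Y)) :
    StarSubalgebra ℂ (B Y) where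
  carrier := {m | ∀ d ∈ D, m * d ∈ D ∧ d * m ∈ D}
  mul_mem' {m m'} hm hm' d hd :=
    ⟨by rw [mul_assoc]; exact (hm _ (hm' d hd).1).1,
      by rw [← mul_assoc]; exact (hm' _ (hm d hd).2).2⟩
  one_mem' d hd := by simpa using hd
  add_mem' {m m'} hm hm' d hd :=
    ⟨by rw [add_mul]; exact add_mem (hm d hd).1 (hm' d hd).1,
      by rw [mul_add]; exact add_mem (hm d hd).2 (hm' d hd).2⟩
  zero_mem' d hd := by simp
  algebraMap_mem' c d hd := by
    rw [Algebra.algebraMap_eq_smul_one]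
    have h := SMulMemClass.smul_mem c hd
    simpa using h
  star_mem' {m} hm d hd := by
    have h := hm _ (star_mem hd)
    refine ⟨?_, ?_⟩
    · have := star_mem h.2
      rwa [star_mul, star_star] at this
    · have := star_mem h.1
      rwa [star_mul, star_star] at this

/-- `(A, Δ)` is a `C*`-bialgebra of operators on `L²(X)`: `A` is a nondegenerate `C*`-algebra of
operators and `Δ` is a nondegenerate `*`-homomorphism `A → M(A ⊗ A)` which is coassociative,
`(Δ ⊗ id)Δ = (id ⊗ Δ)Δ`.  Here `Δ ⊗ id` and `id ⊗ Δ` are the unital `*`-homomorphisms on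
`M(A ⊗ A)`, with values in operators on `L²(X × X × X)`, which extend
`a ⊗ b ↦ Δ(a) ⊗ b` and `a ⊗ b ↦ a ⊗ Δ(b)`. -/
structure IsCStarBialgebra (A : NonUnitalStarSubalgebra ℂ (B X))
    (Δ : A →⋆ₙₐ[ℂ] multiplierAlg (tensorAlg A)) : Prop where
  isClosed : IsClosed (A : Set (B X))
  nondegenerate : Dense (Submodule.span ℂ {v : L2 X | ∃ a ∈ A, ∃ ξ, v = a ξ} : Set (L2 X))
  comul_nondegenerate : (tensorAlg A : Set (B (X × X))) ⊆
    closure (Submodule.span ℂ {t : B (X × X) | ∃ a : A, ∃ d ∈ tensorAlg A,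
      t = (Δ a : B (X × X)) * d} : Set (B (X × X)))
  coassoc : ∃ Δ₁ Δ₂ : multiplierAlg (tensorAlg A) →⋆ₐ[ℂ] B (X × X × X),
    (∀ (a b : A) (m : multiplierAlg (tensorAlg A)),
      (m : B (X × X)) = legFst (a : B X) * legSnd (b : B X) →
        Δ₁ m = leg12 (Δ a : B (X × X)) * legSnd (legSnd (b : B X))) ∧
    (∀ (a b : A) (m : multiplierAlg (tensorAlg A)),
      (m : B (X × X)) = legFst (a : B X) * legSnd (b : B X) →
        Δ₂ m = legFst (a : B X) * leg23 (Δ b : B (X × X))) ∧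
    ∀ a : A, Δ₁ (Δ a) = Δ₂ (Δ a)

/-- The duality between the two slice algebras of `W`, with the comultiplications
`Δ(a) = W (a ⊗ 1) W*` and `Δ̂(b) = W* (1 ⊗ b) W`, for the pairing
`⟨(ω ⊗ id)(W), (id ⊗ ω')(W)⟩ = (ω ⊗ ω')(W)`, where `(ω ⊗ ω')(T) = ω'((ω ⊗ id)(T))`: the pairing
turns the product of each of the two algebras into the comultiplication of the other one,
`⟨a, b b'⟩ = ⟨Δ(a), b ⊗ b'⟩` and `⟨a a', b⟩ = ⟨a ⊗ a', Δ̂(b)⟩`. -/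
structure AreMutuallyDual (W : B (X × X)) : Prop where
  pairing : ∀ ω ω', IsNormal ω → IsNormal ω' → ω' (leftSlice ω W) = ω (rightSlice ω' W)
  comul : ∀ ω ω' ω'', IsNormal ω → IsNormal ω' → IsNormal ω'' →
    ω (rightSlice ω' W * rightSlice ω'' W) =
      ω'' (leftSlice ω' (W * legFst (leftSlice ω W) * star W))
  comul_hat : ∀ ω ω' ω'', IsNormal ω → IsNormal ω' → IsNormal ω'' →
    ω'' (leftSlice ω W * leftSlice ω' W) =
      ω' (leftSlice ω (star W * legSnd (rightSlice ω'' W) * W))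

end Bialgebra

section CrossedProduct

variable (G X : Type) [AddGroup G] [TopologicalSpace G] [TopologicalSpace X]

/-- A twisted transformation group: a continuous action of `G` on `X` together with a continuous
normalised `2`-cocycle `σ` on `G` with values in the functions from `X` to the unit circle.
It gives the twisted action `(α, σ)` of `G` on `C₀(X)` with `(α_s f)(x) = f((-s) • x)`. -/
structure TwistedSystem where
  act : G → X → X
  act_zero : ∀ x, act 0 x = x
  act_add : ∀ s t x, act (s + t) x = act s (act t x)
  continuous_act : Continuous fun p : G × X => act p.1 p.2
  σ : G → G → X → Circle
  continuous_σ : Continuous fun p : G × G × X => σ p.1 p.2.1 p.2.2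
  σ_zero_left : ∀ s x, σ 0 s x = 1
  σ_zero_right : ∀ s x, σ s 0 x = 1
  cocycle : ∀ s t u x, σ s t x * σ (s + t) u x = σ t u (act (-s) x) * σ s (t + u) x

variable {G X}

namespace TwistedSystem

variable (D : TwistedSystem G X)

/-- The action of `s ∈ G` as a homeomorphism of `X`. -/
def homeo (s : G) : X ≃ₜ X where
  toFun := D.act s
  invFun := D.act (-s)
  left_inv x := by rw [← D.act_add, neg_add_cancel, D.act_zero]
  right_inv x := by rw [← D.act_add, add_neg_cancel, D.act_zero]
  continuous_toFun := D.continuous_act.comp (by fun_prop : Continuous fun x : X => (s, x))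
  continuous_invFun := D.continuous_act.comp (by fun_prop : Continuous fun x : X => (-s, x))

/-- The automorphism `α_s` of `C₀(X)`: `(α_s f)(x) = f((-s) • x)`. -/
def aut (s : G) (f : C₀(X, ℂ)) : C₀(X, ℂ) where
  toFun x := f (D.act (-s) x)
  continuous_toFun := f.continuous.comp (D.homeo s).symm.continuous
  zero_at_infty' :=
    f.zero_at_infty'.comp (D.homeo s).symm.isClosedEmbedding.tendsto_cocompact

/-- The product `σ(s, t) f` of `f ∈ C₀(X)` with the multiplier `σ(s, t)`. -/
def cocycleMul (s t : G) (f : C₀(X, ℂ)) : C₀(X, ℂ) where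
  toFun x := (D.σ s t x : ℂ) * f x
  continuous_toFun := by
    have : Continuous fun x => D.σ s t x :=
      D.continuous_σ.comp (by fun_prop : Continuous fun x : X => (s, t, x))
    exact (continuous_subtype_val.comp this).mul f.continuous
  zero_at_infty' := by
    have h := f.zero_at_infty'
    rw [tendsto_zero_iff_norm_tendsto_zero] at h ⊢
    refine h.congr fun x => ?_
    rw [norm_mul, Circle.norm_coe, one_mul]
    rfl

end TwistedSystem

/-- A covariant representation of a twisted transformation group on a Hilbert space `H`: a
nondegenerate `*`-representation `π` of `C₀(X)` and a strongly continuous family of unitaries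
`U_s` with `U_s π(f) U_s* = π(α_s f)` and `U_s U_t = π(σ(s, t)) U_{s+t}`.  (As `π` is
nondegenerate, the last identity may be tested after multiplication by all `π(f)`.) -/
structure CovariantRep (D : TwistedSystem G X) where
  H : Type
  [normedAddCommGroup : NormedAddCommGroup H]
  [innerProductSpace : InnerProductSpace ℂ H]
  [completeSpace : CompleteSpace H]
  π : C₀(X, ℂ) →⋆ₙₐ[ℂ] (H →L[ℂ] H)
  nondegenerate : Dense (Submodule.span ℂ {v : H | ∃ f ξ, v = π f ξ} : Set H)
  U : G → unitary (H →L[ℂ] H)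
  continuous_U : ∀ ξ : H, Continuous fun s => (U s : H →L[ℂ] H) ξ
  covariant : ∀ s f, (U s : H →L[ℂ] H) * π f * star (U s : H →L[ℂ] H) = π (D.aut s f)
  twisted : ∀ s t f, π f * ((U s : H →L[ℂ] H) * (U t : H →L[ℂ] H)) =
    π (D.cocycleMul s t f) * (U (s + t) : H →L[ℂ] H)

attribute [instance] CovariantRep.normedAddCommGroup CovariantRep.innerProductSpace
  CovariantRep.completeSpace

section Integrated

set_option linter.unusedSectionVars false

variable [MeasureSpace G] [BorelSpace G] [IsFiniteMeasureOnCompacts (volume : Measure G)]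
variable {D : TwistedSystem G X}

theorem CovariantRep.continuous_integrand (ρ : CovariantRep D) (f : C_c(G, C₀(X, ℂ))) (ξ : ρ.H) :
    Continuous fun s => ρ.π (f s) ((ρ.U s : ρ.H →L[ℂ] ρ.H) ξ) := by
  have h1 : Continuous ρ.π :=
    AddMonoidHomClass.continuous_of_bound ρ.π 1 fun a => by
      simpa using NonUnitalStarAlgHom.norm_apply_le ρ.π a
  exact (h1.comp f.continuous).clm_apply (ρ.continuous_U ξ)

theorem CovariantRep.norm_integrand_le (ρ : CovariantRep D) (f : C_c(G, C₀(X, ℂ))) (ξ : ρ.H)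
    (s : G) : ‖ρ.π (f s) ((ρ.U s : ρ.H →L[ℂ] ρ.H) ξ)‖ ≤ ‖f s‖ * ‖ξ‖ := by
  have h2 : ‖(ρ.U s : ρ.H →L[ℂ] ρ.H) ξ‖ = ‖ξ‖ := by
    have h := Unitary.norm_map (ρ.U s) ξ
    exact h
  calc _ ≤ ‖ρ.π (f s)‖ * ‖(ρ.U s : ρ.H →L[ℂ] ρ.H) ξ‖ := ContinuousLinearMap.le_opNorm _ _
    _ ≤ _ := by
      rw [h2]
      exact mul_le_mul_of_nonneg_right (NonUnitalStarAlgHom.norm_apply_le ρ.π _) (norm_nonneg _)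

theorem CovariantRep.integrable_integrand (ρ : CovariantRep D) (f : C_c(G, C₀(X, ℂ)))
    (ξ : ρ.H) : Integrable fun s => ρ.π (f s) ((ρ.U s : ρ.H →L[ℂ] ρ.H) ξ) := by
  refine (ρ.continuous_integrand f ξ).integrable_of_hasCompactSupport ?_
  refine f.hasCompactSupport.mono fun s hs => ?_
  contrapose! hs
  simp [Function.notMem_support.1 hs]

theorem integrable_norm (f : C_c(G, C₀(X, ℂ))) : Integrable fun s => ‖f s‖ :=
  (f.continuous.integrable_of_hasCompactSupport f.hasCompactSupport).norm

/-- The integrated form `(π ⋊ U)(f) = ∫ π(f(s)) U_s ds` of a covariant representation. -/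
def CovariantRep.integrated (ρ : CovariantRep D) (f : C_c(G, C₀(X, ℂ))) : ρ.H →L[ℂ] ρ.H :=
  LinearMap.mkContinuous
    { toFun := fun ξ => ∫ s, ρ.π (f s) ((ρ.U s : ρ.H →L[ℂ] ρ.H) ξ)
      map_add' := fun ξ η => by
        simp only [map_add]
        exact integral_add (ρ.integrable_integrand f ξ) (ρ.integrable_integrand f η)
      map_smul' := fun c ξ => by
        simp only [map_smul, RingHom.id_apply]
        exact integral_smul c _ }
    (∫ s, ‖f s‖)
    (fun ξ => by
      rw [← integral_mul_const]
      exact norm_integral_le_of_norm_le ((integrable_norm f).mul_const _)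
        (Filter.Eventually.of_forall fun s => ρ.norm_integrand_le f ξ s))

theorem CovariantRep.norm_integrated_le (ρ : CovariantRep D) (f : C_c(G, C₀(X, ℂ))) :
    ‖ρ.integrated f‖ ≤ ∫ s, ‖f s‖ :=
  LinearMap.mkContinuous_norm_le _ (integral_nonneg fun _ => norm_nonneg _) _

/-- The image of `f ∈ C_c(G, C₀(X))` in the product of all covariant representations. -/
def universalRep (D : TwistedSystem G X) (f : C_c(G, C₀(X, ℂ))) :
    lp (fun ρ : CovariantRep D => ρ.H →L[ℂ] ρ.H) ∞ :=
  ⟨fun ρ => ρ.integrated f, memℓp_infty ⟨∫ s, ‖f s‖, by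
    rintro _ ⟨ρ, rfl⟩
    exact ρ.norm_integrated_le f⟩⟩

/-- The (full) twisted crossed product `C₀(X) ⋊^σ_α G`: the completion of `C_c(G, C₀(X))` in the
norm `‖f‖ = sup ‖(π ⋊ U)(f)‖`, the supremum over all covariant representations `(π, U)`,
realised as the closed `*`-algebra which `C_c(G, C₀(X))` generates in the product of all covariant
representations. -/
def crossedProduct (D : TwistedSystem G X) :
    NonUnitalStarSubalgebra ℂ (lp (fun ρ : CovariantRep D => ρ.H →L[ℂ] ρ.H) ∞) :=
  (NonUnitalStarAlgebra.adjoin ℂ (Set.range (universalRep D))).topologicalClosure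

end Integrated
end CrossedProduct
section Multiplication

variable {Z : Type} [MeasureSpace Z]

theorem memLp_mul (θ : Z → Circle) (hθ : Measurable fun z => (θ z : ℂ)) (ξ : L2 Z) :
    MemLp (fun z => (θ z : ℂ) * ξ z) 2 (volume : Measure Z) :=
  (Lp.memLp ξ).of_le (hθ.aestronglyMeasurable.mul (Lp.aestronglyMeasurable ξ))
    (Filter.Eventually.of_forall fun z => by rw [norm_mul, Circle.norm_coe, one_mul])

/-- The unitary multiplication operator `ξ ↦ θ ξ` by a circle-valued function `θ`. -/
def mulOp (θ : Z → Circle) (hθ : Measurable fun z => (θ z : ℂ)) : B Z :=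
  LinearMap.mkContinuous
    { toFun := fun ξ => (memLp_mul θ hθ ξ).toLp _
      map_add' := fun ξ η => by
        apply Lp.ext
        filter_upwards [(memLp_mul θ hθ (ξ + η)).coeFn_toLp, (memLp_mul θ hθ ξ).coeFn_toLp,
          (memLp_mul θ hθ η).coeFn_toLp, Lp.coeFn_add ξ η,
          Lp.coeFn_add ((memLp_mul θ hθ ξ).toLp _) ((memLp_mul θ hθ η).toLp _)]
          with z h1 h2 h3 h4 h5
        rw [h1, h5, Pi.add_apply, h2, h3, h4, Pi.add_apply, mul_add]
      map_smul' := fun c ξ => by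
        apply Lp.ext
        filter_upwards [(memLp_mul θ hθ (c • ξ)).coeFn_toLp, (memLp_mul θ hθ ξ).coeFn_toLp,
          Lp.coeFn_smul c ξ, Lp.coeFn_smul c ((memLp_mul θ hθ ξ).toLp _)] with z h1 h2 h4 h5
        rw [RingHom.id_apply, h1, h5, Pi.smul_apply, h2, h4, Pi.smul_apply, smul_eq_mul,
          smul_eq_mul, mul_left_comm] }
    1 (fun ξ => by
      rw [one_mul]
      refine Lp.norm_le_norm_of_ae_le ?_
      filter_upwards [(memLp_mul θ hθ ξ).coeFn_toLp] with z h1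
      change ‖(memLp_mul θ hθ ξ).toLp _ z‖ ≤ _
      rw [h1, norm_mul, Circle.norm_coe, one_mul])

theorem mulOp_coe (θ : Z → Circle) (hθ : Measurable fun z => (θ z : ℂ)) (ξ : L2 Z) :
    (mulOp θ hθ ξ : Z → ℂ) =ᵐ[volume] fun z => (θ z : ℂ) * ξ z :=
  (memLp_mul θ hθ ξ).coeFn_toLp

end Multiplication

section Example

variable {n : ℕ}

/-- The abelian group `H/Z ≅ ℝⁿ × ℝⁿ` (the Heisenberg group modulo its centre), with
elements `(x, y)`. -/
abbrev HZ (n : ℕ) : Type := (Fin n → ℝ) × (Fin n → ℝ)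

/-- The space `H/Z × G₁`, with `G₁ ≅ ℝ`, with elements `((x, y), r)`. -/
abbrev KK (n : ℕ) : Type := HZ n × ℝ

/-- `e[t] = exp(2πit)`. -/
def ee (t : ℝ) : Circle := Real.fourierChar t

/-- `ē[t] = exp(-2πit)`. -/
def eebar (t : ℝ) : Circle := Real.fourierChar (-t)

/-- `β(x, y) = x · y`. -/
def beta (x y : Fin n → ℝ) : ℝ := ∑ i, x i * y i

/-- `∑_{i,k} J_{ik} y_k y'_i`. -/
def Jform (J : Matrix (Fin n) (Fin n) ℝ) (y y' : Fin n → ℝ) : ℝ :=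
  ∑ i, ∑ k, J i k * y k * y' i

/-- `∑_{i,k} J_{ik} y_k 𝐱_i`, the vector with `i`-th coordinate `∑_k J_{ik} y_k`. -/
def Jvec (J : Matrix (Fin n) (Fin n) ℝ) (y : Fin n → ℝ) : Fin n → ℝ :=
  fun i => ∑ k, J i k * y k

/-- The action `α_r(x, y) = (x + r ∑_{i,k} J_{ik} y_k 𝐱_i, y)` of `G₁` on `H/Z`. -/
def alpha (J : Matrix (Fin n) (Fin n) ℝ) (r : ℝ) (h : HZ n) : HZ n :=
  (h.1 + r • Jvec J h.2, h.2)

/-- The cocycle `σ^r((x, y), (x', y')) = ē[r²/2 ∑_{i,k} J_{ik} y_k y'_i] ē[r β(x, y')]`. -/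
def sigma (J : Matrix (Fin n) (Fin n) ℝ) (r : ℝ) (h h' : HZ n) : Circle :=
  eebar (r ^ 2 / 2 * Jform J h.2 h'.2) * eebar (r * beta h.1 h'.2)

theorem continuous_ee : Continuous ee := Real.continuous_fourierChar

theorem continuous_eebar : Continuous eebar := Real.continuous_fourierChar.comp continuous_neg

theorem eebar_zero : eebar 0 = 1 := by simp [eebar]

theorem eebar_add (s t : ℝ) : eebar (s + t) = eebar s * eebar t := by
  rw [eebar, neg_add, AddChar.map_add_eq_mul]
  rfl

theorem Jvec_add (J : Matrix (Fin n) (Fin n) ℝ) (y y' : Fin n → ℝ) :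
    Jvec J (y + y') = Jvec J y + Jvec J y' := by
  funext i
  simp [Jvec, mul_add, Finset.sum_add_distrib]

theorem continuous_Jvec (J : Matrix (Fin n) (Fin n) ℝ) : Continuous (Jvec J) := by
  unfold Jvec
  fun_prop

theorem continuous_alpha (J : Matrix (Fin n) (Fin n) ℝ) :
    Continuous fun p : ℝ × HZ n => alpha J p.1 p.2 := by
  have := continuous_Jvec J
  unfold alpha
  fun_prop

theorem continuous_sigma (J : Matrix (Fin n) (Fin n) ℝ) :
    Continuous fun p : HZ n × HZ n × ℝ => sigma J p.2.2 p.1 p.2.1 := by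
  have := continuous_eebar
  unfold sigma Jform beta
  fun_prop

/-- The trivial action `γ` of `H/Z` on `G₁`, without a cocycle. -/
def gammaSystem (n : ℕ) : TwistedSystem (HZ n) ℝ where
  act _ r := r
  act_zero _ := rfl
  act_add _ _ _ := rfl
  continuous_act := continuous_snd
  σ _ _ _ := 1
  continuous_σ := continuous_const
  σ_zero_left _ _ := rfl
  σ_zero_right _ _ := rfl
  cocycle _ _ _ _ := rfl

/-- The trivial action `γ` of `H/Z` on `G₁`, twisted by the continuous field of cocycles
`σ : r ↦ σ^r`. -/
def gammaSigmaSystem (J : Matrix (Fin n) (Fin n) ℝ) : TwistedSystem (HZ n) ℝ where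
  act _ r := r
  act_zero _ := rfl
  act_add _ _ _ := rfl
  continuous_act := continuous_snd
  σ h h' r := sigma J r h h'
  continuous_σ := continuous_sigma J
  σ_zero_left h r := by simp [sigma, Jform, beta, eebar_zero]
  σ_zero_right h r := by simp [sigma, Jform, beta, eebar_zero]
  cocycle h h' h'' r := by
    simp only [sigma, ← eebar_add]
    congr 1
    simp only [Jform, beta, Prod.fst_add, Prod.snd_add, Pi.add_apply, mul_add, add_mul,
      Finset.sum_add_distrib]
    ring

/-- The action `α` of `G₁` on `H/Z`, without a cocycle. -/
def alphaSystem (J : Matrix (Fin n) (Fin n) ℝ) : TwistedSystem ℝ (HZ n) where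
  act := alpha J
  act_zero h := by simp [alpha]
  act_add r s h := by
    simp only [alpha, Prod.mk.injEq, and_true]
    rw [add_smul, add_comm (r • _), ← add_assoc]
  continuous_act := continuous_alpha J
  σ _ _ _ := 1
  continuous_σ := continuous_const
  σ_zero_left _ _ := rfl
  σ_zero_right _ _ := rfl
  cocycle _ _ _ _ := rfl

theorem mp_alpha (J : Matrix (Fin n) (Fin n) ℝ) (r : ℝ) : MeasurePreserving (alpha J r) := by
  have h : MeasurePreserving
      (fun p : (Fin n → ℝ) × (Fin n → ℝ) => (p.1, p.2 + r • Jvec J p.1))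
      ((volume : Measure (Fin n → ℝ)).prod volume)
      ((volume : Measure (Fin n → ℝ)).prod volume) := by
    refine MeasurePreserving.skew_product (g := fun y x => x + r • Jvec J y)
      (MeasurePreserving.id _) ?_ (Filter.Eventually.of_forall fun y => ?_)
    · have := continuous_Jvec J
      exact Continuous.measurable (by unfold Function.uncurry; fun_prop)
    · exact map_add_right_eq_self volume (r • Jvec J y)
  exact Measure.measurePreserving_swap.comp (h.comp Measure.measurePreserving_swap)

theorem mp_Z (J : Matrix (Fin n) (Fin n) ℝ) :
    MeasurePreserving (fun p : KK n => ((alpha J p.2 p.1, p.2) : KK n)) := by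
  have h : MeasurePreserving (fun p : ℝ × HZ n => (p.1, alpha J p.1 p.2))
      ((volume : Measure ℝ).prod volume) ((volume : Measure ℝ).prod volume) :=
    MeasurePreserving.skew_product (g := fun r h => alpha J r h)
      (MeasurePreserving.id _) (continuous_alpha J).measurable
      (Filter.Eventually.of_forall fun r => (mp_alpha J r).map_eq)
  exact Measure.measurePreserving_swap.comp (h.comp Measure.measurePreserving_swap)

/-- The unitary operator `Zξ(x, y; r) = ξ(x + r ∑_{i,k} J_{ik} y_k 𝐱_i, y; r)`. -/
def opZ (J : Matrix (Fin n) (Fin n) ℝ) : B (KK n) := compOp _ (mp_Z J)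

theorem mp_X : MeasurePreserving (fun p : ℝ × ℝ => ((p.1 + p.2, p.2) : ℝ × ℝ)) :=
  measurePreserving_add_prod volume volume

/-- The multiplicative unitary operator `Xξ(r; r') = ξ(r + r'; r')` of `G₁`. -/
def opX : B (ℝ × ℝ) := compOp _ mp_X

theorem mp_Y (n : ℕ) :
    MeasurePreserving (fun p : HZ n × HZ n => ((p.1, p.2 - p.1) : HZ n × HZ n)) := by
  have : (volume : Measure (HZ n)).IsAddRightInvariant := by
    rw [Measure.volume_eq_prod]
    infer_instance
  exact measurePreserving_prod_sub volume volume

/-- The multiplicative unitary operator `Yζ(x, y; x', y') = ζ(x, y; x' - x, y' - y)`. -/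
def opY (n : ℕ) : B (HZ n × HZ n) := compOp _ (mp_Y n)

theorem mp_prodProdProdComm (P Q R S : Type) [MeasureSpace P] [MeasureSpace Q] [MeasureSpace R]
    [MeasureSpace S] [SigmaFinite (volume : Measure P)] [SigmaFinite (volume : Measure Q)]
    [SigmaFinite (volume : Measure R)] [SigmaFinite (volume : Measure S)] :
    MeasurePreserving (fun p : (P × Q) × R × S => (((p.1.1, p.2.1), (p.1.2, p.2.2)) :
      (P × R) × Q × S)) := by
  have h1 : MeasurePreserving (MeasurableEquiv.prodAssoc : (P × Q) × R × S ≃ᵐ P × Q × R × S) :=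
    measurePreserving_prodAssoc volume volume volume
  have h2 : MeasurePreserving (MeasurableEquiv.prodAssoc.symm : Q × R × S ≃ᵐ (Q × R) × S) :=
    (measurePreserving_prodAssoc volume volume volume).symm _
  have h3 : MeasurePreserving (Prod.map Prod.swap id : (Q × R) × S → (R × Q) × S) :=
    Measure.measurePreserving_swap.prod (.id _)
  have h4 : MeasurePreserving (MeasurableEquiv.prodAssoc : (R × Q) × S ≃ᵐ R × Q × S) :=
    measurePreserving_prodAssoc volume volume volume
  have h5 : MeasurePreserving
      (Prod.map id (MeasurableEquiv.prodAssoc ∘ Prod.map Prod.swap id ∘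
        MeasurableEquiv.prodAssoc.symm) : P × Q × R × S → P × R × Q × S) :=
    (MeasurePreserving.id _).prod (h4.comp (h3.comp h2))
  have h6 : MeasurePreserving
      (MeasurableEquiv.prodAssoc.symm : P × R × Q × S ≃ᵐ (P × R) × Q × S) :=
    (measurePreserving_prodAssoc volume volume volume).symm _
  exact h6.comp (h5.comp h1)

/-- The identification `((h, r), (h', r')) ↦ ((h, h'), (r, r'))`. -/
def f13 (n : ℕ) : KK n × KK n ≃ᵐ (HZ n × HZ n) × (ℝ × ℝ) where
  toEquiv := Equiv.prodProdProdComm _ _ _ _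
  measurable_toFun := (mp_prodProdProdComm (HZ n) ℝ (HZ n) ℝ).measurable
  measurable_invFun := (mp_prodProdProdComm (HZ n) (HZ n) ℝ ℝ).measurable

theorem mp_f13 (n : ℕ) : MeasurePreserving (f13 n) := mp_prodProdProdComm (HZ n) ℝ (HZ n) ℝ

/-- The identification `((h, r), (h', r')) ↦ ((r, r'), (h, h'))`. -/
def f24 (n : ℕ) : KK n × KK n ≃ᵐ (ℝ × ℝ) × (HZ n × HZ n) :=
  (f13 n).trans MeasurableEquiv.prodComm

theorem mp_f24 (n : ℕ) : MeasurePreserving (f24 n) :=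
  Measure.measurePreserving_swap.comp (mp_f13 n)

/-- The operator `V = (Z₁₂ X₂₄ Z₁₂*) Y₁₃` on `L²(H/Z × G₁ × H/Z × G₁)`. -/
def opV (J : Matrix (Fin n) (Fin n) ℝ) : B (KK n × KK n) :=
  (legFst (opZ J) * leg (f24 n) (mp_f24 n) opX * star (legFst (opZ J))) *
    leg (f13 n) (mp_f13 n) (opY n)

/-- The function
`Θ(x, y, r; x', y', r') = ē[r' β(x, y')] ē[r'²/2 ∑_{i,k} J_{ik} y_k y'_i]`. -/
def ThetaFun (J : Matrix (Fin n) (Fin n) ℝ) : KK n × KK n → Circle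
  | (((x, y), _), ((_, y'), r')) => eebar (r' * beta x y') * eebar (r' ^ 2 / 2 * Jform J y y')

theorem continuous_ThetaFun (J : Matrix (Fin n) (Fin n) ℝ) : Continuous (ThetaFun J) := by
  have h : ThetaFun J = fun p => eebar (p.2.2 * beta p.1.1.1 p.2.1.2) *
    eebar (p.2.2 ^ 2 / 2 * Jform J p.1.1.2 p.2.1.2) := rfl
  have := continuous_eebar
  rw [h]
  unfold Jform beta
  fun_prop

/-- The function `Θ` as a unitary (multiplication) operator. -/
def opTheta (J : Matrix (Fin n) (Fin n) ℝ) : B (KK n × KK n) :=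
  mulOp (ThetaFun J) (continuous_subtype_val.comp (continuous_ThetaFun J)).measurable

/-- `V_Θ = V Θ`. -/
def opVTheta (J : Matrix (Fin n) (Fin n) ℝ) : B (KK n × KK n) := opV J * opTheta J

end Example

end QG

end

open QG

/-!
Both `V` and `V_Θ` are instances of one construction.  Let a vector group `X` act on a vector group
`G` by measure preserving automorphisms `α_r`, and let `σ^r` be a field of 2-cocycles on `G` with
`σ^{r+s} = (σ^r ∘ α_s) σ^s` (`Bicrossed`).  Then
`W ξ((h, r), (h', r')) = σ^{r'}(k, h' - k) ξ((k, r + r'), (h' - k, r'))`, `k = α_{-r'} h`,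
is a composition operator weighted by a phase.  In the pentagon equation the points agree because
`α` is an action by automorphisms, and the phases because of the cocycle identity and the
compatibility with `α` (`Bicrossed.isMultiplicativeUnitary_W`).  For the Heisenberg group modulo its
centre the compatibility holds because the quadratic term of `σ^r` absorbs the shear `α_s`
(`twistedData`); the data with `σ = 1` give `V` (`opV_eq_W`), the data with `σ` give `V_Θ`
(`opVTheta_eq_W`).  Since both satisfy the pentagon equation, `Θ` satisfies the cocycle identity,
which is equivalent to it (`isCocycleFor_of_isMultiplicativeUnitary`).

*The slice algebras.*  A slice of `W` by the vector functional of two functions in `C_c(G × X)` is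
the operator `T_F` of the regular representation of the twisted crossed product, for an explicit
symbol `F` (`Bicrossed.leftSlice_W`, `Bicrossed.rightSlice_W`).  Conversely every `T_F` with
`F ∈ C_c` is a limit of slices, by an approximate identity (`Bicrossed.leftOp_mem_leftAlg`,
`Bicrossed.rightOp_mem_rightAlg`).  So the slice algebras are the images of the crossed products in
their regular representations, for the right algebra after the change of variables
`Bicrossed.dualHomeo`.

*Amenability.*  The crossed products are full ones, hence the regular representation has to be shown
to be faithful: `‖ρ(F)‖ ≤ ‖T_F‖` for every covariant representation `ρ`
(`CovariantRep.norm_integrated_le_regOp`).  To a vector `v` one associates the field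
`(s, x) ↦ g(s) π(k(x, ·)) U_s* v`, where `g` is an almost invariant unit vector of `L²(G)`
(`exists_almost_invariant`) and the kernel `k` is concentrated near the diagonal of `X × X`.  The
map almost preserves the action of `F`, with `T_F ⊗ 1` on the side of the fields, and it preserves
the norm of `ρ(F) v` when `k` is normalized on a large compact set.

*The bialgebra structure.*  Let `A` be the left slice algebra and `𝓚` the compact operators.  If `W`
and `W*` map `𝓚 ⊗ A` into itself, then slicing the pentagon equation `W₁₂ W₁₃ = W₂₃ W₁₂ W₂₃*` shows
that `Δ(a) = W (a ⊗ 1) W*` multiplies `A ⊗ A` into itself and that `Δ(A)(A ⊗ A)` is total in `A ⊗ A`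
(`comul_mem_and_total`, `IsMultiplicativeUnitary.exists_comul_left`); coassociativity is the
pentagon equation again.  The condition need only be checked on the columns `w ↦ W (ξ ⊗ T_F w)` with
`ξ` and `F` of compact support.  Such a column has a continuous compactly supported kernel, which is
a uniform limit of sums of products; Schur's test turns this into approximation in norm by columns
of `𝓚 ⊗ A` (`HasKernel.mem_cspan`).  The right algebra is treated in the same way.

*Duality.*  The pairing identities compare two ways of evaluating `ω ⊗ ω' ⊗ ω''` on `W₁₂ W₁₃` and on
`W₁₃ W₂₃` (`IsMultiplicativeUnitary.areMutuallyDual`).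
-/

noncomputable section

namespace QG

/-! ### Composition and multiplication operators -/

section WeightedComposition

variable {X Y Z : Type} [MeasureSpace X] [MeasureSpace Y] [MeasureSpace Z]

theorem compOp_coe (φ : X → Y) (hφ : MeasurePreserving φ) (ξ : L2 Y) :
    (compOp φ hφ ξ : X → ℂ) =ᵐ[volume] fun x => ξ (φ x) :=
  Lp.coeFn_compMeasurePreserving ξ hφ

theorem norm_compOp_apply (φ : X → Y) (hφ : MeasurePreserving φ) (ξ : L2 Y) :
    ‖compOp φ hφ ξ‖ = ‖ξ‖ :=
  (Lp.compMeasurePreservingₗᵢ ℂ φ hφ).norm_map ξ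

theorem inner_compOp_compOp (φ : X → Y) (hφ : MeasurePreserving φ) (ξ η : L2 Y) :
    ⟪compOp φ hφ ξ, compOp φ hφ η⟫_ℂ = ⟪ξ, η⟫_ℂ :=
  (Lp.compMeasurePreservingₗᵢ ℂ φ hφ).inner_map_map ξ η

theorem compOp_comp (φ : X → Y) (hφ : MeasurePreserving φ) (ψ : Y → Z)
    (hψ : MeasurePreserving ψ) (ξ : L2 Z) :
    compOp φ hφ (compOp ψ hψ ξ) = compOp (ψ ∘ φ) (hψ.comp hφ) ξ := by
  apply Lp.ext
  filter_upwards [compOp_coe φ hφ (compOp ψ hψ ξ), compOp_coe (ψ ∘ φ) (hψ.comp hφ) ξ,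
    hφ.quasiMeasurePreserving.ae_eq_comp (compOp_coe ψ hψ ξ)] with x h1 h2 h3
  rw [h1, h2]
  exact h3

theorem compOp_id (ξ : L2 X) (φ : X → X) (hφ : MeasurePreserving φ) (h : ∀ x, φ x = x) :
    compOp φ hφ ξ = ξ := by
  apply Lp.ext
  filter_upwards [compOp_coe φ hφ ξ] with x h1
  rw [h1, h]

/-- The weighted composition operator `ξ ↦ θ · (ξ ∘ φ)`, with a circle-valued weight. -/
def wcomp (θ : X → Circle) (hθ : Measurable fun x => (θ x : ℂ)) (φ : X → Y)
    (hφ : MeasurePreserving φ) : L2 Y →L[ℂ] L2 X := mulOp θ hθ ∘L compOp φ hφ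

theorem wcomp_coe (θ : X → Circle) (hθ : Measurable fun x => (θ x : ℂ)) (φ : X → Y)
    (hφ : MeasurePreserving φ) (ξ : L2 Y) :
    (wcomp θ hθ φ hφ ξ : X → ℂ) =ᵐ[volume] fun x => (θ x : ℂ) * ξ (φ x) := by
  filter_upwards [mulOp_coe θ hθ (compOp φ hφ ξ), compOp_coe φ hφ ξ] with x h1 h2
  change mulOp θ hθ (compOp φ hφ ξ) x = _
  rw [h1, h2]

theorem mulOp_eq_wcomp (θ : X → Circle) (hθ : Measurable fun x => (θ x : ℂ)) :
    mulOp θ hθ = wcomp θ hθ id (.id _) := by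
  ext1 ξ
  change _ = mulOp θ hθ (compOp id _ ξ)
  rw [compOp_id ξ id _ fun _ => rfl]

theorem compOp_eq_wcomp (φ : X → Y) (hφ : MeasurePreserving φ) :
    compOp φ hφ = wcomp (fun _ => 1) measurable_const φ hφ := by
  ext1 ξ
  apply Lp.ext
  filter_upwards [compOp_coe φ hφ ξ, wcomp_coe (fun _ => 1) measurable_const φ hφ ξ] with x h1 h2
  rw [h1, h2]
  simp

theorem wcomp_congr {θ θ' : X → Circle} {hθ : Measurable fun x => (θ x : ℂ)}
    {hθ' : Measurable fun x => (θ' x : ℂ)} {φ φ' : X → Y}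
    {hφ : MeasurePreserving φ} {hφ' : MeasurePreserving φ'} (h : ∀ x, θ x = θ' x)
    (h' : ∀ x, φ x = φ' x) : wcomp θ hθ φ hφ = wcomp θ' hθ' φ' hφ' := by
  obtain rfl := funext h
  obtain rfl := funext h'
  rfl

theorem measurable_mul_comp {θ : X → Circle} (hθ : Measurable fun x => (θ x : ℂ))
    {θ' : Y → Circle} (hθ' : Measurable fun x => (θ' x : ℂ)) {φ : X → Y} (hφ : Measurable φ) :
    Measurable fun x => ((θ x * θ' (φ x) : Circle) : ℂ) := by
  simp only [Circle.coe_mul]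
  exact hθ.mul (hθ'.comp hφ)

theorem wcomp_comp_wcomp (θ : X → Circle) (hθ : Measurable fun x => (θ x : ℂ)) (φ : X → Y)
    (hφ : MeasurePreserving φ) (θ' : Y → Circle) (hθ' : Measurable fun x => (θ' x : ℂ))
    (φ' : Y → Z) (hφ' : MeasurePreserving φ') :
    wcomp θ hθ φ hφ ∘L wcomp θ' hθ' φ' hφ' =
      wcomp (fun x => θ x * θ' (φ x)) (measurable_mul_comp hθ hθ' hφ.measurable)
        (fun x => φ' (φ x)) (hφ'.comp hφ) := by
  ext1 ξ
  apply Lp.ext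
  filter_upwards [wcomp_coe θ hθ φ hφ (wcomp θ' hθ' φ' hφ' ξ),
    wcomp_coe (fun x => θ x * θ' (φ x)) (measurable_mul_comp hθ hθ' hφ.measurable)
        (fun x => φ' (φ x)) (hφ'.comp hφ) ξ,
    hφ.quasiMeasurePreserving.ae_eq_comp (wcomp_coe θ' hθ' φ' hφ' ξ)] with x h1 h2 h3
  simp only [Function.comp_apply] at h3
  rw [ContinuousLinearMap.comp_apply, h1, h2, h3, Circle.coe_mul, mul_assoc]

theorem wcomp_mul_wcomp (θ : X → Circle) (hθ : Measurable fun x => (θ x : ℂ)) (φ : X → X)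
    (hφ : MeasurePreserving φ) (θ' : X → Circle) (hθ' : Measurable fun x => (θ' x : ℂ))
    (φ' : X → X) (hφ' : MeasurePreserving φ') :
    wcomp θ hθ φ hφ * wcomp θ' hθ' φ' hφ' =
      wcomp (fun x => θ x * θ' (φ x)) (measurable_mul_comp hθ hθ' hφ.measurable)
        (fun x => φ' (φ x)) (hφ'.comp hφ) :=
  wcomp_comp_wcomp θ hθ φ hφ θ' hθ' φ' hφ'

theorem wcomp_eq_one {θ : X → Circle} {hθ : Measurable fun x => (θ x : ℂ)} {φ : X → X}
    {hφ : MeasurePreserving φ} (h : ∀ x, θ x = 1) (h' : ∀ x, φ x = x) :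
    wcomp θ hθ φ hφ = 1 := by
  ext1 ξ
  apply Lp.ext
  filter_upwards [wcomp_coe θ hθ φ hφ ξ] with x h1
  rw [h1, h, h']
  simp

theorem norm_wcomp_apply (θ : X → Circle) (hθ : Measurable fun x => (θ x : ℂ)) (φ : X → Y)
    (hφ : MeasurePreserving φ) (ξ : L2 Y) : ‖wcomp θ hθ φ hφ ξ‖ = ‖ξ‖ := by
  rw [← norm_compOp_apply φ hφ ξ, Lp.norm_def, Lp.norm_def]
  congr 1
  refine eLpNorm_congr_norm_ae ?_
  filter_upwards [wcomp_coe θ hθ φ hφ ξ, compOp_coe φ hφ ξ] with x h1 h2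
  rw [h1, h2, norm_mul, Circle.norm_coe, one_mul]

theorem star_eq_of_isometry {T S : B X} (hT : ∀ ξ, ‖T ξ‖ = ‖ξ‖) (h : T * S = 1) :
    star T = S := by
  have h1 : star T * T = 1 := by
    refine ContinuousLinearMap.ext fun ξ => ext_inner_left ℂ fun η => ?_
    change ⟪η, ContinuousLinearMap.adjoint T (T ξ)⟫_ℂ = ⟪η, ξ⟫_ℂ
    rw [ContinuousLinearMap.adjoint_inner_right]
    exact (LinearMap.isometryOfInner (𝕜 := ℂ) T.toLinearMap fun x y => by
      let L : L2 X →ₗᵢ[ℂ] L2 X := ⟨T.toLinearMap, hT⟩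
      exact L.inner_map_map x y).inner_map_map η ξ
  calc star T = star T * (T * S) := by rw [h, mul_one]
    _ = S := by rw [← mul_assoc, h1, one_mul]

theorem measurable_star_comp {θ : X → Circle} (hθ : Measurable fun x => (θ x : ℂ)) {φ : Y → X}
    (hφ : Measurable φ) : Measurable fun x => (((θ (φ x))⁻¹ : Circle) : ℂ) := by
  simp only [Circle.coe_inv_eq_conj]
  exact Complex.continuous_conj.measurable.comp (hθ.comp hφ)

theorem star_wcomp (θ : X → Circle) (hθ : Measurable fun x => (θ x : ℂ)) (φ ψ : X → X)
    (hφ : MeasurePreserving φ) (hψ : MeasurePreserving ψ) (h : ∀ x, ψ (φ x) = x) :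
    star (wcomp θ hθ φ hφ) =
      wcomp (fun x => (θ (ψ x))⁻¹) (measurable_star_comp hθ hψ.measurable) ψ hψ := by
  refine star_eq_of_isometry (norm_wcomp_apply θ hθ φ hφ) ?_
  rw [wcomp_mul_wcomp]
  exact wcomp_eq_one (fun x => by simp [h]) h

theorem wcomp_mem_unitary (θ : X → Circle) (hθ : Measurable fun x => (θ x : ℂ)) (φ ψ : X → X)
    (hφ : MeasurePreserving φ) (hψ : MeasurePreserving ψ) (h : ∀ x, ψ (φ x) = x)
    (h' : ∀ x, φ (ψ x) = x) : wcomp θ hθ φ hφ ∈ unitary (B X) := by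
  rw [Unitary.mem_iff, star_wcomp θ hθ φ ψ hφ hψ h, wcomp_mul_wcomp, wcomp_mul_wcomp]
  exact ⟨wcomp_eq_one (fun x => by simp) h', wcomp_eq_one (fun x => by simp [h]) h⟩

theorem compOp_symm_apply (e : Z ≃ᵐ X) (he : MeasurePreserving e) (ξ : L2 X) :
    compOp e.symm (he.symm e) (compOp e he ξ) = ξ := by
  rw [compOp_comp]
  exact compOp_id _ _ _ (by simp)

theorem compOp_apply_symm (e : Z ≃ᵐ X) (he : MeasurePreserving e) (ξ : L2 Z) :
    compOp e he (compOp e.symm (he.symm e) ξ) = ξ := by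
  rw [compOp_comp]
  exact compOp_id _ _ _ (by simp)

theorem adjoint_compOp (e : Z ≃ᵐ X) (he : MeasurePreserving e) :
    ContinuousLinearMap.adjoint (compOp e he) = compOp e.symm (he.symm e) := by
  refine ContinuousLinearMap.ext fun ξ => ext_inner_left ℂ fun η => ?_
  rw [ContinuousLinearMap.adjoint_inner_right, ← inner_compOp_compOp e he η,
    compOp_apply_symm]

/-- Transport of operators along a measure preserving identification. -/
def conjHom (e : Z ≃ᵐ X) (he : MeasurePreserving e) : B X →⋆ₐ[ℂ] B Z where
  toFun T := compOp e he ∘L T ∘L compOp e.symm (he.symm e)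
  map_one' := ContinuousLinearMap.ext fun ξ => compOp_apply_symm e he ξ
  map_mul' S T := ContinuousLinearMap.ext fun ξ => by
    simp [compOp_symm_apply]
  map_zero' := by simp
  map_add' S T := by simp
  commutes' c := ContinuousLinearMap.ext fun ξ => by
    simp [Algebra.algebraMap_eq_smul_one, compOp_apply_symm]
  map_star' T := by
    simp only [ContinuousLinearMap.star_eq_adjoint, ContinuousLinearMap.adjoint_comp,
      adjoint_compOp]
    exact ContinuousLinearMap.ext fun ξ => rfl

end WeightedComposition

/-! ### Amplifications and leg numbering -/

section Legs

variable {X Y Z : Type} [MeasureSpace X] [MeasureSpace Y] [MeasureSpace Z]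
  [SigmaFinite (volume : Measure X)] [SigmaFinite (volume : Measure Y)]

/-- The amplification `T ↦ T ⊗ 1` as a unital `*`-homomorphism. -/
def amplHom : B X →⋆ₐ[ℂ] B (X × Y) where
  toFun := ampl
  map_one' := (ampl_unique _ _ fun ξ ζ => rfl).symm
  map_mul' S T := (ampl_unique _ _ fun ξ ζ => by
    change ampl S (ampl T _) = _
    rw [ampl_tmul, ampl_tmul]; rfl).symm
  map_zero' := (ampl_unique _ _ fun ξ ζ => by simp).symm
  map_add' S T := (ampl_unique _ _ fun ξ ζ => by simp [ampl_tmul]).symm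
  commutes' c := (ampl_unique _ _ fun ξ ζ => by
    simp [Algebra.algebraMap_eq_smul_one]).symm
  map_star' T := by
    refine (ampl_unique _ _ fun ξ ζ => ?_).symm
    rw [← sub_eq_zero]
    refine eq_zero_of_inner_tmul _ fun ξ' ζ' => ?_
    rw [inner_sub_right, sub_eq_zero]
    change ⟪_, ContinuousLinearMap.adjoint (ampl T) _⟫_ℂ =
      ⟪_, tmul (ContinuousLinearMap.adjoint T ξ) ζ⟫_ℂ
    rw [ContinuousLinearMap.adjoint_inner_right, ampl_tmul]
    simp only [tmul_apply, inner_tmulFun, ContinuousLinearMap.adjoint_inner_right]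

/-- Leg numbering as a unital `*`-homomorphism. -/
def legHom (e : Z ≃ᵐ X × Y) (he : MeasurePreserving e) : B X →⋆ₐ[ℂ] B Z :=
  (conjHom e he).comp amplHom

theorem leg_mul (e : Z ≃ᵐ X × Y) (he : MeasurePreserving e) (S T : B X) :
    leg e he (S * T) = leg e he S * leg e he T := map_mul (legHom e he) S T

theorem leg_one (e : Z ≃ᵐ X × Y) (he : MeasurePreserving e) : leg e he 1 = 1 :=
  map_one (legHom e he)

theorem leg_star (e : Z ≃ᵐ X × Y) (he : MeasurePreserving e) (T : B X) :
    leg e he (star T) = star (leg e he T) := map_star (legHom e he) T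

theorem norm_leg_le (e : Z ≃ᵐ X × Y) (he : MeasurePreserving e) (T : B X) :
    ‖leg e he T‖ ≤ ‖T‖ := NonUnitalStarAlgHom.norm_apply_le (legHom e he) T

theorem continuous_leg (e : Z ≃ᵐ X × Y) (he : MeasurePreserving e) :
    Continuous (leg e he : B X → B Z) :=
  AddMonoidHomClass.continuous_of_bound (legHom e he) 1 fun T => by
    rw [one_mul]
    exact norm_leg_le e he T

theorem mp_prodMap {φ : X → X} (hφ : MeasurePreserving φ) :
    MeasurePreserving (fun p : X × Y => (φ p.1, p.2)) :=
  hφ.prod (.id _)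

theorem ampl_wcomp (θ : X → Circle) (hθ : Measurable fun x => (θ x : ℂ)) (φ : X → X)
    (hφ : MeasurePreserving φ) :
    ampl (Y := Y) (wcomp θ hθ φ hφ) = wcomp (fun p : X × Y => θ p.1) (hθ.comp measurable_fst)
      (fun p => (φ p.1, p.2)) (mp_prodMap hφ) := by
  symm
  refine ampl_unique _ _ fun ξ ζ => Lp.ext ?_
  filter_upwards [wcomp_coe (fun p : X × Y => θ p.1) (hθ.comp measurable_fst)
      (fun p => (φ p.1, p.2)) (mp_prodMap hφ) (tmul ξ ζ),
    tmulFun_coe (wcomp θ hθ φ hφ ξ) ζ,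
    (mp_prodMap (Y := Y) hφ).quasiMeasurePreserving.ae_eq_comp (tmulFun_coe ξ ζ),
    (Measure.quasiMeasurePreserving_fst (μ := (volume : Measure X))
          (ν := (volume : Measure Y))).ae_eq_comp (wcomp_coe θ hθ φ hφ ξ)] with p h1 h2 h3 h4
  simp only [Function.comp_apply] at h3 h4
  rw [h1, tmul_apply, h3, tmul_apply, h2, h4, mul_assoc]

theorem mp_leg (e : Z ≃ᵐ X × Y) (he : MeasurePreserving e) {φ : X → X}
    (hφ : MeasurePreserving φ) :
    MeasurePreserving (fun z => e.symm (φ (e z).1, (e z).2)) :=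
  (he.symm e).comp ((mp_prodMap hφ).comp he)

/-- Leg numbering of a weighted composition operator, which acts on the coordinates selected by
the identification. -/
theorem leg_wcomp (e : Z ≃ᵐ X × Y) (he : MeasurePreserving e) (θ : X → Circle)
    (hθ : Measurable fun x => (θ x : ℂ)) (φ : X → X) (hφ : MeasurePreserving φ) :
    leg e he (wcomp θ hθ φ hφ) = wcomp (fun z => θ (e z).1)
      (hθ.comp (measurable_fst.comp e.measurable)) (fun z => e.symm (φ (e z).1, (e z).2))
      (mp_leg e he hφ) := by
  rw [leg, ampl_wcomp, compOp_eq_wcomp, compOp_eq_wcomp, wcomp_comp_wcomp, wcomp_comp_wcomp]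
  exact wcomp_congr (by simp) (by simp)

theorem legFst_tmul (T : B X) (ξ : L2 X) (ζ : L2 Y) :
    legFst T (tmul ξ ζ) = tmul (T ξ) ζ := by
  have h (v : L2 (X × Y)) : compOp (MeasurableEquiv.refl (X × Y)) (.id _) v = v :=
    compOp_id _ _ _ fun _ => rfl
  have := leg_tmul (MeasurableEquiv.refl (X × Y)) (.id _) T ξ ζ
  rwa [h, h] at this

theorem mp_prodComm :
    MeasurePreserving (MeasurableEquiv.prodComm : X × Y ≃ᵐ Y × X) :=
  Measure.measurePreserving_swap

theorem compOp_swap_tmul (ξ : L2 X) (ζ : L2 Y) :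
    compOp MeasurableEquiv.prodComm mp_prodComm (tmul ξ ζ) = tmul ζ ξ := by
  apply Lp.ext
  filter_upwards [compOp_coe MeasurableEquiv.prodComm mp_prodComm (tmul ξ ζ),
    tmulFun_coe ζ ξ,
    (mp_prodComm (X := Y) (Y := X)).quasiMeasurePreserving.ae_eq_comp (tmulFun_coe ξ ζ)]
    with p h1 h2 h3
  rw [h1, tmul_apply, tmul_apply, h2]
  exact h3.trans (mul_comm _ _)

theorem legSnd_tmul (T : B Y) (ξ : L2 X) (ζ : L2 Y) :
    legSnd T (tmul ξ ζ) = tmul ξ (T ζ) := by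
  have := leg_tmul (X := Y) (Y := X) MeasurableEquiv.prodComm Measure.measurePreserving_swap T ζ ξ
  rwa [compOp_swap_tmul, compOp_swap_tmul] at this

theorem legFst_mul_legSnd_comm (S : B X) (T : B Y) :
    legFst S * legSnd T = legSnd T * legFst S :=
  ext_tmul fun ξ ζ => by
    change legFst S (legSnd T _) = legSnd T (legFst S _)
    simp only [legFst_tmul, legSnd_tmul]

end Legs

section TripleLegs

variable {X : Type} [MeasureSpace X] [SigmaFinite (volume : Measure X)]

theorem compOp_e12_tmul (ξ η ζ : L2 X) :
    compOp (e12 X) mp_e12 (tmul (tmul ξ η) ζ) = tmul ξ (tmul η ζ) := by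
  apply Lp.ext
  have hs : Measure.QuasiMeasurePreserving (Prod.snd : X × X × X → X × X) volume volume :=
    Measure.quasiMeasurePreserving_snd
  have hf : Measure.QuasiMeasurePreserving (Prod.fst : (X × X) × X → X × X) volume volume :=
    Measure.quasiMeasurePreserving_fst
  filter_upwards [compOp_coe (e12 X) mp_e12 (tmul (tmul ξ η) ζ),
    (mp_e12 (X := X)).quasiMeasurePreserving.ae_eq_comp (tmulFun_coe (tmul ξ η) ζ),
    (hf.comp (mp_e12 (X := X)).quasiMeasurePreserving).ae_eq_comp (tmulFun_coe ξ η),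
    tmulFun_coe ξ (tmul η ζ), hs.ae_eq_comp (tmulFun_coe η ζ)] with p h1 h2 h3 h4 h5
  simp only [Function.comp_apply] at h2 h3 h5
  rw [h1, tmul_apply, h2, tmul_apply, h3, tmul_apply, h4, tmul_apply, h5]
  exact mul_assoc _ _ _

theorem compOp_e13_tmul (ξ η ζ : L2 X) :
    compOp (e13 X) mp_e13 (tmul (tmul ξ ζ) η) = tmul ξ (tmul η ζ) := by
  apply Lp.ext
  have hs : Measure.QuasiMeasurePreserving (Prod.snd : X × X × X → X × X) volume volume :=
    Measure.quasiMeasurePreserving_snd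
  have hf : Measure.QuasiMeasurePreserving (Prod.fst : (X × X) × X → X × X) volume volume :=
    Measure.quasiMeasurePreserving_fst
  filter_upwards [compOp_coe (e13 X) mp_e13 (tmul (tmul ξ ζ) η),
    (mp_e13 (X := X)).quasiMeasurePreserving.ae_eq_comp (tmulFun_coe (tmul ξ ζ) η),
    (hf.comp (mp_e13 (X := X)).quasiMeasurePreserving).ae_eq_comp (tmulFun_coe ξ ζ),
    tmulFun_coe ξ (tmul η ζ), hs.ae_eq_comp (tmulFun_coe η ζ)] with p h1 h2 h3 h4 h5
  simp only [Function.comp_apply] at h2 h3 h5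
  rw [h1, tmul_apply, h2, tmul_apply, h3, tmul_apply, h4, tmul_apply, h5]
  change ξ p.1 * ζ p.2.2 * η p.2.1 = _
  ring

theorem leg12_tmul_mul (T : B (X × X)) (ξ η ζ : L2 X) :
    leg12 T (tmul ξ (tmul η ζ)) = compOp (e12 X) mp_e12 (tmul (T (tmul ξ η)) ζ) := by
  rw [← compOp_e12_tmul]
  exact leg_tmul _ _ _ _ _

theorem leg13_tmul_mul (T : B (X × X)) (ξ η ζ : L2 X) :
    leg13 T (tmul ξ (tmul η ζ)) = compOp (e13 X) mp_e13 (tmul (T (tmul ξ ζ)) η) := by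
  rw [← compOp_e13_tmul]
  exact leg_tmul _ _ _ _ _

theorem leg23_eq_legSnd (T : B (X × X)) : leg23 T = legSnd T := rfl

theorem ext_tmul₃ {E : Type*} [NormedAddCommGroup E] [NormedSpace ℂ E]
    {S T : L2 (X × X × X) →L[ℂ] E}
    (h : ∀ ξ η ζ, S (tmul ξ (tmul η ζ)) = T (tmul ξ (tmul η ζ))) : S = T :=
  ext_tmul fun ξ Ψ => by
    have : S ∘L tmul ξ = T ∘L tmul ξ := ext_tmul fun η ζ => h ξ η ζ
    exact DFunLike.congr_fun this Ψ

theorem leg12_legFst (T : B X) : leg12 (legFst T) = (legFst T : B (X × X × X)) :=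
  ext_tmul₃ fun ξ η ζ => by
    rw [leg12_tmul_mul, legFst_tmul, legFst_tmul, compOp_e12_tmul]

theorem leg12_legSnd (T : B X) : leg12 (legSnd T) = (legSnd (legFst T) : B (X × X × X)) :=
  ext_tmul₃ fun ξ η ζ => by
    rw [leg12_tmul_mul, legSnd_tmul, legSnd_tmul, legFst_tmul, compOp_e12_tmul]

theorem leg13_legFst (T : B X) : leg13 (legFst T) = (legFst T : B (X × X × X)) :=
  ext_tmul₃ fun ξ η ζ => by
    rw [leg13_tmul_mul, legFst_tmul, legFst_tmul, compOp_e13_tmul]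

theorem leg13_legSnd (T : B X) : leg13 (legSnd T) = (legSnd (legSnd T) : B (X × X × X)) :=
  ext_tmul₃ fun ξ η ζ => by
    rw [leg13_tmul_mul, legSnd_tmul, legSnd_tmul, legSnd_tmul, compOp_e13_tmul]

end TripleLegs

end QG

end

noncomputable section

namespace QG

/-! ### Normal functionals and slices -/

section Slices

variable {X : Type} [MeasureSpace X] [SigmaFinite (volume : Measure X)]

set_option linter.unusedSectionVars false

/-- The vector functional `T ↦ ⟨η, T ξ⟩`. -/
def vec (η ξ : L2 X) : B X →L[ℂ] ℂ := innerSL ℂ η ∘L ContinuousLinearMap.apply ℂ (L2 X) ξ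

@[simp]
theorem vec_apply (η ξ : L2 X) (T : B X) : vec η ξ T = ⟪η, T ξ⟫_ℂ := rfl

theorem norm_vec_le (η ξ : L2 X) : ‖vec η ξ‖ ≤ ‖η‖ * ‖ξ‖ :=
  ContinuousLinearMap.opNorm_le_bound _ (by positivity) fun T => by
    rw [vec_apply]
    calc ‖⟪η, T ξ⟫_ℂ‖ ≤ ‖η‖ * (‖T‖ * ‖ξ‖) :=
          (norm_inner_le_norm _ _).trans (by gcongr; exact T.le_opNorm ξ)
      _ = _ := by ring

theorem isNormal_vec (η ξ : L2 X) : IsNormal (vec η ξ) := by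
  have hs (ζ : L2 X) : Summable fun i => ‖Pi.single (M := fun _ : ℕ => L2 X) 0 ζ i‖ ^ 2 :=
    summable_of_ne_finset_zero (s := {0}) fun i hi => by
      rw [Pi.single_eq_of_ne (by simpa using hi), norm_zero, zero_pow two_ne_zero]
  refine ⟨Pi.single 0 ξ, Pi.single 0 η, hs ξ, hs η, fun T => ?_⟩
  have := hasSum_single (f := fun i => ⟪Pi.single (M := fun _ : ℕ => L2 X) 0 η i,
    T (Pi.single (M := fun _ : ℕ => L2 X) 0 ξ i)⟫_ℂ) 0 fun i hi => by
      rw [Pi.single_eq_of_ne hi, inner_zero_left]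
  rwa [Pi.single_eq_same, Pi.single_eq_same] at this

/-- The bounded functionals on the bounded operators of `L²(X)`. -/
abbrev BDual (X : Type) [MeasureSpace X] : Type := B X →L[ℂ] ℂ

/-- Evaluation of functionals at an operator. -/
def evalAt (T : B X) : BDual X →L[ℂ] ℂ := ContinuousLinearMap.apply ℂ ℂ T

/-- A normal functional is a norm convergent series of vector functionals. -/
theorem IsNormal.exists_hasSum {ω : BDual X} (h : IsNormal ω) :
    ∃ η ξ : ℕ → L2 X, HasSum (fun i => vec (η i) (ξ i)) ω := by
  obtain ⟨ξ, η, hξ, hη, hs⟩ := h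
  refine ⟨η, ξ, ?_⟩
  have key (a b : ℝ) : a * b ≤ a ^ 2 + b ^ 2 := by
    nlinarith [sq_nonneg (a - b), sq_nonneg a, sq_nonneg b]
  obtain ⟨ω', h⟩ : Summable fun i => vec (η i) (ξ i) :=
    Summable.of_norm_bounded (E := BDual X) (hη.add hξ) fun i => (norm_vec_le _ _).trans (key _ _)
  have : ω = ω' := ContinuousLinearMap.ext fun T => HasSum.unique (hs T) (h.mapL (evalAt T))
  exact this ▸ h

/-- Continuous linear maps which agree on vector functionals agree on normal functionals. -/
theorem IsNormal.eq_of_vec {E : Type*} [NormedAddCommGroup E] [NormedSpace ℂ E]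
    {f g : BDual X →L[ℂ] E} (h : ∀ η ξ, f (vec η ξ) = g (vec η ξ)) {ω : BDual X}
    (hω : IsNormal ω) : f ω = g ω := by
  obtain ⟨η, ξ, hs⟩ := hω.exists_hasSum
  refine (hs.mapL f).unique ?_
  simp only [h]
  exact hs.mapL g

theorem IsNormal.mem_of_vec {E : Type*} [NormedAddCommGroup E] [NormedSpace ℂ E]
    (f : BDual X →L[ℂ] E) (M : Submodule ℂ E) (hM : IsClosed (M : Set E))
    (h : ∀ η ξ, f (vec η ξ) ∈ M) {ω : BDual X} (hω : IsNormal ω) : f ω ∈ M := by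
  obtain ⟨η, ξ, hs⟩ := hω.exists_hasSum
  exact hM.mem_of_tendsto (hs.mapL f) (Filter.Eventually.of_forall fun s =>
    Submodule.sum_mem _ fun i _ => h _ _)

theorem norm_le_of_inner_bound {T : B X} {C : ℝ} (hC : 0 ≤ C)
    (h : ∀ v w, ‖⟪v, T w⟫_ℂ‖ ≤ C * ‖v‖ * ‖w‖) : ‖T‖ ≤ C := by
  refine ContinuousLinearMap.opNorm_le_bound _ hC fun w => ?_
  have h1 := h (T w) w
  rw [inner_self_eq_norm_sq_to_K] at h1
  have h2 : ‖((‖T w‖ : ℂ)) ^ 2‖ = ‖T w‖ * ‖T w‖ := by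
    rw [norm_pow, sq]; simp
  erw [h2] at h1
  rcases (norm_nonneg (T w)).eq_or_lt with h0 | h0
  · rw [← h0]; positivity
  · refine le_of_mul_le_mul_left ?_ h0
    calc _ ≤ _ := h1
      _ = _ := by ring

theorem norm_leftSlice_le (ω : BDual X) (W : B (X × X)) : ‖leftSlice ω W‖ ≤ ‖ω‖ * ‖W‖ :=
  norm_le_of_inner_bound (by positivity) fun v w => by
    rw [inner_leftSlice]
    exact slice_bound ω W _ _ _ _ (norm_tensRight_le v) (norm_tensRight_le w)

theorem norm_rightSlice_le (ω : BDual X) (W : B (X × X)) : ‖rightSlice ω W‖ ≤ ‖ω‖ * ‖W‖ :=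
  norm_le_of_inner_bound (by positivity) fun v w => by
    rw [inner_rightSlice]
    exact slice_bound ω W _ _ _ _ (norm_tensLeft_le v) (norm_tensLeft_le w)

/-- The slice `(ω ⊗ id)(W)` as a continuous linear function of `ω`. -/
def leftSliceAt (W : B (X × X)) : BDual X →L[ℂ] B X :=
  LinearMap.mkContinuous
    { toFun := fun ω => leftSlice ω W
      map_add' := fun ω ω' => ContinuousLinearMap.ext fun w => ext_inner_left ℂ fun v => by
        simp [inner_leftSlice, inner_add_right]
      map_smul' := fun c ω => ContinuousLinearMap.ext fun w => ext_inner_left ℂ fun v => by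
        simp [inner_leftSlice, inner_smul_right] }
    ‖W‖ (fun ω => by rw [mul_comm]; exact norm_leftSlice_le ω W)

/-- The slice `(id ⊗ ω)(W)` as a continuous linear function of `ω`. -/
def rightSliceAt (W : B (X × X)) : BDual X →L[ℂ] B X :=
  LinearMap.mkContinuous
    { toFun := fun ω => rightSlice ω W
      map_add' := fun ω ω' => ContinuousLinearMap.ext fun w => ext_inner_left ℂ fun v => by
        simp [inner_rightSlice, inner_add_right]
      map_smul' := fun c ω => ContinuousLinearMap.ext fun w => ext_inner_left ℂ fun v => by
        simp [inner_rightSlice, inner_smul_right] }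
    ‖W‖ (fun ω => by rw [mul_comm]; exact norm_rightSlice_le ω W)

/-- The slice map `W ↦ (ω ⊗ id)(W)` as a continuous linear map. -/
def leftSliceL (ω : BDual X) : B (X × X) →L[ℂ] B X :=
  LinearMap.mkContinuous
    { toFun := fun W => leftSlice ω W
      map_add' := fun W W' => ContinuousLinearMap.ext fun w => ext_inner_left ℂ fun v => by
        simp [inner_leftSlice, inner_add_right]
      map_smul' := fun c W => ContinuousLinearMap.ext fun w => ext_inner_left ℂ fun v => by
        simp [inner_leftSlice, inner_smul_right] }
    ‖ω‖ (fun W => norm_leftSlice_le ω W)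

/-- Left multiplication `T ↦ a T` as a continuous linear map. -/
def lmulL {Y : Type} [MeasureSpace Y] (a : B Y) : B Y →L[ℂ] B Y := ContinuousLinearMap.mul ℂ (B Y) a

/-- Right multiplication `T ↦ T a` as a continuous linear map. -/
def rmulL {Y : Type} [MeasureSpace Y] (a : B Y) : B Y →L[ℂ] B Y :=
  (ContinuousLinearMap.mul ℂ (B Y)).flip a

/-- Leg numbering as a continuous linear map. -/
def legL {Y Z : Type} [MeasureSpace Y] [MeasureSpace Z] [SigmaFinite (volume : Measure Y)]
    (e : Z ≃ᵐ X × Y) (he : MeasurePreserving e) : B X →L[ℂ] B Z :=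
  ⟨(legHom e he).toAlgHom.toLinearMap, continuous_leg e he⟩

theorem leftSlice_vec (η ξ : L2 X) (W : B (X × X)) :
    leftSlice (vec η ξ) W = ContinuousLinearMap.adjoint (tensLeft η) ∘L W ∘L tensLeft ξ :=
  ContinuousLinearMap.ext fun w => ext_inner_left ℂ fun v => by
    rw [inner_leftSlice]
    simp only [vec_apply, ContinuousLinearMap.comp_apply,
      ContinuousLinearMap.adjoint_inner_right]
    rfl

theorem rightSlice_vec (η ξ : L2 X) (W : B (X × X)) :
    rightSlice (vec η ξ) W = ContinuousLinearMap.adjoint (tensRight η) ∘L W ∘L tensRight ξ :=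
  ContinuousLinearMap.ext fun w => ext_inner_left ℂ fun v => by
    rw [inner_rightSlice]
    simp only [vec_apply, ContinuousLinearMap.comp_apply,
      ContinuousLinearMap.adjoint_inner_right]
    rfl

theorem inner_tmul {Y : Type} [MeasureSpace Y] [SigmaFinite (volume : Measure Y)]
    (ξ ξ' : L2 X) (ζ ζ' : L2 Y) :
    ⟪tmul ξ ζ, tmul ξ' ζ'⟫_ℂ = ⟪ξ, ξ'⟫_ℂ * ⟪ζ, ζ'⟫_ℂ := inner_tmulFun ξ ξ' ζ ζ'

theorem ext_inner_tmul {S T : B (X × X)}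
    (h : ∀ u v u' v', ⟪tmul u' v', S (tmul u v)⟫_ℂ = ⟪tmul u' v', T (tmul u v)⟫_ℂ) : S = T :=
  ext_tmul fun u v => by
    rw [← sub_eq_zero]
    refine eq_zero_of_inner_tmul _ fun u' v' => ?_
    rw [inner_sub_right, h, sub_self]

/-- Insertion of a vector in the first leg, `Ψ ↦ ξ ⊗ Ψ`. -/
def insFst (ξ : L2 X) : L2 (X × X) →L[ℂ] L2 (X × X × X) := tmul ξ

/-- Insertion of a vector in the third leg, `Ψ ↦ Ψ ⊗ ξ`. -/
def insThd (ξ : L2 X) : L2 (X × X) →L[ℂ] L2 (X × X × X) :=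
  compOp (e12 X) mp_e12 ∘L tmul.flip ξ

theorem insFst_tmul (ξ u v : L2 X) : insFst ξ (tmul u v) = tmul ξ (tmul u v) := rfl

theorem insThd_tmul (ξ u v : L2 X) : insThd ξ (tmul u v) = tmul u (tmul v ξ) :=
  compOp_e12_tmul u v ξ

theorem leg23_insFst (W : B (X × X)) (ξ : L2 X) : leg23 W ∘L insFst ξ = insFst ξ ∘L W :=
  ContinuousLinearMap.ext fun Ψ => legSnd_tmul W ξ Ψ

theorem leg12_insThd (W : B (X × X)) (ξ : L2 X) : leg12 W ∘L insThd ξ = insThd ξ ∘L W :=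
  ContinuousLinearMap.ext fun Ψ => leg_tmul (e12 X) mp_e12 W Ψ ξ

theorem adjoint_insFst_leg23 (W : B (X × X)) (ξ : L2 X) :
    ContinuousLinearMap.adjoint (insFst ξ) ∘L leg23 W =
      W ∘L ContinuousLinearMap.adjoint (insFst ξ) := by
  have h := congrArg ContinuousLinearMap.adjoint (leg23_insFst (star W) ξ)
  rw [leg23, leg_star, ← leg23] at h
  simpa only [ContinuousLinearMap.adjoint_comp, ContinuousLinearMap.star_eq_adjoint,
    ContinuousLinearMap.adjoint_adjoint] using h

theorem adjoint_insThd_leg12 (W : B (X × X)) (ξ : L2 X) :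
    ContinuousLinearMap.adjoint (insThd ξ) ∘L leg12 W =
      W ∘L ContinuousLinearMap.adjoint (insThd ξ) := by
  have h := congrArg ContinuousLinearMap.adjoint (leg12_insThd (star W) ξ)
  rw [leg12, leg_star, ← leg12] at h
  simpa only [ContinuousLinearMap.adjoint_comp, ContinuousLinearMap.star_eq_adjoint,
    ContinuousLinearMap.adjoint_adjoint] using h

theorem slice_insFst_leg12 (W : B (X × X)) (η ξ : L2 X) :
    ContinuousLinearMap.adjoint (insFst η) ∘L leg12 W ∘L insFst ξ =
      legFst (leftSlice (vec η ξ) W) :=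
  ext_inner_tmul fun u v u' v' => by
    simp only [ContinuousLinearMap.comp_apply, ContinuousLinearMap.adjoint_inner_right,
      insFst_tmul, leg12_tmul_mul, legFst_tmul, leftSlice_vec, inner_tmul]
    rw [← compOp_e12_tmul, inner_compOp_compOp, inner_tmul]
    rfl

theorem slice_insFst_leg13 (W : B (X × X)) (η ξ : L2 X) :
    ContinuousLinearMap.adjoint (insFst η) ∘L leg13 W ∘L insFst ξ =
      legSnd (leftSlice (vec η ξ) W) :=
  ext_inner_tmul fun u v u' v' => by
    simp only [ContinuousLinearMap.comp_apply, ContinuousLinearMap.adjoint_inner_right,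
      insFst_tmul, leg13_tmul_mul, legSnd_tmul, leftSlice_vec, inner_tmul]
    rw [← compOp_e13_tmul, inner_compOp_compOp, inner_tmul, mul_comm]
    rfl

theorem slice_insThd_leg13 (W : B (X × X)) (η ξ : L2 X) :
    ContinuousLinearMap.adjoint (insThd η) ∘L leg13 W ∘L insThd ξ =
      legFst (rightSlice (vec η ξ) W) :=
  ext_inner_tmul fun u v u' v' => by
    simp only [ContinuousLinearMap.comp_apply, ContinuousLinearMap.adjoint_inner_right,
      insThd_tmul, leg13_tmul_mul, legFst_tmul, rightSlice_vec, inner_tmul]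
    rw [← compOp_e13_tmul, inner_compOp_compOp, inner_tmul]
    rfl

theorem slice_insThd_leg23 (W : B (X × X)) (η ξ : L2 X) :
    ContinuousLinearMap.adjoint (insThd η) ∘L leg23 W ∘L insThd ξ =
      legSnd (rightSlice (vec η ξ) W) :=
  ext_inner_tmul fun u v u' v' => by
    simp only [ContinuousLinearMap.comp_apply, ContinuousLinearMap.adjoint_inner_right,
      insThd_tmul, leg23_eq_legSnd, legSnd_tmul, rightSlice_vec, inner_tmul]
    rfl

end Slices

/-! ### Duality of the two slice algebras -/

section Duality

variable {X : Type} [MeasureSpace X] [SigmaFinite (volume : Measure X)] {W : B (X × X)}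

theorem IsMultiplicativeUnitary.leg23_mul_star (hW : IsMultiplicativeUnitary W) :
    leg23 W * star (leg23 W) = 1 := by
  rw [leg23, ← leg_star, ← leg_mul, (Unitary.mem_iff.1 hW.1).2, leg_one]

theorem IsMultiplicativeUnitary.star_leg12_mul (hW : IsMultiplicativeUnitary W) :
    star (leg12 W) * leg12 W = 1 := by
  rw [leg12, ← leg_star, ← leg_mul, (Unitary.mem_iff.1 hW.1).1, leg_one]

theorem IsMultiplicativeUnitary.leg23_leg12_star (hW : IsMultiplicativeUnitary W) :
    leg23 W * leg12 W * star (leg23 W) = leg12 W * leg13 W := by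
  rw [← hW.2, mul_assoc, hW.leg23_mul_star, mul_one]

theorem IsMultiplicativeUnitary.star_leg12_leg23 (hW : IsMultiplicativeUnitary W) :
    star (leg12 W) * (leg23 W * leg12 W) = leg13 W * leg23 W := by
  rw [← hW.2, mul_assoc, ← mul_assoc, hW.star_leg12_mul, one_mul]

/-- The comultiplication of a slice: `W (s ⊗ 1) W* = (ω ⊗ id ⊗ id)(W₁₂ W₁₃)`
for `s = (ω ⊗ id)(W)`. -/
theorem IsMultiplicativeUnitary.conj_legFst_leftSlice (hW : IsMultiplicativeUnitary W)
    (η ξ : L2 X) :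
    W * legFst (leftSlice (vec η ξ) W) * star W =
      ContinuousLinearMap.adjoint (insFst η) ∘L (leg12 W * leg13 W) ∘L insFst ξ := by
  have h1 := leg23_insFst (star W) ξ
  rw [leg23, leg_star, ← leg23] at h1
  rw [← slice_insFst_leg12, ← hW.leg23_leg12_star]
  calc _ = (W ∘L ContinuousLinearMap.adjoint (insFst η)) ∘L leg12 W ∘L (insFst ξ ∘L star W) := rfl
    _ = _ := by rw [← h1, ← adjoint_insFst_leg23]; rfl

/-- The dual comultiplication of a slice: `W* (1 ⊗ s) W = (id ⊗ id ⊗ ω)(W₁₃ W₂₃)`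
for `s = (id ⊗ ω)(W)`. -/
theorem IsMultiplicativeUnitary.conj_legSnd_rightSlice (hW : IsMultiplicativeUnitary W)
    (η ξ : L2 X) :
    star W * legSnd (rightSlice (vec η ξ) W) * W =
      ContinuousLinearMap.adjoint (insThd η) ∘L (leg13 W * leg23 W) ∘L insThd ξ := by
  have h1 := adjoint_insThd_leg12 (star W) η
  rw [leg12, leg_star, ← leg12] at h1
  rw [← slice_insThd_leg23, ← hW.star_leg12_leg23]
  calc _ = (star W ∘L ContinuousLinearMap.adjoint (insThd η)) ∘L leg23 W ∘L (insThd ξ ∘L W) := rfl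
    _ = _ := by rw [← h1, ← leg12_insThd]; rfl

theorem adjoint_tensLeft_legSnd (T : B X) (η : L2 X) :
    ContinuousLinearMap.adjoint (tensLeft η) ∘L legSnd T =
      T ∘L ContinuousLinearMap.adjoint (tensLeft η) := by
  refine ext_tmul fun u v => ext_inner_left ℂ fun w => ?_
  rw [ContinuousLinearMap.comp_apply, ContinuousLinearMap.comp_apply, legSnd_tmul,
    ContinuousLinearMap.adjoint_inner_right, ← ContinuousLinearMap.adjoint_inner_left T,
    ContinuousLinearMap.adjoint_inner_right]
  change ⟪tmul _ _, _⟫_ℂ = ⟪tmul _ _, _⟫_ℂ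
  rw [inner_tmul, inner_tmul, ContinuousLinearMap.adjoint_inner_left]

/-- The product of two slices `(id ⊗ ω')(W)` pairs with `s = (ω ⊗ id)(W)` like `W (s ⊗ 1) W*`; both
sides are values of `ω ⊗ ω' ⊗ ω''` on `W₁₂ W₁₃`. -/
theorem comul_pairing_vec (hW : IsMultiplicativeUnitary W) (η ξ η' ξ' η'' ξ'' : L2 X) :
    vec η ξ (rightSlice (vec η' ξ') W * rightSlice (vec η'' ξ'') W) =
      vec η'' ξ'' (leftSlice (vec η' ξ') (W * legFst (leftSlice (vec η ξ) W) * star W)) := by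
  have h2 : ⟪tmul η' η'', (ContinuousLinearMap.adjoint (insFst η) ∘L (leg12 W * leg13 W) ∘L
      insFst ξ) (tmul ξ' ξ'')⟫_ℂ = ⟪tmul η η', (W ∘L (ContinuousLinearMap.adjoint (insThd η'') ∘L
        leg13 W ∘L insThd ξ'')) (tmul ξ ξ')⟫_ℂ := by
    have : W ∘L (ContinuousLinearMap.adjoint (insThd η'') ∘L leg13 W ∘L insThd ξ'') =
        (W ∘L ContinuousLinearMap.adjoint (insThd η'')) ∘L leg13 W ∘L insThd ξ'' := rfl
    rw [this, ← adjoint_insThd_leg12]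
    simp only [ContinuousLinearMap.comp_apply, ContinuousLinearMap.adjoint_inner_right,
      insThd_tmul, insFst_tmul]
    rfl
  rw [hW.conj_legFst_leftSlice, vec_apply, vec_apply, leftSlice_vec]
  simp only [ContinuousLinearMap.comp_apply, ContinuousLinearMap.adjoint_inner_right]
  simp only [ContinuousLinearMap.comp_apply, ContinuousLinearMap.adjoint_inner_right] at h2
  refine Eq.trans ?_ h2.symm
  change _ = ⟪tmul η η', W ((ContinuousLinearMap.adjoint (insThd η'') ∘L leg13 W ∘L insThd ξ'')
    (tmul ξ ξ'))⟫_ℂ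
  rw [slice_insThd_leg13, legFst_tmul, rightSlice_vec (η := η')]
  change ⟪η, ContinuousLinearMap.adjoint (tensRight η') _⟫_ℂ = _
  rw [ContinuousLinearMap.adjoint_inner_right]
  rfl

/-- The product of two slices `(ω ⊗ id)(W)` pairs with `s = (id ⊗ ω'')(W)` like `W* (1 ⊗ s) W`; both
sides are values of `ω ⊗ ω' ⊗ ω''` on `W₁₃ W₂₃`. -/
theorem comul_hat_pairing_vec (hW : IsMultiplicativeUnitary W) (η ξ η' ξ' η'' ξ'' : L2 X) :
    vec η'' ξ'' (leftSlice (vec η ξ) W * leftSlice (vec η' ξ') W) =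
      vec η' ξ' (leftSlice (vec η ξ) (star W * legSnd (rightSlice (vec η'' ξ'') W) * W)) := by
  have h2 : ⟪tmul η η', (ContinuousLinearMap.adjoint (insThd η'') ∘L (leg13 W * leg23 W) ∘L
      insThd ξ'') (tmul ξ ξ')⟫_ℂ = ⟪tmul η' η'', ((ContinuousLinearMap.adjoint (insFst η) ∘L
        leg13 W ∘L insFst ξ) ∘L W) (tmul ξ' ξ'')⟫_ℂ := by
    have : (ContinuousLinearMap.adjoint (insFst η) ∘L leg13 W ∘L insFst ξ) ∘L W =
        ContinuousLinearMap.adjoint (insFst η) ∘L leg13 W ∘L (insFst ξ ∘L W) := rfl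
    rw [this, ← leg23_insFst]
    simp only [ContinuousLinearMap.comp_apply, ContinuousLinearMap.adjoint_inner_right,
      insThd_tmul, insFst_tmul]
    rfl
  rw [hW.conj_legSnd_rightSlice, vec_apply, vec_apply]
  rw [slice_insFst_leg13] at h2
  rw [leftSlice_vec (W := _ ∘L _)]
  simp only [ContinuousLinearMap.comp_apply, ContinuousLinearMap.adjoint_inner_right] at h2 ⊢
  refine Eq.trans ?_ h2.symm
  rw [leftSlice_vec (η := η')]
  change ⟪η'', ((leftSlice (vec η ξ) W) ∘L (ContinuousLinearMap.adjoint (tensLeft η')))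
    (W (tensLeft ξ' ξ''))⟫_ℂ = _
  rw [← adjoint_tensLeft_legSnd, ContinuousLinearMap.comp_apply,
    ContinuousLinearMap.adjoint_inner_right]
  rfl

/-- The two slice algebras of a multiplicative unitary are dual to each other. -/
theorem IsMultiplicativeUnitary.areMutuallyDual (hW : IsMultiplicativeUnitary W) :
    AreMutuallyDual W where
  pairing ω ω' hω hω' := by
    refine IsNormal.eq_of_vec (f := ω'.comp (leftSliceAt W))
      (g := evalAt (rightSlice ω' W)) (fun η ξ => ?_) hω
    refine IsNormal.eq_of_vec (f := evalAt (leftSlice (vec η ξ) W))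
      (g := (vec η ξ).comp (rightSliceAt W)) (fun η' ξ' => ?_) hω'
    change vec η' ξ' (leftSlice (vec η ξ) W) = vec η ξ (rightSlice (vec η' ξ') W)
    rw [leftSlice_vec, rightSlice_vec, vec_apply, vec_apply]
    simp only [ContinuousLinearMap.comp_apply, ContinuousLinearMap.adjoint_inner_right]
    rfl
  comul ω ω' ω'' hω hω' hω'' := by
    refine IsNormal.eq_of_vec (f := ω.comp ((lmulL (rightSlice ω' W)).comp (rightSliceAt W)))
      (g := evalAt (leftSlice ω' (W * legFst (leftSlice ω W) * star W))) (fun η'' ξ'' => ?_) hω''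
    refine IsNormal.eq_of_vec
      (f := ω.comp ((rmulL (rightSlice (vec η'' ξ'') W)).comp (rightSliceAt W)))
      (g := (vec η'' ξ'').comp (leftSliceAt (W * legFst (leftSlice ω W) * star W)))
      (fun η' ξ' => ?_) hω'
    exact IsNormal.eq_of_vec (f := evalAt (rightSlice (vec η' ξ') W * rightSlice (vec η'' ξ'') W))
      (g := (vec η'' ξ'').comp ((leftSliceL (vec η' ξ')).comp ((rmulL (star W)).comp
        ((lmulL W).comp ((legL (MeasurableEquiv.refl (X × X)) (.id _)).comp (leftSliceAt W))))))
      (fun η ξ => comul_pairing_vec hW η ξ η' ξ' η'' ξ'') hω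
  comul_hat ω ω' ω'' hω hω' hω'' := by
    refine IsNormal.eq_of_vec (f := ω''.comp ((lmulL (leftSlice ω W)).comp (leftSliceAt W)))
      (g := evalAt (leftSlice ω (star W * legSnd (rightSlice ω'' W) * W))) (fun η' ξ' => ?_) hω'
    refine IsNormal.eq_of_vec
      (f := ω''.comp ((rmulL (leftSlice (vec η' ξ') W)).comp (leftSliceAt W)))
      (g := (vec η' ξ').comp (leftSliceAt (star W * legSnd (rightSlice ω'' W) * W)))
      (fun η ξ => ?_) hω
    exact IsNormal.eq_of_vec (f := evalAt (leftSlice (vec η ξ) W * leftSlice (vec η' ξ') W))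
      (g := (vec η' ξ').comp ((leftSliceL (vec η ξ)).comp ((rmulL W).comp
        ((lmulL (star W)).comp ((legL (X := X) (Y := X) MeasurableEquiv.prodComm
        Measure.measurePreserving_swap).comp (rightSliceAt W))))))
      (fun η'' ξ'' => comul_hat_pairing_vec hW η ξ η' ξ' η'' ξ'') hω''

end Duality

end QG

end

noncomputable section

namespace QG

/-! ### Bialgebras from multiplicative unitaries -/

section ClosedSpan

variable {E F : Type*} [NormedAddCommGroup E] [NormedSpace ℂ E] [NormedAddCommGroup F]
  [NormedSpace ℂ F]

/-- The closed linear span of a set. -/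
abbrev cspan (S : Set E) : Submodule ℂ E := (Submodule.span ℂ S).topologicalClosure

theorem isClosed_cspan (S : Set E) : IsClosed (cspan S : Set E) :=
  Submodule.isClosed_topologicalClosure _

theorem subset_cspan {S : Set E} {x : E} (hx : x ∈ S) : x ∈ cspan S :=
  Submodule.le_topologicalClosure _ (Submodule.subset_span hx)

theorem map_mem_of_mem_cspan (f : E →L[ℂ] F) {S : Set E} {M : Submodule ℂ F}
    (hM : IsClosed (M : Set F)) (h : ∀ s ∈ S, f s ∈ M) {x : E} (hx : x ∈ cspan S) : f x ∈ M :=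
  Submodule.topologicalClosure_minimal (Submodule.span ℂ S) (t := M.comap f.toLinearMap)
    (Submodule.span_le.2 h) (hM.preimage f.continuous) hx

end ClosedSpan

section Sandwich

variable {H K : Type*} [NormedAddCommGroup H] [InnerProductSpace ℂ H] [CompleteSpace H]
  [NormedAddCommGroup K] [InnerProductSpace ℂ K] [CompleteSpace K]

/-- The map `T ↦ P* T Q`. -/
def sandwich (P Q : H →L[ℂ] K) : (K →L[ℂ] K) →L[ℂ] (H →L[ℂ] H) :=
  LinearMap.mkContinuous
    { toFun := fun T => ContinuousLinearMap.adjoint P ∘L T ∘L Q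
      map_add' := fun S T => by ext1 v; simp
      map_smul' := fun c T => by ext1 v; simp }
    (‖P‖ * ‖Q‖) (fun T => by
      calc ‖ContinuousLinearMap.adjoint P ∘L T ∘L Q‖
          ≤ ‖ContinuousLinearMap.adjoint P‖ * (‖T‖ * ‖Q‖) :=
            (ContinuousLinearMap.opNorm_comp_le _ _).trans
              (by gcongr; exact ContinuousLinearMap.opNorm_comp_le _ _)
        _ = _ := by rw [LinearIsometryEquiv.norm_map]; ring)

/-- The rank one operator `v ↦ ⟨η, v⟩ ξ`. -/
def rankOne (ξ η : H) : H →L[ℂ] H := (innerSL ℂ η).smulRight ξ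

omit [CompleteSpace H] in
theorem rankOne_apply (ξ η v : H) : rankOne ξ η v = ⟪η, v⟫_ℂ • ξ := rfl

end Sandwich

section Criterion

variable {X : Type} [MeasureSpace X] [SigmaFinite (volume : Measure X)]

/-- The elementary tensors `a ⊗ b` with `a, b ∈ A`. -/
def elemTensors (A : NonUnitalStarSubalgebra ℂ (B X)) : Set (B (X × X)) :=
  {t : B (X × X) | ∃ a ∈ A, ∃ b ∈ A, t = legFst a * legSnd b}

theorem legFst_mul (S T : B X) :
    (legFst (S * T) : B (X × X)) = legFst S * legFst T := leg_mul _ _ _ _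

theorem legSnd_mul {Y : Type} [MeasureSpace Y] [SigmaFinite (volume : Measure Y)] (S T : B Y) :
    (legSnd (S * T) : B (X × Y)) = legSnd S * legSnd T := leg_mul _ _ _ _

theorem legFst_star (T : B X) : (legFst (star T) : B (X × X)) = star (legFst T) := leg_star _ _ _

theorem legSnd_star (T : B X) : (legSnd (star T) : B (X × X)) = star (legSnd T) := leg_star _ _ _

/-- The elementary tensors are closed under products and adjoints, so that their span is already
a `*`-algebra. -/
theorem adjoin_elemTensors_le (A : NonUnitalStarSubalgebra ℂ (B X)) {t : B (X × X)}
    (ht : t ∈ NonUnitalStarAlgebra.adjoin ℂ (elemTensors A)) :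
    t ∈ Submodule.span ℂ (elemTensors A) := by
  induction ht using NonUnitalStarAlgebra.adjoin_induction with
  | mem x hx => exact Submodule.subset_span hx
  | add x y _ _ hx hy => exact add_mem hx hy
  | zero => exact zero_mem _
  | mul x y _ _ hx hy =>
    have h := Submodule.mul_mem_mul hx hy
    rw [Submodule.span_mul_span] at h
    refine Submodule.span_mono ?_ h
    rintro _ ⟨_, ⟨a, ha, b, hb, rfl⟩, _, ⟨a', ha', b', hb', rfl⟩, rfl⟩
    refine ⟨a * a', mul_mem ha ha', b * b', mul_mem hb hb', ?_⟩
    change legFst a * legSnd b * (legFst a' * legSnd b') = _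
    rw [legFst_mul, legSnd_mul, mul_assoc, ← mul_assoc (legSnd b),
      ← legFst_mul_legSnd_comm a' b]
    simp only [mul_assoc]
  | smul c x _ hx => exact Submodule.smul_mem _ c hx
  | star x h hx =>
    clear h
    induction hx using Submodule.span_induction with
    | mem x hx =>
      obtain ⟨a, ha, b, hb, rfl⟩ := hx
      refine Submodule.subset_span ⟨star a, star_mem ha, star b, star_mem hb, ?_⟩
      rw [star_mul, legFst_star, legSnd_star, ← legFst_star, ← legSnd_star,
        legFst_mul_legSnd_comm]
    | zero => rw [star_zero]; exact zero_mem _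
    | add x y _ _ hx hy => rw [star_add]; exact add_mem hx hy
    | smul c x _ hx => rw [star_smul]; exact Submodule.smul_mem _ _ hx

theorem isClosed_tensorAlg (A : NonUnitalStarSubalgebra ℂ (B X)) :
    IsClosed ((tensorAlg A).toSubmodule : Set (B (X × X))) :=
  NonUnitalStarSubalgebra.isClosed_topologicalClosure _

theorem elemTensor_mem (A : NonUnitalStarSubalgebra ℂ (B X)) {a b : B X} (ha : a ∈ A)
    (hb : b ∈ A) : legFst a * legSnd b ∈ tensorAlg A :=
  NonUnitalStarSubalgebra.le_topologicalClosure _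
    (NonUnitalStarAlgebra.subset_adjoin ℂ _ ⟨a, ha, b, hb, rfl⟩)

theorem tensorAlg_le_cspan (A : NonUnitalStarSubalgebra ℂ (B X)) {t : B (X × X)}
    (ht : t ∈ tensorAlg A) : t ∈ cspan (elemTensors A) :=
  closure_mono (fun _ h => adjoin_elemTensors_le A h) ht

/-- The common core of the two bialgebra criteria.  A unitary `U` on a triple tensor product
preserves the closed span of the operators `|ξ⟩⟨η| ⊗ b ⊗ c`, encoded by `gen`, and its slices
along the distinguished leg are the operators `Γ η ξ`.  Then the slices multiply `A ⊗ A` into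
itself, and their products with `A ⊗ A` are total in `A ⊗ A`. -/
theorem comul_mem_and_total (A : NonUnitalStarSubalgebra ℂ (B X))
    (ins : L2 X → (L2 (X × X) →L[ℂ] L2 (X × X × X)))
    (gen : L2 X → L2 X → B (X × X) → B (X × X × X)) (U : B (X × X × X))
    (Γ : L2 X → L2 X → B (X × X))
    (h1 : ∀ η ζ ξ η' d, sandwich (ins η) (ins ζ) (gen ξ η' d) = (⟪η, ξ⟫_ℂ * ⟪η', ζ⟫_ℂ) • d)
    (h2 : ∀ η ζ ξ η' d, sandwich (ins η) (ins ζ) (U * gen ξ η' d) = ⟪η', ζ⟫_ℂ • (Γ η ξ * d))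
    (h3 : ∀ ξ η, ∀ t ∈ elemTensors A,
      U * gen ξ η t ∈ cspan {T | ∃ ξ η, ∃ t ∈ elemTensors A, T = gen ξ η t})
    (h4 : ∀ ξ η, ∀ t ∈ elemTensors A,
      star U * gen ξ η t ∈ cspan {T | ∃ ξ η, ∃ t ∈ elemTensors A, T = gen ξ η t})
    (h5 : U * star U = 1) :
    (∀ η ξ, ∀ t ∈ elemTensors A, Γ η ξ * t ∈ tensorAlg A) ∧
    (∀ t ∈ elemTensors A, t ∈ cspan {T | ∃ η ξ, ∃ d ∈ elemTensors A, T = Γ η ξ * d}) := by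
  -- if `L²(X) = 0` there is no vector to slice with, but then all operators vanish
  have h0 : ∀ t ∈ elemTensors A, t = 0 ∨ ∃ v : L2 X, ⟪v, v⟫_ℂ ≠ 0 := by
    rintro t ⟨a, -, b, -, rfl⟩
    by_cases h : ∃ v : L2 X, v ≠ 0
    · obtain ⟨v, hv⟩ := h
      exact Or.inr ⟨v, fun h => hv (inner_self_eq_zero.1 h)⟩
    · push Not at h
      have ha : a = 0 := ContinuousLinearMap.ext fun v => by rw [h v, map_zero, map_zero]
      refine Or.inl ?_
      rw [ha, show legFst (0 : B X) = (0 : B (X × X)) from map_zero (legHom _ _), zero_mul]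
  refine ⟨fun η ξ t ht => ?_, fun t ht => ?_⟩
  · obtain rfl | ⟨v, hv⟩ := h0 t ht
    · rw [mul_zero]; exact zero_mem _
    -- `Γ η ξ * t` is a multiple of a slice of `U (|ξ⟩⟨v| ⊗ t)`
    have key : ⟪v, v⟫_ℂ • (Γ η ξ * t) ∈ (tensorAlg A).toSubmodule := by
      rw [← h2 η v ξ v t]
      refine map_mem_of_mem_cspan _ (isClosed_tensorAlg A) ?_ (h3 ξ v t ht)
      rintro _ ⟨ξ', η', t', ⟨a, ha, b, hb, rfl⟩, rfl⟩
      rw [h1]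
      exact Submodule.smul_mem _ _ (elemTensor_mem A ha hb)
    have := Submodule.smul_mem _ (⟪v, v⟫_ℂ)⁻¹ key
    rwa [smul_smul, inv_mul_cancel₀ hv, one_smul] at this
  · obtain rfl | ⟨v, hv⟩ := h0 t ht
    · exact zero_mem _
    have key : (⟪v, v⟫_ℂ * ⟪v, v⟫_ℂ) • t ∈
        cspan {T | ∃ η ξ, ∃ d ∈ elemTensors A, T = Γ η ξ * d} := by
      -- `t` is a multiple of a slice of `U (U* (|v⟩⟨v| ⊗ t))`, where `U*` preserves the span
      have : gen v v t = U * (star U * gen v v t) := by rw [← mul_assoc, h5, one_mul]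
      rw [← h1 v v v v t, this]
      refine map_mem_of_mem_cspan ((sandwich (ins v) (ins v)).comp (lmulL U)) (isClosed_cspan _) ?_
        (h4 v v t ht)
      rintro _ ⟨ξ', η', t', ht', rfl⟩
      change sandwich (ins v) (ins v) (U * gen ξ' η' t') ∈ _
      rw [h2]
      exact Submodule.smul_mem _ _ (subset_cspan ⟨v, ξ', t', ht', rfl⟩)
    have := Submodule.smul_mem _ (⟪v, v⟫_ℂ * ⟪v, v⟫_ℂ)⁻¹ key
    rwa [smul_smul, inv_mul_cancel₀ (mul_ne_zero hv hv), one_smul] at this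

/-- Assembly of a bialgebra from a `*`-homomorphism `Φ` on all bounded operators, whose values on
the slices generating `A` satisfy the conclusions of `comul_mem_and_total`. -/
theorem exists_comul (A : NonUnitalStarSubalgebra ℂ (B X)) (sl : BDual X →L[ℂ] B X)
    (hA : (A : Set (B X)) = closure {a | ∃ ω, IsNormal ω ∧ a = sl ω})
    (hsl : ∀ v : L2 X, (∀ η ξ w, ⟪v, sl (vec η ξ) w⟫_ℂ = 0) → v = 0)
    (Φ : B X →⋆ₐ[ℂ] B (X × X)) (hΦ : Continuous Φ)
    (hmem : ∀ η ξ, ∀ t ∈ elemTensors A, Φ (sl (vec η ξ)) * t ∈ tensorAlg A)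
    (htot : ∀ t ∈ elemTensors A,
      t ∈ cspan {T | ∃ η ξ, ∃ d ∈ elemTensors A, T = Φ (sl (vec η ξ)) * d})
    (Δ₁ Δ₂ : B (X × X) →⋆ₐ[ℂ] B (X × X × X))
    (hΔ₁ : ∀ a b, Δ₁ (legFst a * legSnd b) = leg12 (Φ a) * legSnd (legSnd b))
    (hΔ₂ : ∀ a b, Δ₂ (legFst a * legSnd b) = legFst a * leg23 (Φ b))
    (hco : ∀ a, Δ₁ (Φ a) = Δ₂ (Φ a)) :
    ∃ Δ : A →⋆ₙₐ[ℂ] multiplierAlg (tensorAlg A),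
      (∀ a : A, (Δ a : B (X × X)) = Φ a) ∧ IsCStarBialgebra A Δ := by
  have hsA : ∀ η ξ, sl (vec η ξ) ∈ A := fun η ξ => by
    change sl (vec η ξ) ∈ (A : Set (B X))
    rw [hA]
    exact subset_closure ⟨_, isNormal_vec η ξ, rfl⟩
  -- closed linear conditions on `A` need only be checked on the slices by vector functionals
  have hcl : ∀ {E : Type} [NormedAddCommGroup E] [NormedSpace ℂ E] (f : B X →L[ℂ] E)
      (M : Submodule ℂ E), IsClosed (M : Set E) → (∀ η ξ, f (sl (vec η ξ)) ∈ M) →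
      ∀ a ∈ A, f a ∈ M := by
    intro E _ _ f M hM h a ha
    have ha' : a ∈ closure {a | ∃ ω, IsNormal ω ∧ a = sl ω} := by rw [← hA]; exact ha
    refine closure_minimal ?_ (hM.preimage f.continuous) ha'
    rintro _ ⟨ω, hω, rfl⟩
    exact hω.mem_of_vec (f.comp sl) M hM h
  let ΦL : B X →L[ℂ] B (X × X) := ⟨Φ.toAlgHom.toLinearMap, hΦ⟩
  have hl : ∀ a ∈ A, ∀ d ∈ tensorAlg A, Φ a * d ∈ tensorAlg A := by
    intro a ha d hd
    refine map_mem_of_mem_cspan (lmulL (Φ a)) (isClosed_tensorAlg A) (fun t ht => ?_)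
      (tensorAlg_le_cspan A hd)
    exact hcl ((rmulL t).comp ΦL) _ (isClosed_tensorAlg A) (fun η ξ => hmem η ξ t ht) a ha
  have hm : ∀ a : A, Φ a ∈ multiplierAlg (tensorAlg A) := by
    refine fun a d hd => ⟨hl _ a.2 d hd, ?_⟩
    have := star_mem (hl _ (star_mem a.2) _ (star_mem hd))
    rwa [star_mul, star_star, map_star, star_star] at this
  let Δ : A →⋆ₙₐ[ℂ] multiplierAlg (tensorAlg A) :=
    { toFun := fun a => ⟨Φ a, hm a⟩
      map_smul' := fun c a => Subtype.ext (map_smul Φ c (a : B X))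
      map_zero' := Subtype.ext (map_zero Φ)
      map_add' := fun a b => Subtype.ext (map_add Φ (a : B X) b)
      map_mul' := fun a b => Subtype.ext (map_mul Φ (a : B X) b)
      map_star' := fun a => Subtype.ext (map_star Φ (a : B X)) }
  refine ⟨Δ, fun a => rfl, ⟨?_, ?_, ?_, ?_⟩⟩
  · rw [hA]; exact isClosed_closure
  · refine Submodule.dense_iff_topologicalClosure_eq_top.2
      (Submodule.topologicalClosure_eq_top_iff.2 ((Submodule.eq_bot_iff _).2 fun v hv => ?_))
    refine hsl v fun η ξ w => ?_
    rw [inner_eq_zero_symm]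
    exact (Submodule.mem_orthogonal _ _).1 hv _ (Submodule.subset_span ⟨_, hsA η ξ, w, rfl⟩)
  · intro t ht
    refine Submodule.topologicalClosure_minimal _ (Submodule.span_le.2 fun t ht => ?_)
      (isClosed_cspan _) (tensorAlg_le_cspan A ht)
    refine closure_mono (Submodule.span_mono ?_) (htot t ht)
    rintro _ ⟨η, ξ, d, ⟨a, ha, b, hb, rfl⟩, rfl⟩
    exact ⟨⟨_, hsA η ξ⟩, _, elemTensor_mem A ha hb, rfl⟩
  · refine ⟨Δ₁.comp (multiplierAlg (tensorAlg A)).subtype,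
      Δ₂.comp (multiplierAlg (tensorAlg A)).subtype, fun a b m h => ?_, fun a b m h => ?_,
      fun a => hco a⟩
    · change Δ₁ (m : B (X × X)) = _
      rw [h]; exact hΔ₁ a b
    · change Δ₂ (m : B (X × X)) = _
      rw [h]; exact hΔ₂ a b

/-- Conjugation `T ↦ U T U*` by a unitary, as a `*`-homomorphism. -/
def conjUnitary {Y : Type} [MeasureSpace Y] (U : B Y) (h : star U * U = 1) (h' : U * star U = 1) :
    B Y →⋆ₐ[ℂ] B Y where
  toFun T := U * T * star U
  map_one' := by rw [mul_one, h']
  map_mul' S T := by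
    calc U * (S * T) * star U = U * S * 1 * T * star U := by simp only [mul_one, mul_assoc]
      _ = _ := by rw [← h]; simp only [mul_assoc]
  map_zero' := by simp
  map_add' S T := by rw [mul_add, add_mul]
  commutes' c := by
    rw [Algebra.algebraMap_eq_smul_one, mul_smul_comm, smul_mul_assoc, mul_one, h']
  map_star' T := by simp only [star_mul, star_star, mul_assoc]

theorem continuous_starAlgHom {Y Z : Type} [MeasureSpace Y] [MeasureSpace Z]
    (Φ : B Y →⋆ₐ[ℂ] B Z) : Continuous Φ :=
  AddMonoidHomClass.continuous_of_bound Φ 1 fun T => by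
    rw [one_mul]
    exact NonUnitalStarAlgHom.norm_apply_le Φ T

/-- The operators `|ξ⟩⟨η| ⊗ a` with `a ∈ A`; their closed span is `𝓚 ⊗ A`. -/
def compactLeft (A : NonUnitalStarSubalgebra ℂ (B X)) : Set (B (X × X)) :=
  {t | ∃ ξ η, ∃ a ∈ A, t = legFst (rankOne ξ η) * legSnd a}

/-- The operators `a ⊗ |ξ⟩⟨η|` with `a ∈ A`; their closed span is `A ⊗ 𝓚`. -/
def compactRight (A : NonUnitalStarSubalgebra ℂ (B X)) : Set (B (X × X)) :=
  {t | ∃ ξ η, ∃ a ∈ A, t = legFst a * legSnd (rankOne ξ η)}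

theorem sandwich_insFst (η ζ ξ η' : L2 X) (d : B (X × X)) :
    sandwich (insFst η) (insFst ζ) (legFst (rankOne ξ η') * legSnd d) =
      (⟪η, ξ⟫_ℂ * ⟪η', ζ⟫_ℂ) • d := by
  refine ContinuousLinearMap.ext fun Ψ => ext_inner_left ℂ fun Ψ' => ?_
  change ⟪Ψ', ContinuousLinearMap.adjoint (insFst η)
    (legFst (rankOne ξ η') (legSnd d (tmul ζ Ψ)))⟫_ℂ = _
  rw [ContinuousLinearMap.adjoint_inner_right, legSnd_tmul, legFst_tmul]
  change ⟪tmul η Ψ', _⟫_ℂ = _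
  rw [inner_tmul, rankOne_apply, inner_smul_right, smul_apply,
    inner_smul_right]
  ring

theorem mul_rankOne_insFst (U : B (X × X × X)) (η ζ ξ η' : L2 X) (d : B (X × X)) :
    sandwich (insFst η) (insFst ζ) (U * (legFst (rankOne ξ η') * legSnd d)) =
      ⟪η', ζ⟫_ℂ • (sandwich (insFst η) (insFst ξ) U * d) := by
  refine ContinuousLinearMap.ext fun Ψ => ?_
  change ContinuousLinearMap.adjoint (insFst η)
    (U (legFst (rankOne ξ η') (legSnd d (tmul ζ Ψ)))) = _
  rw [legSnd_tmul, legFst_tmul, rankOne_apply]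
  simp only [map_smul, smul_apply]
  rfl

theorem insThd_eq (ζ : L2 X) (Ψ : L2 (X × X)) :
    insThd ζ Ψ = compOp (e12 X) mp_e12 (tmul Ψ ζ) := rfl

theorem legSnd_legSnd_insThd (T : B X) (ζ : L2 X) :
    legSnd (legSnd T) ∘L insThd ζ = insThd (T ζ) :=
  ext_tmul fun u v => by
    change legSnd (legSnd T) (insThd ζ (tmul u v)) = _
    rw [insThd_tmul, insThd_tmul, legSnd_tmul, legSnd_tmul]

theorem inner_insThd (η ζ : L2 X) (Ψ Ψ' : L2 (X × X)) :
    ⟪insThd η Ψ', insThd ζ Ψ⟫_ℂ = ⟪Ψ', Ψ⟫_ℂ * ⟪η, ζ⟫_ℂ := by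
  rw [insThd_eq, insThd_eq, inner_compOp_compOp, inner_tmul]

theorem insThd_smul (c : ℂ) (ζ : L2 X) : insThd (c • ζ) = c • insThd ζ := by
  refine ContinuousLinearMap.ext fun Ψ => ?_
  rw [smul_apply, insThd_eq, insThd_eq, map_smul, map_smul]

theorem mul_rankOne_insThd (U : B (X × X × X)) (η ζ ξ η' : L2 X) (d : B (X × X)) :
    sandwich (insThd η) (insThd ζ) (U * (legSnd (legSnd (rankOne ξ η')) * leg12 d)) =
      ⟪η', ζ⟫_ℂ • (sandwich (insThd η) (insThd ξ) U * d) := by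
  have h1 : sandwich (insThd η) (insThd ζ) (U * (legSnd (legSnd (rankOne ξ η')) * leg12 d)) =
      ContinuousLinearMap.adjoint (insThd η) ∘L U ∘L legSnd (legSnd (rankOne ξ η')) ∘L
        (leg12 d ∘L insThd ζ) := rfl
  have h2 : legSnd (legSnd (rankOne ξ η')) ∘L (insThd ζ ∘L d) =
    (legSnd (legSnd (rankOne ξ η')) ∘L insThd ζ) ∘L d := rfl
  rw [h1, leg12_insThd, h2, legSnd_legSnd_insThd, rankOne_apply, insThd_smul]
  refine ContinuousLinearMap.ext fun Ψ => ?_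
  simp only [ContinuousLinearMap.comp_apply, smul_apply, map_smul]
  rfl

theorem sandwich_insThd (η ζ ξ η' : L2 X) (d : B (X × X)) :
    sandwich (insThd η) (insThd ζ) (legSnd (legSnd (rankOne ξ η')) * leg12 d) =
      (⟪η, ξ⟫_ℂ * ⟪η', ζ⟫_ℂ) • d := by
  rw [← one_mul (legSnd (legSnd (rankOne ξ η')) * leg12 d), mul_rankOne_insThd]
  refine ContinuousLinearMap.ext fun Ψ => ext_inner_left ℂ fun Ψ' => ?_
  rw [smul_apply, smul_apply, inner_smul_right,
    inner_smul_right]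
  change _ * ⟪Ψ', ContinuousLinearMap.adjoint (insThd η) (insThd ξ (d Ψ))⟫_ℂ = _
  rw [ContinuousLinearMap.adjoint_inner_right, inner_insThd]
  ring

end Criterion

end QG

end

noncomputable section

namespace QG

section TripleAlgebra

variable {X : Type} [MeasureSpace X] [SigmaFinite (volume : Measure X)]

theorem leg12_mul (S T : B (X × X)) : leg12 (S * T) = leg12 S * leg12 T := leg_mul _ _ _ _

theorem leg13_mul (S T : B (X × X)) : leg13 (S * T) = leg13 S * leg13 T := leg_mul _ _ _ _

theorem leg23_mul (S T : B (X × X)) : leg23 (S * T) = leg23 S * leg23 T := leg_mul _ _ _ _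

theorem leg12_star (T : B (X × X)) : leg12 (star T) = star (leg12 T) := leg_star _ _ _

theorem leg13_star (T : B (X × X)) : leg13 (star T) = star (leg13 T) := leg_star _ _ _

theorem leg23_star (T : B (X × X)) : leg23 (star T) = star (leg23 T) := leg_star _ _ _

theorem leg12_one : leg12 (1 : B (X × X)) = 1 := leg_one _ _

theorem leg13_one : leg13 (1 : B (X × X)) = 1 := leg_one _ _

theorem leg23_one : leg23 (1 : B (X × X)) = 1 := leg_one _ _

theorem leg12_mul_legSnd_legSnd (S : B (X × X)) (T : B X) :
    leg12 S * legSnd (legSnd T) = legSnd (legSnd T) * leg12 S := by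
  refine ext_tmul₃ fun u v w => ?_
  have h : leg12 S ∘L (legSnd (legSnd T) ∘L insThd w) =
      legSnd (legSnd T) ∘L (leg12 S ∘L insThd w) := by
    rw [legSnd_legSnd_insThd, leg12_insThd, leg12_insThd, ← legSnd_legSnd_insThd]
    rfl
  have h' := DFunLike.congr_fun h (tmul u v)
  simp only [ContinuousLinearMap.comp_apply, insThd_tmul] at h'
  exact h'

theorem leg23_mul_legFst (S : B (X × X)) (T : B X) :
    leg23 S * legFst T = legFst T * leg23 S := (legFst_mul_legSnd_comm T S).symm

theorem legFst_mul_legSnd_eq_leg12 (a b c : B X) :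
    legFst a * legSnd (legFst b * legSnd c) = leg12 (legFst a * legSnd b) * legSnd (legSnd c) := by
  rw [leg12_mul, leg12_legFst, leg12_legSnd, legSnd_mul, mul_assoc]

theorem legFst_mul_legSnd_eq_leg13 (a b c : B X) :
    legFst a * legSnd (legFst b * legSnd c) = leg13 (legFst a * legSnd c) * legSnd (legFst b) := by
  rw [leg13_mul, leg13_legFst, leg13_legSnd, legFst_mul_legSnd_comm b, legSnd_mul, mul_assoc]

theorem legSnd_mul_leg12_eq_leg23 (a b c : B X) :
    legSnd (legSnd c) * leg12 (legFst a * legSnd b) = leg23 (legFst b * legSnd c) * legFst a := by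
  rw [leg12_mul, leg12_legFst, leg12_legSnd, leg23_mul_legFst, leg23_eq_legSnd, ← mul_assoc,
    ← legFst_mul_legSnd_comm a (legSnd c), mul_assoc, ← legSnd_mul, legFst_mul_legSnd_comm b c]

theorem legSnd_mul_leg12_eq_leg13 (a b c : B X) :
    legSnd (legSnd c) * leg12 (legFst a * legSnd b) =
      leg13 (legFst a * legSnd c) * legSnd (legFst b) := by
  rw [leg12_mul, leg12_legFst, leg12_legSnd, leg13_mul, leg13_legFst, leg13_legSnd, ← mul_assoc,
    legFst_mul_legSnd_comm a (legSnd c)]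

end TripleAlgebra

section Coassociativity

variable {X : Type} [MeasureSpace X] [SigmaFinite (volume : Measure X)] {W : B (X × X)}

theorem IsMultiplicativeUnitary.leg12_mul_star (hW : IsMultiplicativeUnitary W) :
    leg12 W * star (leg12 W) = 1 := by
  rw [← leg12_star, ← leg12_mul, (Unitary.mem_iff.1 hW.1).2, leg12_one]

theorem IsMultiplicativeUnitary.leg13_mul_star (hW : IsMultiplicativeUnitary W) :
    leg13 W * star (leg13 W) = 1 := by
  rw [← leg13_star, ← leg13_mul, (Unitary.mem_iff.1 hW.1).2, leg13_one]

theorem IsMultiplicativeUnitary.star_leg23_mul (hW : IsMultiplicativeUnitary W) :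
    star (leg23 W) * leg23 W = 1 := by
  rw [← leg23_star, ← leg23_mul, (Unitary.mem_iff.1 hW.1).1, leg23_one]

/-- Coassociativity of `a ↦ W (a ⊗ 1) W*` is the pentagon equation. -/
theorem IsMultiplicativeUnitary.coassoc_left (hW : IsMultiplicativeUnitary W) (a : B X) :
    leg12 W * leg13 (W * legFst a * star W) * star (leg12 W) =
      leg23 W * leg12 (W * legFst a * star W) * star (leg23 W) := by
  have h : leg23 W * legFst a * star (leg23 W) = legFst a := by
    rw [leg23_mul_legFst, mul_assoc, hW.leg23_mul_star, mul_one]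
  calc leg12 W * leg13 (W * legFst a * star W) * star (leg12 W)
      = (leg12 W * leg13 W) * legFst a * star (leg12 W * leg13 W) := by
        simp only [leg13_mul, leg13_star, leg13_legFst, star_mul, mul_assoc]
    _ = (leg12 W * leg13 W) * (leg23 W * legFst a * star (leg23 W)) *
          star (leg12 W * leg13 W) := by rw [h]
    _ = (leg12 W * leg13 W * leg23 W) * legFst a * star (leg12 W * leg13 W * leg23 W) := by
        simp only [star_mul, mul_assoc]
    _ = (leg23 W * leg12 W) * legFst a * star (leg23 W * leg12 W) := by rw [hW.2]
    _ = _ := by simp only [leg12_mul, leg12_star, leg12_legFst, star_mul, mul_assoc]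

/-- Coassociativity of `b ↦ W* (1 ⊗ b) W` is the pentagon equation. -/
theorem IsMultiplicativeUnitary.coassoc_right (hW : IsMultiplicativeUnitary W) (b : B X) :
    star (leg12 W) * leg23 (star W * legSnd b * W) * leg12 W =
      star (leg23 W) * leg13 (star W * legSnd b * W) * leg23 W := by
  have h : star (leg12 W) * legSnd (legSnd b) * leg12 W = legSnd (legSnd b) := by
    rw [mul_assoc, ← leg12_mul_legSnd_legSnd, ← mul_assoc, hW.star_leg12_mul, one_mul]
  have h23 : leg23 (legSnd b) = (legSnd (legSnd b) : B (X × X × X)) := rfl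
  calc star (leg12 W) * leg23 (star W * legSnd b * W) * leg12 W
      = star (leg23 W * leg12 W) * legSnd (legSnd b) * (leg23 W * leg12 W) := by
        simp only [leg23_mul, leg23_star, h23, star_mul, mul_assoc]
    _ = star (leg12 W * leg13 W * leg23 W) * legSnd (legSnd b) *
          (leg12 W * leg13 W * leg23 W) := by rw [hW.2]
    _ = star (leg13 W * leg23 W) * (star (leg12 W) * legSnd (legSnd b) * leg12 W) *
          (leg13 W * leg23 W) := by simp only [star_mul, mul_assoc]
    _ = _ := by
        rw [h]
        simp only [leg13_mul, leg13_star, leg13_legSnd, star_mul, mul_assoc]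

theorem IsMultiplicativeUnitary.eq_zero_of_apply_tmul (hW : W ∈ unitary (B (X × X))) (v : L2 X)
    (h : ∀ u w, ⟪tmul v v, W (tmul u w)⟫_ℂ = 0 ) : v = 0 := by
  have h : ContinuousLinearMap.adjoint W (tmul v v) = 0 := by
    refine eq_zero_of_inner_tmul _ fun u w => ?_
    rw [ContinuousLinearMap.adjoint_inner_right, inner_eq_zero_symm]
    exact h u w
  have h' : tmul v v = 0 := by
    have := congrArg W h
    rw [map_zero] at this
    rw [← this]
    exact (DFunLike.congr_fun (Unitary.mem_iff.1 hW).2 (tmul v v)).symm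
  have h'' : ‖tmulFun v v‖ = 0 := by rw [← tmul_apply, h', norm_zero]
  rw [norm_tmulFun] at h''
  exact norm_eq_zero.1 (mul_self_eq_zero.1 h'')

end Coassociativity

section CriterionLeft

variable {X : Type} [MeasureSpace X] [SigmaFinite (volume : Measure X)]

/-- The operators `|ξ⟩⟨η| ⊗ b ⊗ c` with `b, c ∈ A`. -/
def compactFst (A : NonUnitalStarSubalgebra ℂ (B X)) : Set (B (X × X × X)) :=
  {T | ∃ ξ η, ∃ t ∈ elemTensors A, T = legFst (rankOne ξ η) * legSnd t}

theorem leg12_mul_mem_cspan_compactFst {A : NonUnitalStarSubalgebra ℂ (B X)} {V : B (X × X)}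
    (hV : ∀ t ∈ compactLeft A, V * t ∈ cspan (compactLeft A)) {T : B (X × X × X)}
    (hT : T ∈ cspan (compactFst A)) : leg12 V * T ∈ cspan (compactFst A) := by
  refine map_mem_of_mem_cspan (lmulL (leg12 V)) (isClosed_cspan _) ?_ hT
  rintro _ ⟨ξ, η, _, ⟨b, hb, c, hc, rfl⟩, rfl⟩
  have h : lmulL (leg12 V) (legFst (rankOne ξ η) * legSnd (legFst b * legSnd c)) =
      ((rmulL (legSnd (legSnd c))).comp (legL (e12 X) mp_e12))
        (V * (legFst (rankOne ξ η) * legSnd b)) := by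
    change leg12 V * _ = leg12 (V * _) * legSnd (legSnd c)
    rw [legFst_mul_legSnd_eq_leg12, leg12_mul V, mul_assoc]
  rw [h]
  refine map_mem_of_mem_cspan _ (isClosed_cspan _) ?_ (hV _ ⟨ξ, η, b, hb, rfl⟩)
  rintro _ ⟨ξ', η', b', hb', rfl⟩
  exact subset_cspan ⟨ξ', η', _, ⟨b', hb', c, hc, rfl⟩, (legFst_mul_legSnd_eq_leg12 _ _ _).symm⟩

theorem leg13_mul_mem_cspan_compactFst {A : NonUnitalStarSubalgebra ℂ (B X)} {V : B (X × X)}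
    (hV : ∀ t ∈ compactLeft A, V * t ∈ cspan (compactLeft A)) {T : B (X × X × X)}
    (hT : T ∈ cspan (compactFst A)) : leg13 V * T ∈ cspan (compactFst A) := by
  refine map_mem_of_mem_cspan (lmulL (leg13 V)) (isClosed_cspan _) ?_ hT
  rintro _ ⟨ξ, η, _, ⟨b, hb, c, hc, rfl⟩, rfl⟩
  have h : lmulL (leg13 V) (legFst (rankOne ξ η) * legSnd (legFst b * legSnd c)) =
      ((rmulL (legSnd (legFst b))).comp (legL (e13 X) mp_e13))
        (V * (legFst (rankOne ξ η) * legSnd c)) := by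
    change leg13 V * _ = leg13 (V * _) * legSnd (legFst b)
    rw [legFst_mul_legSnd_eq_leg13, leg13_mul V, mul_assoc]
  rw [h]
  refine map_mem_of_mem_cspan _ (isClosed_cspan _) ?_ (hV _ ⟨ξ, η, c, hc, rfl⟩)
  rintro _ ⟨ξ', η', c', hc', rfl⟩
  exact subset_cspan ⟨ξ', η', _, ⟨b, hb, c', hc', rfl⟩, (legFst_mul_legSnd_eq_leg13 _ _ _).symm⟩

/-- If `W` and `W*` map `𝓚 ⊗ A` into itself, where `A` is the algebra of the slices
`(ω ⊗ id)(W)`, then `a ↦ W (a ⊗ 1) W*` makes `A` a bialgebra. -/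
theorem IsMultiplicativeUnitary.exists_comul_left {W : B (X × X)}
    (hW : IsMultiplicativeUnitary W) (A : NonUnitalStarSubalgebra ℂ (B X))
    (hA : (A : Set (B X)) = leftAlg W)
    (h1 : ∀ t ∈ compactLeft A, W * t ∈ cspan (compactLeft A))
    (h2 : ∀ t ∈ compactLeft A, star W * t ∈ cspan (compactLeft A)) :
    ∃ Δ : A →⋆ₙₐ[ℂ] multiplierAlg (tensorAlg A),
      (∀ a : A, (Δ a : B (X × X)) = W * legFst (a : B X) * star W) ∧ IsCStarBialgebra A Δ := by
  obtain ⟨hu1, hu2⟩ := Unitary.mem_iff.1 hW.1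
  let Φ : B X →⋆ₐ[ℂ] B (X × X) :=
    (conjUnitary W hu1 hu2).comp (legHom (MeasurableEquiv.refl (X × X)) (.id _))
  have hΦ (a : B X) : Φ a = W * legFst a * star W := rfl
  obtain ⟨hmem, htot⟩ := comul_mem_and_total A insFst
    (fun ξ η d => legFst (rankOne ξ η) * legSnd d) (leg12 W * leg13 W)
    (fun η ξ => Φ (leftSlice (vec η ξ) W)) sandwich_insFst
    (fun η ζ ξ η' d => by
      rw [hΦ, hW.conj_legFst_leftSlice]
      exact mul_rankOne_insFst _ η ζ ξ η' d)
    (fun ξ η t ht => by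
      rw [mul_assoc]
      exact leg12_mul_mem_cspan_compactFst h1
        (leg13_mul_mem_cspan_compactFst h1 (subset_cspan ⟨ξ, η, t, ht, rfl⟩)))
    (fun ξ η t ht => by
      rw [star_mul, mul_assoc, ← leg12_star, ← leg13_star]
      exact leg13_mul_mem_cspan_compactFst h2
        (leg12_mul_mem_cspan_compactFst h2 (subset_cspan ⟨ξ, η, t, ht, rfl⟩)))
    (by rw [star_mul, mul_assoc, ← mul_assoc (leg13 W), hW.leg13_mul_star, one_mul,
      hW.leg12_mul_star])
  refine exists_comul A (leftSliceAt W) hA (fun v hv => ?_) Φ (continuous_starAlgHom Φ) hmem htot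
    ((conjUnitary (leg12 W) hW.star_leg12_mul hW.leg12_mul_star).comp (legHom (e13 X) mp_e13))
    ((conjUnitary (leg23 W) hW.star_leg23_mul hW.leg23_mul_star).comp (legHom (e12 X) mp_e12))
    (fun a b => ?_) (fun a b => ?_) hW.coassoc_left
  · refine IsMultiplicativeUnitary.eq_zero_of_apply_tmul hW.1 v fun u w => ?_
    have := hv v u w
    change ⟪v, leftSlice (vec v u) W w⟫_ℂ = 0 at this
    rw [leftSlice_vec, ContinuousLinearMap.comp_apply,
      ContinuousLinearMap.adjoint_inner_right] at this
    exact this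
  · change leg12 W * leg13 (legFst a * legSnd b) * star (leg12 W) = _
    rw [leg13_mul, leg13_legFst, leg13_legSnd, hΦ, leg12_mul, leg12_mul, leg12_legFst,
      mul_assoc _ (leg12 (star W)), leg12_mul_legSnd_legSnd, leg12_star]
    simp only [mul_assoc]
  · change leg23 W * leg12 (legFst a * legSnd b) * star (leg23 W) = _
    rw [leg12_mul, leg12_legFst, leg12_legSnd, hΦ, leg23_mul, leg23_mul, leg23_star, ← mul_assoc,
      leg23_mul_legFst]
    simp only [mul_assoc]
    rfl

end CriterionLeft

section CriterionRight

variable {X : Type} [MeasureSpace X] [SigmaFinite (volume : Measure X)]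

/-- The operators `a ⊗ b ⊗ |ξ⟩⟨η|` with `a, b ∈ A`. -/
def compactThd (A : NonUnitalStarSubalgebra ℂ (B X)) : Set (B (X × X × X)) :=
  {T | ∃ ξ η, ∃ t ∈ elemTensors A, T = legSnd (legSnd (rankOne ξ η)) * leg12 t}

theorem leg23_mul_mem_cspan_compactThd {A : NonUnitalStarSubalgebra ℂ (B X)} {V : B (X × X)}
    (hV : ∀ t ∈ compactRight A, V * t ∈ cspan (compactRight A)) {T : B (X × X × X)}
    (hT : T ∈ cspan (compactThd A)) : leg23 V * T ∈ cspan (compactThd A) := by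
  refine map_mem_of_mem_cspan (lmulL (leg23 V)) (isClosed_cspan _) ?_ hT
  rintro _ ⟨ξ, η, _, ⟨a, ha, b, hb, rfl⟩, rfl⟩
  have h : lmulL (leg23 V) (legSnd (legSnd (rankOne ξ η)) * leg12 (legFst a * legSnd b)) =
      ((rmulL (legFst a)).comp (legL (e23 X) mp_e23))
        (V * (legFst b * legSnd (rankOne ξ η))) := by
    change leg23 V * _ = leg23 (V * _) * legFst a
    rw [legSnd_mul_leg12_eq_leg23, leg23_mul V, mul_assoc]
  rw [h]
  refine map_mem_of_mem_cspan _ (isClosed_cspan _) ?_ (hV _ ⟨ξ, η, b, hb, rfl⟩)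
  rintro _ ⟨ξ', η', b', hb', rfl⟩
  exact subset_cspan ⟨ξ', η', _, ⟨a, ha, b', hb', rfl⟩, (legSnd_mul_leg12_eq_leg23 _ _ _).symm⟩

theorem leg13_mul_mem_cspan_compactThd {A : NonUnitalStarSubalgebra ℂ (B X)} {V : B (X × X)}
    (hV : ∀ t ∈ compactRight A, V * t ∈ cspan (compactRight A)) {T : B (X × X × X)}
    (hT : T ∈ cspan (compactThd A)) : leg13 V * T ∈ cspan (compactThd A) := by
  refine map_mem_of_mem_cspan (lmulL (leg13 V)) (isClosed_cspan _) ?_ hT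
  rintro _ ⟨ξ, η, _, ⟨a, ha, b, hb, rfl⟩, rfl⟩
  have h : lmulL (leg13 V) (legSnd (legSnd (rankOne ξ η)) * leg12 (legFst a * legSnd b)) =
      ((rmulL (legSnd (legFst b))).comp (legL (e13 X) mp_e13))
        (V * (legFst a * legSnd (rankOne ξ η))) := by
    change leg13 V * _ = leg13 (V * _) * legSnd (legFst b)
    rw [legSnd_mul_leg12_eq_leg13, leg13_mul V, mul_assoc]
  rw [h]
  refine map_mem_of_mem_cspan _ (isClosed_cspan _) ?_ (hV _ ⟨ξ, η, a, ha, rfl⟩)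
  rintro _ ⟨ξ', η', a', ha', rfl⟩
  exact subset_cspan ⟨ξ', η', _, ⟨a', ha', b, hb, rfl⟩, (legSnd_mul_leg12_eq_leg13 _ _ _).symm⟩

/-- If `W` and `W*` map `A ⊗ 𝓚` into itself, where `A` is the algebra of the slices
`(id ⊗ ω)(W)`, then `b ↦ W* (1 ⊗ b) W` makes `A` a bialgebra. -/
theorem IsMultiplicativeUnitary.exists_comul_right {W : B (X × X)}
    (hW : IsMultiplicativeUnitary W) (A : NonUnitalStarSubalgebra ℂ (B X))
    (hA : (A : Set (B X)) = rightAlg W)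
    (h1 : ∀ t ∈ compactRight A, W * t ∈ cspan (compactRight A))
    (h2 : ∀ t ∈ compactRight A, star W * t ∈ cspan (compactRight A)) :
    ∃ Δ : A →⋆ₙₐ[ℂ] multiplierAlg (tensorAlg A),
      (∀ b : A, (Δ b : B (X × X)) = star W * legSnd (b : B X) * W) ∧ IsCStarBialgebra A Δ := by
  obtain ⟨hu1, hu2⟩ := Unitary.mem_iff.1 hW.1
  have hu1' : star (star W) * star W = 1 := by rw [star_star, hu2]
  have hu2' : star W * star (star W) = 1 := by rw [star_star, hu1]
  let Φ : B X →⋆ₐ[ℂ] B (X × X) :=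
    (conjUnitary (star W) hu1' hu2').comp
      (legHom (X := X) (Y := X) MeasurableEquiv.prodComm Measure.measurePreserving_swap)
  have hΦ (b : B X) : Φ b = star W * legSnd b * W := by
    change star W * legSnd b * star (star W) = _
    rw [star_star]
  obtain ⟨hmem, htot⟩ := comul_mem_and_total A insThd
    (fun ξ η d => legSnd (legSnd (rankOne ξ η)) * leg12 d) (leg13 W * leg23 W)
    (fun η ξ => Φ (rightSlice (vec η ξ) W)) sandwich_insThd
    (fun η ζ ξ η' d => by
      rw [hΦ, hW.conj_legSnd_rightSlice]
      exact mul_rankOne_insThd _ η ζ ξ η' d)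
    (fun ξ η t ht => by
      rw [mul_assoc]
      exact leg13_mul_mem_cspan_compactThd h1
        (leg23_mul_mem_cspan_compactThd h1 (subset_cspan ⟨ξ, η, t, ht, rfl⟩)))
    (fun ξ η t ht => by
      rw [star_mul, mul_assoc, ← leg13_star, ← leg23_star]
      exact leg23_mul_mem_cspan_compactThd h2
        (leg13_mul_mem_cspan_compactThd h2 (subset_cspan ⟨ξ, η, t, ht, rfl⟩)))
    (by rw [star_mul, mul_assoc, ← mul_assoc (leg23 W), hW.leg23_mul_star, one_mul,
      hW.leg13_mul_star])
  have hs12 : star (star (leg12 W)) * star (leg12 W) = 1 := by rw [star_star, hW.leg12_mul_star]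
  have hs12' : star (leg12 W) * star (star (leg12 W)) = 1 := by rw [star_star, hW.star_leg12_mul]
  have hs23 : star (star (leg23 W)) * star (leg23 W) = 1 := by rw [star_star, hW.leg23_mul_star]
  have hs23' : star (leg23 W) * star (star (leg23 W)) = 1 := by rw [star_star, hW.star_leg23_mul]
  have hres := exists_comul A (rightSliceAt W) hA (fun v hv => ?_) Φ (continuous_starAlgHom Φ)
    hmem htot
    ((conjUnitary (star (leg12 W)) hs12 hs12').comp (legHom (e23 X) mp_e23))
    ((conjUnitary (star (leg23 W)) hs23 hs23').comp (legHom (e13 X) mp_e13))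
    (fun a b => ?_) (fun a b => ?_) (fun b => ?_)
  · obtain ⟨Δ, h, h'⟩ := hres
    exact ⟨Δ, fun b => by rw [h, hΦ], h'⟩
  · refine IsMultiplicativeUnitary.eq_zero_of_apply_tmul hW.1 v fun u w => ?_
    have := hv v w u
    change ⟪v, rightSlice (vec v w) W u⟫_ℂ = 0 at this
    rw [rightSlice_vec, ContinuousLinearMap.comp_apply,
      ContinuousLinearMap.adjoint_inner_right] at this
    exact this
  · change star (leg12 W) * leg23 (legFst a * legSnd b) * star (star (leg12 W)) = _
    have h23 : leg23 (legSnd b) = (legSnd (legSnd b) : B (X × X × X)) := rfl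
    rw [star_star, leg23_mul, h23, hΦ, leg12_mul, leg12_mul, leg12_star, leg12_legSnd,
      mul_assoc, mul_assoc, ← leg12_mul_legSnd_legSnd]
    simp only [mul_assoc]
    rfl
  · change star (leg23 W) * leg13 (legFst a * legSnd b) * star (star (leg23 W)) = _
    have h23 : leg23 (legSnd b) = (legSnd (legSnd b) : B (X × X × X)) := rfl
    rw [star_star, leg13_mul, leg13_legFst, leg13_legSnd, hΦ, leg23_mul, leg23_mul, h23,
      ← leg23_star, ← mul_assoc, leg23_mul_legFst]
    simp only [mul_assoc]
  · change star (leg12 W) * leg23 (Φ b) * star (star (leg12 W)) =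
      star (leg23 W) * leg13 (Φ b) * star (star (leg23 W))
    rw [star_star, star_star, hΦ]
    exact hW.coassoc_right b

end CriterionRight

end QG

end

noncomputable section

namespace QG

/-! ### Compactly supported functions of two variables -/

section Curry

set_option linter.unusedSectionVars false

variable {G X : Type} [NormedAddCommGroup G] [NormedSpace ℝ G] [FiniteDimensional ℝ G]
  [NormedAddCommGroup X] [NormedSpace ℝ X] [FiniteDimensional ℝ X]

/-- The bundled form of a continuous compactly supported function. -/
def mkCc {Y : Type} [TopologicalSpace Y] (f : Y → ℂ) (hf : Continuous f)
    (hf' : HasCompactSupport f) : C_c(Y, ℂ) := ⟨⟨f, hf⟩, hf'⟩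

@[simp]
theorem mkCc_apply {Y : Type} [TopologicalSpace Y] (f : Y → ℂ) (hf : Continuous f)
    (hf' : HasCompactSupport f) (y : Y) : mkCc f hf hf' y = f y := rfl

theorem norm_C0_le {f : C₀(X, ℂ)} {C : ℝ} (hC : 0 ≤ C) (h : ∀ x, ‖f x‖ ≤ C) : ‖f‖ ≤ C := by
  rw [← ZeroAtInftyContinuousMap.norm_toBCF_eq_norm]
  exact (BoundedContinuousFunction.norm_le hC).2 h

theorem norm_C0_apply_le (f : C₀(X, ℂ)) (x : X) : ‖f x‖ ≤ ‖f‖ := by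
  rw [← ZeroAtInftyContinuousMap.norm_toBCF_eq_norm]
  exact f.toBCF.norm_coe_le_norm x

theorem exists_norm_le_Cc {Y : Type} [TopologicalSpace Y] (F : C_c(Y, ℂ)) :
    ∃ M, 0 ≤ M ∧ ∀ p, ‖F p‖ ≤ M := by
  obtain ⟨M, hM⟩ := F.hasCompactSupport.exists_bound_of_continuous F.continuous
  exact ⟨max M 0, le_max_right _ _, fun p => (hM p).trans (le_max_left _ _)⟩

theorem exists_compact_Cc (F : C_c(G × X, ℂ)) :
    ∃ (K : Set G) (L : Set X), IsCompact K ∧ IsCompact L ∧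
      ∀ t x, F (t, x) ≠ 0 → t ∈ K ∧ x ∈ L := by
  have hc : IsCompact (tsupport F) := F.hasCompactSupport
  exact ⟨_, _, hc.image continuous_fst, hc.image continuous_snd, fun t x h =>
    ⟨⟨_, subset_tsupport _ h, rfl⟩, ⟨_, subset_tsupport _ h, rfl⟩⟩⟩

/-- A function of two variables as a function with values in `C₀(X)`. -/
def cc (F : C_c(G × X, ℂ)) : C_c(G, C₀(X, ℂ)) where
  toFun t :=
    { toFun := fun x => F (t, x)
      continuous_toFun := F.continuous.comp (by fun_prop)
      zero_at_infty' := by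
        obtain ⟨K, L, -, hL, h⟩ := exists_compact_Cc F
        refine HasCompactSupport.is_zero_at_infty (HasCompactSupport.intro hL fun x hx => ?_)
        by_contra h'
        exact hx (h t x h').2 }
  continuous_toFun := by
    rw [Metric.continuous_iff]
    intro t ε hε
    obtain ⟨δ, hδ, h⟩ := Metric.uniformContinuous_iff.1
      (F.hasCompactSupport.uniformContinuous_of_continuous F.continuous) (ε / 2) (by positivity)
    refine ⟨δ, hδ, fun t' ht' => ?_⟩
    rw [dist_eq_norm]
    refine (norm_C0_le (by positivity : (0 : ℝ) ≤ ε / 2) fun x => ?_).trans_lt (by linarith)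
    have := h (a := (t', x)) (b := (t, x)) (by simpa [Prod.dist_eq] using ht')
    rw [dist_eq_norm] at this
    exact this.le
  hasCompactSupport' := by
    obtain ⟨K, L, hK, -, h⟩ := exists_compact_Cc F
    refine HasCompactSupport.intro hK fun t ht => ?_
    ext x
    by_contra h'
    exact ht (h t x h').1

@[simp]
theorem cc_apply (F : C_c(G × X, ℂ)) (t : G) (x : X) : cc F t x = F (t, x) := rfl

theorem cc_add (F F' : C_c(G × X, ℂ)) : cc (F + F') = cc F + cc F' := by
  ext t x; rfl

theorem cc_smul (c : ℂ) (F : C_c(G × X, ℂ)) : cc (c • F) = c • cc F := by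
  ext t x; rfl

theorem exists_cutoff {K : Set X} (hK : IsCompact K) :
    ∃ χ : C(X, ℝ), (∀ x ∈ K, χ x = 1) ∧ HasCompactSupport χ ∧ ∀ x, 0 ≤ χ x ∧ χ x ≤ 1 := by
  obtain ⟨f, h1, -, h2, h3⟩ :=
    exists_continuous_one_zero_of_isCompact hK isClosed_empty (Set.disjoint_empty K)
  exact ⟨f, fun x hx => h1 hx, h2, fun x => h3 x⟩

/-- Functions of two variables are dense in the inductive limit topology of
`C_c(G, C₀(X))`. -/
theorem exists_cc_near (f : C_c(G, C₀(X, ℂ))) {ε : ℝ} (hε : 0 < ε) :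
    ∃ F : C_c(G × X, ℂ), (∀ t, ‖f t - cc F t‖ ≤ ε) ∧ ∀ t ∉ tsupport f, f t - cc F t = 0 := by
  have hK : IsCompact (tsupport f) := f.hasCompactSupport
  obtain ⟨N, -, hNf, hN⟩ := (hK.image f.continuous).finite_cover_balls (half_pos hε)
  have hdec : ∀ g : C₀(X, ℂ), ∃ C, IsCompact C ∧ ∀ x ∉ C, ‖g x‖ < ε / 2 := by
    intro g
    have h := g.zero_at_infty'
    rw [tendsto_zero_iff_norm_tendsto_zero] at h
    have h' := h.eventually (gt_mem_nhds (half_pos hε))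
    obtain ⟨C, hC, hC'⟩ := Filter.mem_cocompact.1 h'
    exact ⟨C, hC, fun x hx => hC' hx⟩
  choose C hC hC' using hdec
  obtain ⟨χ, hχ1, hχc, hχ⟩ := exists_cutoff (hNf.isCompact_biUnion fun g _ => hC g)
  have hcont : Continuous fun p : G × X => ((χ p.2 : ℝ) : ℂ) * f p.1 p.2 := by
    have h1 : Continuous fun p : G × X => (f p.1).toBCF p.2 := by
      have : Continuous fun p : G × X => ((f p.1).toBCF, p.2) :=
        (ZeroAtInftyContinuousMap.isometry_toBCF.continuous.comp
          (f.continuous.comp continuous_fst)).prodMk continuous_snd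
      exact this.fst.eval this.snd
    exact (Complex.continuous_ofReal.comp (χ.continuous.comp continuous_snd)).mul h1
  let F : C_c(G × X, ℂ) := mkCc _ hcont (by
    refine HasCompactSupport.intro (hK.prod (show IsCompact (tsupport χ) from hχc))
      fun p hp => ?_
    by_contra h
    refine hp ⟨subset_tsupport _ fun h' => h ?_, subset_tsupport _ fun h' => h ?_⟩
    · rw [h']; simp
    · rw [h']; simp)
  refine ⟨F, fun t => ?_, fun t ht => ?_⟩
  · refine norm_C0_le hε.le fun x => ?_
    have hval : (f t - cc F t) x = (1 - (χ x : ℂ)) * f t x := by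
      change f t x - (χ x : ℂ) * f t x = _
      ring
    rw [hval, norm_mul]
    have h1 : ‖(1 - (χ x : ℂ))‖ = 1 - χ x := by
      rw [← Complex.ofReal_one, ← Complex.ofReal_sub, Complex.norm_real, Real.norm_eq_abs,
        abs_of_nonneg (by linarith [(hχ x).2])]
    rw [h1]
    by_cases hx : x ∈ ⋃ g ∈ N, C g
    · rw [hχ1 x hx]; simp [hε.le]
    · by_cases ht : t ∈ tsupport f
      · obtain ⟨g, hg, hg'⟩ := Set.mem_iUnion₂.1 (hN ⟨t, ht, rfl⟩)
        have hx' : x ∉ C g := fun h => hx (Set.mem_iUnion₂.2 ⟨g, hg, h⟩)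
        have h2 := hC' g x hx'
        have h3 : ‖f t x - g x‖ ≤ ε / 2 := by
          rw [Metric.mem_ball, dist_eq_norm] at hg'
          exact (norm_C0_apply_le (f t - g) x).trans hg'.le
        have h4 : ‖f t x‖ ≤ ε := by
          calc ‖f t x‖ = ‖(f t x - g x) + g x‖ := by ring_nf
            _ ≤ _ := norm_add_le _ _
            _ ≤ ε := by linarith
        calc (1 - χ x) * ‖f t x‖ ≤ 1 * ε :=
              mul_le_mul (by linarith [(hχ x).1]) h4 (norm_nonneg _) zero_le_one
          _ = ε := one_mul ε
      · rw [image_eq_zero_of_notMem_tsupport ht]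
        simp [hε.le]
  · have h0 : f t = 0 := image_eq_zero_of_notMem_tsupport ht
    ext x
    change f t x - (χ x : ℂ) * f t x = 0
    rw [h0]
    simp

/-- Evaluation at a point as a continuous functional on `C₀(X)`. -/
def evalC0 (x : X) : C₀(X, ℂ) →L[ℂ] ℂ :=
  LinearMap.mkContinuous ⟨⟨fun f => f x, fun _ _ => rfl⟩, fun _ _ => rfl⟩ 1
    (fun f => by rw [one_mul]; exact norm_C0_apply_le f x)

theorem integral_C0_apply {T : Type*} [MeasurableSpace T] {μ : Measure T} {f : T → C₀(X, ℂ)}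
    (hf : Integrable f μ) (x : X) : (∫ t, f t ∂μ) x = ∫ t, f t x ∂μ :=
  ((evalC0 x).integral_comp_comm hf).symm

end Curry

/-! ### Convolution and involution in the crossed product -/

section Convolution

set_option linter.unusedSectionVars false

variable {G X : Type} [NormedAddCommGroup G] [NormedSpace ℝ G] [FiniteDimensional ℝ G]
  [MeasureSpace G] [BorelSpace G] [(volume : Measure G).IsAddHaarMeasure]
  [NormedAddCommGroup X] [NormedSpace ℝ X] [FiniteDimensional ℝ X]
  {D : TwistedSystem G X}

/-- The representation of `C₀(X)` as a continuous linear map. -/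
def CovariantRep.πL (ρ : CovariantRep D) : C₀(X, ℂ) →L[ℂ] (ρ.H →L[ℂ] ρ.H) :=
  LinearMap.mkContinuous ⟨⟨ρ.π, map_add ρ.π⟩, map_smul ρ.π⟩ 1 (fun f => by
    rw [one_mul]; exact NonUnitalStarAlgHom.norm_apply_le ρ.π f)

theorem CovariantRep.πL_apply (ρ : CovariantRep D) (f : C₀(X, ℂ)) : ρ.πL f = ρ.π f := rfl

theorem CovariantRep.integrated_apply (ρ : CovariantRep D) (f : C_c(G, C₀(X, ℂ))) (ξ : ρ.H) :
    ρ.integrated f ξ = ∫ s, ρ.π (f s) ((ρ.U s : ρ.H →L[ℂ] ρ.H) ξ) := rfl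

theorem CovariantRep.inner_integrated (ρ : CovariantRep D) (f : C_c(G, C₀(X, ℂ))) (w v : ρ.H) :
    ⟪w, ρ.integrated f v⟫_ℂ = ∫ s, ⟪w, ρ.π (f s) ((ρ.U s : ρ.H →L[ℂ] ρ.H) v)⟫_ℂ :=
  ((innerSL ℂ w).integral_comp_comm (ρ.integrable_integrand f v)).symm

theorem CovariantRep.integrated_add (ρ : CovariantRep D) (f g : C_c(G, C₀(X, ℂ))) :
    ρ.integrated (f + g) = ρ.integrated f + ρ.integrated g := by
  ext1 v
  rw [add_apply, ρ.integrated_apply, ρ.integrated_apply, ρ.integrated_apply,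
    ← integral_add (ρ.integrable_integrand f v) (ρ.integrable_integrand g v)]
  refine integral_congr_ae (Filter.Eventually.of_forall fun s => ?_)
  simp

theorem CovariantRep.integrated_smul (ρ : CovariantRep D) (c : ℂ) (f : C_c(G, C₀(X, ℂ))) :
    ρ.integrated (c • f) = c • ρ.integrated f := by
  ext1 v
  rw [smul_apply, ρ.integrated_apply, ρ.integrated_apply, ← integral_smul]
  refine integral_congr_ae (Filter.Eventually.of_forall fun s => ?_)
  simp

theorem CovariantRep.eq_zero_of_π (ρ : CovariantRep D) (v : ρ.H) (h : ∀ f, ρ.π f v = 0) :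
    v = 0 := by
  have hd : Submodule.span ℂ {v : ρ.H | ∃ f ξ, v = ρ.π f ξ} ≤ (Submodule.span ℂ {v})ᗮ := by
    refine Submodule.span_le.2 ?_
    rintro _ ⟨f, ξ, rfl⟩
    rw [SetLike.mem_coe, Submodule.mem_orthogonal_singleton_iff_inner_right,
      ← ContinuousLinearMap.adjoint_inner_left, ← ContinuousLinearMap.star_eq_adjoint,
      ← map_star, h, inner_zero_left]
  have h2 := (Submodule.span ℂ {v}).isClosed_orthogonal.closure_subset_iff.2 hd
  rw [ρ.nondegenerate.closure_eq] at h2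
  have h3 := (Submodule.mem_orthogonal_singleton_iff_inner_right).1 (h2 (Set.mem_univ v))
  exact inner_self_eq_zero.1 h3

theorem CovariantRep.ext_π (ρ : CovariantRep D) {S T : ρ.H →L[ℂ] ρ.H}
    (h : ∀ f, ρ.π f * S = ρ.π f * T) : S = T := by
  ext1 v
  rw [← sub_eq_zero]
  refine ρ.eq_zero_of_π _ fun f => ?_
  rw [map_sub, sub_eq_zero]
  exact DFunLike.congr_fun (h f) v

theorem TwistedSystem.cocycleMul_apply (s t : G) (f : C₀(X, ℂ)) (x : X) :
    D.cocycleMul s t f x = (D.σ s t x : ℂ) * f x := rfl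

theorem TwistedSystem.aut_apply (s : G) (f : C₀(X, ℂ)) (x : X) :
    D.aut s f x = f (D.act (-s) x) := rfl

theorem CovariantRep.U_mul_star (ρ : CovariantRep D) (s : G) :
    (ρ.U s : ρ.H →L[ℂ] ρ.H) * star (ρ.U s : ρ.H →L[ℂ] ρ.H) = 1 :=
  (Unitary.mem_iff.1 (ρ.U s).2).2

theorem CovariantRep.star_U_mul (ρ : CovariantRep D) (s : G) :
    star (ρ.U s : ρ.H →L[ℂ] ρ.H) * (ρ.U s : ρ.H →L[ℂ] ρ.H) = 1 :=
  (Unitary.mem_iff.1 (ρ.U s).2).1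

theorem CovariantRep.U_zero (ρ : CovariantRep D) : (ρ.U 0 : ρ.H →L[ℂ] ρ.H) = 1 := by
  have h : (ρ.U 0 : ρ.H →L[ℂ] ρ.H) * ρ.U 0 = ρ.U 0 := ρ.ext_π fun f => by
    have h1 : D.cocycleMul 0 0 f = f := by
      ext x
      rw [D.cocycleMul_apply, D.σ_zero_left]; simp
    rw [ρ.twisted, h1, add_zero]
  calc (ρ.U 0 : ρ.H →L[ℂ] ρ.H) = ρ.U 0 * (ρ.U 0 * star (ρ.U 0 : ρ.H →L[ℂ] ρ.H)) := by
        rw [ρ.U_mul_star, mul_one]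
    _ = 1 := by rw [← mul_assoc, h, ρ.U_mul_star]

theorem CovariantRep.U_mul_π (ρ : CovariantRep D) (s : G) (f : C₀(X, ℂ)) :
    (ρ.U s : ρ.H →L[ℂ] ρ.H) * ρ.π f = ρ.π (D.aut s f) * ρ.U s := by
  rw [← ρ.covariant, mul_assoc, ρ.star_U_mul, mul_one]

/-- The adjoint `U_s*` in terms of `U_{-s}`. -/
theorem CovariantRep.π_mul_star_U (ρ : CovariantRep D) (s : G) (f : C₀(X, ℂ)) :
    ρ.π (D.cocycleMul (-s) s f) * star (ρ.U s : ρ.H →L[ℂ] ρ.H) = ρ.π f * ρ.U (-s) := by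
  have h := ρ.twisted (-s) s f
  rw [neg_add_cancel, ρ.U_zero, mul_one] at h
  rw [← h, mul_assoc, mul_assoc, ρ.U_mul_star, mul_one]

/-- The involution on `C_c(G × X)`:
`F*(s, x) = \overline{σ(s, -s)(x) F(-s, (-s) • x)}`. -/
def starCc (D : TwistedSystem G X) (F : C_c(G × X, ℂ)) : C_c(G × X, ℂ) :=
  mkCc (fun p => starRingEnd ℂ ((D.σ p.1 (-p.1) p.2 : ℂ) * F (-p.1, D.act (-p.1) p.2)))
    (by
      have h1 : Continuous fun p : G × X => D.σ p.1 (-p.1) p.2 :=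
        D.continuous_σ.comp (by fun_prop : Continuous fun p : G × X => (p.1, -p.1, p.2))
      have h2 : Continuous fun p : G × X => D.act (-p.1) p.2 :=
        D.continuous_act.comp (by fun_prop : Continuous fun p : G × X => (-p.1, p.2))
      exact Complex.continuous_conj.comp ((continuous_subtype_val.comp h1).mul
        (F.continuous.comp ((continuous_fst.neg).prodMk h2))))
    (by
      obtain ⟨K, L, hK, hL, h⟩ := exists_compact_Cc F
      have hc : IsCompact ((fun q : G × X => (-q.1, D.act (-q.1) q.2)) '' (K ×ˢ L)) :=
        (hK.prod hL).image ((continuous_fst.neg).prodMk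
          (D.continuous_act.comp (by fun_prop : Continuous fun p : G × X => (-p.1, p.2))))
      refine HasCompactSupport.intro hc fun p hp => ?_
      by_contra h'
      refine hp ⟨(-p.1, D.act (-p.1) p.2), h _ _ fun h0 => h' ?_, ?_⟩
      · rw [h0]; simp
      · ext1
        · simp
        · change D.act (- -p.1) (D.act (-p.1) p.2) = p.2
          rw [← D.act_add, neg_neg, add_neg_cancel, D.act_zero])

theorem CovariantRep.star_integrated (ρ : CovariantRep D) (F : C_c(G × X, ℂ)) :
    star (ρ.integrated (cc F)) = ρ.integrated (cc (starCc D F)) := by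
  refine ContinuousLinearMap.ext fun v => ext_inner_left ℂ fun w => ?_
  rw [ρ.inner_integrated, ContinuousLinearMap.star_eq_adjoint,
    ContinuousLinearMap.adjoint_inner_right, ← inner_conj_symm, ρ.inner_integrated,
    ← integral_conj, ← integral_neg_eq_self]
  refine integral_congr_ae (Filter.Eventually.of_forall fun s => ?_)
  have key : star (ρ.π (cc F (-s)) * (ρ.U (-s) : ρ.H →L[ℂ] ρ.H)) =
      ρ.π (cc (starCc D F) s) * ρ.U s := by
    have h2 := ρ.π_mul_star_U (-s) (cc (starCc D F) s)
    rw [neg_neg] at h2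
    have h3 : D.cocycleMul s (-s) (cc (starCc D F) s) = D.aut s (star (cc F (-s))) := by
      ext x
      rw [D.cocycleMul_apply, D.aut_apply, cc_apply]
      change (D.σ s (-s) x : ℂ) * starRingEnd ℂ ((D.σ s (-s) x : ℂ) * F (-s, D.act (-s) x)) =
        starRingEnd ℂ (F (-s, D.act (-s) x))
      rw [map_mul, ← mul_assoc, Complex.mul_conj, Circle.normSq_coe]
      simp
    have h4 := ρ.U_mul_π (-s) (D.aut s (star (cc F (-s))))
    have h5 : D.aut (-s) (D.aut s (star (cc F (-s)))) = star (cc F (-s)) := by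
      ext x
      rw [D.aut_apply, D.aut_apply, ← D.act_add, neg_neg, neg_add_cancel, D.act_zero]
    rw [h5] at h4
    have h6 : star (ρ.U (-s) : ρ.H →L[ℂ] ρ.H) * ρ.π (star (cc F (-s))) =
        ρ.π (D.aut s (star (cc F (-s)))) * star (ρ.U (-s) : ρ.H →L[ℂ] ρ.H) := by
      calc _ = star (ρ.U (-s) : ρ.H →L[ℂ] ρ.H) * (ρ.π (star (cc F (-s))) * ρ.U (-s)) *
            star (ρ.U (-s) : ρ.H →L[ℂ] ρ.H) := by
            rw [mul_assoc, mul_assoc, ρ.U_mul_star, mul_one]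
        _ = _ := by rw [← h4, ← mul_assoc, ρ.star_U_mul, one_mul]
    rw [← h2, h3, star_mul, ← map_star, h6]
  change starRingEnd ℂ ⟪v, (ρ.π (cc F (-s)) * (ρ.U (-s) : ρ.H →L[ℂ] ρ.H)) w⟫_ℂ =
    ⟪w, (ρ.π (cc (starCc D F) s) * (ρ.U s : ρ.H →L[ℂ] ρ.H)) v⟫_ℂ
  rw [← key, inner_conj_symm, ContinuousLinearMap.star_eq_adjoint,
    ContinuousLinearMap.adjoint_inner_right]

end Convolution

end QG

end

noncomputable section

namespace QG

section Convolution

set_option linter.unusedSectionVars false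

variable {G X : Type} [NormedAddCommGroup G] [NormedSpace ℝ G] [FiniteDimensional ℝ G]
  [MeasureSpace G] [BorelSpace G] [(volume : Measure G).IsAddHaarMeasure]
  [NormedAddCommGroup X] [NormedSpace ℝ X] [FiniteDimensional ℝ X]
  {D : TwistedSystem G X}

/-- The integrand `F(t, x) F'(s - t, (-t) • x) σ(t, s - t)(x)` of the twisted convolution, as a
function of `((t, s), x)`. -/
def convIntegrand (D : TwistedSystem G X) (F F' : C_c(G × X, ℂ)) : C_c((G × G) × X, ℂ) :=
  mkCc (fun p => F (p.1.1, p.2) * F' (p.1.2 - p.1.1, D.act (-p.1.1) p.2) *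
      (D.σ p.1.1 (p.1.2 - p.1.1) p.2 : ℂ))
    (by
      have h1 : Continuous fun p : (G × G) × X => D.σ p.1.1 (p.1.2 - p.1.1) p.2 :=
        D.continuous_σ.comp
          (by fun_prop : Continuous fun p : (G × G) × X => (p.1.1, p.1.2 - p.1.1, p.2))
      have h2 : Continuous fun p : (G × G) × X => D.act (-p.1.1) p.2 :=
        D.continuous_act.comp (by fun_prop : Continuous fun p : (G × G) × X => (-p.1.1, p.2))
      have h3 := F.continuous
      have h4 := F'.continuous
      exact ((h3.comp (by fun_prop)).mul (h4.comp ((by fun_prop : Continuous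
        fun p : (G × G) × X => p.1.2 - p.1.1).prodMk h2))).mul (continuous_subtype_val.comp h1))
    (by
      obtain ⟨K, L, hK, hL, h⟩ := exists_compact_Cc F
      obtain ⟨K', L', hK', -, h'⟩ := exists_compact_Cc F'
      refine HasCompactSupport.intro ((hK.prod (hK'.add hK)).prod hL) fun p hp => ?_
      by_contra h0
      have h1 : F (p.1.1, p.2) ≠ 0 := fun h1 => h0 (by rw [h1]; ring)
      have h2 : F' (p.1.2 - p.1.1, D.act (-p.1.1) p.2) ≠ 0 := fun h1 => h0 (by rw [h1]; ring)
      refine hp ⟨⟨(h _ _ h1).1, ?_⟩, (h _ _ h1).2⟩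
      exact ⟨_, (h' _ _ h2).1, _, (h _ _ h1).1, by simp⟩)

/-- The integrand of the twisted convolution as a function with values in `C₀(X)`. -/
def convVal (D : TwistedSystem G X) (F F' : C_c(G × X, ℂ)) : C_c(G × G, C₀(X, ℂ)) :=
  cc (G := G × G) (convIntegrand D F F')

theorem convVal_apply (F F' : C_c(G × X, ℂ)) (t s : G) (x : X) :
    convVal D F F' (t, s) x =
      F (t, x) * F' (s - t, D.act (-t) x) * (D.σ t (s - t) x : ℂ) := rfl

/-- Integration over the first variable. -/
def intFst {T : Type} [NormedAddCommGroup T] [NormedSpace ℝ T] [FiniteDimensional ℝ T]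
    [MeasureSpace T] [BorelSpace T] [(volume : Measure T).IsAddHaarMeasure]
    (F : C_c((T × G) × X, ℂ)) : C_c(G × X, ℂ) :=
  mkCc (fun p => ∫ t, F ((t, p.1), p.2))
    (by
      obtain ⟨K, L, hK, hL, h⟩ := exists_compact_Cc F
      have h0 : (fun p : G × X => ∫ t, F ((t, p.1), p.2)) = fun p : G × X =>
          ∫ t in Prod.fst '' K, F ((t, p.1), p.2) := by
        funext p
        refine (setIntegral_eq_integral_of_forall_compl_eq_zero fun t ht => ?_).symm
        by_contra h1
        exact ht ⟨_, (h _ _ h1).1, rfl⟩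
      rw [h0]
      refine continuous_parametric_integral_of_continuous
        (f := fun (p : G × X) t => F ((t, p.1), p.2)) ?_ (hK.image continuous_fst)
      exact F.continuous.comp (by fun_prop : Continuous fun q : (G × X) × T =>
          ((q.2, q.1.1), q.1.2)))
    (by
      obtain ⟨K, L, hK, hL, h⟩ := exists_compact_Cc F
      refine HasCompactSupport.intro ((hK.image continuous_snd).prod hL) fun p hp => ?_
      refine integral_eq_zero_of_ae (Filter.Eventually.of_forall fun t => ?_)
      by_contra h1
      exact hp ⟨⟨_, (h _ _ h1).1, rfl⟩, (h _ _ h1).2⟩)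

/-- The twisted convolution product on `C_c(G × X)`. -/
def convCc (D : TwistedSystem G X) (F F' : C_c(G × X, ℂ)) : C_c(G × X, ℂ) :=
  intFst (convIntegrand D F F')

theorem CovariantRep.integrand_mul (ρ : CovariantRep D) (F F' : C_c(G × X, ℂ)) (t r : G) :
    (ρ.π (cc F t) * (ρ.U t : ρ.H →L[ℂ] ρ.H)) * (ρ.π (cc F' r) * (ρ.U r : ρ.H →L[ℂ] ρ.H)) =
      ρ.π (convVal D F F' (t, r + t)) * ρ.U (r + t) := by
  have : convVal D F F' (t, r + t) =
      D.cocycleMul t r (cc F t * D.aut t (cc F' r)) := by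
    ext x
    rw [D.cocycleMul_apply]
    rw [convVal_apply, add_sub_cancel_right]
    change _ = (D.σ t r x : ℂ) * (F (t, x) * F' (r, D.act (-t) x))
    ring
  rw [this, add_comm r t, ← ρ.twisted, map_mul]
  calc _ = ρ.π (cc F t) * ((ρ.U t : ρ.H →L[ℂ] ρ.H) * ρ.π (cc F' r)) * ρ.U r := by
        simp only [mul_assoc]
    _ = _ := by rw [ρ.U_mul_π]; simp only [mul_assoc]

theorem integrable_section (H : C_c(G × G, C₀(X, ℂ))) (s : G) :
    Integrable fun t => H (t, s) := by
  refine (H.continuous.comp (by fun_prop :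
    Continuous fun t : G => (t, s))).integrable_of_hasCompactSupport ?_
  refine HasCompactSupport.intro
    ((show IsCompact (tsupport H) from H.hasCompactSupport).image continuous_fst)
    fun t ht => ?_
  by_contra h
  exact ht ⟨(t, s), subset_tsupport _ h, rfl⟩

/-- The substitution `s = r + t` in the double integral of the product of two integrated
operators. -/
theorem CovariantRep.integral_integral_shift (ρ : CovariantRep D) (H : C_c(G × G, C₀(X, ℂ)))
    (v w : ρ.H) :
    ∫ t, ∫ r, ⟪w, ρ.πL (H (t, r + t)) ((ρ.U (r + t) : ρ.H →L[ℂ] ρ.H) v)⟫_ℂ =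
      ∫ s, ⟪w, ρ.πL (∫ t, H (t, s)) ((ρ.U s : ρ.H →L[ℂ] ρ.H) v)⟫_ℂ := by
  let q : G → G → ℂ := fun t s => ⟪w, ρ.πL (H (t, s)) ((ρ.U s : ρ.H →L[ℂ] ρ.H) v)⟫_ℂ
  have hcont : Continuous (Function.uncurry q) := by
    refine continuous_const.inner ?_
    exact (ρ.πL.continuous.comp H.continuous).clm_apply
      ((ρ.continuous_U v).comp continuous_snd)
  have hsupp : HasCompactSupport (Function.uncurry q) := by
    refine HasCompactSupport.intro H.hasCompactSupport fun p hp => ?_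
    have h : H p = 0 := image_eq_zero_of_notMem_tsupport hp
    change ⟪w, ρ.πL (H p) _⟫_ℂ = 0
    rw [h, map_zero, zero_apply, inner_zero_right]
  calc _ = ∫ t, ∫ s, q t s := by
        refine integral_congr_ae (Filter.Eventually.of_forall fun t => ?_)
        exact integral_add_right_eq_self (q t) t
    _ = ∫ s, ∫ t, q t s := integral_integral_swap_of_hasCompactSupport hcont hsupp
    _ = _ := by
        refine integral_congr_ae (Filter.Eventually.of_forall fun s => ?_)
        let Ψ : C₀(X, ℂ) →L[ℂ] ℂ := innerSL ℂ w ∘L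
          (ContinuousLinearMap.apply ℂ ρ.H ((ρ.U s : ρ.H →L[ℂ] ρ.H) v)) ∘L ρ.πL
        exact Ψ.integral_comp_comm (integrable_section H s)

theorem cc_convCc (F F' : C_c(G × X, ℂ)) (s : G) :
    cc (convCc D F F') s = ∫ t, convVal D F F' (t, s) := by
  ext x
  rw [integral_C0_apply (integrable_section _ s)]
  rfl

theorem CovariantRep.integrated_mul (ρ : CovariantRep D) (F F' : C_c(G × X, ℂ)) :
    ρ.integrated (cc F) * ρ.integrated (cc F') = ρ.integrated (cc (convCc D F F')) := by
  refine ContinuousLinearMap.ext fun v => ext_inner_left ℂ fun w => ?_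
  rw [ρ.inner_integrated (cc (convCc D F F'))]
  simp only [cc_convCc]
  refine Eq.trans ?_ (ρ.integral_integral_shift _ v w)
  change ⟪w, ρ.integrated (cc F) (ρ.integrated (cc F') v)⟫_ℂ = _
  rw [ρ.inner_integrated]
  refine integral_congr_ae (Filter.Eventually.of_forall fun t => ?_)
  change ⟪w, (ρ.π (cc F t) * (ρ.U t : ρ.H →L[ℂ] ρ.H)) (ρ.integrated (cc F') v)⟫_ℂ = _
  rw [← ContinuousLinearMap.adjoint_inner_left, ρ.inner_integrated]
  refine integral_congr_ae (Filter.Eventually.of_forall fun r => ?_)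
  beta_reduce
  rw [ContinuousLinearMap.adjoint_inner_left]
  exact congrArg (fun T : ρ.H →L[ℂ] ρ.H => ⟪w, T v⟫_ℂ) (ρ.integrand_mul F F' t r)

theorem norm_universalRep_le (f : C_c(G, C₀(X, ℂ))) :
    ‖universalRep D f‖ ≤ ∫ s, ‖f s‖ :=
  lp.norm_le_of_forall_le (integral_nonneg fun _ => norm_nonneg _)
    fun ρ => ρ.norm_integrated_le f

/-- The image of `C_c(G × X)` in the crossed product, a dense `*`-algebra. -/
def ccAlg (D : TwistedSystem G X) :
    NonUnitalStarSubalgebra ℂ (lp (fun ρ : CovariantRep D => ρ.H →L[ℂ] ρ.H) ∞) where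
  carrier := Set.range fun F : C_c(G × X, ℂ) => universalRep D (cc F)
  add_mem' := by
    rintro _ _ ⟨F, rfl⟩ ⟨F', rfl⟩
    refine ⟨F + F', ?_⟩
    ext1; funext ρ
    rw [lp.coeFn_add]
    change ρ.integrated _ = ρ.integrated _ + ρ.integrated _
    rw [cc_add, ρ.integrated_add]
  zero_mem' := by
    refine ⟨0, ?_⟩
    ext1; funext ρ
    change ρ.integrated (cc 0) = 0
    have h : cc (0 : C_c(G × X, ℂ)) = (0 : ℂ) • cc 0 := by ext t x; exact (zero_mul _).symm
    rw [h, ρ.integrated_smul, zero_smul]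
  smul_mem' := by
    rintro c _ ⟨F, rfl⟩
    refine ⟨c • F, ?_⟩
    ext1; funext ρ
    rw [lp.coeFn_smul]
    change ρ.integrated _ = c • ρ.integrated _
    rw [cc_smul, ρ.integrated_smul]
  mul_mem' := by
    rintro _ _ ⟨F, rfl⟩ ⟨F', rfl⟩
    refine ⟨convCc D F F', ?_⟩
    ext1; funext ρ
    rw [lp.infty_coeFn_mul]
    exact (ρ.integrated_mul F F').symm
  star_mem' := by
    rintro _ ⟨F, rfl⟩
    refine ⟨starCc D F, ?_⟩
    ext1; funext ρ
    rw [lp.coeFn_star]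
    exact (ρ.star_integrated F).symm

theorem universalRep_sub (f g : C_c(G, C₀(X, ℂ))) :
    universalRep D (f - g) = universalRep D f - universalRep D g := by
  ext1; funext ρ
  rw [lp.coeFn_sub]
  change ρ.integrated _ = ρ.integrated _ - ρ.integrated _
  have h : f - g = f + (-1 : ℂ) • g := by
    ext s x
    change f s x - g s x = f s x + -1 * g s x
    ring
  rw [h, ρ.integrated_add, ρ.integrated_smul, neg_one_smul, sub_eq_add_neg]

theorem integral_norm_le_of_support {f g : C_c(G, C₀(X, ℂ))} {K : Set G} (hK : IsCompact K)
    {ε : ℝ} (h : ∀ s, ‖f s - g s‖ ≤ ε) (h0 : ∀ s ∉ K, f s - g s = 0) :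
    ∫ s, ‖(f - g) s‖ ≤ ε * volume.real K := by
  have h1 : ∫ s, ‖(f - g) s‖ = ∫ s in K, ‖(f - g) s‖ := by
    refine (setIntegral_eq_integral_of_forall_compl_eq_zero fun t ht => ?_).symm
    change ‖f t - g t‖ = 0
    rw [h0 t ht, norm_zero]
  rw [h1]
  refine (le_abs_self _).trans (norm_setIntegral_le_of_norm_le_const
    (f := fun s => ‖(f - g) s‖) hK.measure_lt_top fun s _ => ?_)
  rw [norm_norm]
  exact h s

theorem universalRep_mem_closure (D : TwistedSystem G X) (f : C_c(G, C₀(X, ℂ))) :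
    universalRep D f ∈ closure (Set.range fun F : C_c(G × X, ℂ) => universalRep D (cc F)) := by
  refine Metric.mem_closure_iff.2 fun ε hε => ?_
  have hK : IsCompact (tsupport f) := f.hasCompactSupport
  obtain ⟨δ, hδ, hδ'⟩ : ∃ δ > 0, δ * volume.real (tsupport f) < ε := by
    have hV0 : 0 ≤ volume.real (tsupport f) := measureReal_nonneg
    refine ⟨ε / (volume.real (tsupport f) + 1), by positivity, ?_⟩
    rw [div_mul_eq_mul_div, div_lt_iff₀ (by linarith)]
    exact mul_lt_mul_of_pos_left (by linarith) hε
  obtain ⟨F, hF, hF'⟩ := exists_cc_near f hδ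
  refine ⟨_, ⟨F, rfl⟩, ?_⟩
  have h1 := integral_norm_le_of_support (g := cc F) hK hF hF'
  have h2 := norm_universalRep_le (D := D) (f - cc F)
  rw [universalRep_sub] at h2
  rw [dist_eq_norm]
  exact h2.trans_lt (h1.trans_lt hδ')

theorem closure_adjoin_eq {E : Type*} [NonUnitalCStarAlgebra E] (A : NonUnitalStarSubalgebra ℂ E)
    {s : Set E} (h : s ⊆ closure (A : Set E)) (h' : (A : Set E) ⊆ s) :
    closure (NonUnitalStarAlgebra.adjoin ℂ s : Set E) = closure (A : Set E) := by
  refine Set.Subset.antisymm (closure_minimal ?_ isClosed_closure)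
    (closure_mono (h'.trans (NonUnitalStarAlgebra.subset_adjoin ℂ s)))
  exact NonUnitalStarAlgebra.adjoin_le (S := A.topologicalClosure) h

theorem coe_crossedProduct (D : TwistedSystem G X) :
    (crossedProduct D : Set (lp (fun ρ : CovariantRep D => ρ.H →L[ℂ] ρ.H) ∞)) =
      closure (ccAlg D) :=
  closure_adjoin_eq (ccAlg D) (Set.range_subset_iff.2 (universalRep_mem_closure D))
    (Set.range_subset_iff.2 fun F => Set.mem_range_self (cc F))

end Convolution

end QG

end

noncomputable section

namespace QG

/-! ### Pointwise formulas for integrals of `L²`-valued functions -/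

section Pointwise

set_option linter.unusedSectionVars false

variable {T Y : Type} [MeasurableSpace T] {μ : Measure T} [SigmaFinite μ] [MeasureSpace Y]
  [SigmaFinite (volume : Measure Y)]

theorem setIntegral_norm_le (f : L2 Y) {A : Set Y} (hA : MeasurableSet A) (hA' : volume A ≠ ∞) :
    ∫ y in A, ‖f y‖ ≤ √(volume.real A) * ‖f‖ := by
  have hm : MemLp (fun y => ‖f y‖) 2 (volume : Measure Y) := (Lp.memLp f).norm
  have h1 := L2.inner_indicatorConstLp_one (𝕜 := ℝ) hA hA' (hm.toLp _)
  have h2 : ∫ y in A, hm.toLp _ y = ∫ y in A, ‖f y‖ :=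
    integral_congr_ae (ae_restrict_of_ae hm.coeFn_toLp)
  have h3 : ‖hm.toLp _‖ = ‖f‖ := by
    rw [Lp.norm_toLp, Lp.norm_def, eLpNorm_norm]
  rw [← h2, ← h1]
  refine (real_inner_le_norm _ _).trans ?_
  rw [h3, norm_indicatorConstLp two_ne_zero ENNReal.ofNat_ne_top, norm_one, one_mul,
    Real.sqrt_eq_rpow]
  simp

/-- The Bochner integral of an `L²`-valued function is computed pointwise. -/
theorem coeFn_integral {U : T → L2 Y} (hU : Integrable U μ) {u : T → Y → ℂ}
    (hu : Measurable (Function.uncurry u)) (h : ∀ t, U t =ᵐ[volume] u t) :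
    (∫ t, U t ∂μ : L2 Y) =ᵐ[volume] fun y => ∫ t, u t y ∂μ := by
  have hint : ∀ A : Set Y, MeasurableSet A → volume A < ∞ →
      Integrable (Function.uncurry u) (μ.prod (volume.restrict A)) := by
    intro A hA hA'
    rw [integrable_prod_iff hu.aestronglyMeasurable]
    refine ⟨Filter.Eventually.of_forall fun t => ?_, ?_⟩
    · exact (integrableOn_Lp_of_measure_ne_top (U t) (by norm_num) hA'.ne).congr
        (ae_restrict_of_ae (h t))
    · refine ((hU.norm.const_mul (√(volume.real A)))).mono'
        hu.aestronglyMeasurable.norm.integral_prod_right'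
        (Filter.Eventually.of_forall fun t => ?_)
      rw [Real.norm_of_nonneg (integral_nonneg fun _ => norm_nonneg _)]
      refine le_trans (le_of_eq ?_) (setIntegral_norm_le (U t) hA hA'.ne)
      refine integral_congr_ae (ae_restrict_of_ae ?_)
      filter_upwards [h t] with y hy
      rw [hy]
      rfl
  refine ae_eq_of_forall_setIntegral_eq_of_sigmaFinite (fun A _ hA' =>
    integrableOn_Lp_of_measure_ne_top _ (by norm_num) hA'.ne)
    (fun A hA hA' => (hint A hA hA').integral_prod_right) fun A hA hA' => ?_
  rw [← L2.inner_indicatorConstLp_one (𝕜 := ℂ) hA hA'.ne]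
  calc _ = ∫ t, ⟪indicatorConstLp 2 hA hA'.ne (1 : ℂ), U t⟫_ℂ ∂μ :=
        ((innerSL ℂ (indicatorConstLp 2 hA hA'.ne (1 : ℂ))).integral_comp_comm hU).symm
    _ = ∫ t, ∫ y in A, u t y ∂volume ∂μ := by
        refine integral_congr_ae (Filter.Eventually.of_forall fun t => ?_)
        beta_reduce
        rw [L2.inner_indicatorConstLp_one]
        exact integral_congr_ae (ae_restrict_of_ae (h t))
    _ = _ := integral_integral_swap (hint A hA hA')

theorem memLp_mulB [TopologicalSpace Y] [BorelSpace Y] (g : BoundedContinuousFunction Y ℂ)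
    (ξ : L2 Y) : MemLp ((g : Y → ℂ) * (ξ : Y → ℂ)) 2 (volume : Measure Y) :=
  (Lp.memLp ξ).of_le_mul (c := ‖g‖)
    (g.continuous.measurable.aestronglyMeasurable.mul (Lp.aestronglyMeasurable ξ))
    (Filter.Eventually.of_forall fun y => by
      rw [Pi.mul_apply, norm_mul]
      exact mul_le_mul_of_nonneg_right (g.norm_coe_le_norm y) (norm_nonneg _))

/-- Multiplication by a bounded continuous function. -/
def mulB [TopologicalSpace Y] [BorelSpace Y] (g : BoundedContinuousFunction Y ℂ) : B Y :=
  LinearMap.mkContinuous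
    { toFun := fun ξ => (memLp_mulB g ξ).toLp _
      map_add' := fun ξ η => by
        rw [← MemLp.toLp_add]
        refine MemLp.toLp_congr _ _ ?_
        filter_upwards [Lp.coeFn_add ξ η] with y h1
        simp only [Pi.mul_apply, Pi.add_apply, h1, mul_add]
      map_smul' := fun c ξ => by
        rw [RingHom.id_apply, ← MemLp.toLp_const_smul]
        refine MemLp.toLp_congr _ _ ?_
        filter_upwards [Lp.coeFn_smul c ξ] with y h1
        simp only [Pi.mul_apply, Pi.smul_apply, h1, smul_eq_mul, mul_left_comm] }
    ‖g‖ (fun ξ => by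
      refine Lp.norm_le_mul_norm_of_ae_le_mul ?_
      refine (memLp_mulB g ξ).coeFn_toLp.mono fun y h1 => ?_
      change ‖((memLp_mulB g ξ).toLp _ : L2 Y) y‖ ≤ _
      rw [h1, Pi.mul_apply, norm_mul]
      exact mul_le_mul_of_nonneg_right (g.norm_coe_le_norm y) (norm_nonneg _))

theorem mulB_coe [TopologicalSpace Y] [BorelSpace Y] (g : BoundedContinuousFunction Y ℂ)
    (ξ : L2 Y) : (mulB g ξ : Y → ℂ) =ᵐ[volume] fun y => g y * ξ y :=
  (memLp_mulB g ξ).coeFn_toLp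

theorem adjoint_mulB [TopologicalSpace Y] [BorelSpace Y] (g : BoundedContinuousFunction Y ℂ) :
    star (mulB g) = mulB (star g) := by
  refine ContinuousLinearMap.ext fun ξ => ext_inner_left ℂ fun η => ?_
  rw [ContinuousLinearMap.star_eq_adjoint, ContinuousLinearMap.adjoint_inner_right,
    L2.inner_def, L2.inner_def]
  refine integral_congr_ae ?_
  filter_upwards [mulB_coe g η, mulB_coe (star g) ξ] with y h1 h2
  rw [h1, h2]
  simp [mul_comm, mul_left_comm]

end Pointwise

section StrongContinuity

variable {T H : Type*} [TopologicalSpace T] [NormedAddCommGroup H] [InnerProductSpace ℂ H]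

/-- A weakly continuous family of isometries is strongly continuous. -/
theorem continuous_of_weak {A : T → H →L[ℂ] H} (hA : ∀ t v, ‖A t v‖ = ‖v‖) (v : H)
    (h : ∀ w, Continuous fun t => ⟪w, A t v⟫_ℂ) : Continuous fun t => A t v := by
  refine continuous_iff_continuousAt.2 fun t₀ => ?_
  have h1 : Filter.Tendsto (fun t => ‖A t v - A t₀ v‖ ^ 2) (𝓝 t₀) (𝓝 0) := by
    have h2 : ∀ t, ‖A t v - A t₀ v‖ ^ 2 = 2 * ‖v‖ ^ 2 - 2 * (⟪A t₀ v, A t v⟫_ℂ).re := by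
      intro t
      rw [← norm_neg, neg_sub, @norm_sub_sq ℂ, hA, hA]
      simp only [RCLike.re_to_complex]
      ring
    have h3 : Filter.Tendsto (fun t => ⟪A t₀ v, A t v⟫_ℂ) (𝓝 t₀) (𝓝 ⟪A t₀ v, A t₀ v⟫_ℂ) :=
      (h (A t₀ v)).continuousAt
    have h4 := ((Complex.continuous_re.tendsto _).comp h3).const_mul 2 |>.const_sub (2 * ‖v‖ ^ 2)
    simp only [h2]
    have h5 : 2 * ‖v‖ ^ 2 - 2 * (⟪A t₀ v, A t₀ v⟫_ℂ).re = 0 := by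
      have h6 : (⟪A t₀ v, A t₀ v⟫_ℂ).re = ‖v‖ ^ 2 := by
        rw [← hA t₀ v]
        exact inner_self_eq_norm_sq (𝕜 := ℂ) _
      rw [h6, sub_self]
    rw [h5] at h4
    exact h4
  have h5 := h1.sqrt
  simp only [Real.sqrt_zero, Real.sqrt_sq (norm_nonneg _)] at h5
  exact tendsto_iff_norm_sub_tendsto_zero.2 h5

theorem continuous_apply_of_isometry {A : T → H →L[ℂ] H} (hA : ∀ t v, ‖A t v‖ = ‖v‖)
    (h : ∀ v, Continuous fun t => A t v) {η : T → H} (hη : Continuous η) :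
    Continuous fun t => A t (η t) := by
  refine continuous_iff_continuousAt.2 fun t₀ => ?_
  refine tendsto_iff_norm_sub_tendsto_zero.2 ?_
  have h1 := tendsto_iff_norm_sub_tendsto_zero.1 (hη.tendsto t₀)
  have h2 := tendsto_iff_norm_sub_tendsto_zero.1 ((h (η t₀)).tendsto t₀)
  have h3 := h1.add h2
  rw [add_zero] at h3
  refine squeeze_zero (fun _ => norm_nonneg _) (fun t => ?_) h3
  calc ‖A t (η t) - A t₀ (η t₀)‖ = ‖A t (η t - η t₀) + (A t (η t₀) - A t₀ (η t₀))‖ := by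
        rw [map_sub]; congr 1; abel
    _ ≤ _ := (norm_add_le _ _).trans (by rw [hA])

end StrongContinuity

/-! ### The regular representation -/

section Regular

set_option linter.unusedSectionVars false

variable {G X : Type} [NormedAddCommGroup G] [NormedSpace ℝ G] [FiniteDimensional ℝ G]
  [MeasureSpace G] [BorelSpace G] [(volume : Measure G).IsAddHaarMeasure]
  [NormedAddCommGroup X] [NormedSpace ℝ X] [FiniteDimensional ℝ X]
  [MeasureSpace X] [BorelSpace X] [(volume : Measure X).IsAddHaarMeasure]
  (D : TwistedSystem G X)

/-- The function `(s, x) ↦ f(s • x)` on `G × X`. -/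
def pullC0 (f : C₀(X, ℂ)) : BoundedContinuousFunction (G × X) ℂ :=
  f.toBCF.compContinuous ⟨fun p => D.act p.1 p.2, D.continuous_act⟩

theorem mp_shift (t : G) : MeasurePreserving (fun p : G × X => (p.1 - t, p.2)) :=
  (measurePreserving_sub_right volume t).prod (.id _)

/-- The phase `σ(t, s - t)(s • x)` of the regular representation. -/
def regPhase (t : G) (p : G × X) : Circle := D.σ t (p.1 - t) (D.act p.1 p.2)

theorem continuous_regPhase : Continuous fun q : G × G × X => regPhase D q.1 q.2 := by
  have h2 : Continuous fun q : G × G × X => D.act q.2.1 q.2.2 :=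
    D.continuous_act.comp continuous_snd
  exact D.continuous_σ.comp (continuous_fst.prodMk
    ((by fun_prop : Continuous fun q : G × G × X => q.2.1 - q.1).prodMk h2))

theorem measurable_regPhase (t : G) : Measurable fun p : G × X => (regPhase D t p : ℂ) :=
  (continuous_subtype_val.comp ((continuous_regPhase D).comp
    (by fun_prop : Continuous fun p : G × X => (t, p)))).measurable

/-- The operator `U_t ζ(s, x) = σ(t, s - t)(s • x) ζ(s - t, x)`. -/
def regU (t : G) : B (G × X) := wcomp (regPhase D t) (measurable_regPhase D t) _ (mp_shift t)

theorem regU_mem (t : G) : regU D t ∈ unitary (B (G × X)) := by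
  refine wcomp_mem_unitary _ _ _ (fun p => (p.1 - (-t), p.2)) _ (mp_shift (-t)) ?_ ?_ <;>
  · intro p; ext1 <;> simp

theorem regU_coe (t : G) (ζ : L2 (G × X)) :
    (regU D t ζ : G × X → ℂ) =ᵐ[volume] fun p => (regPhase D t p : ℂ) * ζ (p.1 - t, p.2) :=
  wcomp_coe _ _ _ _ _

theorem continuous_regU (ζ : L2 (G × X)) : Continuous fun t => regU D t ζ := by
  have h1 : Continuous fun t : G => compOp _ (mp_shift (X := X) t) ζ :=
    Continuous.compMeasurePreservingLp (f := fun _ : G => ζ)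
      (g := fun t : G => (⟨fun p : G × X => (p.1 - t, p.2), by fun_prop⟩ : C(G × X, G × X)))
      continuous_const (by
        refine ContinuousMap.continuous_of_continuous_uncurry _ ?_
        unfold Function.uncurry
        exact (by fun_prop : Continuous fun q : G × G × X => (q.2.1 - q.1, q.2.2)))
      (fun t => mp_shift t) (by norm_num)
  refine continuous_apply_of_isometry (A := fun t => mulOp (regPhase D t)
    (measurable_regPhase D t)) (fun t v => ?_) (fun v => ?_) h1
  · rw [mulOp_eq_wcomp]; exact norm_wcomp_apply _ _ _ _ _
  · refine continuous_of_weak (A := fun t => mulOp (regPhase D t)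
      (measurable_regPhase D t)) (fun t v => ?_) v (fun w => ?_)
    · rw [mulOp_eq_wcomp]; exact norm_wcomp_apply _ _ _ _ _
    · have h2 : ∀ t, ⟪w, mulOp (regPhase D t) (measurable_regPhase D t) v⟫_ℂ =
          ∫ p, (regPhase D t p : ℂ) * ⟪w p, v p⟫_ℂ := by
        intro t
        rw [L2.inner_def]
        refine integral_congr_ae ?_
        filter_upwards [mulOp_coe (regPhase D t) (measurable_regPhase D t) v] with p hp
        rw [hp]
        simp [mul_assoc]
      simp only [h2]
      refine continuous_of_dominated (bound := fun p => ‖⟪w p, v p⟫_ℂ‖) (fun t => ?_)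
        (fun t => Filter.Eventually.of_forall fun p => ?_) (L2.integrable_inner w v).norm
        (Filter.Eventually.of_forall fun p => ?_)
      · exact (measurable_regPhase D t).aestronglyMeasurable.mul
          (L2.integrable_inner w v).aestronglyMeasurable
      · rw [norm_mul, Circle.norm_coe, one_mul]
      · exact (continuous_subtype_val.comp ((continuous_regPhase D).comp
          (by fun_prop : Continuous fun t : G => (t, p)))).mul continuous_const

/-- The representation `π(f)ζ(s, x) = f(s • x) ζ(s, x)`. -/
def regPi : C₀(X, ℂ) →⋆ₙₐ[ℂ] B (G × X) where
  toFun f := mulB (pullC0 D f)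
  map_smul' c f := by
    refine ContinuousLinearMap.ext fun ζ => Lp.ext ?_
    filter_upwards [mulB_coe (pullC0 D (c • f)) ζ, mulB_coe (pullC0 D f) ζ,
      Lp.coeFn_smul c (mulB (pullC0 D f) ζ)] with p h1 h2 h3
    rw [h1]
    refine Eq.trans ?_ h3.symm
    rw [Pi.smul_apply, h2]
    exact mul_assoc _ _ _
  map_zero' := by
    refine ContinuousLinearMap.ext fun ζ => Lp.ext ?_
    filter_upwards [mulB_coe (pullC0 D 0) ζ, Lp.coeFn_zero ℂ 2 (volume : Measure (G × X))]
      with p h1 h2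
    rw [h1]
    refine Eq.trans ?_ h2.symm
    exact zero_mul _
  map_add' f g := by
    refine ContinuousLinearMap.ext fun ζ => Lp.ext ?_
    filter_upwards [mulB_coe (pullC0 D (f + g)) ζ, mulB_coe (pullC0 D f) ζ,
      mulB_coe (pullC0 D g) ζ,
      Lp.coeFn_add (mulB (pullC0 D f) ζ) (mulB (pullC0 D g) ζ)] with p h1 h2 h3 h4
    rw [h1]
    refine Eq.trans ?_ h4.symm
    rw [Pi.add_apply, h2, h3]
    exact add_mul _ _ _
  map_mul' f g := by
    refine ContinuousLinearMap.ext fun ζ => Lp.ext ?_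
    filter_upwards [mulB_coe (pullC0 D (f * g)) ζ, mulB_coe (pullC0 D g) ζ,
      mulB_coe (pullC0 D f) (mulB (pullC0 D g) ζ)] with p h1 h2 h3
    rw [h1]
    refine Eq.trans ?_ h3.symm
    rw [h2]
    exact mul_assoc _ _ _
  map_star' f := by
    rw [adjoint_mulB]
    rfl

theorem regPi_coe (f : C₀(X, ℂ)) (ζ : L2 (G × X)) :
    (regPi D f ζ : G × X → ℂ) =ᵐ[volume] fun p => f (D.act p.1 p.2) * ζ p :=
  mulB_coe (pullC0 D f) ζ

/-- A strictly positive function in `C₀(X)`. -/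
def posC0 (X : Type) [NormedAddCommGroup X] [ProperSpace X] : C₀(X, ℂ) where
  toFun x := (((1 + ‖x‖)⁻¹ : ℝ) : ℂ)
  continuous_toFun := by
    refine Complex.continuous_ofReal.comp (Continuous.inv₀ (by fun_prop) fun x => ?_)
    positivity
  zero_at_infty' := by
    have h : Filter.Tendsto (fun x : X => (1 + ‖x‖)⁻¹) (Filter.cocompact X) (𝓝 0) :=
      Filter.Tendsto.inv_tendsto_atTop
        (Filter.tendsto_atTop_add_const_left _ _ (tendsto_norm_cocompact_atTop (E := X)))
    have h2 := (Complex.continuous_ofReal.tendsto 0).comp h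
    rwa [Complex.ofReal_zero] at h2

theorem posC0_ne (x : X) : posC0 X x ≠ 0 := by
  change (((1 + ‖x‖)⁻¹ : ℝ) : ℂ) ≠ 0
  have : (0 : ℝ) < 1 + ‖x‖ := by positivity
  exact_mod_cast (inv_pos.2 this).ne'

theorem regPi_nondegenerate :
    Dense (Submodule.span ℂ {v : L2 (G × X) | ∃ f ξ, v = regPi D f ξ} : Set (L2 (G × X))) := by
  rw [Submodule.dense_iff_topologicalClosure_eq_top, Submodule.topologicalClosure_eq_top_iff,
    Submodule.eq_bot_iff]
  intro η hη
  have h1 : regPi D (posC0 X) η = 0 := by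
    refine ext_inner_left ℂ fun ξ => ?_
    rw [inner_zero_right, ← ContinuousLinearMap.adjoint_inner_left,
      ← ContinuousLinearMap.star_eq_adjoint, ← map_star]
    exact (Submodule.mem_orthogonal _ _).1 hη _ (Submodule.subset_span ⟨_, ξ, rfl⟩)
  refine Lp.eq_zero_iff_ae_eq_zero.2 ?_
  filter_upwards [regPi_coe D (posC0 X) η, Lp.eq_zero_iff_ae_eq_zero.1 h1] with p h2 h3
  rw [h2] at h3
  exact (mul_eq_zero.1 h3).resolve_left (posC0_ne _)

theorem regU_mul_regPi (t : G) (f : C₀(X, ℂ)) :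
    regU D t * regPi D f = regPi D (D.aut t f) * regU D t := by
  refine ContinuousLinearMap.ext fun ζ => Lp.ext ?_
  filter_upwards [regU_coe D t (regPi D f ζ),
    (mp_shift (X := X) t).quasiMeasurePreserving.ae_eq_comp (regPi_coe D f ζ),
    regPi_coe D (D.aut t f) (regU D t ζ), regU_coe D t ζ] with p h1 h2 h3 h4
  refine h1.trans (Eq.trans ?_ h3.symm)
  rw [h4]
  have h2' : (regPi D f ζ) (p.1 - t, p.2) = f (D.act (p.1 - t) p.2) * ζ (p.1 - t, p.2) := h2
  rw [h2', D.aut_apply, ← D.act_add, neg_add_eq_sub]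
  ring

/-- The regular representation of a twisted transformation group on `L²(G × X)`. -/
def regRep : CovariantRep D where
  H := L2 (G × X)
  π := regPi D
  nondegenerate := regPi_nondegenerate D
  U t := ⟨regU D t, regU_mem D t⟩
  continuous_U := continuous_regU D
  covariant t f := by
    change regU D t * regPi D f * star (regU D t) = _
    rw [regU_mul_regPi, mul_assoc, (Unitary.mem_iff.1 (regU_mem D t)).2, mul_one]
  twisted t r f := by
    change regPi D f * (regU D t * regU D r) = regPi D (D.cocycleMul t r f) * regU D (t + r)
    refine ContinuousLinearMap.ext fun ζ => Lp.ext ?_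
    filter_upwards [regPi_coe D f (regU D t (regU D r ζ)), regU_coe D t (regU D r ζ),
      (mp_shift (X := X) t).quasiMeasurePreserving.ae_eq_comp (regU_coe D r ζ),
      regPi_coe D (D.cocycleMul t r f) (regU D (t + r) ζ), regU_coe D (t + r) ζ]
      with p h1 h2 h3 h4 h5
    refine h1.trans (Eq.trans ?_ h4.symm)
    have h3' : (regU D r ζ) (p.1 - t, p.2) =
      (regPhase D r (p.1 - t, p.2) : ℂ) * ζ (p.1 - t - r, p.2) := h3
    rw [h2, h5, h3', D.cocycleMul_apply]
    have h6 := D.cocycle t r (p.1 - t - r) (D.act p.1 p.2)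
    have h7 : (D.σ t r (D.act p.1 p.2) : ℂ) * (regPhase D (t + r) p : ℂ) =
        (regPhase D t p : ℂ) * (regPhase D r (p.1 - t, p.2) : ℂ) := by
      rw [← Circle.coe_mul, ← Circle.coe_mul]
      congr 1
      unfold regPhase
      rw [sub_add_eq_sub_sub, h6, ← D.act_add, neg_add_eq_sub, add_sub_cancel, mul_comm]
    rw [sub_add_eq_sub_sub]
    linear_combination -(f (D.act p.1 p.2)) * ζ (p.1 - t - r, p.2) * h7

/-- The operator `(T_F ζ)(s, x) = ∫ F(t, s • x) σ(t, s - t)(s • x) ζ(s - t, x) dt`. -/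
def regOp (F : C_c(G × X, ℂ)) : B (G × X) := (regRep D).integrated (cc F)

theorem regOp_coe (F : C_c(G × X, ℂ)) (ζ : L2 (G × X)) :
    (regOp D F ζ : G × X → ℂ) =ᵐ[volume] fun p =>
      ∫ t, F (t, D.act p.1 p.2) * (regPhase D t p : ℂ) * ζ (p.1 - t, p.2) := by
  refine coeFn_integral (μ := (volume : Measure G)) (U := fun t => regPi D (cc F t) (regU D t ζ))
    (u := fun t p => F (t, D.act p.1 p.2) * (regPhase D t p : ℂ) * ζ (p.1 - t, p.2))
    ((regRep D).integrable_integrand (cc F) ζ) ?_ fun t => ?_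
  · refine Measurable.mul (Measurable.mul ?_ ?_) ?_
    · exact (F.continuous.comp (continuous_fst.prodMk
        (D.continuous_act.comp continuous_snd))).measurable
    · exact (continuous_subtype_val.comp (continuous_regPhase D)).measurable
    · exact (Lp.stronglyMeasurable ζ).measurable.comp
        (by fun_prop : Continuous fun q : G × G × X => (q.2.1 - q.1, q.2.2)).measurable
  · filter_upwards [regPi_coe D (cc F t) (regU D t ζ), regU_coe D t ζ] with p h1 h2
    rw [h1, h2, cc_apply, mul_assoc]

end Regular

end QG

end

noncomputable section

namespace QG

/-! ### Estimates for square integrals -/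

section Estimates

/-- The Cauchy–Schwarz inequality in the form of a bound for the square of an integral. -/
theorem sq_lintegral_le {T : Type*} [MeasurableSpace T] (μ : Measure T) {f : T → ℝ≥0∞}
    (hf : AEMeasurable f μ) (K : Set T) :
    (∫⁻ t in K, f t ∂μ) ^ 2 ≤ μ K * ∫⁻ t in K, f t ^ 2 ∂μ := by
  have h := ENNReal.lintegral_mul_le_Lp_mul_Lq (μ.restrict K) Real.HolderConjugate.two_two
    (f := fun _ => 1) (g := f) aemeasurable_const hf.restrict
  have h2 : ∫⁻ t in K, f t ∂μ ≤ (μ K) ^ (1 / 2 : ℝ) * (∫⁻ t in K, f t ^ 2 ∂μ) ^ (1 / 2 : ℝ) := by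
    simpa using h
  calc (∫⁻ t in K, f t ∂μ) ^ 2
      ≤ ((μ K) ^ (1 / 2 : ℝ) * (∫⁻ t in K, f t ^ 2 ∂μ) ^ (1 / 2 : ℝ)) ^ 2 := by gcongr
    _ = _ := by
      rw [mul_pow, ← ENNReal.rpow_natCast, ← ENNReal.rpow_mul, ← ENNReal.rpow_natCast,
        ← ENNReal.rpow_mul]
      norm_num

theorem lintegral_sq_lintegral_le {T Y : Type*} [MeasurableSpace T] [MeasurableSpace Y]
    (μ : Measure T) [SFinite μ] (ν : Measure Y) [SFinite ν] {f : T → Y → ℝ≥0∞}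
    (hf : Measurable (Function.uncurry f)) (K : Set T) {C : ℝ≥0∞}
    (hC : ∀ t ∈ K, ∫⁻ y, f t y ^ 2 ∂ν ≤ C) (hK : MeasurableSet K) :
    ∫⁻ y, (∫⁻ t in K, f t y ∂μ) ^ 2 ∂ν ≤ μ K * (μ K * C) := by
  calc ∫⁻ y, (∫⁻ t in K, f t y ∂μ) ^ 2 ∂ν
      ≤ ∫⁻ y, μ K * ∫⁻ t in K, f t y ^ 2 ∂μ ∂ν := by
        refine lintegral_mono fun y => sq_lintegral_le μ ?_ K
        exact (hf.comp measurable_prodMk_right).aemeasurable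
    _ = μ K * ∫⁻ y, ∫⁻ t in K, f t y ^ 2 ∂μ ∂ν := by
        refine lintegral_const_mul _ ?_
        exact Measurable.lintegral_prod_left' (f := fun p : T × Y => f p.1 p.2 ^ 2)
          (hf.pow_const 2)
    _ = μ K * ∫⁻ t in K, ∫⁻ y, f t y ^ 2 ∂ν ∂μ := by
        rw [lintegral_lintegral_swap]
        exact ((hf.comp measurable_swap).pow_const 2).aemeasurable
    _ ≤ μ K * ∫⁻ _ in K, C ∂μ := by
        gcongr 1
        exact setLIntegral_mono' hK hC
    _ = _ := by rw [setLIntegral_const, mul_comm C]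

end Estimates

/-! ### Almost invariant functions and partitions of unity -/

section Folner

variable {G : Type} [NormedAddCommGroup G] [NormedSpace ℝ G] [FiniteDimensional ℝ G]
  [MeasureSpace G] [BorelSpace G] [(volume : Measure G).IsAddHaarMeasure]

/-- Amenability of `G`: there are almost invariant compactly supported unit vectors in
`L²(G)`. -/
theorem exists_almost_invariant {K : Set G} (hK : IsCompact K) {δ : ℝ} (hδ : 0 < δ) :
    ∃ g : C_c(G, ℝ), ∫ s, g s ^ 2 = 1 ∧ ∀ t ∈ K, ∫ s, (g s - g (s - t)) ^ 2 ≤ δ := by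
  -- the function `g` is the tent `φ`, dilated by a large factor `R` and normalized
  let φ : G → ℝ := fun s => max (1 - ‖s‖) 0
  have hφ : Continuous φ := by fun_prop
  have hφ0 : ∀ s, 1 ≤ ‖s‖ → φ s = 0 := fun s hs => max_eq_right (by linarith)
  have hφl : ∀ s t, |φ s - φ t| ≤ ‖s - t‖ := fun s t =>
    (abs_max_sub_max_le_abs _ _ _).trans (by
      rw [sub_sub_sub_cancel_left, norm_sub_rev]
      exact abs_norm_sub_norm_le t s)
  have hφc : HasCompactSupport φ := HasCompactSupport.intro (isCompact_closedBall (0 : G) 1)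
    fun s hs => hφ0 s (by
      rw [mem_closedBall_zero_iff, not_le] at hs
      exact hs.le)
  obtain ⟨A, hA⟩ : ∃ A, A = ∫ s, φ s ^ 2 := ⟨_, rfl⟩
  have hA0 : 0 < A := by
    rw [hA]
    refine (hφ.pow 2).integral_pos_of_hasCompactSupport_nonneg_nonzero
      (hφc.comp_left (g := fun x : ℝ => x ^ 2) (by simp)) (fun s => sq_nonneg _) (x := 0) ?_
    simp [φ]
  obtain ⟨ρ, hρ0, hρ⟩ : ∃ ρ > 0, ∀ t ∈ K, ‖t‖ ≤ ρ := by
    obtain ⟨ρ, hρ⟩ := hK.isBounded.exists_norm_le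
    exact ⟨max ρ 1, by positivity, fun t ht => (hρ t ht).trans (le_max_left _ _)⟩
  obtain ⟨b, hb⟩ : ∃ b, b = volume.real (Metric.closedBall (0 : G) 2) := ⟨_, rfl⟩
  have hb0 : 0 ≤ b := by rw [hb]; exact measureReal_nonneg
  have hdiff : ∀ τ : G, ‖τ‖ ≤ 1 → ∫ s, (φ s - φ (s - τ)) ^ 2 ≤ ‖τ‖ ^ 2 * b := by
    intro τ hτ
    have h1 : ∫ s, (φ s - φ (s - τ)) ^ 2 =
        ∫ s in Metric.closedBall (0 : G) 2, (φ s - φ (s - τ)) ^ 2 := by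
      refine (setIntegral_eq_integral_of_forall_compl_eq_zero fun s hs => ?_).symm
      rw [mem_closedBall_zero_iff, not_le] at hs
      have h3 : ‖s‖ - ‖τ‖ ≤ ‖s - τ‖ := norm_sub_norm_le _ _
      rw [hφ0 s (by linarith), hφ0 (s - τ) (by linarith)]
      simp
    rw [h1, hb]
    refine (Real.le_norm_self _).trans (norm_setIntegral_le_of_norm_le_const
      (f := fun s => (φ s - φ (s - τ)) ^ 2) (isCompact_closedBall (0 : G) 2).measure_lt_top
      fun s _ => ?_)
    rw [norm_pow, Real.norm_eq_abs]
    have := hφl s (s - τ)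
    rw [sub_sub_cancel] at this
    exact pow_le_pow_left₀ (abs_nonneg _) this 2
  obtain ⟨R, hR1, hR2⟩ : ∃ R : ℝ, ρ ≤ R ∧ A⁻¹ * ((ρ / R) ^ 2 * b) ≤ δ := by
    have h1 : Filter.Tendsto (fun R : ℝ => A⁻¹ * ((ρ / R) ^ 2 * b)) Filter.atTop (𝓝 0) := by
      have h2 : Filter.Tendsto (fun R : ℝ => ρ / R) Filter.atTop (𝓝 0) :=
        tendsto_const_nhds.div_atTop Filter.tendsto_id
      simpa using ((h2.pow 2).mul_const b).const_mul A⁻¹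
    obtain ⟨R, h2, h3⟩ := ((h1.eventually (ge_mem_nhds hδ)).and
      (Filter.eventually_ge_atTop ρ)).exists
    exact ⟨R, h3, h2⟩
  have hR0 : 0 < R := hρ0.trans_le hR1
  let d := Module.finrank ℝ G
  have hscale : ∀ f : G → ℝ, ∫ s, f (R⁻¹ • s) = R ^ d * ∫ s, f s := by
    intro f
    rw [Measure.integral_comp_inv_smul, abs_of_pos (pow_pos hR0 _), smul_eq_mul]
  let c := √(A⁻¹ * (R ^ d)⁻¹)
  have hc : c ^ 2 = A⁻¹ * (R ^ d)⁻¹ := Real.sq_sqrt (by positivity)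
  have hR' : R⁻¹ ≠ 0 := inv_ne_zero hR0.ne'
  refine ⟨⟨⟨fun s => c * φ (R⁻¹ • s), by fun_prop⟩, ?_⟩, ?_, fun t ht => ?_⟩
  · exact (hφc.comp_smul hR').mul_left
  · change ∫ s, (c * φ (R⁻¹ • s)) ^ 2 = 1
    simp only [mul_pow]
    rw [integral_const_mul, hscale (fun s => φ s ^ 2), ← hA, hc]
    have : R ^ d ≠ 0 := (pow_pos hR0 _).ne'
    field_simp
  · change ∫ s, (c * φ (R⁻¹ • s) - c * φ (R⁻¹ • (s - t))) ^ 2 ≤ δ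
    simp only [← mul_sub, mul_pow, smul_sub]
    rw [integral_const_mul, hscale (fun s => (φ s - φ (s - R⁻¹ • t)) ^ 2), hc]
    have h1 : ‖R⁻¹ • t‖ ≤ ρ / R := by
      rw [norm_smul, norm_inv, Real.norm_of_nonneg hR0.le, inv_mul_eq_div]
      gcongr
      exact hρ t ht
    have h2 := hdiff (R⁻¹ • t) (h1.trans ((div_le_one hR0).2 hR1))
    have h3 : R ^ d ≠ 0 := (pow_pos hR0 _).ne'
    calc A⁻¹ * (R ^ d)⁻¹ * (R ^ d * ∫ s, (φ s - φ (s - R⁻¹ • t)) ^ 2)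
        = A⁻¹ * ∫ s, (φ s - φ (s - R⁻¹ • t)) ^ 2 := by field_simp
      _ ≤ A⁻¹ * ((ρ / R) ^ 2 * b) := by
        gcongr
        exact h2.trans (by gcongr)
      _ ≤ δ := hR2

/-- A compactly supported kernel on `G × G`, concentrated near the diagonal, with
`∫ k(x, y)² dx ≤ 1`, and with equality for `y` in a given compact set. -/
theorem exists_diagonal_kernel {L : Set G} (hL : IsCompact L) {r : ℝ} (hr : 0 < r) :
    ∃ k : C_c(G × G, ℂ), (∀ x y, k (x, y) ≠ 0 → ‖y - x‖ < r) ∧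
      (∀ y, (∫ x, starRingEnd ℂ (k (x, y)) * k (x, y)).im = 0 ∧
        ‖∫ x, starRingEnd ℂ (k (x, y)) * k (x, y)‖ ≤ 1) ∧
      ∀ y ∈ L, ∫ x, starRingEnd ℂ (k (x, y)) * k (x, y) = 1 := by
  let b : ContDiffBump (0 : G) := ⟨r / 2, r, by positivity, by linarith⟩
  -- the kernel is `k(x, y) = χ(x) κ(x - y)`, where `κ²` is a bump of integral one
  let κ : G → ℝ := fun z => √(b.normed volume z)
  have hκ : Continuous κ := (b.continuous_normed).sqrt
  have hκ2 : ∀ z, κ z * κ z = b.normed volume z := fun z =>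
    Real.mul_self_sqrt (b.nonneg_normed z)
  have hκs : ∀ z, κ z ≠ 0 → ‖z‖ < r := by
    intro z hz
    have h1 : z ∈ Function.support (b.normed volume) := by
      intro h0
      exact hz (by simp only [κ, h0, Real.sqrt_zero])
    rwa [b.support_normed_eq, mem_ball_zero_iff] at h1
  obtain ⟨χ, hχ1, hχc, hχ⟩ := exists_cutoff (hL.add (isCompact_closedBall (0 : G) r))
  have hχc' : IsCompact (tsupport χ) := hχc
  let k : C_c(G × G, ℂ) := mkCc (fun p => ((χ p.1 * κ (p.1 - p.2) : ℝ) : ℂ))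
    (by
      have := χ.continuous
      exact Complex.continuous_ofReal.comp (by fun_prop))
    (by
      refine HasCompactSupport.intro (hχc'.prod (hχc'.add (isCompact_closedBall (0 : G) r)))
        fun p hp => ?_
      by_contra h
      have h1 : χ p.1 ≠ 0 := fun h1 => h (by rw [h1]; simp)
      have h2 : κ (p.1 - p.2) ≠ 0 := fun h1 => h (by rw [h1]; simp)
      refine hp ⟨subset_tsupport _ h1, p.1, subset_tsupport _ h1, p.2 - p.1, ?_, by simp⟩
      rw [mem_closedBall_zero_iff, norm_sub_rev]
      exact (hκs _ h2).le)
  have hval : ∀ x y, starRingEnd ℂ (k (x, y)) * k (x, y) =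
      ((χ x ^ 2 * b.normed volume (x - y) : ℝ) : ℂ) := by
    intro x y
    change starRingEnd ℂ ((χ x * κ (x - y) : ℝ) : ℂ) * ((χ x * κ (x - y) : ℝ) : ℂ) = _
    rw [Complex.conj_ofReal, ← hκ2, ← Complex.ofReal_mul]
    congr 1
    ring
  have hone : ∀ y, ∫ x, b.normed volume (x - y) = 1 := fun y => by
    rw [integral_sub_right_eq_self (b.normed volume) y]
    exact b.integral_normed
  have hint : ∀ y, Integrable fun x => b.normed volume (x - y) := fun y =>
    (b.integrable_normed (μ := volume)).comp_sub_right y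
  refine ⟨k, fun x y h => ?_, fun y => ?_, fun y hy => ?_⟩
  · rw [norm_sub_rev]
    refine hκs _ fun h1 => h ?_
    change ((χ x * κ (x - y) : ℝ) : ℂ) = 0
    rw [h1]
    simp
  · simp only [hval]
    rw [integral_complex_ofReal]
    refine ⟨Complex.ofReal_im _, ?_⟩
    have h0 : 0 ≤ ∫ x, χ x ^ 2 * b.normed volume (x - y) :=
      integral_nonneg fun x => mul_nonneg (sq_nonneg _) (b.nonneg_normed _)
    rw [Complex.norm_real, Real.norm_of_nonneg h0, ← hone y]
    refine integral_mono_of_nonneg (Filter.Eventually.of_forall fun x =>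
      mul_nonneg (sq_nonneg _) (b.nonneg_normed _)) (hint y)
      (Filter.Eventually.of_forall fun x => ?_)
    exact mul_le_of_le_one_left (b.nonneg_normed _) (pow_le_one₀ (hχ x).1 (hχ x).2)
  · simp only [hval]
    rw [integral_complex_ofReal, ← Complex.ofReal_one, ← hone y]
    congr 1
    refine integral_congr_ae (Filter.Eventually.of_forall fun x => ?_)
    beta_reduce
    by_cases h : b.normed volume (x - y) = 0
    · rw [h, mul_zero]
    · have h1 : x - y ∈ Function.support (b.normed volume) := h
      rw [b.support_normed_eq, mem_ball_zero_iff] at h1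
      have h2 : x - y ∈ Metric.closedBall (0 : G) r := by
        rw [mem_closedBall_zero_iff]; exact h1.le
      rw [hχ1 x ⟨y, hy, x - y, h2, by simp⟩]
      simp

end Folner

end QG

end

noncomputable section

namespace QG

/-! ### Estimates in covariant representations -/

section RepEstimates

set_option linter.unusedSectionVars false

variable {G X : Type} [NormedAddCommGroup G] [NormedSpace ℝ G] [FiniteDimensional ℝ G]
  [MeasureSpace G] [BorelSpace G] [(volume : Measure G).IsAddHaarMeasure]
  [NormedAddCommGroup X] [NormedSpace ℝ X] [FiniteDimensional ℝ X]
  [MeasureSpace X] [BorelSpace X] [(volume : Measure X).IsAddHaarMeasure]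
  {D : TwistedSystem G X}

theorem CovariantRep.norm_π_sq (ρ : CovariantRep D) (a : C₀(X, ℂ)) (u : ρ.H) :
    ‖ρ.π a u‖ ^ 2 = (⟪u, ρ.π (star a * a) u⟫_ℂ).re := by
  rw [map_mul, map_star, ContinuousLinearMap.star_eq_adjoint]
  change _ = (⟪u, ContinuousLinearMap.adjoint (ρ.π a) (ρ.π a u)⟫_ℂ).re
  rw [ContinuousLinearMap.adjoint_inner_right]
  exact (inner_self_eq_norm_sq (𝕜 := ℂ) _).symm

/-- A pointwise bound `|a| ≤ M |b|` gives `π(a)* π(a) ≤ M² π(b)* π(b)`, because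
`M² |b|² - |a|²` is a square. -/
theorem CovariantRep.norm_π_le_of_norm_le (ρ : CovariantRep D) {a b : C₀(X, ℂ)} {M : ℝ}
    (hM : 0 ≤ M) (h : ∀ y, ‖a y‖ ≤ M * ‖b y‖) (u : ρ.H) : ‖ρ.π a u‖ ≤ M * ‖ρ.π b u‖ := by
  have hle : ∀ y, ‖a y‖ ^ 2 ≤ (M * ‖b y‖) ^ 2 := fun y =>
    pow_le_pow_left₀ (norm_nonneg _) (h y) 2
  let c : C₀(X, ℂ) :=
    { toFun := fun y => ((√((M * ‖b y‖) ^ 2 - ‖a y‖ ^ 2) : ℝ) : ℂ)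
      continuous_toFun := by
        have h1 : Continuous fun y => a y := a.continuous
        have h2 : Continuous fun y => b y := b.continuous
        exact Complex.continuous_ofReal.comp (by fun_prop)
      zero_at_infty' := by
        have h1 := (tendsto_zero_iff_norm_tendsto_zero.1 b.zero_at_infty').const_mul M
        rw [mul_zero] at h1
        refine squeeze_zero_norm (fun y => ?_) h1
        rw [Complex.norm_real, Real.norm_of_nonneg (Real.sqrt_nonneg _)]
        refine Real.sqrt_le_iff.2 ⟨mul_nonneg hM (norm_nonneg _), ?_⟩
        have := sq_nonneg ‖a y‖
        change (M * ‖b y‖) ^ 2 - ‖a y‖ ^ 2 ≤ (M * ‖b y‖) ^ 2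
        linarith }
  have hc : star c * c = (M ^ 2 : ℂ) • (star b * b) - star a * a := by
    ext y
    change starRingEnd ℂ ((√((M * ‖b y‖) ^ 2 - ‖a y‖ ^ 2) : ℝ) : ℂ) *
      ((√((M * ‖b y‖) ^ 2 - ‖a y‖ ^ 2) : ℝ) : ℂ) =
      (M ^ 2 : ℂ) * (starRingEnd ℂ (b y) * b y) - starRingEnd ℂ (a y) * a y
    rw [Complex.conj_ofReal, ← Complex.ofReal_mul, Real.mul_self_sqrt (by linarith [hle y]),
      Complex.conj_mul', Complex.conj_mul']
    push_cast
    ring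
  have h1 := ρ.norm_π_sq c u
  rw [hc, map_sub, map_smul, sub_apply, smul_apply, inner_sub_right, inner_smul_right,
    Complex.sub_re] at h1
  have h2 : ((M ^ 2 : ℂ) * ⟪u, ρ.π (star b * b) u⟫_ℂ).re = M ^ 2 * ‖ρ.π b u‖ ^ 2 := by
    rw [ρ.norm_π_sq b, ← Complex.ofReal_pow, Complex.re_ofReal_mul]
  rw [h2, ← ρ.norm_π_sq a] at h1
  refine abs_le_of_sq_le_sq' ?_ (mul_nonneg hM (norm_nonneg _)) |>.2
  rw [mul_pow]
  have := sq_nonneg ‖ρ.π c u‖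
  linarith

/-- The adjoint of `U_s`. -/
def CovariantRep.UStar (ρ : CovariantRep D) (s : G) : ρ.H →L[ℂ] ρ.H :=
  star (ρ.U s : ρ.H →L[ℂ] ρ.H)

theorem CovariantRep.norm_UStar (ρ : CovariantRep D) (s : G) (v : ρ.H) :
    ‖ρ.UStar s v‖ = ‖v‖ :=
  Unitary.norm_map (star (ρ.U s)) v

theorem CovariantRep.continuous_UStar (ρ : CovariantRep D) (v : ρ.H) :
    Continuous fun s => ρ.UStar s v := by
  refine continuous_of_weak ρ.norm_UStar v fun w => ?_
  have : ∀ s, ⟪w, ρ.UStar s v⟫_ℂ = ⟪(ρ.U s : ρ.H →L[ℂ] ρ.H) w, v⟫_ℂ := fun s => by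
    rw [CovariantRep.UStar, ContinuousLinearMap.star_eq_adjoint,
      ContinuousLinearMap.adjoint_inner_right]
  simp only [this]
  exact (ρ.continuous_U w).inner continuous_const

theorem CovariantRep.π_mul_UStar (ρ : CovariantRep D) (s : G) (f : C₀(X, ℂ)) :
    ρ.π f * ρ.UStar s = ρ.UStar s * ρ.π (D.aut s f) := by
  rw [← ρ.covariant, CovariantRep.UStar, ← mul_assoc, ← mul_assoc, ρ.star_U_mul, one_mul]

theorem CovariantRep.UStar_mul_π (ρ : CovariantRep D) (s : G) (f : C₀(X, ℂ)) :
    ρ.UStar s * ρ.π f = ρ.π (D.aut (-s) f) * ρ.UStar s := by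
  rw [ρ.π_mul_UStar]
  congr 2
  ext x
  rw [D.aut_apply, D.aut_apply, ← D.act_add, neg_neg, add_neg_cancel, D.act_zero]

theorem CovariantRep.UStar_mul_π_mul_U (ρ : CovariantRep D) (s t : G) (f : C₀(X, ℂ)) :
    ρ.UStar s * (ρ.π f * (ρ.U t : ρ.H →L[ℂ] ρ.H)) =
      ρ.π (D.aut (-s) (D.cocycleMul t (s - t) f)) * ρ.UStar (s - t) := by
  have h := ρ.twisted t (s - t) f
  rw [add_sub_cancel] at h
  have h2 : ρ.π f * (ρ.U t : ρ.H →L[ℂ] ρ.H) =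
      ρ.π (D.cocycleMul t (s - t) f) * ρ.U s * ρ.UStar (s - t) := by
    rw [← h, CovariantRep.UStar, mul_assoc, mul_assoc, ρ.U_mul_star, mul_one]
  rw [h2, ← mul_assoc, ← mul_assoc, ρ.UStar_mul_π, mul_assoc (ρ.π _)]
  rw [CovariantRep.UStar, ρ.star_U_mul, mul_one]

/-- The function `∫ |k(x, ·)|² dx` in `C₀(X)`. -/
def sqInt (k : C_c(X × X, ℂ)) : C₀(X, ℂ) := ∫ x, star (cc k x) * cc k x

theorem integrable_sqInt (k : C_c(X × X, ℂ)) : Integrable fun x => star (cc k x) * cc k x := by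
  have h := (cc k).continuous
  refine Continuous.integrable_of_hasCompactSupport (h.star.mul h) ?_
  exact HasCompactSupport.mul_left (cc k).hasCompactSupport

theorem sqInt_apply (k : C_c(X × X, ℂ)) (y : X) :
    sqInt k y = ∫ x, starRingEnd ℂ (k (x, y)) * k (x, y) :=
  integral_C0_apply (integrable_sqInt k) y

theorem CovariantRep.lintegral_π_sq (ρ : CovariantRep D) (k : C_c(X × X, ℂ)) (u : ρ.H) :
    ∫⁻ x, ‖ρ.π (cc k x) u‖ₑ ^ 2 = ENNReal.ofReal (⟪u, ρ.π (sqInt k) u⟫_ℂ).re := by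
  have h1 : ∀ x, ‖ρ.π (cc k x) u‖ₑ ^ 2 =
      ENNReal.ofReal (⟪u, ρ.πL (star (cc k x) * cc k x) u⟫_ℂ).re := by
    intro x
    rw [ρ.πL_apply, ← ρ.norm_π_sq, ENNReal.ofReal_pow (norm_nonneg _), ofReal_norm]
  let Ψ : C₀(X, ℂ) →L[ℂ] ℂ := innerSL ℂ u ∘L (ContinuousLinearMap.apply ℂ ρ.H u) ∘L ρ.πL
  have h2 : Integrable fun x => (Ψ (star (cc k x) * cc k x)).re :=
    (Ψ.integrable_comp (integrable_sqInt k)).re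
  simp only [h1]
  refine (ofReal_integral_eq_lintegral_ofReal h2
    (Filter.Eventually.of_forall fun x => ?_)).symm.trans
    ?_
  · change 0 ≤ (⟪u, ρ.π (star (cc k x) * cc k x) u⟫_ℂ).re
    rw [← ρ.norm_π_sq]
    positivity
  · congr 1
    have h3 := integral_re (Ψ.integrable_comp (integrable_sqInt k))
    refine h3.trans ?_
    rw [Ψ.integral_comp_comm (integrable_sqInt k)]
    rfl

/-- The vector field `(s, x) ↦ g(s) π(k(x, ·)) U_s* v`. -/
def CovariantRep.field (ρ : CovariantRep D) (g : C_c(G, ℝ)) (k : C_c(X × X, ℂ)) (v : ρ.H)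
    (p : G × X) : ρ.H := (g p.1 : ℂ) • ρ.π (cc k p.2) (ρ.UStar p.1 v)

theorem CovariantRep.continuous_π_UStar (ρ : CovariantRep D) (k : C_c(X × X, ℂ)) (v : ρ.H) :
    Continuous fun p : G × X => ρ.π (cc k p.2) (ρ.UStar p.1 v) :=
  (ρ.πL.continuous.comp ((cc k).continuous.comp continuous_snd)).clm_apply
    ((ρ.continuous_UStar v).comp continuous_fst)

theorem CovariantRep.continuous_field (ρ : CovariantRep D) (g : C_c(G, ℝ)) (k : C_c(X × X, ℂ))
    (v : ρ.H) : Continuous (ρ.field g k v) :=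
  (Complex.continuous_ofReal.comp (g.continuous.comp continuous_fst)).smul
    (ρ.continuous_π_UStar k v)

theorem CovariantRep.hasCompactSupport_field (ρ : CovariantRep D) (g : C_c(G, ℝ))
    (k : C_c(X × X, ℂ)) (v : ρ.H) : HasCompactSupport (ρ.field g k v) := by
  have h1 : IsCompact (tsupport g) := g.hasCompactSupport
  have h2 : IsCompact (tsupport (cc k)) := (cc k).hasCompactSupport
  refine HasCompactSupport.intro (h1.prod h2) fun p hp => ?_
  by_contra h
  refine hp ⟨?_, ?_⟩
  · by_contra h'
    exact h (by rw [CovariantRep.field, image_eq_zero_of_notMem_tsupport h']; simp)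
  · by_contra h'
    exact h (by rw [CovariantRep.field, image_eq_zero_of_notMem_tsupport h']; simp)

theorem CovariantRep.lintegral_field_sq (ρ : CovariantRep D) (g : C_c(G, ℝ)) (k : C_c(X × X, ℂ))
    (v : ρ.H) : ∫⁻ p, ‖ρ.field g k v p‖ₑ ^ 2 =
      ∫⁻ s, ‖g s‖ₑ ^ 2 * ENNReal.ofReal (⟪ρ.UStar s v, ρ.π (sqInt k) (ρ.UStar s v)⟫_ℂ).re := by
  rw [Measure.volume_eq_prod, lintegral_prod _
    ((ρ.continuous_field g k v).enorm.measurable.pow_const 2).aemeasurable]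
  refine lintegral_congr fun s => ?_
  have hm : Measurable fun x => ‖ρ.π (cc k x) (ρ.UStar s v)‖ₑ ^ 2 :=
    (((ρ.continuous_π_UStar k v).comp
      (by fun_prop : Continuous fun x : X => (s, x))).enorm.measurable).pow_const 2
  rw [← ρ.lintegral_π_sq, ← lintegral_const_mul _ hm]
  refine lintegral_congr fun x => ?_
  rw [CovariantRep.field, enorm_smul, mul_pow]
  congr 2
  rw [← ofReal_norm, ← ofReal_norm, Complex.norm_real]

theorem measurable_enorm_sq_Cc (g : C_c(G, ℝ)) : Measurable fun s => ‖g s‖ₑ ^ 2 :=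
  g.continuous.enorm.measurable.pow_const 2

theorem lintegral_enorm_sq_Cc (g : C_c(G, ℝ)) :
    ∫⁻ s, ‖g s‖ₑ ^ 2 = ENNReal.ofReal (∫ s, g s ^ 2) := by
  rw [ofReal_integral_eq_lintegral_ofReal]
  · refine lintegral_congr fun s => ?_
    rw [← sq_abs, ENNReal.ofReal_pow (abs_nonneg _), ← Real.norm_eq_abs, ofReal_norm]
  · exact (g.continuous.pow 2).integrable_of_hasCompactSupport
      (HasCompactSupport.intro g.hasCompactSupport fun s hs => by
        change g s ^ 2 = 0
        rw [image_eq_zero_of_notMem_tsupport hs]; norm_num)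
  · exact Filter.Eventually.of_forall fun s => sq_nonneg _

theorem CovariantRep.lintegral_π_sq_le (ρ : CovariantRep D) {k : C_c(X × X, ℂ)}
    (hk : ‖sqInt k‖ ≤ 1) (u : ρ.H) : ∫⁻ x, ‖ρ.π (cc k x) u‖ₑ ^ 2 ≤ ‖u‖ₑ ^ 2 := by
  rw [ρ.lintegral_π_sq, ← ofReal_norm, ← ENNReal.ofReal_pow (norm_nonneg _)]
  refine ENNReal.ofReal_le_ofReal ?_
  calc _ ≤ ‖⟪u, ρ.π (sqInt k) u⟫_ℂ‖ := Complex.re_le_norm _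
    _ ≤ ‖u‖ * (‖ρ.π (sqInt k)‖ * ‖u‖) := (norm_inner_le_norm _ _).trans
        (mul_le_mul_of_nonneg_left ((ρ.π (sqInt k)).le_opNorm u) (norm_nonneg _))
    _ ≤ ‖u‖ * (1 * ‖u‖) := by
        gcongr
        exact (NonUnitalStarAlgHom.norm_apply_le ρ.π _).trans hk
    _ = ‖u‖ ^ 2 := by ring

theorem CovariantRep.lintegral_field_sq_le (ρ : CovariantRep D) {g : C_c(G, ℝ)}
    {k : C_c(X × X, ℂ)} (hg : ∫ s, g s ^ 2 = 1) (hk : ‖sqInt k‖ ≤ 1) (v : ρ.H) :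
    ∫⁻ p, ‖ρ.field g k v p‖ₑ ^ 2 ≤ ‖v‖ₑ ^ 2 := by
  rw [ρ.lintegral_field_sq]
  calc _ ≤ ∫⁻ s, ‖g s‖ₑ ^ 2 * ‖v‖ₑ ^ 2 := by
        refine lintegral_mono fun s => ?_
        beta_reduce
        gcongr
        rw [← ρ.lintegral_π_sq]
        refine (ρ.lintegral_π_sq_le hk _).trans (le_of_eq ?_)
        rw [← ofReal_norm, ρ.norm_UStar, ofReal_norm]
    _ = _ := by
        rw [lintegral_mul_const _ (measurable_enorm_sq_Cc g),
          lintegral_enorm_sq_Cc, hg, ENNReal.ofReal_one, one_mul]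

/-- The field of `v` has the norm of `v` if `∫ |k(x, ·)|² dx` acts trivially on `U_s* v`. -/
theorem CovariantRep.lintegral_field_sq_eq (ρ : CovariantRep D) {g : C_c(G, ℝ)}
    {k : C_c(X × X, ℂ)} (hg : ∫ s, g s ^ 2 = 1) (v : ρ.H)
    (h : ∀ s, g s ≠ 0 → ρ.π (sqInt k) (ρ.UStar s v) = ρ.UStar s v) :
    ∫⁻ p, ‖ρ.field g k v p‖ₑ ^ 2 = ‖v‖ₑ ^ 2 := by
  rw [ρ.lintegral_field_sq]
  calc _ = ∫⁻ s, ‖g s‖ₑ ^ 2 * ‖v‖ₑ ^ 2 := by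
        refine lintegral_congr fun s => ?_
        by_cases hs : g s = 0
        · rw [hs]; simp
        · rw [h s hs]
          congr 1
          have h1 : (⟪ρ.UStar s v, ρ.UStar s v⟫_ℂ).re = ‖ρ.UStar s v‖ ^ 2 :=
            inner_self_eq_norm_sq (𝕜 := ℂ) _
          rw [h1, ρ.norm_UStar, ENNReal.ofReal_pow (norm_nonneg _), ofReal_norm]
    _ = _ := by
        rw [lintegral_mul_const _ (measurable_enorm_sq_Cc g),
          lintegral_enorm_sq_Cc, hg, ENNReal.ofReal_one, one_mul]

theorem CovariantRep.π_mul_integrated (ρ : CovariantRep D) (F : C_c(G × X, ℂ)) (q : C₀(X, ℂ))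
    (h : ∀ t x, F (t, x) ≠ 0 → q x = 1) (v : ρ.H) :
    ρ.π q (ρ.integrated (cc F) v) = ρ.integrated (cc F) v := by
  rw [ρ.integrated_apply]
  rw [← ContinuousLinearMap.integral_comp_comm _ (ρ.integrable_integrand (cc F) v)]
  refine integral_congr_ae (Filter.Eventually.of_forall fun t => ?_)
  change (ρ.π q * ρ.π (cc F t)) _ = _
  rw [← map_mul]
  congr 2
  ext x
  change q x * F (t, x) = F (t, x)
  by_cases hx : F (t, x) = 0
  · rw [hx, mul_zero]
  · rw [h t x hx, one_mul]

end RepEstimates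

/-! ### Amplification of bounds to vector valued functions -/

section Amplification

set_option linter.unusedSectionVars false

variable {Y H : Type} [NormedAddCommGroup H] [InnerProductSpace ℂ H] [TopologicalSpace Y]
  [R1Space Y] [MeasureSpace Y] [BorelSpace Y] [IsFiniteMeasureOnCompacts (volume : Measure Y)]

theorem memLp_of_hasCompactSupport {ψ : Y → ℂ} (h : Continuous ψ) (h' : HasCompactSupport ψ) :
    MemLp ψ 2 (volume : Measure Y) := h.memLp_of_hasCompactSupport h'

theorem integrable_norm_sq {Ψ : Y → H} (h : Continuous Ψ) (h' : HasCompactSupport Ψ) :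
    Integrable fun y => ‖Ψ y‖ ^ 2 :=
  (h.norm.pow 2).integrable_of_hasCompactSupport
    (HasCompactSupport.intro h' fun y hy => by
      change ‖Ψ y‖ ^ 2 = 0
      rw [image_eq_zero_of_notMem_tsupport hy]; norm_num)

theorem norm_toLp_sq {ψ : Y → ℂ} (hm : MemLp ψ 2 (volume : Measure Y)) :
    ‖hm.toLp ψ‖ ^ 2 = ∫ y, ‖ψ y‖ ^ 2 := by
  have h := inner_self_eq_norm_sq (𝕜 := ℂ) (hm.toLp ψ)
  rw [← h, L2.inner_def]
  have h2 : ∫ y, ⟪hm.toLp ψ y, hm.toLp ψ y⟫_ℂ = ((∫ y, ‖ψ y‖ ^ 2 : ℝ) : ℂ) := by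
    rw [← integral_complex_ofReal]
    refine integral_congr_ae ?_
    filter_upwards [hm.coeFn_toLp] with y hy
    rw [hy, inner_self_eq_norm_sq_to_K]
    norm_cast
  rw [h2]
  exact Complex.ofReal_re _

/-- If `R` is the image of the vector valued function `Ψ` under `T ⊗ 1`, tested on vectors of
`H`, then `‖R‖ ≤ ‖T‖ ‖Ψ‖`.  The compact image of `R` is almost contained in a
finite-dimensional subspace. -/
theorem integral_norm_sq_le_of_weak {T : B Y} {Ψ R : Y → H} (hΨ : Continuous Ψ)
    (hΨ' : HasCompactSupport Ψ) (hR : Continuous R) (hR' : HasCompactSupport R)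
    (h : ∀ (e : H) (hm : MemLp (fun y => ⟪e, Ψ y⟫_ℂ) 2 (volume : Measure Y)),
      T (hm.toLp _) =ᵐ[volume] fun y => ⟪e, R y⟫_ℂ) :
    ∫ y, ‖R y‖ ^ 2 ≤ ‖T‖ ^ 2 * ∫ y, ‖Ψ y‖ ^ 2 := by
  have hc : ∀ {Ω : Y → H}, Continuous Ω → HasCompactSupport Ω → ∀ e : H,
      Continuous (fun y => ⟪e, Ω y⟫_ℂ) ∧ HasCompactSupport (fun y => ⟪e, Ω y⟫_ℂ) :=
    fun hΩ hΩ' e => ⟨continuous_const.inner hΩ,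
      HasCompactSupport.intro hΩ' fun y hy => by
        rw [image_eq_zero_of_notMem_tsupport hy, inner_zero_right]⟩
  have hone : ∀ e : H, ∫ y, ‖⟪e, R y⟫_ℂ‖ ^ 2 ≤ ‖T‖ ^ 2 * ∫ y, ‖⟪e, Ψ y⟫_ℂ‖ ^ 2 := by
    intro e
    have hm := memLp_of_hasCompactSupport (hc hΨ hΨ' e).1 (hc hΨ hΨ' e).2
    have hm' := memLp_of_hasCompactSupport (hc hR hR' e).1 (hc hR hR' e).2
    have h1 : T (hm.toLp _) = hm'.toLp _ := Lp.ext ((h e hm).trans hm'.coeFn_toLp.symm)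
    rw [← norm_toLp_sq hm, ← norm_toLp_sq hm', ← h1, ← mul_pow]
    exact pow_le_pow_left₀ (norm_nonneg _) (T.le_opNorm _) 2
  have hK : IsCompact (tsupport R) := hR'
  have key : ∀ ε > 0, ∫ y, ‖R y‖ ^ 2 ≤
      ‖T‖ ^ 2 * (∫ y, ‖Ψ y‖ ^ 2) + ε ^ 2 * volume.real (tsupport R) := by
    intro ε hε
    -- `V` approximates the compact image of `R` up to `ε`; in an orthonormal basis of `V` the
    -- bound holds for each coefficient, with Bessel's inequality for `Ψ`
    obtain ⟨N, -, hNf, hN⟩ := (hR'.isCompact_range hR).finite_cover_balls hε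
    let V : Submodule ℂ H := Submodule.span ℂ N
    have : FiniteDimensional ℂ V := FiniteDimensional.span_of_finite ℂ hNf
    let b := stdOrthonormalBasis ℂ V
    have hbo : Orthonormal ℂ fun i => (b i : H) :=
      b.orthonormal.comp_linearIsometry V.subtypeₗᵢ
    have hdist : ∀ y, ‖R y‖ ^ 2 ≤ (∑ i, ‖⟪(b i : H), R y⟫_ℂ‖ ^ 2) +
        (tsupport R).indicator (fun _ => ε ^ 2) y := by
      intro y
      by_cases hy : y ∈ tsupport R
      · rw [Set.indicator_of_mem hy]
        have h1 := V.norm_sq_eq_add_norm_sq_projection (R y)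
        have h2 := b.sum_sq_norm_inner_right (V.orthogonalProjectionOnto (R y))
        simp only [V.inner_orthogonalProjectionOnto_eq_of_mem_left] at h2
        obtain ⟨x, hx, hxy⟩ := Set.mem_iUnion₂.1 (hN ⟨y, rfl⟩)
        rw [Metric.mem_ball, dist_eq_norm] at hxy
        have h3 : Vᗮ.orthogonalProjectionOnto x = 0 :=
          V.orthogonalProjectionOnto_orthogonal_apply_eq_zero (Submodule.subset_span hx)
        have h4 : ‖Vᗮ.orthogonalProjectionOnto (R y)‖ ≤ ε := by
          calc _ = ‖Vᗮ.orthogonalProjectionOnto (R y - x)‖ := by rw [map_sub, h3, sub_zero]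
            _ ≤ ‖R y - x‖ := Vᗮ.norm_orthogonalProjectionOnto_apply_le _
            _ ≤ ε := hxy.le
        rw [h1, ← h2]
        gcongr
      · rw [image_eq_zero_of_notMem_tsupport hy, Set.indicator_of_notMem hy]
        simp
    have hi : ∀ {Ω : Y → H}, Continuous Ω → HasCompactSupport Ω → ∀ e : H,
        Integrable fun y => ‖⟪e, Ω y⟫_ℂ‖ ^ 2 := fun hΩ hΩ' e =>
      integrable_norm_sq (hc hΩ hΩ' e).1 (hc hΩ hΩ' e).2
    have hind : Integrable ((tsupport R).indicator fun _ => ε ^ 2) :=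
      (integrable_indicator_iff (isClosed_tsupport R).measurableSet).2
        (integrableOn_const hK.measure_lt_top.ne)
    calc ∫ y, ‖R y‖ ^ 2
        ≤ ∫ y, ((∑ i, ‖⟪(b i : H), R y⟫_ℂ‖ ^ 2) + (tsupport R).indicator (fun _ => ε ^ 2) y) :=
          integral_mono (integrable_norm_sq hR hR')
            ((integrable_finsetSum _ fun i _ => hi hR hR' _).add hind) hdist
      _ = (∑ i, ∫ y, ‖⟪(b i : H), R y⟫_ℂ‖ ^ 2) + ε ^ 2 * volume.real (tsupport R) := by
          rw [integral_add (integrable_finsetSum _ fun i _ => hi hR hR' _) hind,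
            integral_finsetSum _ fun i _ => hi hR hR' _,
            integral_indicator (isClosed_tsupport R).measurableSet, setIntegral_const,
            smul_eq_mul, mul_comm (volume.real _)]
      _ ≤ (∑ i, ‖T‖ ^ 2 * ∫ y, ‖⟪(b i : H), Ψ y⟫_ℂ‖ ^ 2) +
            ε ^ 2 * volume.real (tsupport R) := by
          gcongr with i
          exact hone _
      _ = ‖T‖ ^ 2 * (∫ y, ∑ i, ‖⟪(b i : H), Ψ y⟫_ℂ‖ ^ 2) +
            ε ^ 2 * volume.real (tsupport R) := by
          rw [← Finset.mul_sum, integral_finsetSum _ fun i _ => hi hΨ hΨ' _]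
      _ ≤ _ := by
          gcongr 2
          refine integral_mono (integrable_finsetSum _ fun i _ => hi hΨ hΨ' _)
            (integrable_norm_sq hΨ hΨ') fun y => ?_
          exact hbo.sum_inner_products_le (Ψ y)
  refine le_of_forall_pos_le_add fun δ hδ => ?_
  have hV : 0 ≤ volume.real (tsupport R) := measureReal_nonneg
  refine (key (√(δ / (volume.real (tsupport R) + 1))) (by positivity)).trans ?_
  gcongr
  rw [Real.sq_sqrt (by positivity), div_mul_eq_mul_div, div_le_iff₀ (by linarith)]
  exact mul_le_mul_of_nonneg_left (by linarith) hδ.le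

end Amplification

end QG

end

noncomputable section

namespace QG

/-! ### The regular representation dominates every covariant representation -/

section Amenable

set_option linter.unusedSectionVars false

variable {G X : Type} [NormedAddCommGroup G] [NormedSpace ℝ G] [FiniteDimensional ℝ G]
  [MeasureSpace G] [BorelSpace G] [(volume : Measure G).IsAddHaarMeasure]
  [NormedAddCommGroup X] [NormedSpace ℝ X] [FiniteDimensional ℝ X]
  [MeasureSpace X] [BorelSpace X] [(volume : Measure X).IsAddHaarMeasure]
  (D : TwistedSystem G X)

/-- The integral kernel `F(t, s • x) σ(t, s - t)(s • x)` of the operator `T_F`. -/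
def regKernel (F : C_c(G × X, ℂ)) (t : G) (p : G × X) : ℂ :=
  F (t, D.act p.1 p.2) * (regPhase D t p : ℂ)

theorem continuous_regKernel (F : C_c(G × X, ℂ)) :
    Continuous fun q : G × G × X => regKernel D F q.1 q.2 :=
  (F.continuous.comp (continuous_fst.prodMk (D.continuous_act.comp continuous_snd))).mul
    (continuous_subtype_val.comp (continuous_regPhase D))

theorem ae_ae_shift {ζ ψ : G × X → ℂ} (hζ : Measurable ζ) (hψ : Measurable ψ)
    (h : ζ =ᵐ[volume] ψ) :
    ∀ᵐ p : G × X, ∀ᵐ t : G, ζ (p.1 - t, p.2) = ψ (p.1 - t, p.2) := by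
  have hs : Measurable fun q : (G × X) × G => (q.1.1 - q.2, q.1.2) :=
    (by fun_prop : Continuous fun q : (G × X) × G => (q.1.1 - q.2, q.1.2)).measurable
  refine (Measure.ae_ae_comm (measurableSet_eq_fun
    (f := fun q : (G × X) × G => ζ (q.1.1 - q.2, q.1.2))
    (g := fun q : (G × X) × G => ψ (q.1.1 - q.2, q.1.2)) (hζ.comp hs) (hψ.comp hs))).2 ?_
  exact Filter.Eventually.of_forall fun t =>
    (mp_shift (X := X) t).quasiMeasurePreserving.ae_eq_comp h

theorem regOp_toLp_coe (F : C_c(G × X, ℂ)) {ψ : G × X → ℂ} (hψ : Measurable ψ)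
    (hm : MemLp ψ 2 (volume : Measure (G × X))) :
    (regOp D F (hm.toLp ψ) : G × X → ℂ) =ᵐ[volume] fun p =>
      ∫ t, regKernel D F t p * ψ (p.1 - t, p.2) := by
  filter_upwards [regOp_coe D F (hm.toLp ψ),
    ae_ae_shift (Lp.stronglyMeasurable _).measurable hψ hm.coeFn_toLp] with p h1 h2
  rw [h1]
  refine integral_congr_ae ?_
  filter_upwards [h2] with t ht
  rw [ht]
  rfl

section Field

variable {H : Type} [NormedAddCommGroup H] [InnerProductSpace ℂ H] [CompleteSpace H]

/-- The operator `T_F ⊗ 1` on vector valued functions. -/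
def regField (F : C_c(G × X, ℂ)) (Ψ : G × X → H) (p : G × X) : H :=
  ∫ t, regKernel D F t p • Ψ (p.1 - t, p.2)

theorem regKernel_eq_zero {F : C_c(G × X, ℂ)} {K : Set G} {L : Set X}
    (h : ∀ t x, F (t, x) ≠ 0 → t ∈ K ∧ x ∈ L) {t : G} (ht : t ∉ K) (p : G × X) :
    regKernel D F t p = 0 := by
  have h1 : F (t, D.act p.1 p.2) = 0 := by
    by_contra h'
    exact ht (h _ _ h').1
  rw [regKernel, h1, zero_mul]

theorem continuous_regField_integrand (F : C_c(G × X, ℂ)) {Ψ : G × X → H} (hΨ : Continuous Ψ) :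
    Continuous fun q : (G × X) × G => regKernel D F q.2 q.1 • Ψ (q.1.1 - q.2, q.1.2) :=
  ((continuous_regKernel D F).comp
    (by fun_prop : Continuous fun q : (G × X) × G => (q.2, q.1))).smul
    (hΨ.comp (by fun_prop))

theorem integrable_regField_integrand (F : C_c(G × X, ℂ)) {Ψ : G × X → H} (hΨ : Continuous Ψ)
    (p : G × X) : Integrable fun t => regKernel D F t p • Ψ (p.1 - t, p.2) := by
  obtain ⟨K, L, hK, -, h⟩ := exists_compact_Cc F
  refine ((continuous_regField_integrand D F hΨ).comp
    (by fun_prop : Continuous fun t : G => (p, t))).integrable_of_hasCompactSupport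
    (HasCompactSupport.intro hK fun t ht => ?_)
  change regKernel D F t p • Ψ (p.1 - t, p.2) = 0
  rw [regKernel_eq_zero D h ht, zero_smul]

theorem continuous_regField (F : C_c(G × X, ℂ)) {Ψ : G × X → H} (hΨ : Continuous Ψ) :
    Continuous (regField D F Ψ) := by
  obtain ⟨K, L, hK, -, h⟩ := exists_compact_Cc F
  have h0 : regField D F Ψ = fun p => ∫ t in K, regKernel D F t p • Ψ (p.1 - t, p.2) := by
    funext p
    refine (setIntegral_eq_integral_of_forall_compl_eq_zero fun t ht => ?_).symm
    rw [regKernel_eq_zero D h ht, zero_smul]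
  rw [h0]
  exact continuous_parametric_integral_of_continuous
    (f := fun (p : G × X) t => regKernel D F t p • Ψ (p.1 - t, p.2))
    (continuous_regField_integrand D F hΨ) hK

theorem hasCompactSupport_regField (F : C_c(G × X, ℂ)) {Ψ : G × X → H}
    (hΨ : HasCompactSupport Ψ) : HasCompactSupport (regField D F Ψ) := by
  obtain ⟨K, L, hK, -, h⟩ := exists_compact_Cc F
  have hc : IsCompact (tsupport Ψ) := hΨ
  refine HasCompactSupport.intro (((hc.image continuous_fst).add hK).prod
    (hc.image continuous_snd)) fun p hp => ?_
  refine integral_eq_zero_of_ae (Filter.Eventually.of_forall fun t => ?_)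
  by_contra h'
  have h1 : t ∈ K := by
    by_contra ht
    exact h' (by simp only [regKernel_eq_zero D h ht, zero_smul, Pi.zero_apply])
  have h2 : (p.1 - t, p.2) ∈ tsupport Ψ := by
    by_contra ht
    exact h' (by simp only [image_eq_zero_of_notMem_tsupport ht, smul_zero, Pi.zero_apply])
  exact hp ⟨⟨p.1 - t, ⟨_, h2, rfl⟩, t, h1, by simp⟩, ⟨_, h2, rfl⟩⟩

theorem integral_norm_sq_regField_le (F : C_c(G × X, ℂ)) {Ψ : G × X → H} (hΨ : Continuous Ψ)
    (hΨ' : HasCompactSupport Ψ) :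
    ∫ p, ‖regField D F Ψ p‖ ^ 2 ≤ ‖regOp D F‖ ^ 2 * ∫ p, ‖Ψ p‖ ^ 2 := by
  refine integral_norm_sq_le_of_weak hΨ hΨ' (continuous_regField D F hΨ)
    (hasCompactSupport_regField D F hΨ') fun e hm => ?_
  have hc : Continuous fun p => ⟪e, Ψ p⟫_ℂ := continuous_const.inner hΨ
  filter_upwards [regOp_toLp_coe D F hc.measurable hm] with p hp
  rw [hp]
  refine Eq.trans ?_ ((innerSL ℂ e).integral_comp_comm
    (integrable_regField_integrand D F hΨ p))
  refine integral_congr_ae (Filter.Eventually.of_forall fun t => ?_)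
  exact (inner_smul_right _ _ _).symm

end Field

variable {D}

theorem CovariantRep.field_integrated (ρ : CovariantRep D) (F : C_c(G × X, ℂ)) (g : C_c(G, ℝ))
    (k : C_c(X × X, ℂ)) (v : ρ.H) (p : G × X) :
    ρ.field g k (ρ.integrated (cc F) v) p = ∫ t, ρ.π ((g p.1 : ℂ) • (cc k p.2 *
      D.aut (-p.1) (D.cocycleMul t (p.1 - t) (cc F t)))) (ρ.UStar (p.1 - t) v) := by
  let A : ρ.H →L[ℂ] ρ.H := (g p.1 : ℂ) • (ρ.π (cc k p.2) * ρ.UStar p.1)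
  have h1 : ρ.field g k (ρ.integrated (cc F) v) p = A (ρ.integrated (cc F) v) := rfl
  rw [h1, ρ.integrated_apply, ← A.integral_comp_comm (ρ.integrable_integrand (cc F) v)]
  refine integral_congr_ae (Filter.Eventually.of_forall fun t => ?_)
  change (A * (ρ.π (cc F t) * (ρ.U t : ρ.H →L[ℂ] ρ.H))) v =
    (ρ.π _ * ρ.UStar (p.1 - t)) v
  congr 1
  rw [smul_mul_assoc, mul_assoc, ρ.UStar_mul_π_mul_U, ← mul_assoc, ← map_mul, map_smul,
    smul_mul_assoc]

theorem CovariantRep.regField_field (ρ : CovariantRep D) (F : C_c(G × X, ℂ)) (g : C_c(G, ℝ))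
    (k : C_c(X × X, ℂ)) (v : ρ.H) (p : G × X) :
    regField D F (ρ.field g k v) p = ∫ t, ρ.π ((regKernel D F t p * (g (p.1 - t) : ℂ)) •
      cc k p.2) (ρ.UStar (p.1 - t) v) := by
  refine integral_congr_ae (Filter.Eventually.of_forall fun t => ?_)
  beta_reduce
  rw [map_smul, smul_apply, mul_smul]
  rfl

theorem CovariantRep.integrable_field_integrated (ρ : CovariantRep D) (F : C_c(G × X, ℂ))
    (g : C_c(G, ℝ)) (k : C_c(X × X, ℂ)) (v : ρ.H) (p : G × X) :
    Integrable fun t => ρ.π ((g p.1 : ℂ) • (cc k p.2 *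
      D.aut (-p.1) (D.cocycleMul t (p.1 - t) (cc F t)))) (ρ.UStar (p.1 - t) v) := by
  let A : ρ.H →L[ℂ] ρ.H := (g p.1 : ℂ) • (ρ.π (cc k p.2) * ρ.UStar p.1)
  refine (A.integrable_comp (ρ.integrable_integrand (cc F) v)).congr
    (Filter.Eventually.of_forall fun t => ?_)
  change (A * (ρ.π (cc F t) * (ρ.U t : ρ.H →L[ℂ] ρ.H))) v =
    (ρ.π _ * ρ.UStar (p.1 - t)) v
  congr 1
  rw [smul_mul_assoc, mul_assoc, ρ.UStar_mul_π_mul_U, ← mul_assoc, ← map_mul, map_smul,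
    smul_mul_assoc]

theorem CovariantRep.integrable_regField_field (ρ : CovariantRep D) (F : C_c(G × X, ℂ))
    (g : C_c(G, ℝ)) (k : C_c(X × X, ℂ)) (v : ρ.H) (p : G × X) :
    Integrable fun t => ρ.π ((regKernel D F t p * (g (p.1 - t) : ℂ)) •
      cc k p.2) (ρ.UStar (p.1 - t) v) := by
  refine (integrable_regField_integrand D F (ρ.continuous_field g k v) p).congr
    (Filter.Eventually.of_forall fun t => ?_)
  beta_reduce
  rw [map_smul, smul_apply, mul_smul]
  rfl

/-- The two vector fields are compared pointwise: the difference is controlled by the modulus of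
continuity `ε` of `g(s) F(t, s • x) σ(t, s - t)(s • x)` in `x` on the scale of the support of
`k`, and by the variation of `g`. -/
theorem CovariantRep.norm_field_sub_le (ρ : CovariantRep D) {F : C_c(G × X, ℂ)} {K : Set G}
    {L : Set X} (hK : IsCompact K) (hF : ∀ t x, F (t, x) ≠ 0 → t ∈ K ∧ x ∈ L) {M : ℝ}
    (hM : ∀ q, ‖F q‖ ≤ M) (g : C_c(G, ℝ)) (k : C_c(X × X, ℂ)) {ε : ℝ} (hε : 0 ≤ ε)
    (hk : ∀ s t x y, k (x, y) ≠ 0 →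
      ‖(g s : ℂ) * regKernel D F t (s, y) - (g s : ℂ) * regKernel D F t (s, x)‖ ≤ ε)
    (v : ρ.H) (p : G × X) :
    ‖ρ.field g k (ρ.integrated (cc F) v) p - regField D F (ρ.field g k v) p‖ₑ ≤
      ∫⁻ t in K, ENNReal.ofReal ((tsupport g).indicator (fun _ => ε) p.1 +
        M * |g p.1 - g (p.1 - t)|) * ‖ρ.π (cc k p.2) (ρ.UStar (p.1 - t) v)‖ₑ := by
  have hM0 : 0 ≤ M := (norm_nonneg _).trans (hM 0)
  rw [ρ.field_integrated, ρ.regField_field, ← integral_sub (ρ.integrable_field_integrated F g k v p)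
    (ρ.integrable_regField_field F g k v p)]
  have hval : ∀ t, ρ.π ((g p.1 : ℂ) • (cc k p.2 *
      D.aut (-p.1) (D.cocycleMul t (p.1 - t) (cc F t)))) (ρ.UStar (p.1 - t) v) -
      ρ.π ((regKernel D F t p * (g (p.1 - t) : ℂ)) • cc k p.2) (ρ.UStar (p.1 - t) v) =
      ρ.π ((g p.1 : ℂ) • (cc k p.2 * D.aut (-p.1) (D.cocycleMul t (p.1 - t) (cc F t))) -
        (regKernel D F t p * (g (p.1 - t) : ℂ)) • cc k p.2) (ρ.UStar (p.1 - t) v) := by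
    intro t
    rw [map_sub ρ.π]
    rfl
  simp only [hval]
  have hpt : ∀ t y, ((g p.1 : ℂ) • (cc k p.2 *
      D.aut (-p.1) (D.cocycleMul t (p.1 - t) (cc F t))) -
        (regKernel D F t p * (g (p.1 - t) : ℂ)) • cc k p.2) y =
      k (p.2, y) * ((g p.1 : ℂ) * regKernel D F t (p.1, y) -
        regKernel D F t p * (g (p.1 - t) : ℂ)) := by
    intro t y
    change (g p.1 : ℂ) * (k (p.2, y) * ((D.σ t (p.1 - t) (D.act (- -p.1) y) : ℂ) *
      F (t, D.act (- -p.1) y))) - regKernel D F t p * (g (p.1 - t) : ℂ) * k (p.2, y) = _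
    simp only [neg_neg, regKernel, regPhase]
    ring
  have hcoef : ∀ t y, ‖k (p.2, y) * ((g p.1 : ℂ) * regKernel D F t (p.1, y) -
        regKernel D F t p * (g (p.1 - t) : ℂ))‖ ≤
      ((tsupport g).indicator (fun _ => ε) p.1 + M * |g p.1 - g (p.1 - t)|) *
        ‖k (p.2, y)‖ := by
    intro t y
    rw [norm_mul, mul_comm]
    by_cases hy : k (p.2, y) = 0
    · rw [hy]; simp
    refine mul_le_mul_of_nonneg_right ?_ (norm_nonneg _)
    have h1 : (g p.1 : ℂ) * regKernel D F t (p.1, y) - regKernel D F t p * (g (p.1 - t) : ℂ) =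
        ((g p.1 : ℂ) * regKernel D F t (p.1, y) - (g p.1 : ℂ) * regKernel D F t (p.1, p.2)) +
          regKernel D F t p * (((g p.1 - g (p.1 - t) : ℝ)) : ℂ) := by
      push_cast
      ring
    rw [h1]
    refine (norm_add_le _ _).trans (add_le_add ?_ ?_)
    · by_cases hs : p.1 ∈ tsupport g
      · rw [Set.indicator_of_mem hs]
        exact hk p.1 t p.2 y hy
      · rw [image_eq_zero_of_notMem_tsupport hs, Set.indicator_of_notMem hs]
        simp
    · rw [norm_mul, Complex.norm_real, Real.norm_eq_abs, regKernel, norm_mul, Circle.norm_coe,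
        mul_one]
      exact mul_le_mul_of_nonneg_right (hM _) (abs_nonneg _)
  refine (enorm_integral_le_lintegral_enorm _).trans ?_
  rw [← lintegral_indicator hK.measurableSet]
  refine lintegral_mono fun t => ?_
  by_cases ht : t ∈ K
  · rw [Set.indicator_of_mem ht]
    have h0 : 0 ≤ (tsupport g).indicator (fun _ => ε) p.1 + M * |g p.1 - g (p.1 - t)| :=
      add_nonneg (Set.indicator_nonneg (fun _ _ => hε) _) (mul_nonneg hM0 (abs_nonneg _))
    rw [← ofReal_norm, ← ofReal_norm, ← ENNReal.ofReal_mul h0]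
    refine ENNReal.ofReal_le_ofReal ?_
    refine ρ.norm_π_le_of_norm_le h0 (fun y => ?_) _
    rw [hpt]
    exact hcoef t y
  · have h2 : (g p.1 : ℂ) • (cc k p.2 * D.aut (-p.1) (D.cocycleMul t (p.1 - t) (cc F t))) -
        (regKernel D F t p * (g (p.1 - t) : ℂ)) • cc k p.2 = 0 := by
      ext y
      rw [hpt, regKernel_eq_zero D hF ht, regKernel_eq_zero D hF ht]
      change _ = (0 : ℂ)
      ring
    simp only [h2, map_zero, zero_apply, enorm_zero, zero_le]

end Amenable

end QG

end

noncomputable section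

namespace QG

section Amenable

set_option linter.unusedSectionVars false

variable {G X : Type} [NormedAddCommGroup G] [NormedSpace ℝ G] [FiniteDimensional ℝ G]
  [MeasureSpace G] [BorelSpace G] [(volume : Measure G).IsAddHaarMeasure]
  [NormedAddCommGroup X] [NormedSpace ℝ X] [FiniteDimensional ℝ X]
  [MeasureSpace X] [BorelSpace X] [(volume : Measure X).IsAddHaarMeasure]
  {D : TwistedSystem G X}

theorem eLpNorm_two_sq {Y H : Type*} [MeasurableSpace Y] [NormedAddCommGroup H] (μ : Measure Y)
    (f : Y → H) : eLpNorm f 2 μ ^ 2 = ∫⁻ y, ‖f y‖ₑ ^ 2 ∂μ := by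
  have h := eLpNorm_nnreal_pow_eq_lintegral (f := f) (μ := μ) (p := 2) two_ne_zero
  norm_num at h
  exact h

theorem eLpNorm_two_le {Y H : Type*} [MeasurableSpace Y] [NormedAddCommGroup H] {μ : Measure Y}
    {f : Y → H} {c : ℝ} (hc : 0 ≤ c) (h : ∫⁻ y, ‖f y‖ₑ ^ 2 ∂μ ≤ ENNReal.ofReal (c ^ 2)) :
    eLpNorm f 2 μ ≤ ENNReal.ofReal c := by
  rw [← eLpNorm_two_sq, ENNReal.ofReal_pow hc] at h
  exact (ENNReal.pow_le_pow_left_iff two_ne_zero).1 h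

theorem lintegral_enorm_sq {Y H : Type} [NormedAddCommGroup H] [TopologicalSpace Y]
    [R1Space Y] [MeasureSpace Y] [BorelSpace Y] [IsFiniteMeasureOnCompacts (volume : Measure Y)]
    {f : Y → H} (hf : Continuous f) (hf' : HasCompactSupport f) :
    ∫⁻ y, ‖f y‖ₑ ^ 2 = ENNReal.ofReal (∫ y, ‖f y‖ ^ 2) := by
  rw [ofReal_integral_eq_lintegral_ofReal]
  · refine lintegral_congr fun s => ?_
    rw [ENNReal.ofReal_pow (norm_nonneg _), ofReal_norm]
  · exact (hf.norm.pow 2).integrable_of_hasCompactSupport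
      (HasCompactSupport.intro hf' fun y hy => by
        change ‖f y‖ ^ 2 = 0
        rw [image_eq_zero_of_notMem_tsupport hy]; norm_num)
  · exact Filter.Eventually.of_forall fun s => sq_nonneg _

theorem lintegral_coef_sq_le (g : C_c(G, ℝ)) (M ε δ : ℝ) (t : G)
    (ht : ∫ s, (g s - g (s - t)) ^ 2 ≤ δ) :
    ∫⁻ s, ENNReal.ofReal ((tsupport g).indicator (fun _ => ε) s +
      M * |g s - g (s - t)|) ^ 2 ≤
      ENNReal.ofReal (2 * (ε ^ 2 * volume.real (tsupport g)) + 2 * (M ^ 2 * δ)) := by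
  have hS : IsCompact (tsupport g) := g.hasCompactSupport
  have hi1 : Integrable ((tsupport g).indicator fun _ => ε ^ 2) :=
    (integrable_indicator_iff (isClosed_tsupport g).measurableSet).2
      (integrableOn_const hS.measure_lt_top.ne)
  have hc : Continuous fun s => (g s - g (s - t)) ^ 2 := by
    have := g.continuous
    exact (this.sub (this.comp (by fun_prop : Continuous fun s : G => s - t))).pow 2
  have hi2 : Integrable fun s => (g s - g (s - t)) ^ 2 := by
    refine hc.integrable_of_hasCompactSupport (HasCompactSupport.intro
      (hS.union (hS.add (isCompact_singleton (x := t)))) fun s hs => ?_)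
    rw [image_eq_zero_of_notMem_tsupport fun h => hs (Or.inl h),
      image_eq_zero_of_notMem_tsupport fun h => hs (Or.inr ⟨s - t, h, t, rfl, by simp⟩)]
    norm_num
  calc _ ≤ ∫⁻ s, ENNReal.ofReal (2 * (tsupport g).indicator (fun _ => ε ^ 2) s +
        2 * (M ^ 2 * (g s - g (s - t)) ^ 2)) := by
        refine lintegral_mono fun s => ?_
        beta_reduce
        by_cases h0 : 0 ≤ (tsupport g).indicator (fun _ => ε) s + M * |g s - g (s - t)|
        · rw [← ENNReal.ofReal_pow h0]
          refine ENNReal.ofReal_le_ofReal ?_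
          have h1 : (tsupport g).indicator (fun _ => ε ^ 2) s =
              (tsupport g).indicator (fun _ => ε) s ^ 2 := by
            by_cases hs : s ∈ tsupport g <;> simp [hs]
          rw [h1, ← sq_abs (g s - g (s - t)), ← mul_pow]
          exact (add_sq_le).trans (by rw [mul_add])
        · rw [ENNReal.ofReal_of_nonpos (not_le.1 h0).le]
          simp
    _ = ENNReal.ofReal (∫ s, (2 * (tsupport g).indicator (fun _ => ε ^ 2) s +
        2 * (M ^ 2 * (g s - g (s - t)) ^ 2))) := by
        rw [ofReal_integral_eq_lintegral_ofReal]
        · exact (hi1.const_mul 2).add ((hi2.const_mul (M ^ 2)).const_mul 2)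
        · refine Filter.Eventually.of_forall fun s => add_nonneg ?_ (by positivity)
          exact mul_nonneg zero_le_two (Set.indicator_nonneg (fun _ _ => sq_nonneg _) _)
    _ ≤ _ := by
        refine ENNReal.ofReal_le_ofReal ?_
        rw [integral_add (hi1.const_mul 2) ((hi2.const_mul (M ^ 2)).const_mul 2),
          integral_const_mul, integral_const_mul, integral_const_mul,
          integral_indicator (isClosed_tsupport g).measurableSet, setIntegral_const,
          smul_eq_mul, mul_comm (volume.real _)]
        gcongr

/-- The square integral of the difference of the two vector fields. -/
theorem CovariantRep.lintegral_field_sub_sq_le (ρ : CovariantRep D) {F : C_c(G × X, ℂ)}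
    {K : Set G} {L : Set X} (hK : IsCompact K) (hF : ∀ t x, F (t, x) ≠ 0 → t ∈ K ∧ x ∈ L) {M : ℝ}
    (hM : ∀ q, ‖F q‖ ≤ M) (g : C_c(G, ℝ)) (k : C_c(X × X, ℂ)) {ε δ : ℝ} (hε : 0 ≤ ε)
    (hk : ∀ s t x y, k (x, y) ≠ 0 →
      ‖(g s : ℂ) * regKernel D F t (s, y) - (g s : ℂ) * regKernel D F t (s, x)‖ ≤ ε)
    (hk' : ‖sqInt k‖ ≤ 1) (hg : ∀ t ∈ K, ∫ s, (g s - g (s - t)) ^ 2 ≤ δ) (v : ρ.H) :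
    ∫⁻ p, ‖ρ.field g k (ρ.integrated (cc F) v) p - regField D F (ρ.field g k v) p‖ₑ ^ 2 ≤
      volume K * (volume K * (ENNReal.ofReal (2 * (ε ^ 2 * volume.real (tsupport g)) +
        2 * (M ^ 2 * δ)) * ‖v‖ₑ ^ 2)) := by
  have hmc : ∀ t, Measurable fun s => ENNReal.ofReal ((tsupport g).indicator (fun _ => ε) s +
      M * |g s - g (s - t)|) := by
    intro t
    have h1 := g.continuous
    refine ENNReal.measurable_ofReal.comp (Measurable.add
      (measurable_const.indicator (isClosed_tsupport g).measurableSet) ?_)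
    exact (continuous_const.mul ((h1.sub (h1.comp
      (by fun_prop : Continuous fun s : G => s - t))).abs)).measurable
  have hmN : Continuous fun q : G × G × X =>
      ‖ρ.π (cc k q.2.2) (ρ.UStar (q.2.1 - q.1) v)‖ₑ :=
    ((ρ.continuous_π_UStar k v).comp
      (by fun_prop : Continuous fun q : G × G × X => (q.2.1 - q.1, q.2.2))).enorm
  refine (lintegral_mono fun p => pow_le_pow_left₀ zero_le
    (ρ.norm_field_sub_le hK hF hM g k hε hk v p) 2).trans ?_
  refine lintegral_sq_lintegral_le (T := G) (Y := G × X) volume volume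
    (f := fun t p => ENNReal.ofReal ((tsupport g).indicator (fun _ => ε) p.1 +
        M * |g p.1 - g (p.1 - t)|) * ‖ρ.π (cc k p.2) (ρ.UStar (p.1 - t) v)‖ₑ)
    ?_ K (fun t ht => ?_) hK.measurableSet
  · refine Measurable.mul (ENNReal.measurable_ofReal.comp (Measurable.add ?_ ?_))
      hmN.measurable
    · exact (measurable_const.indicator (isClosed_tsupport g).measurableSet).comp
        (measurable_fst.comp measurable_snd)
    · have h1 := g.continuous
      exact (continuous_const.mul (((h1.comp (by fun_prop : Continuous
        fun q : G × G × X => q.2.1)).sub (h1.comp (by fun_prop : Continuous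
        fun q : G × G × X => q.2.1 - q.1))).abs)).measurable
  · have hmt : Measurable fun p : G × X => ‖ρ.π (cc k p.2) (ρ.UStar (p.1 - t) v)‖ₑ :=
      (hmN.comp (by fun_prop : Continuous fun p : G × X => (t, p))).measurable
    have hmp : Measurable fun p : G × X => (ENNReal.ofReal ((tsupport g).indicator
        (fun _ => ε) p.1 + M * |g p.1 - g (p.1 - t)|) *
          ‖ρ.π (cc k p.2) (ρ.UStar (p.1 - t) v)‖ₑ) ^ 2 :=
      (((hmc t).comp measurable_fst).mul hmt).pow_const 2
    rw [Measure.volume_eq_prod, lintegral_prod _ hmp.aemeasurable]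
    calc _ ≤ ∫⁻ s, ENNReal.ofReal ((tsupport g).indicator (fun _ => ε) s +
          M * |g s - g (s - t)|) ^ 2 * ‖v‖ₑ ^ 2 := by
          refine lintegral_mono fun s => ?_
          simp only [mul_pow]
          have hms : Measurable fun x => ‖ρ.π (cc k x) (ρ.UStar (s - t) v)‖ₑ ^ 2 :=
            (hmt.comp measurable_prodMk_left).pow_const 2
          rw [lintegral_const_mul _ hms]
          gcongr
          refine (ρ.lintegral_π_sq_le hk' _).trans (le_of_eq ?_)
          rw [← ofReal_norm, ρ.norm_UStar, ofReal_norm]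
      _ ≤ _ := by
          rw [lintegral_mul_const _ ((hmc t).pow_const 2)]
          gcongr
          exact lintegral_coef_sq_le g M ε δ t (hg t ht)

/-- The regular representation weakly contains every covariant representation: this is the
amenability of the vector group `G`.  The fields `(s, x) ↦ g(s) π(k(x, ·)) U_s* v`, with `g`
almost invariant and `k` concentrated near the diagonal, almost intertwine `ρ` with a multiple of
the regular representation. -/
theorem CovariantRep.norm_integrated_le_regOp (ρ : CovariantRep D) (F : C_c(G × X, ℂ)) :
    ‖ρ.integrated (cc F)‖ ≤ ‖regOp D F‖ := by
  refine ContinuousLinearMap.opNorm_le_bound _ (norm_nonneg _) fun v => ?_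
  obtain ⟨K, L, hK, hL, hF⟩ := exists_compact_Cc F
  obtain ⟨M, hM0, hM⟩ := exists_norm_le_Cc F
  have key : ∀ η > 0, ‖ρ.integrated (cc F) v‖ ≤ ‖regOp D F‖ * ‖v‖ +
      volume.real K * (η * ‖v‖) := by
    intro η hη
    -- the constants are such that the variation of `g` and the modulus of continuity contribute at
    -- most `η² / 2` each to the square of the error
    obtain ⟨g, hg1, hg2⟩ := exists_almost_invariant hK
      (δ := η ^ 2 / (4 * (M ^ 2 + 1))) (by positivity)
    have hS : IsCompact (tsupport g) := g.hasCompactSupport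
    obtain ⟨b, hb⟩ : ∃ b, b = volume.real (tsupport g) := ⟨_, rfl⟩
    have hb0 : 0 ≤ b := by rw [hb]; exact measureReal_nonneg
    obtain ⟨ε, hε0, hε⟩ : ∃ ε > 0, ε ^ 2 * b ≤ η ^ 2 / 4 := by
      refine ⟨√(η ^ 2 / (4 * (b + 1))), by positivity, ?_⟩
      rw [Real.sq_sqrt (by positivity), div_mul_eq_mul_div, div_le_div_iff₀ (by positivity)
        (by norm_num)]
      have := sq_nonneg η
      nlinarith
    -- the scale on which `g(s) F(t, s • x) σ(t, s - t)(s • x)` is almost constant in `x`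
    obtain ⟨r, hr0, hr⟩ : ∃ r > 0, ∀ s t x y, ‖y - x‖ < r →
        ‖(g s : ℂ) * regKernel D F t (s, y) - (g s : ℂ) * regKernel D F t (s, x)‖ ≤ ε := by
      have hc : Continuous fun q : G × G × X => (g q.2.1 : ℂ) * regKernel D F q.1 q.2 :=
        (Complex.continuous_ofReal.comp (g.continuous.comp
          (by fun_prop : Continuous fun q : G × G × X => q.2.1))).mul (continuous_regKernel D F)
      have hact : Continuous fun q : G × X => D.act (-q.1) q.2 :=
        D.continuous_act.comp (by fun_prop : Continuous fun q : G × X => (-q.1, q.2))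
      have hcs : HasCompactSupport fun q : G × G × X =>
          (g q.2.1 : ℂ) * regKernel D F q.1 q.2 := by
        refine HasCompactSupport.intro (hK.prod (hS.prod ((hS.prod hL).image hact)))
          fun q hq => ?_
        by_contra h
        have h1 : g q.2.1 ≠ 0 := fun h1 => h (by rw [h1]; simp)
        have h2 : F (q.1, D.act q.2.1 q.2.2) ≠ 0 := fun h1 => h (by
          rw [regKernel, h1]; simp)
        refine hq ⟨(hF _ _ h2).1, subset_tsupport _ h1, (q.2.1, D.act q.2.1 q.2.2),
          ⟨subset_tsupport _ h1, (hF _ _ h2).2⟩, ?_⟩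
        change D.act (-q.2.1) (D.act q.2.1 q.2.2) = q.2.2
        rw [← D.act_add, neg_add_cancel, D.act_zero]
      obtain ⟨r, hr, h⟩ := Metric.uniformContinuous_iff.1
        (hcs.uniformContinuous_of_continuous hc) ε hε0
      refine ⟨r, hr, fun s t x y hxy => ?_⟩
      have h1 := h (a := (t, s, y)) (b := (t, s, x)) (by
        rw [dist_eq_norm]
        simpa using hxy)
      rw [dist_eq_norm] at h1
      exact h1.le
    have hact : Continuous fun q : G × X => D.act (-q.1) q.2 :=
      D.continuous_act.comp (by fun_prop : Continuous fun q : G × X => (-q.1, q.2))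
    obtain ⟨k, hk1, hk2, hk3⟩ := exists_diagonal_kernel ((hS.prod hL).image hact) hr0
    have hk' : ‖sqInt k‖ ≤ 1 := norm_C0_le zero_le_one fun y => by
      rw [sqInt_apply]
      exact (hk2 y).2
    -- `∫ |k(x, ·)|² dx` equals one on the translates of the support of `F`, so that the field of
    -- `ρ(F) v` has the norm of `ρ(F) v`
    have htriv : ∀ s, g s ≠ 0 → ρ.π (sqInt k) (ρ.UStar s (ρ.integrated (cc F) v)) =
        ρ.UStar s (ρ.integrated (cc F) v) := by
      intro s hs
      have h1 : ρ.π (sqInt k) (ρ.UStar s (ρ.integrated (cc F) v)) =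
          ρ.UStar s (ρ.π (D.aut s (sqInt k)) (ρ.integrated (cc F) v)) :=
        DFunLike.congr_fun (ρ.π_mul_UStar s (sqInt k)) _
      rw [h1, ρ.π_mul_integrated F _ fun t x hx => ?_]
      rw [D.aut_apply, sqInt_apply]
      exact hk3 _ ⟨(s, x), ⟨subset_tsupport _ hs, (hF t x hx).2⟩, rfl⟩
    let Ψ := ρ.field g k v
    let Ψ' := ρ.field g k (ρ.integrated (cc F) v)
    let R := regField D F Ψ
    have hΨc : Continuous Ψ := ρ.continuous_field g k v
    have hΨs : HasCompactSupport Ψ := ρ.hasCompactSupport_field g k v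
    have hRc : Continuous R := continuous_regField D F hΨc
    have hRs : HasCompactSupport R := hasCompactSupport_regField D F hΨs
    have h1 : eLpNorm Ψ' 2 volume = ENNReal.ofReal ‖ρ.integrated (cc F) v‖ := by
      have h0 : eLpNorm Ψ' 2 volume ^ 2 = ENNReal.ofReal ‖ρ.integrated (cc F) v‖ ^ 2 := by
        rw [eLpNorm_two_sq, ofReal_norm]
        exact ρ.lintegral_field_sq_eq hg1 _ htriv
      exact le_antisymm ((ENNReal.pow_le_pow_left_iff two_ne_zero).1 h0.le)
        ((ENNReal.pow_le_pow_left_iff two_ne_zero).1 h0.ge)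
    have h2 : eLpNorm R 2 volume ≤ ENNReal.ofReal (‖regOp D F‖ * ‖v‖) := by
      refine eLpNorm_two_le (by positivity) ?_
      rw [lintegral_enorm_sq hRc hRs]
      refine ENNReal.ofReal_le_ofReal ?_
      refine (integral_norm_sq_regField_le D F hΨc hΨs).trans ?_
      rw [mul_pow]
      gcongr
      have h3 := ρ.lintegral_field_sq_le hg1 hk' v
      rw [lintegral_enorm_sq hΨc hΨs, ← ofReal_norm, ← ENNReal.ofReal_pow (norm_nonneg _)] at h3
      exact (ENNReal.ofReal_le_ofReal_iff (sq_nonneg _)).1 h3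
    have h3 : eLpNorm (Ψ' - R) 2 volume ≤ ENNReal.ofReal (volume.real K * (η * ‖v‖)) := by
      refine eLpNorm_two_le (by positivity) ?_
      refine (ρ.lintegral_field_sub_sq_le hK hF hM g k hε0.le
        (fun s t x y hxy => hr s t x y (hk1 x y hxy)) hk' hg2 v).trans ?_
      have h4 : volume K = ENNReal.ofReal (volume.real K) :=
        (ENNReal.ofReal_toReal hK.measure_lt_top.ne).symm
      have h5 : 2 * (ε ^ 2 * volume.real (tsupport g)) +
          2 * (M ^ 2 * (η ^ 2 / (4 * (M ^ 2 + 1)))) ≤ η ^ 2 := by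
        rw [← hb]
        have h6 : M ^ 2 * (η ^ 2 / (4 * (M ^ 2 + 1))) ≤ η ^ 2 / 4 := by
          rw [mul_div_assoc', div_le_div_iff₀ (by positivity) (by norm_num)]
          have := sq_nonneg η
          nlinarith
        linarith
      rw [← ofReal_norm, ← ENNReal.ofReal_pow (norm_nonneg _), h4,
        ← ENNReal.ofReal_mul (by positivity), ← ENNReal.ofReal_mul measureReal_nonneg,
        ← ENNReal.ofReal_mul measureReal_nonneg]
      refine ENNReal.ofReal_le_ofReal ?_
      calc _ ≤ volume.real K * (volume.real K * (η ^ 2 * ‖v‖ ^ 2)) := by gcongr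
        _ = _ := by ring
    have h4 : eLpNorm Ψ' 2 volume ≤ eLpNorm R 2 volume + eLpNorm (Ψ' - R) 2 volume := by
      have hΨc' : Continuous Ψ' := ρ.continuous_field g k _
      have h5 := eLpNorm_add_le (μ := (volume : Measure (G × X))) (p := 2) (f := R) (g := Ψ' - R)
        hRc.aestronglyMeasurable (hΨc'.sub hRc).aestronglyMeasurable (by norm_num)
      rwa [add_sub_cancel] at h5
    rw [h1] at h4
    have h5 := h4.trans (add_le_add h2 h3)
    rw [← ENNReal.ofReal_add (by positivity) (by positivity)] at h5
    exact (ENNReal.ofReal_le_ofReal_iff (by positivity)).1 h5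
  refine le_of_forall_pos_le_add fun δ hδ => ?_
  obtain ⟨c, hc⟩ : ∃ c, c = volume.real K * ‖v‖ := ⟨_, rfl⟩
  have hc0 : 0 ≤ c := by rw [hc]; positivity
  refine (key (δ / (c + 1)) (by positivity)).trans ?_
  have h1 : volume.real K * (δ / (c + 1) * ‖v‖) = δ / (c + 1) * c := by rw [hc]; ring
  rw [h1, div_mul_eq_mul_div]
  gcongr
  rw [div_le_iff₀ (by linarith)]
  exact mul_le_mul_of_nonneg_left (by linarith) hδ.le

/-- The regular representation is faithful on the full crossed product. -/
theorem norm_universalRep_eq (F : C_c(G × X, ℂ)) : ‖universalRep D (cc F)‖ = ‖regOp D F‖ := by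
  refine le_antisymm (lp.norm_le_of_forall_le (norm_nonneg _)
    fun ρ => ρ.norm_integrated_le_regOp F) ?_
  exact lp.norm_apply_le_norm ENNReal.top_ne_zero (universalRep D (cc F)) (regRep D)

end Amenable

end QG

end

noncomputable section

namespace QG

/-! ### Crossed products as concrete algebras -/

section Reduced

/-- A `*`-homomorphism which is isometric on a dense `*`-algebra is an isomorphism onto the closure
of its image. -/
theorem exists_starIsomorphic_closure {E F : Type*} [NonUnitalCStarAlgebra E]
    [NonUnitalCStarAlgebra F] (S : NonUnitalStarSubalgebra ℂ E) {S' : NonUnitalStarSubalgebra ℂ E}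
    (hS' : (S' : Set E) = closure S) (Φ : E →⋆ₙₐ[ℂ] F) (h : ∀ x ∈ S, ‖Φ x‖ = ‖x‖) :
    ∃ A : NonUnitalStarSubalgebra ℂ F, (A : Set F) = closure (Φ '' S) ∧
      StarIsomorphic A S' := by
  obtain rfl : S' = S.topologicalClosure := SetLike.coe_injective hS'
  have hc : Continuous Φ := AddMonoidHomClass.continuous_of_bound Φ 1 fun x => by
    rw [one_mul]; exact NonUnitalStarAlgHom.norm_apply_le Φ x
  have h' : ∀ x ∈ S.topologicalClosure, ‖Φ x‖ = ‖x‖ := fun x hx =>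
    closure_minimal (s := (S : Set E)) (t := {x | ‖Φ x‖ = ‖x‖}) h
      (isClosed_eq hc.norm continuous_norm) hx
  let f : S.topologicalClosure →⋆ₙₐ[ℂ] F :=
    Φ.comp (NonUnitalStarSubalgebraClass.subtype S.topologicalClosure)
  have hf : Isometry f := AddMonoidHomClass.isometry_of_norm f fun x => h' x x.2
  have : CompleteSpace S.topologicalClosure :=
    (NonUnitalStarSubalgebra.isClosed_topologicalClosure S).completeSpace_coe
  have hr : IsClosed (Set.range f) := hf.isClosedEmbedding.isClosed_range
  refine ⟨NonUnitalStarAlgHom.range f, ?_, ⟨?_⟩⟩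
  · refine Set.Subset.antisymm ?_ (closure_minimal ?_ hr)
    · rintro _ ⟨x, rfl⟩
      exact image_closure_subset_closure_image hc ⟨x, x.2, rfl⟩
    · rintro _ ⟨x, hx, rfl⟩
      exact ⟨⟨x, subset_closure hx⟩, rfl⟩
  · refine (StarAlgEquiv.ofBijective (NonUnitalStarAlgHom.codRestrict f
      (NonUnitalStarAlgHom.range f) fun x => ⟨x, rfl⟩) ⟨fun x y hxy => ?_, ?_⟩).symm
    · exact hf.injective (congrArg Subtype.val hxy)
    · rintro ⟨_, x, rfl⟩
      exact ⟨x, rfl⟩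

variable {G X : Type} [NormedAddCommGroup G] [NormedSpace ℝ G] [FiniteDimensional ℝ G]
  [MeasureSpace G] [BorelSpace G] [(volume : Measure G).IsAddHaarMeasure]
  [NormedAddCommGroup X] [NormedSpace ℝ X] [FiniteDimensional ℝ X]
  [MeasureSpace X] [BorelSpace X] [(volume : Measure X).IsAddHaarMeasure]

/-- Evaluation of the elements of a product of algebras at an index. -/
def evalHom {ι : Type*} {A : ι → Type*} [∀ i, NonUnitalCStarAlgebra (A i)] (i : ι) :
    lp A ∞ →⋆ₙₐ[ℂ] A i where
  toFun f := f i
  map_smul' _ _ := rfl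
  map_zero' := rfl
  map_add' _ _ := rfl
  map_mul' _ _ := rfl
  map_star' _ := rfl

theorem norm_conjHom {Z Y : Type} [MeasureSpace Z] [MeasureSpace Y] (e : Z ≃ᵐ Y)
    (he : MeasurePreserving e) (T : B Y) : ‖conjHom e he T‖ = ‖T‖ := by
  refine le_antisymm (NonUnitalStarAlgHom.norm_apply_le (conjHom e he) T) ?_
  have h : conjHom e.symm (he.symm e) (conjHom e he T) = T :=
    ContinuousLinearMap.ext fun ξ => by
      change compOp e.symm (he.symm e) (compOp e he (T (compOp e.symm (he.symm e)
        (compOp e he ξ)))) = T ξ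
      rw [compOp_symm_apply, compOp_symm_apply]
  calc ‖T‖ = ‖conjHom e.symm (he.symm e) (conjHom e he T)‖ := by rw [h]
    _ ≤ _ := NonUnitalStarAlgHom.norm_apply_le (conjHom e.symm (he.symm e)) _

/-- The crossed product is isomorphic to the closure of the operators `T_F` of the regular
representation. -/
theorem exists_starIsomorphic_crossedProduct (D : TwistedSystem G X) {Z : Type} [MeasureSpace Z]
    (e : Z ≃ᵐ G × X) (he : MeasurePreserving e) :
    ∃ A : NonUnitalStarSubalgebra ℂ (B Z),
      (A : Set (B Z)) = closure (Set.range fun F : C_c(G × X, ℂ) => conjHom e he (regOp D F)) ∧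
      StarIsomorphic A (crossedProduct D) := by
  let Φ : lp (fun ρ : CovariantRep D => ρ.H →L[ℂ] ρ.H) ∞ →⋆ₙₐ[ℂ] B Z :=
    (conjHom e he : B (G × X) →⋆ₙₐ[ℂ] B Z).comp (evalHom (regRep D))
  obtain ⟨A, hA, h⟩ := exists_starIsomorphic_closure (ccAlg D) (coe_crossedProduct D) Φ (by
    rintro _ ⟨F, rfl⟩
    rw [norm_universalRep_eq]
    exact norm_conjHom e he (regOp D F))
  refine ⟨A, ?_, h⟩
  rw [hA]
  congr 1
  exact (Set.range_comp Φ fun F : C_c(G × X, ℂ) => universalRep D (cc F)).symm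

end Reduced

end QG

end

noncomputable section

namespace QG

/-! ### The multiplicative unitary of a twisted semidirect product -/

/-- The data of the construction: an action `α` of the group `X` on the group `G` by measure
preserving automorphisms, and a field `σ^r` of cocycles on `G`, indexed by `r ∈ X`, with trivial
action of `G` on `X`, which is compatible with `α`: `σ^{r+s} = (σ^r ∘ α_s) σ^s`. -/
structure Bicrossed (G X : Type) [NormedAddCommGroup G] [NormedAddCommGroup X]
    [MeasureSpace G] where
  α : X → G → G
  α_zero : ∀ h, α 0 h = h
  α_add : ∀ r s h, α (r + s) h = α r (α s h)
  α_map_add : ∀ r h h', α r (h + h') = α r h + α r h'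
  continuous_α : Continuous fun p : X × G => α p.1 p.2
  mp_α : ∀ r, MeasurePreserving (α r)
  D : TwistedSystem G X
  act_eq : ∀ h r, D.act h r = r
  σ_add : ∀ r s u v, D.σ u v (r + s) = D.σ (α s u) (α s v) r * D.σ u v s

namespace Bicrossed

set_option linter.unusedSectionVars false

variable {G X : Type} [NormedAddCommGroup G] [NormedSpace ℝ G] [FiniteDimensional ℝ G]
  [MeasureSpace G] [BorelSpace G] [(volume : Measure G).IsAddHaarMeasure]
  [NormedAddCommGroup X] [NormedSpace ℝ X] [FiniteDimensional ℝ X]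
  [MeasureSpace X] [BorelSpace X] [(volume : Measure X).IsAddHaarMeasure]
  (b : Bicrossed G X)

theorem α_neg_α (r : X) (h : G) : b.α (-r) (b.α r h) = h := by
  rw [← b.α_add, neg_add_cancel, b.α_zero]

theorem α_α_neg (r : X) (h : G) : b.α r (b.α (-r) h) = h := by
  rw [← b.α_add, add_neg_cancel, b.α_zero]

theorem α_map_zero (r : X) : b.α r 0 = 0 := by
  have h := b.α_map_add r 0 0
  rw [add_zero] at h
  exact left_eq_add.1 h

theorem α_map_sub (r : X) (h h' : G) : b.α r (h - h') = b.α r h - b.α r h' := by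
  rw [eq_sub_iff_add_eq, ← b.α_map_add, sub_add_cancel]

theorem continuous_α_comp {Y : Type} [TopologicalSpace Y] {f : Y → X} {g : Y → G}
    (hf : Continuous f) (hg : Continuous g) : Continuous fun y => b.α (f y) (g y) :=
  b.continuous_α.comp (hf.prodMk hg)

theorem continuous_σ_comp {Y : Type} [TopologicalSpace Y] {f g : Y → G} {k : Y → X}
    (hf : Continuous f) (hg : Continuous g) (hk : Continuous k) :
    Continuous fun y => b.D.σ (f y) (g y) (k y) :=
  b.D.continuous_σ.comp (hf.prodMk (hg.prodMk hk))

/-- The homeomorphism `((h, r), (h', r')) ↦ ((α_{-r'} h, r + r'), (h' - α_{-r'} h, r'))`. -/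
def phi : (G × X) × (G × X) ≃ₜ (G × X) × (G × X) where
  toFun p := ((b.α (-p.2.2) p.1.1, p.1.2 + p.2.2), (p.2.1 - b.α (-p.2.2) p.1.1, p.2.2))
  invFun p := ((b.α p.2.2 p.1.1, p.1.2 - p.2.2), (p.2.1 + p.1.1, p.2.2))
  left_inv p := by simp [b.α_α_neg]
  right_inv p := by simp [b.α_neg_α]
  continuous_toFun := by
    have h : Continuous fun p : (G × X) × (G × X) => b.α (-p.2.2) p.1.1 :=
      b.continuous_α_comp (by fun_prop) (by fun_prop)
    fun_prop
  continuous_invFun := by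
    have h : Continuous fun p : (G × X) × (G × X) => b.α p.2.2 p.1.1 :=
      b.continuous_α_comp (by fun_prop) (by fun_prop)
    fun_prop

theorem phi_apply (p : (G × X) × (G × X)) : b.phi p =
    ((b.α (-p.2.2) p.1.1, p.1.2 + p.2.2), (p.2.1 - b.α (-p.2.2) p.1.1, p.2.2)) := rfl

theorem phi_symm_apply (p : (G × X) × (G × X)) : b.phi.symm p =
    ((b.α p.2.2 p.1.1, p.1.2 - p.2.2), (p.2.1 + p.1.1, p.2.2)) := rfl

theorem mp_phi : MeasurePreserving b.phi := by
  have h1 : MeasurePreserving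
      (fun p : (G × X) × (G × X) => (p.1, (b.α (-p.1.2) p.2.1, p.2.2 + p.1.2)))
      (volume.prod volume) (volume.prod volume) := by
    refine MeasurePreserving.skew_product
      (g := fun (z : G × X) (z' : G × X) => (b.α (-z.2) z'.1, z'.2 + z.2)) (.id _) ?_
      (Filter.Eventually.of_forall fun z => ?_)
    · have h : Continuous fun p : (G × X) × (G × X) => b.α (-p.1.2) p.2.1 :=
        b.continuous_α_comp (by fun_prop) (by fun_prop)
      exact (by fun_prop : Continuous fun p : (G × X) × (G × X) =>
        (b.α (-p.1.2) p.2.1, p.2.2 + p.1.2)).measurable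
    · exact ((b.mp_α (-z.2)).prod (measurePreserving_add_right volume z.2)).map_eq
  have h2 : MeasurePreserving
      (fun p : (G × X) × (G × X) => (p.1, (p.2.1 - p.1.1, p.2.2)))
      (volume.prod volume) (volume.prod volume) := by
    refine MeasurePreserving.skew_product
      (g := fun (z : G × X) (z' : G × X) => (z'.1 - z.1, z'.2)) (.id _) ?_
      (Filter.Eventually.of_forall fun z => ?_)
    · exact (by fun_prop : Continuous fun p : (G × X) × (G × X) =>
        (p.2.1 - p.1.1, p.2.2)).measurable
    · exact (mp_shift z.1).map_eq
  exact h2.comp (Measure.measurePreserving_swap.comp (h1.comp Measure.measurePreserving_swap))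

theorem mp_phi_symm : MeasurePreserving b.phi.symm :=
  b.mp_phi.symm b.phi.toMeasurableEquiv

/-- The phase `σ^{r'}(α_{-r'} h, h' - α_{-r'} h)`. -/
def phase (p : (G × X) × (G × X)) : Circle :=
  b.D.σ (b.α (-p.2.2) p.1.1) (p.2.1 - b.α (-p.2.2) p.1.1) p.2.2

theorem continuous_phase : Continuous b.phase := by
  have h : Continuous fun p : (G × X) × (G × X) => b.α (-p.2.2) p.1.1 :=
    b.continuous_α_comp (by fun_prop) (by fun_prop)
  exact b.continuous_σ_comp h (by fun_prop) (by fun_prop)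

theorem phase_phi_symm (p : (G × X) × (G × X)) :
    b.phase (b.phi.symm p) = b.D.σ p.1.1 p.2.1 p.2.2 := by
  simp [phase, phi_symm_apply, b.α_neg_α]

theorem measurable_phase : Measurable fun p => (b.phase p : ℂ) :=
  (continuous_subtype_val.comp b.continuous_phase).measurable

/-- The multiplicative unitary
`W ξ(z, z') = σ^{r'}(α_{-r'} h, h' - α_{-r'} h) ξ((α_{-r'} h, r + r'), (h' - α_{-r'} h, r'))`,
where `z = (h, r)` and `z' = (h', r')`. -/
def W : B ((G × X) × (G × X)) := wcomp b.phase b.measurable_phase b.phi b.mp_phi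

theorem W_coe (ξ : L2 ((G × X) × (G × X))) : (b.W ξ : _ → ℂ) =ᵐ[volume]
    fun p => (b.phase p : ℂ) * ξ (b.phi p) := wcomp_coe _ _ _ _ _

theorem W_mem_unitary : b.W ∈ unitary (B ((G × X) × (G × X))) :=
  wcomp_mem_unitary _ _ _ _ b.mp_phi b.mp_phi_symm b.phi.symm_apply_apply b.phi.apply_symm_apply

theorem star_W_coe (ξ : L2 ((G × X) × (G × X))) : (star b.W ξ : _ → ℂ) =ᵐ[volume]
    fun p => ((b.D.σ p.1.1 p.2.1 p.2.2)⁻¹ : Circle) * ξ (b.phi.symm p) := by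
  have h := star_wcomp b.phase b.measurable_phase b.phi b.phi.symm b.mp_phi b.mp_phi_symm
    b.phi.symm_apply_apply
  rw [W, h]
  filter_upwards [wcomp_coe _ (measurable_star_comp b.measurable_phase
    b.mp_phi_symm.measurable) b.phi.symm b.mp_phi_symm ξ] with p hp
  rw [hp, b.phase_phi_symm]

/-- The pentagon equation: the points agree because `α` acts by automorphisms, the phases because
of the cocycle identity of `σ^r` and the compatibility of `σ` with `α`. -/
theorem isMultiplicativeUnitary_W : IsMultiplicativeUnitary b.W := by
  refine ⟨b.W_mem_unitary, ?_⟩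
  unfold W leg12 leg13 leg23
  rw [leg_wcomp, leg_wcomp, leg_wcomp, wcomp_mul_wcomp, wcomp_mul_wcomp, wcomp_mul_wcomp]
  refine wcomp_congr ?_ ?_
  · rintro ⟨⟨h, r⟩, ⟨h', r'⟩, ⟨h'', r''⟩⟩
    change b.phase ((h, r), (h', r')) * b.phase ((b.α (-r') h, r + r'), (h'', r'')) *
        b.phase ((h' - b.α (-r') h, r'), (h'' - b.α (-r'') (b.α (-r') h), r'')) =
      b.phase ((h', r'), (h'', r'')) * b.phase ((h, r), (b.α (-r'') h', r' + r''))
    have e1 : b.α (-(r' + r'')) h = b.α (-r'') (b.α (-r') h) := by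
      rw [← b.α_add, neg_add_rev]
    obtain ⟨u, hu⟩ : ∃ u, b.α (-r'') (b.α (-r') h) = u := ⟨_, rfl⟩
    obtain ⟨v, hv⟩ : ∃ v, b.α (-r'') (h' - b.α (-r') h) = v := ⟨_, rfl⟩
    have e2 : b.α (-r') h = b.α r'' u := by rw [← hu, b.α_α_neg]
    have e3 : h' - b.α (-r') h = b.α r'' v := by rw [← hv, b.α_α_neg]
    have e4 : b.α (-r'') h' = u + v := by
      rw [← hu, ← hv, b.α_map_sub, add_sub_cancel]
    simp only [phase]
    rw [e1, hu, hv, e4, e3, e2, add_sub_cancel_left, b.σ_add]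
    have hc := b.D.cocycle u v (h'' - (u + v)) r''
    rw [b.act_eq, show v + (h'' - (u + v)) = h'' - u by abel] at hc
    rw [show h'' - u - v = h'' - (u + v) by abel, mul_assoc,
      mul_comm (b.D.σ u (h'' - u) r''), ← hc]
    ac_rfl
  · rintro ⟨⟨h, r⟩, ⟨h', r'⟩, ⟨h'', r''⟩⟩
    change ((b.α (-r'') (b.α (-r') h), r + r' + r''), (b.α (-r'') (h' - b.α (-r') h), r' + r''),
        (h'' - b.α (-r'') (b.α (-r') h) - b.α (-r'') (h' - b.α (-r') h), r'')) =
      ((b.α (-(r' + r'')) h, r + (r' + r'')), (b.α (-r'') h' - b.α (-(r' + r'')) h, r' + r''),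
        (h'' - b.α (-r'') h', r''))
    have e1 : b.α (-(r' + r'')) h = b.α (-r'') (b.α (-r') h) := by
      rw [← b.α_add, neg_add_rev]
    rw [e1, b.α_map_sub, add_assoc, sub_sub, add_sub_cancel]

end Bicrossed

end QG

end

noncomputable section

namespace QG

/-! ### Continuous compactly supported functions in `L²` -/

section Dense

set_option linter.unusedSectionVars false

variable {Y : Type} [NormedAddCommGroup Y] [ProperSpace Y] [MeasureSpace Y] [BorelSpace Y]
  [(volume : Measure Y).Regular]

/-- The class in `L²(Y)` of a continuous compactly supported function. -/
def toL2 (f : C_c(Y, ℂ)) : L2 Y :=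
  (memLp_of_hasCompactSupport f.continuous f.hasCompactSupport).toLp f

theorem toL2_coe (f : C_c(Y, ℂ)) : (toL2 f : Y → ℂ) =ᵐ[volume] f := MemLp.coeFn_toLp _

theorem denseRange_toL2 : DenseRange (toL2 : C_c(Y, ℂ) → L2 Y) := by
  intro ξ
  rw [Metric.mem_closure_iff]
  intro ε hε
  obtain ⟨g, hg, h, hc, hm⟩ := (Lp.memLp ξ).exists_hasCompactSupport_eLpNorm_sub_le
    (by norm_num) (ENNReal.ofReal_pos.2 (half_pos hε)).ne'
  refine ⟨_, Set.mem_range_self (mkCc g hc hg), ?_⟩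
  have h1 : dist ξ (toL2 (mkCc g hc hg)) ≤ ε / 2 := by
    rw [Lp.dist_def]
    refine ENNReal.toReal_le_of_le_ofReal (half_pos hε).le ((le_of_eq ?_).trans h)
    refine eLpNorm_congr_ae ?_
    filter_upwards [toL2_coe (mkCc g hc hg)] with y hy
    simp only [Pi.sub_apply, hy, mkCc_apply]
  linarith

theorem ext_toL2 {E : Type*} [NormedAddCommGroup E] [NormedSpace ℂ E] {S T : L2 Y →L[ℂ] E}
    (h : ∀ f : C_c(Y, ℂ), S (toL2 f) = T (toL2 f)) : S = T := by
  ext1 ξ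
  exact congrFun (denseRange_toL2.equalizer S.continuous T.continuous (funext h)) ξ

theorem ext_inner_toL2 {S T : B Y}
    (h : ∀ v w : C_c(Y, ℂ), ⟪toL2 v, S (toL2 w)⟫_ℂ = ⟪toL2 v, T (toL2 w)⟫_ℂ) : S = T := by
  refine ext_toL2 fun w => ext_inner_left ℂ fun ξ => ?_
  refine denseRange_toL2.induction_on ξ ?_ fun v => h v w
  exact isClosed_eq (by fun_prop) (by fun_prop)

theorem inner_toL2 (v : C_c(Y, ℂ)) {ξ : L2 Y} {g : Y → ℂ} (hg : ξ =ᵐ[volume] g) :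
    ⟪toL2 v, ξ⟫_ℂ = ∫ y, starRingEnd ℂ (v y) * g y := by
  rw [L2.inner_def]
  refine integral_congr_ae ?_
  filter_upwards [toL2_coe v, hg] with y h1 h2
  rw [h1, h2, RCLike.inner_apply, mul_comm]

theorem opNorm_le_of_toL2 {E : Type*} [NormedAddCommGroup E] [NormedSpace ℂ E]
    {T : L2 Y →L[ℂ] E} {C : ℝ} (hC : 0 ≤ C) (h : ∀ f : C_c(Y, ℂ), ‖T (toL2 f)‖ ≤ C * ‖toL2 f‖) :
    ‖T‖ ≤ C := by
  refine T.opNorm_le_bound hC fun ξ => ?_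
  refine denseRange_toL2.induction_on ξ ?_ h
  exact isClosed_le (by fun_prop) (by fun_prop)

theorem lintegral_enorm_sq_toL2 (f : C_c(Y, ℂ)) :
    ∫⁻ y, ‖f y‖ₑ ^ 2 = ENNReal.ofReal (‖toL2 f‖ ^ 2) := by
  rw [toL2, norm_toLp_sq]
  exact lintegral_enorm_sq f.continuous f.hasCompactSupport

end Dense

/-- A continuous compactly supported function on a product is uniformly a limit of sums of
functions `φ(y) f(p)`, with supports in a common compact set. -/
theorem exists_tensor_approx {Y P : Type} [NormedAddCommGroup Y] [ProperSpace Y]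
    [NormedAddCommGroup P] (F : C_c(Y × P, ℂ)) :
    ∃ (K : Set Y) (L : Set P), IsCompact K ∧ IsCompact L ∧ ∀ ε : ℝ, 0 < ε →
      ∃ (n : ℕ) (φ : Fin n → C_c(Y, ℂ)) (f : Fin n → C_c(P, ℂ)), ∀ y p,
        ‖F (y, p) - ∑ i, φ i y * f i p‖ ≤ ε ∧
        (F (y, p) - ∑ i, φ i y * f i p ≠ 0 → y ∈ K ∧ p ∈ L) := by
  have hc : IsCompact (tsupport F) := F.hasCompactSupport
  have hK₀ : IsCompact (Prod.fst '' tsupport F) := hc.image continuous_fst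
  have hL : IsCompact (Prod.snd '' tsupport F) := hc.image continuous_snd
  have hF : ∀ y p, F (y, p) ≠ 0 → y ∈ Prod.fst '' tsupport F ∧ p ∈ Prod.snd '' tsupport F :=
    fun y p h => ⟨⟨_, subset_tsupport _ h, rfl⟩, ⟨_, subset_tsupport _ h, rfl⟩⟩
  have hK : IsCompact (Metric.cthickening 1 (Prod.fst '' tsupport F)) := hK₀.cthickening
  refine ⟨_, _, hK, hL, fun ε hε => ?_⟩
  obtain ⟨δ, hδ, hu⟩ := Metric.uniformContinuous_iff.1
    (F.hasCompactSupport.uniformContinuous_of_continuous F.continuous) ε hε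
  have hδ' : 0 < min δ 1 := lt_min hδ one_pos
  obtain ⟨t, -, ht⟩ := hK.elim_nhds_subcover (fun y => Metric.ball y (min δ 1))
    fun y _ => Metric.ball_mem_nhds y hδ'
  let c : Fin t.card → Y := fun i => (t.equivFin.symm i : Y)
  have hcov : Metric.cthickening 1 (Prod.fst '' tsupport F) ⊆
      ⋃ i, Metric.ball (c i) (min δ 1) := by
    intro y hy
    obtain ⟨x, hx, hxy⟩ := Set.mem_iUnion₂.1 (ht hy)
    exact Set.mem_iUnion.2 ⟨t.equivFin ⟨x, hx⟩, by simpa [c] using hxy⟩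
  obtain ⟨u, hu1, hu2, hu3, hu4⟩ := exists_continuous_sum_one_of_isOpen_isCompact
    (fun i => Metric.isOpen_ball) hK hcov
  have hnear : ∀ i y, u i y ≠ 0 → dist y (c i) < min δ 1 := fun i y h =>
    hu1 i (subset_tsupport _ h)
  have hsec : ∀ i, HasCompactSupport fun p => F (c i, p) := fun i =>
    HasCompactSupport.intro hL fun p hp => by
      by_contra h
      exact hp (hF _ _ h).2
  refine ⟨t.card, fun i => mkCc (fun y => (u i y : ℂ)) (by fun_prop)
    (HasCompactSupport.intro (hu4 i) fun y hy => by
      rw [image_eq_zero_of_notMem_tsupport hy, Complex.ofReal_zero]),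
    fun i => mkCc (fun p => F (c i, p)) (F.continuous.comp (by fun_prop)) (hsec i),
    fun y p => ?_⟩
  simp only [mkCc_apply]
  by_cases hy : y ∈ Metric.cthickening 1 (Prod.fst '' tsupport F)
  · have h1 : ∑ i, (u i y : ℂ) = 1 := by
      have := hu2 hy
      rw [Finset.sum_apply, Pi.one_apply] at this
      exact_mod_cast this
    have h2 : F (y, p) - ∑ i, (u i y : ℂ) * F (c i, p) =
        ∑ i, (u i y : ℂ) * (F (y, p) - F (c i, p)) := by
      simp only [mul_sub, Finset.sum_sub_distrib, ← Finset.sum_mul, h1, one_mul]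
    refine ⟨?_, fun h => ⟨hy, ?_⟩⟩
    · rw [h2]
      calc ‖∑ i, (u i y : ℂ) * (F (y, p) - F (c i, p))‖
          ≤ ∑ i, u i y * ε := by
            refine norm_sum_le_of_le _ fun i _ => ?_
            rw [norm_mul, Complex.norm_real, Real.norm_of_nonneg (hu3 i y).1]
            by_cases h : u i y = 0
            · simp [h]
            refine mul_le_mul_of_nonneg_left ?_ (hu3 i y).1
            have h3 := hu (a := (y, p)) (b := (c i, p)) (by
              rw [Prod.dist_eq, dist_self, max_eq_left dist_nonneg]
              exact (hnear i y h).trans_le (min_le_left _ _))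
            rw [dist_eq_norm] at h3
            exact h3.le
        _ = ε := by
            rw [← Finset.sum_mul]
            have h4 : ∑ i, u i y = 1 := by exact_mod_cast h1
            rw [h4, one_mul]
    · by_contra hp
      refine h ?_
      rw [h2]
      refine Finset.sum_eq_zero fun i _ => ?_
      have h3 : ∀ y', F (y', p) = 0 := fun y' => by
        by_contra h'
        exact hp (hF _ _ h').2
      rw [h3, h3, sub_zero, mul_zero]
  · have h1 : F (y, p) = 0 := by
      by_contra h
      exact hy (Metric.self_subset_cthickening _ (hF _ _ h).1)
    have h2 : ∑ i, (u i y : ℂ) * F (c i, p) = 0 := by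
      refine Finset.sum_eq_zero fun i _ => ?_
      by_contra h
      have h3 : u i y ≠ 0 := fun h0 => h (by rw [h0, Complex.ofReal_zero, zero_mul])
      have h4 : F (c i, p) ≠ 0 := fun h0 => h (by rw [h0, mul_zero])
      exact hy (Metric.mem_cthickening_of_dist_le y (c i) 1 _ (hF _ _ h4).1
        ((hnear i y h3).le.trans (min_le_right _ _)))
    rw [h1, h2, sub_zero, norm_zero]
    exact ⟨hε.le, fun h => absurd rfl h⟩

end QG

end

noncomputable section

namespace QG

/-! ### Operators with compactly supported kernels -/

section Kernel

set_option linter.unusedSectionVars false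

variable {G X : Type} [NormedAddCommGroup G] [NormedSpace ℝ G] [FiniteDimensional ℝ G]
  [MeasureSpace G] [BorelSpace G] [(volume : Measure G).IsAddHaarMeasure]
  [NormedAddCommGroup X] [NormedSpace ℝ X] [FiniteDimensional ℝ X]
  [MeasureSpace X] [BorelSpace X] [(volume : Measure X).IsAddHaarMeasure]
  {Z : Type} [NormedAddCommGroup Z] [ProperSpace Z] [MeasureSpace Z] [BorelSpace Z]
  [(volume : Measure Z).Regular] [SigmaFinite (volume : Measure Z)]
  {Y : Type} [NormedAddCommGroup Y] [ProperSpace Y] [MeasureSpace Y] [BorelSpace Y]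
  [(volume : Measure Y).Regular] [SigmaFinite (volume : Measure Y)]
  (D : TwistedSystem G X) (e : Z ≃ₜ G × X) (he : MeasurePreserving e)

/-- The translation by `t` in the coordinate `G` of `Z ≃ G × X`. -/
def shiftZ (t : G) (z : Z) : Z := e.symm ((e z).1 - t, (e z).2)

theorem continuous_shiftZ : Continuous fun q : G × Z => shiftZ e q.1 q.2 :=
  e.symm.continuous.comp ((((continuous_fst.comp (e.continuous.comp continuous_snd)).sub
    continuous_fst).prodMk (continuous_snd.comp (e.continuous.comp continuous_snd))))

include he in
theorem mp_shiftZ (t : G) : MeasurePreserving (shiftZ e t) :=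
  (he.symm e.toMeasurableEquiv).comp ((mp_shift t).comp he)

/-- The operator `T_F` of the regular representation, transported to `L²(Z)`. -/
def crossOp (F : C_c(G × X, ℂ)) : B Z := conjHom e.toMeasurableEquiv he (regOp D F)

theorem crossOp_toL2_coe (F : C_c(G × X, ℂ)) (w : C_c(Z, ℂ)) :
    (crossOp D e he F (toL2 w) : Z → ℂ) =ᵐ[volume] fun z =>
      ∫ t, regKernel D F t (e z) * w (shiftZ e t z) := by
  have hes : MeasurePreserving e.symm := he.symm e.toMeasurableEquiv
  have h1 : (compOp e.symm hes (toL2 w) : G × X → ℂ) =ᵐ[volume] fun q => w (e.symm q) := by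
    filter_upwards [compOp_coe e.symm hes (toL2 w),
      hes.quasiMeasurePreserving.ae_eq_comp (toL2_coe w)] with q h1 h2
    rw [h1]
    exact h2
  have h2 := ae_ae_shift (Lp.stronglyMeasurable _).measurable
    (w.continuous.comp e.symm.continuous).measurable h1
  have h3 : (regOp D F (compOp e.symm hes (toL2 w)) : G × X → ℂ) =ᵐ[volume] fun p =>
      ∫ t, regKernel D F t p * w (e.symm (p.1 - t, p.2)) := by
    filter_upwards [regOp_coe D F (compOp e.symm hes (toL2 w)), h2] with p h3 h4
    rw [h3]
    refine integral_congr_ae ?_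
    filter_upwards [h4] with t ht
    rw [ht]
    rfl
  filter_upwards [compOp_coe e he (regOp D F (compOp e.symm hes (toL2 w))),
    he.quasiMeasurePreserving.ae_eq_comp h3] with z h4 h5
  exact h4.trans h5

theorem norm_crossOp_le (F : C_c(G × X, ℂ)) {K : Set G} (hK : IsCompact K) {L : Set X}
    (h : ∀ t x, F (t, x) ≠ 0 → t ∈ K ∧ x ∈ L) {ε : ℝ} (hε : 0 ≤ ε) (hF : ∀ p, ‖F p‖ ≤ ε) :
    ‖crossOp D e he F‖ ≤ (volume : Measure G).real K * ε := by
  refine (norm_conjHom e.toMeasurableEquiv he (regOp D F)).le.trans ?_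
  refine ((regRep D).norm_integrated_le (cc F)).trans ?_
  have h1 : ∀ t, ‖cc F t‖ ≤ K.indicator (fun _ => ε) t := by
    intro t
    by_cases ht : t ∈ K
    · rw [Set.indicator_of_mem ht]
      exact norm_C0_le hε fun x => hF _
    · rw [Set.indicator_of_notMem ht]
      refine norm_C0_le le_rfl fun x => ?_
      have h2 : F (t, x) = 0 := by
        by_contra h'
        exact ht (h _ _ h').1
      rw [cc_apply, h2, norm_zero]
  calc ∫ t, ‖cc F t‖ ≤ ∫ t, K.indicator (fun _ => ε) t :=
        integral_mono (integrable_norm _) ((integrable_indicator_iff hK.measurableSet).2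
          (integrableOn_const hK.measure_lt_top.ne)) h1
    _ = _ := by
        rw [integral_indicator hK.measurableSet, setIntegral_const, smul_eq_mul]

theorem crossOp_sub (F F' : C_c(G × X, ℂ)) :
    crossOp D e he (F - F') = crossOp D e he F - crossOp D e he F' := by
  have h : F = F - F' + F' := (sub_add_cancel F F').symm
  have h1 : crossOp D e he (F - F' + F') = crossOp D e he (F - F') + crossOp D e he F' := by
    have h2 : regOp D (F - F' + F') = regOp D (F - F') + regOp D F' := by
      rw [regOp, cc_add, CovariantRep.integrated_add]
      rfl
    exact (congrArg (conjHom e.toMeasurableEquiv he) h2).trans (map_add _ _ _)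
  rw [eq_sub_iff_add_eq, ← h1, ← h]

/-- The operator `Q : L²(Z) → L²(Y × Z)` is given by the kernel `F`: for every `y`, the function
`Q w (y, ·)` is `T_{F(y, ·)} w`. -/
def HasKernel (Q : L2 Z →L[ℂ] L2 (Y × Z)) (F : C_c(Y × (G × X), ℂ)) : Prop :=
  ∀ w : C_c(Z, ℂ), (Q (toL2 w) : Y × Z → ℂ) =ᵐ[volume] fun p =>
    ∫ t, F (p.1, (t, D.act (e p.2).1 (e p.2).2)) * (regPhase D t (e p.2) : ℂ) *
      w (shiftZ e t p.2)

theorem continuous_kernel_integrand (F : C_c(Y × (G × X), ℂ)) (w : C_c(Z, ℂ)) :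
    Continuous fun q : G × (Y × Z) =>
      F (q.2.1, (q.1, D.act (e q.2.2).1 (e q.2.2).2)) * (regPhase D q.1 (e q.2.2) : ℂ) *
        w (shiftZ e q.1 q.2.2) := by
  have h1 : Continuous fun q : G × (Y × Z) => e q.2.2 := e.continuous.comp (by fun_prop)
  have h2 : Continuous fun q : G × (Y × Z) => D.act (e q.2.2).1 (e q.2.2).2 :=
    D.continuous_act.comp h1
  have h3 : Continuous fun q : G × (Y × Z) => (regPhase D q.1 (e q.2.2) : ℂ) :=
    continuous_subtype_val.comp ((continuous_regPhase D).comp (continuous_fst.prodMk h1))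
  have h4 : Continuous fun q : G × (Y × Z) => shiftZ e q.1 q.2.2 :=
    (continuous_shiftZ e).comp (by fun_prop : Continuous fun q : G × (Y × Z) => (q.1, q.2.2))
  exact ((F.continuous.comp ((by fun_prop : Continuous fun q : G × (Y × Z) => q.2.1).prodMk
    (continuous_fst.prodMk h2))).mul h3).mul (w.continuous.comp h4)

theorem integrable_kernel_integrand (F : C_c(Y × (G × X), ℂ)) (w : C_c(Z, ℂ)) (p : Y × Z) :
    Integrable fun t =>
      F (p.1, (t, D.act (e p.2).1 (e p.2).2)) * (regPhase D t (e p.2) : ℂ) *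
        w (shiftZ e t p.2) := by
  have hc : IsCompact (tsupport F) := F.hasCompactSupport
  refine ((continuous_kernel_integrand D e F w).comp
    (by fun_prop : Continuous fun t : G => (t, p))).integrable_of_hasCompactSupport
    (HasCompactSupport.intro ((hc.image continuous_snd).image continuous_fst) fun t ht => ?_)
  have h : F (p.1, (t, D.act (e p.2).1 (e p.2).2)) = 0 := by
    by_contra h
    exact ht ⟨_, ⟨_, subset_tsupport _ h, rfl⟩, rfl⟩
  simp only [Function.comp_apply, h, zero_mul]

variable {D e}

theorem HasKernel.add {Q Q' : L2 Z →L[ℂ] L2 (Y × Z)} {F F' : C_c(Y × (G × X), ℂ)}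
    (h : HasKernel D e Q F) (h' : HasKernel D e Q' F') : HasKernel D e (Q + Q') (F + F') := by
  intro w
  filter_upwards [h w, h' w, Lp.coeFn_add (Q (toL2 w)) (Q' (toL2 w))] with p h1 h2 h3
  change (Q (toL2 w) + Q' (toL2 w) : L2 (Y × Z)) p = _
  rw [h3, Pi.add_apply, h1, h2, ← integral_add (integrable_kernel_integrand D e F w p)
    (integrable_kernel_integrand D e F' w p)]
  refine integral_congr_ae (Filter.Eventually.of_forall fun t => ?_)
  simp only [CompactlySupportedContinuousMap.add_apply]
  ring

theorem HasKernel.sub {Q Q' : L2 Z →L[ℂ] L2 (Y × Z)} {F F' : C_c(Y × (G × X), ℂ)}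
    (h : HasKernel D e Q F) (h' : HasKernel D e Q' F') : HasKernel D e (Q - Q') (F - F') := by
  intro w
  filter_upwards [h w, h' w, Lp.coeFn_sub (Q (toL2 w)) (Q' (toL2 w))] with p h1 h2 h3
  change (Q (toL2 w) - Q' (toL2 w) : L2 (Y × Z)) p = _
  rw [h3, Pi.sub_apply, h1, h2, ← integral_sub (integrable_kernel_integrand D e F w p)
    (integrable_kernel_integrand D e F' w p)]
  refine integral_congr_ae (Filter.Eventually.of_forall fun t => ?_)
  simp only [CompactlySupportedContinuousMap.sub_apply]
  ring

theorem hasKernel_zero : HasKernel D e (0 : L2 Z →L[ℂ] L2 (Y × Z)) 0 := by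
  intro w
  filter_upwards [Lp.coeFn_zero ℂ 2 (volume : Measure (Y × Z))] with p h
  change (0 : L2 (Y × Z)) p = _
  rw [h]
  simp

theorem HasKernel.sum {ι : Type} (s : Finset ι) {Q : ι → L2 Z →L[ℂ] L2 (Y × Z)}
    {F : ι → C_c(Y × (G × X), ℂ)} (h : ∀ i, HasKernel D e (Q i) (F i)) :
    HasKernel D e (∑ i ∈ s, Q i) (∑ i ∈ s, F i) := by
  classical
  induction s using Finset.induction_on with
  | empty => simpa using hasKernel_zero
  | insert i s hi ih =>
    rw [Finset.sum_insert hi, Finset.sum_insert hi]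
    exact (h i).add ih

/-- The function `(y, p) ↦ φ(y) f(p)`. -/
def tensCc {P : Type} [TopologicalSpace P] [T2Space P] (φ : C_c(Y, ℂ)) (f : C_c(P, ℂ)) :
    C_c(Y × P, ℂ) :=
  mkCc (fun q => φ q.1 * f q.2) (by have := φ.continuous; have := f.continuous; fun_prop)
    (HasCompactSupport.intro (K := tsupport φ ×ˢ tsupport f)
      (IsCompact.prod φ.hasCompactSupport f.hasCompactSupport) fun q hq => by
      by_cases h : q.1 ∈ tsupport φ
      · have h' : q.2 ∉ tsupport f := fun h' => hq ⟨h, h'⟩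
        rw [image_eq_zero_of_notMem_tsupport h', mul_zero]
      · rw [image_eq_zero_of_notMem_tsupport h, zero_mul])

theorem hasKernel_tmul (φ : C_c(Y, ℂ)) (f : C_c(G × X, ℂ)) :
    HasKernel D e (tmul (toL2 φ) ∘L crossOp D e he f) (tensCc φ f) := by
  intro w
  filter_upwards [tmulFun_coe (toL2 φ) (crossOp D e he f (toL2 w)),
    Measure.quasiMeasurePreserving_fst.ae_eq_comp (toL2_coe φ),
    Measure.quasiMeasurePreserving_snd.ae_eq_comp (crossOp_toL2_coe D e he f w)] with p h1 h2 h3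
  refine h1.trans ?_
  simp only [Function.comp_apply] at h2 h3
  rw [h2, h3, ← integral_const_mul]
  refine integral_congr_ae (Filter.Eventually.of_forall fun t => ?_)
  simp only [tensCc, mkCc_apply, regKernel]
  ring

include he in
/-- Schur's test for operators with a kernel of small supremum norm and controlled support. -/
theorem HasKernel.norm_le {Q : L2 Z →L[ℂ] L2 (Y × Z)} {F : C_c(Y × (G × X), ℂ)}
    (h : HasKernel D e Q F) {K : Set Y} {L : Set G} (hK : IsCompact K) (hL : IsCompact L)
    {ε : ℝ} (hε : 0 ≤ ε) (hF : ∀ y p, ‖F (y, p)‖ ≤ ε)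
    (hs : ∀ y t x, F (y, (t, x)) ≠ 0 → y ∈ K ∧ t ∈ L) :
    ‖Q‖ ≤ √((volume : Measure Y).real K) * (volume : Measure G).real L * ε := by
  refine opNorm_le_of_toL2 (by positivity) fun w => ?_
  rw [Lp.norm_def (Q (toL2 w))]
  refine ENNReal.toReal_le_of_le_ofReal (by positivity) ?_
  rw [eLpNorm_congr_ae (h w)]
  refine eLpNorm_two_le (by positivity) ?_
  let f : G → Y × Z → ℝ≥0∞ := fun t p =>
    K.indicator (fun _ => ENNReal.ofReal ε) p.1 * ‖w (shiftZ e t p.2)‖ₑ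
  have hm : Measurable (Function.uncurry f) := by
    refine Measurable.mul ?_ ?_
    · exact (measurable_const.indicator hK.measurableSet).comp
        (measurable_fst.comp measurable_snd)
    · exact ((w.continuous.comp ((continuous_shiftZ e).comp
        (by fun_prop : Continuous fun q : G × (Y × Z) => (q.1, q.2.2)))).enorm).measurable
  have hC : ∀ t ∈ L, ∫⁻ p, f t p ^ 2 ≤
      ENNReal.ofReal ((volume : Measure Y).real K * ε ^ 2 * ‖toL2 w‖ ^ 2) := by
    intro t _
    have h1 : ∀ p : Y × Z, f t p ^ 2 =
        K.indicator (fun _ => ENNReal.ofReal ε ^ 2) p.1 * ‖w (shiftZ e t p.2)‖ₑ ^ 2 := by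
      intro p
      simp only [f, mul_pow]
      by_cases hp : p.1 ∈ K <;> simp [hp]
    have hw : Measurable fun z => ‖w (shiftZ e t z)‖ₑ ^ 2 :=
      ((w.continuous.comp ((continuous_shiftZ e).comp
        (by fun_prop : Continuous fun z : Z => (t, z)))).enorm).measurable.pow_const 2
    have h2 : ∫⁻ z, ‖w (shiftZ e t z)‖ₑ ^ 2 = ENNReal.ofReal (‖toL2 w‖ ^ 2) := by
      rw [← lintegral_enorm_sq_toL2]
      exact (mp_shiftZ e he t).lintegral_comp (f := fun z => ‖w z‖ₑ ^ 2)
        (w.continuous.enorm.measurable.pow_const 2)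
    rw [lintegral_congr h1, Measure.volume_eq_prod,
      lintegral_prod_mul (f := fun y => K.indicator (fun _ => ENNReal.ofReal ε ^ 2) y)
        (g := fun z => ‖w (shiftZ e t z)‖ₑ ^ 2)
        (measurable_const.indicator hK.measurableSet).aemeasurable hw.aemeasurable, h2,
      lintegral_indicator hK.measurableSet, setLIntegral_const,
      ENNReal.ofReal_mul (by positivity), ENNReal.ofReal_mul (by positivity),
      ENNReal.ofReal_pow hε, ofReal_measureReal hK.measure_lt_top.ne, mul_comm (volume K)]
  calc _ ≤ ∫⁻ p, (∫⁻ t in L, f t p) ^ 2 := by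
        refine lintegral_mono fun p => ?_
        gcongr
        rw [← lintegral_indicator hL.measurableSet]
        refine (enorm_integral_le_lintegral_enorm _).trans (lintegral_mono fun t => ?_)
        by_cases h0 : F (p.1, (t, D.act (e p.2).1 (e p.2).2)) = 0
        · simp [h0]
        obtain ⟨h1, h2⟩ := hs _ _ _ h0
        rw [Set.indicator_of_mem h2]
        simp only [f]
        rw [Set.indicator_of_mem h1, enorm_mul, enorm_mul]
        have h3 : ‖(regPhase D t (e p.2) : ℂ)‖ₑ = 1 := by
          rw [← ofReal_norm, Circle.norm_coe, ENNReal.ofReal_one]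
        rw [h3, mul_one]
        gcongr
        rw [← ofReal_norm]
        exact ENNReal.ofReal_le_ofReal (hF _ _)
    _ ≤ volume L * (volume L *
          ENNReal.ofReal ((volume : Measure Y).real K * ε ^ 2 * ‖toL2 w‖ ^ 2)) :=
        lintegral_sq_lintegral_le volume volume hm L hC hL.measurableSet
    _ = _ := by
        rw [← ofReal_measureReal hL.measure_lt_top.ne, ← ENNReal.ofReal_mul (by positivity),
          ← ENNReal.ofReal_mul (by positivity)]
        congr 1
        have h1 := Real.sq_sqrt (measureReal_nonneg (μ := (volume : Measure Y)) (s := K))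
        simp only [mul_pow, h1]
        ring

/-- An operator with a continuous compactly supported kernel belongs to the closed linear span of
the operators `w ↦ φ ⊗ T_f w`. -/
theorem HasKernel.mem_cspan {Q : L2 Z →L[ℂ] L2 (Y × Z)} {F : C_c(Y × (G × X), ℂ)}
    (h : HasKernel D e Q F) :
    Q ∈ cspan {T : L2 Z →L[ℂ] L2 (Y × Z) |
      ∃ (φ : L2 Y) (f : C_c(G × X, ℂ)), T = tmul φ ∘L crossOp D e he f} := by
  change Q ∈ closure _
  rw [Metric.mem_closure_iff]
  intro ε hε
  obtain ⟨K, L, hK, hL, hKL⟩ := exists_tensor_approx F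
  have hL' : IsCompact (Prod.fst '' L) := hL.image continuous_fst
  obtain ⟨C, hC⟩ : ∃ C : ℝ, √((volume : Measure Y).real K) *
    (volume : Measure G).real (Prod.fst '' L) = C := ⟨_, rfl⟩
  have hC0 : 0 ≤ C := hC ▸ by positivity
  obtain ⟨n, φ, f, hφ⟩ := hKL (ε / (C + 1)) (by positivity)
  refine ⟨∑ i, tmul (toL2 (φ i)) ∘L crossOp D e he (f i), Submodule.sum_mem _ fun i _ =>
    Submodule.subset_span ⟨_, _, rfl⟩, ?_⟩
  have hk := h.sub (HasKernel.sum Finset.univ fun i => hasKernel_tmul he (φ i) (f i))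
  have hv : ∀ y p, (F - ∑ i, tensCc (φ i) (f i)) (y, p) = F (y, p) - ∑ i, φ i y * f i p := by
    intro y p
    rw [CompactlySupportedContinuousMap.sub_apply, CompactlySupportedContinuousMap.sum_apply]
    rfl
  have hn := hk.norm_le he hK hL' (ε := ε / (C + 1)) (by positivity)
    (fun y p => by rw [hv]; exact (hφ y p).1)
    (fun y t x h' => by
      rw [hv] at h'
      exact ⟨((hφ _ _).2 h').1, _, ((hφ _ _).2 h').2, rfl⟩)
  rw [dist_eq_norm]
  refine hn.trans_lt ?_
  rw [hC, ← mul_div_assoc, div_lt_iff₀ (by positivity)]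
  nlinarith

end Kernel

end QG

end

noncomputable section

namespace QG

/-! ### Mollifiers and changes of variables -/

section Mollifier

variable {V : Type} [NormedAddCommGroup V] [NormedSpace ℝ V] [FiniteDimensional ℝ V]
  [MeasureSpace V] [BorelSpace V] [(volume : Measure V).IsAddHaarMeasure]

/-- Smearing a jointly continuous function near `0` reproduces its value at `0`, uniformly on
compact sets. -/
theorem exists_mollifier {P : Type} [NormedAddCommGroup P] {Φ : V × P → ℂ} (hΦ : Continuous Φ)
    {C : Set P} (hC : IsCompact C) {ε : ℝ} (hε : 0 < ε) :
    ∃ φ : V → ℝ, Continuous φ ∧ HasCompactSupport φ ∧ (∀ s, φ s ≠ 0 → ‖s‖ < 1) ∧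
      ∀ p ∈ C, ‖(∫ s, (φ s : ℂ) * Φ (s, p)) - Φ (0, p)‖ ≤ ε := by
  obtain ⟨δ, hδ, hu⟩ := Metric.uniformContinuousOn_iff.1
    (((isCompact_closedBall (0 : V) 1).prod hC).uniformContinuousOn_of_continuous
      hΦ.continuousOn) ε hε
  have hr : 0 < min δ 1 := lt_min hδ one_pos
  let b : ContDiffBump (0 : V) := ⟨min δ 1 / 2, min δ 1, by positivity, by linarith⟩
  have hs : ∀ s, b.normed volume s ≠ 0 → ‖s‖ < min δ 1 := by
    intro s hs
    have h1 : s ∈ Function.support (b.normed volume) := hs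
    rwa [b.support_normed_eq, mem_ball_zero_iff] at h1
  have hc : Continuous (b.normed volume : V → ℝ) := b.continuous_normed
  have hcs : HasCompactSupport (b.normed volume : V → ℝ) := b.hasCompactSupport_normed
  refine ⟨b.normed volume, hc, hcs, fun s h => (hs s h).trans_le (min_le_right _ _),
    fun p hp => ?_⟩
  have hint : ∀ g : V → ℂ, Continuous g → Integrable fun s => (b.normed volume s : ℂ) * g s := by
    intro g hg
    refine Continuous.integrable_of_hasCompactSupport (by fun_prop)
      (HasCompactSupport.intro hcs fun s hs => ?_)
    rw [image_eq_zero_of_notMem_tsupport hs, Complex.ofReal_zero, zero_mul]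
  have h1 : ∫ s, (b.normed volume s : ℂ) * Φ (0, p) = Φ (0, p) := by
    rw [integral_mul_const, integral_complex_ofReal, b.integral_normed, Complex.ofReal_one,
      one_mul]
  have h2 : (∫ s, (b.normed volume s : ℂ) * Φ (s, p)) - Φ (0, p) =
      ∫ s, (b.normed volume s : ℂ) * (Φ (s, p) - Φ (0, p)) := by
    have h3 := integral_sub (hint (fun s => Φ (s, p)) (hΦ.comp (by fun_prop)))
      (hint (fun _ => Φ (0, p)) continuous_const)
    rw [h1] at h3
    rw [← h3]
    simp only [mul_sub]
  rw [h2]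
  calc ‖∫ s, (b.normed volume s : ℂ) * (Φ (s, p) - Φ (0, p))‖
      ≤ ∫ s, b.normed volume s * ε := by
        refine norm_integral_le_of_norm_le ((hc.integrable_of_hasCompactSupport hcs).mul_const ε)
          (Filter.Eventually.of_forall fun s => ?_)
        rw [norm_mul, Complex.norm_real, Real.norm_of_nonneg (b.nonneg_normed s)]
        by_cases h : b.normed volume s = 0
        · simp [h]
        refine mul_le_mul_of_nonneg_left ?_ (b.nonneg_normed s)
        have h4 := hs s h
        have h5 := hu (s, p) ⟨mem_closedBall_zero_iff.2
          (h4.le.trans (min_le_right _ _)), hp⟩ (0, p)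
          ⟨Metric.mem_closedBall_self zero_le_one, hp⟩ (by
            rw [Prod.dist_eq, dist_self, max_eq_left dist_nonneg, dist_zero_right]
            exact h4.trans_le (min_le_left _ _))
        rw [dist_eq_norm] at h5
        exact h5.le
    _ = ε := by rw [integral_mul_const, b.integral_normed, one_mul]

end Mollifier

section Twist

/-- The function `p ↦ θ(p) f(ψ(p))` for a homeomorphism `ψ`. -/
def twistCc {P Q : Type} [TopologicalSpace P] [TopologicalSpace Q] (θ : P → Circle)
    (hθ : Continuous θ) (ψ : P ≃ₜ Q) (f : C_c(Q, ℂ)) : C_c(P, ℂ) :=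
  mkCc (fun p => (θ p : ℂ) * f (ψ p))
    ((continuous_subtype_val.comp hθ).mul (f.continuous.comp ψ.continuous))
    (HasCompactSupport.mul_left (f.hasCompactSupport.comp_homeomorph ψ))

theorem twistCc_apply {P Q : Type} [TopologicalSpace P] [TopologicalSpace Q] (θ : P → Circle)
    (hθ : Continuous θ) (ψ : P ≃ₜ Q) (f : C_c(Q, ℂ)) (p : P) :
    twistCc θ hθ ψ f p = (θ p : ℂ) * f (ψ p) := rfl

/-- The complex conjugate of a function. -/
def conjCc {P : Type} [TopologicalSpace P] [R1Space P] (f : C_c(P, ℂ)) : C_c(P, ℂ) :=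
  mkCc (fun p => starRingEnd ℂ (f p)) (Complex.continuous_conj.comp f.continuous)
    (HasCompactSupport.intro f.hasCompactSupport fun p hp => by
      rw [image_eq_zero_of_notMem_tsupport hp, map_zero])

set_option linter.unusedSectionVars false

variable {Y Z : Type} [NormedAddCommGroup Y] [ProperSpace Y] [MeasureSpace Y] [BorelSpace Y]
  [(volume : Measure Y).Regular] [SigmaFinite (volume : Measure Y)]
  [NormedAddCommGroup Z] [ProperSpace Z] [MeasureSpace Z] [BorelSpace Z]
  [(volume : Measure Z).Regular] [SigmaFinite (volume : Measure Z)]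

theorem tmul_toL2_coe (f : C_c(Y, ℂ)) (g : C_c(Z, ℂ)) :
    (tmul (toL2 f) (toL2 g) : Y × Z → ℂ) =ᵐ[volume] tensCc f g := by
  filter_upwards [tmulFun_coe (toL2 f) (toL2 g),
    Measure.quasiMeasurePreserving_fst.ae_eq_comp (toL2_coe f),
    Measure.quasiMeasurePreserving_snd.ae_eq_comp (toL2_coe g)] with p h1 h2 h3
  simp only [Function.comp_apply] at h2 h3
  refine h1.trans ?_
  rw [h2, h3]
  rfl

end Twist

section Columns

variable {Z : Type} [MeasureSpace Z] [SigmaFinite (volume : Measure Z)]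

theorem legFst_rankOne_mul_legSnd (ξ η : L2 Z) (a : B Z) :
    (legFst (rankOne ξ η) * legSnd a : B (Z × Z)) =
      tmul ξ ∘L a ∘L ContinuousLinearMap.adjoint (tensLeft η) := by
  refine ext_tmul fun u v => ?_
  have h : ContinuousLinearMap.adjoint (tensLeft η) (tmul u v) = ⟪η, u⟫_ℂ • v := by
    refine ext_inner_left ℂ fun w => ?_
    rw [ContinuousLinearMap.adjoint_inner_right, inner_smul_right]
    exact inner_tmul η u w v
  change legFst (rankOne ξ η) (legSnd a (tmul u v)) =
    tmul ξ (a (ContinuousLinearMap.adjoint (tensLeft η) (tmul u v)))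
  rw [h, legSnd_tmul, legFst_tmul, rankOne_apply]
  simp only [map_smul, smul_apply]

theorem legFst_mul_legSnd_rankOne (ξ η : L2 Z) (a : B Z) :
    (legFst a * legSnd (rankOne ξ η) : B (Z × Z)) =
      tensRight ξ ∘L a ∘L ContinuousLinearMap.adjoint (tensRight η) := by
  refine ext_tmul fun u v => ?_
  have h : ContinuousLinearMap.adjoint (tensRight η) (tmul u v) = ⟪η, v⟫_ℂ • u := by
    refine ext_inner_left ℂ fun w => ?_
    rw [ContinuousLinearMap.adjoint_inner_right, inner_smul_right, mul_comm]
    exact inner_tmul w u η v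
  change legFst a (legSnd (rankOne ξ η) (tmul u v)) =
    tensRight ξ (a (ContinuousLinearMap.adjoint (tensRight η) (tmul u v)))
  rw [h, legSnd_tmul, legFst_tmul, rankOne_apply]
  simp only [map_smul]
  rfl

theorem continuous_tensLeft : Continuous (tensLeft : L2 Z → L2 Z →L[ℂ] L2 (Z × Z)) :=
  (tmul (X := Z) (Y := Z)).continuous

theorem continuous_tensRight : Continuous (tensRight : L2 Z → L2 Z →L[ℂ] L2 (Z × Z)) :=
  (tmul (X := Z) (Y := Z)).flip.continuous

end Columns

section Closures

set_option linter.unusedSectionVars false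

variable {Z : Type} [NormedAddCommGroup Z] [ProperSpace Z] [MeasureSpace Z] [BorelSpace Z]
  [(volume : Measure Z).Regular] [SigmaFinite (volume : Measure Z)] {V : B (Z × Z)}
  {A : NonUnitalStarSubalgebra ℂ (B Z)}

theorem eq_leftAlg (hA : IsClosed (A : Set (B Z)))
    (h1 : ∀ η ξ : C_c(Z, ℂ), leftSlice (vec (toL2 η) (toL2 ξ)) V ∈ A)
    (h2 : (A : Set (B Z)) ⊆ leftAlg V) : (A : Set (B Z)) = leftAlg V := by
  refine h2.antisymm (closure_minimal ?_ hA)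
  rintro _ ⟨ω, hω, rfl⟩
  refine IsNormal.mem_of_vec (leftSliceAt V) A.toNonUnitalSubalgebra.toSubmodule hA
    (fun η ξ => ?_) hω
  change leftSlice (vec η ξ) V ∈ A
  refine denseRange_toL2.induction_on η ?_ fun η' => ?_
  · refine hA.preimage (f := fun η => leftSlice (vec η ξ) V) ?_
    simp only [leftSlice_vec]
    exact ((ContinuousLinearMap.adjoint (𝕜 := ℂ)).continuous.comp continuous_tensLeft).clm_comp
      continuous_const
  refine denseRange_toL2.induction_on ξ ?_ fun ξ' => h1 η' ξ'
  refine hA.preimage (f := fun ξ => leftSlice (vec (toL2 η') ξ) V) ?_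
  simp only [leftSlice_vec]
  exact continuous_const.clm_comp (continuous_const.clm_comp continuous_tensLeft)

theorem eq_rightAlg (hA : IsClosed (A : Set (B Z)))
    (h1 : ∀ η ξ : C_c(Z, ℂ), rightSlice (vec (toL2 η) (toL2 ξ)) V ∈ A)
    (h2 : (A : Set (B Z)) ⊆ rightAlg V) : (A : Set (B Z)) = rightAlg V := by
  refine h2.antisymm (closure_minimal ?_ hA)
  rintro _ ⟨ω, hω, rfl⟩
  refine IsNormal.mem_of_vec (rightSliceAt V) A.toNonUnitalSubalgebra.toSubmodule hA
    (fun η ξ => ?_) hω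
  change rightSlice (vec η ξ) V ∈ A
  refine denseRange_toL2.induction_on η ?_ fun η' => ?_
  · refine hA.preimage (f := fun η => rightSlice (vec η ξ) V) ?_
    simp only [rightSlice_vec]
    exact ((ContinuousLinearMap.adjoint (𝕜 := ℂ)).continuous.comp continuous_tensRight).clm_comp
      continuous_const
  refine denseRange_toL2.induction_on ξ ?_ fun ξ' => h1 η' ξ'
  refine hA.preimage (f := fun ξ => rightSlice (vec (toL2 η') ξ) V) ?_
  simp only [rightSlice_vec]
  exact continuous_const.clm_comp (continuous_const.clm_comp continuous_tensRight)

/-- It suffices to test `V (𝓚 ⊗ A) ⊆ 𝓚 ⊗ A` on the columns `w ↦ V (ξ ⊗ T w)`, for `ξ` in a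
dense subspace and `T` in a dense subset of `A`. -/
theorem mul_mem_cspan_compactLeft {ι : Type*} {c : ι → B Z}
    (hA : (A : Set (B Z)) = closure (Set.range c))
    (h : ∀ (ξ : C_c(Z, ℂ)) (i : ι), V ∘L tensLeft (toL2 ξ) ∘L c i ∈
      cspan {T : L2 Z →L[ℂ] L2 (Z × Z) | ∃ φ j, T = tmul φ ∘L c j}) :
    ∀ t ∈ compactLeft A, V * t ∈ cspan (compactLeft A) := by
  have h1 : ∀ (ξ : L2 Z) (a : B Z), a ∈ A → V ∘L tensLeft ξ ∘L a ∈
      cspan {T : L2 Z →L[ℂ] L2 (Z × Z) | ∃ φ j, T = tmul φ ∘L c j} := by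
    intro ξ a ha
    refine denseRange_toL2.induction_on ξ ?_ fun ξ' => ?_
    · refine (isClosed_cspan _).preimage (f := fun ξ : L2 Z => V ∘L tensLeft ξ ∘L a) ?_
      exact continuous_const.clm_comp (continuous_tensLeft.clm_comp continuous_const)
    · have hcl : closure (Set.range c) ⊆ (fun a : B Z => V ∘L tensLeft (toL2 ξ') ∘L a) ⁻¹'
          (cspan {T : L2 Z →L[ℂ] L2 (Z × Z) | ∃ φ j, T = tmul φ ∘L c j} : Set _) := by
        refine closure_minimal (Set.range_subset_iff.2 fun i => h ξ' i) ?_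
        exact (isClosed_cspan _).preimage
          (continuous_const.clm_comp (continuous_const.clm_comp continuous_id))
      exact hcl (hA ▸ ha)
  rintro _ ⟨ξ, η, a, ha, rfl⟩
  rw [legFst_rankOne_mul_legSnd]
  let f : (L2 Z →L[ℂ] L2 (Z × Z)) →L[ℂ] B (Z × Z) :=
    (ContinuousLinearMap.compL ℂ (L2 (Z × Z)) (L2 Z) (L2 (Z × Z))).flip
      (ContinuousLinearMap.adjoint (tensLeft η))
  refine map_mem_of_mem_cspan f (isClosed_cspan _) ?_ (h1 ξ a ha)
  rintro _ ⟨φ, j, rfl⟩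
  refine subset_cspan ⟨φ, η, c j, ?_, (legFst_rankOne_mul_legSnd φ η (c j)).symm⟩
  have : c j ∈ (A : Set (B Z)) := hA ▸ subset_closure (Set.mem_range_self j)
  exact this

/-- The analogue of `mul_mem_cspan_compactLeft` for `A ⊗ 𝓚`; the tensor factors are exchanged
in order to write the columns with the variable of `A` in the second place. -/
theorem mul_mem_cspan_compactRight {ι : Type*} {c : ι → B Z}
    (hA : (A : Set (B Z)) = closure (Set.range c))
    (h : ∀ (ξ : C_c(Z, ℂ)) (i : ι),
      compOp (MeasurableEquiv.prodComm : Z × Z ≃ᵐ Z × Z) mp_prodComm ∘L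
        V ∘L tensRight (toL2 ξ) ∘L c i ∈
      cspan {T : L2 Z →L[ℂ] L2 (Z × Z) | ∃ φ j, T = tmul φ ∘L c j}) :
    ∀ t ∈ compactRight A, V * t ∈ cspan (compactRight A) := by
  let S : B (Z × Z) := compOp (MeasurableEquiv.prodComm : Z × Z ≃ᵐ Z × Z) mp_prodComm
  have hSS : ∀ u, S (S u) = u := fun u => by
    change compOp _ _ (compOp _ _ u) = u
    rw [compOp_comp]
    exact compOp_id _ _ _ fun _ => rfl
  have h1 : ∀ (ξ : L2 Z) (a : B Z), a ∈ A → S ∘L V ∘L tensRight ξ ∘L a ∈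
      cspan {T : L2 Z →L[ℂ] L2 (Z × Z) | ∃ φ j, T = tmul φ ∘L c j} := by
    intro ξ a ha
    refine denseRange_toL2.induction_on ξ ?_ fun ξ' => ?_
    · refine (isClosed_cspan _).preimage (f := fun ξ : L2 Z => S ∘L V ∘L tensRight ξ ∘L a) ?_
      exact continuous_const.clm_comp
        (continuous_const.clm_comp (continuous_tensRight.clm_comp continuous_const))
    · have hcl : closure (Set.range c) ⊆ (fun a : B Z => S ∘L V ∘L tensRight (toL2 ξ') ∘L a) ⁻¹'
          (cspan {T : L2 Z →L[ℂ] L2 (Z × Z) | ∃ φ j, T = tmul φ ∘L c j} : Set _) := by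
        refine closure_minimal (Set.range_subset_iff.2 fun i => h ξ' i) ?_
        exact (isClosed_cspan _).preimage (continuous_const.clm_comp
          (continuous_const.clm_comp (continuous_const.clm_comp continuous_id)))
      exact hcl (hA ▸ ha)
  rintro _ ⟨ξ, η, a, ha, rfl⟩
  rw [legFst_mul_legSnd_rankOne]
  let f : (L2 Z →L[ℂ] L2 (Z × Z)) →L[ℂ] B (Z × Z) :=
    (ContinuousLinearMap.compL ℂ (L2 (Z × Z)) (L2 (Z × Z)) (L2 (Z × Z)) S) ∘L
    (ContinuousLinearMap.compL ℂ (L2 (Z × Z)) (L2 Z) (L2 (Z × Z))).flip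
      (ContinuousLinearMap.adjoint (tensRight η))
  have hf : f (S ∘L V ∘L tensRight ξ ∘L a) =
      V * (tensRight ξ ∘L a ∘L ContinuousLinearMap.adjoint (tensRight η)) :=
    ContinuousLinearMap.ext fun u => hSS _
  rw [← hf]
  refine map_mem_of_mem_cspan f (isClosed_cspan _) ?_ (h1 ξ a ha)
  rintro _ ⟨φ, j, rfl⟩
  have hj : c j ∈ (A : Set (B Z)) := hA ▸ subset_closure (Set.mem_range_self j)
  refine subset_cspan ⟨φ, η, c j, hj, ?_⟩
  rw [legFst_mul_legSnd_rankOne]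
  exact ContinuousLinearMap.ext fun u => compOp_swap_tmul _ _

end Closures

end QG

end

noncomputable section

namespace QG

/-! ### The left algebra of the multiplicative unitary -/

namespace Bicrossed

set_option linter.unusedSectionVars false

variable {G X : Type} [NormedAddCommGroup G] [NormedSpace ℝ G] [FiniteDimensional ℝ G]
  [MeasureSpace G] [BorelSpace G] [(volume : Measure G).IsAddHaarMeasure]
  [NormedAddCommGroup X] [NormedSpace ℝ X] [FiniteDimensional ℝ X]
  [MeasureSpace X] [BorelSpace X] [(volume : Measure X).IsAddHaarMeasure]
  (b : Bicrossed G X)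

/-- The automorphism `α_r` as a homeomorphism. -/
def αHomeo (r : X) : G ≃ₜ G where
  toFun := b.α r
  invFun := b.α (-r)
  left_inv h := b.α_neg_α r h
  right_inv h := b.α_α_neg r h
  continuous_toFun := b.continuous_α_comp continuous_const continuous_id
  continuous_invFun := b.continuous_α_comp continuous_const continuous_id

/-- The operators `T_F` in the regular representation of `C₀(X) ⋊ G`. -/
def leftOp (F : C_c(G × X, ℂ)) : B (G × X) :=
  crossOp b.D (Homeomorph.refl (G × X)) (.id _) F

theorem regPhase_D (t : G) (p : G × X) : regPhase b.D t p = b.D.σ t (p.1 - t) p.2 := by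
  rw [regPhase, b.act_eq]

theorem leftOp_coe (F : C_c(G × X, ℂ)) (w : C_c(G × X, ℂ)) :
    (b.leftOp F (toL2 w) : G × X → ℂ) =ᵐ[volume] fun p =>
      ∫ t, F (t, p.2) * (b.D.σ t (p.1 - t) p.2 : ℂ) * w (p.1 - t, p.2) := by
  filter_upwards [crossOp_toL2_coe b.D (Homeomorph.refl (G × X)) (.id _) F w] with p hp
  refine hp.trans (integral_congr_ae (Filter.Eventually.of_forall fun t => ?_))
  simp only [regKernel, regPhase_D, b.act_eq, shiftZ, Homeomorph.refl_apply,
    Homeomorph.refl_symm, id_eq]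

theorem leftOp_sub (F F' : C_c(G × X, ℂ)) : b.leftOp (F - F') = b.leftOp F - b.leftOp F' :=
  crossOp_sub _ _ _ _ _

theorem W_toL2_coe {u : L2 ((G × X) × (G × X))} {f : (G × X) × (G × X) → ℂ}
    (hu : u =ᵐ[volume] f) :
    (b.W u : (G × X) × (G × X) → ℂ) =ᵐ[volume] fun p => (b.phase p : ℂ) * f (b.phi p) := by
  filter_upwards [b.W_coe u, b.mp_phi.quasiMeasurePreserving.ae_eq_comp hu] with p h1 h2
  simp only [Function.comp_apply] at h2
  rw [h1, h2]

theorem star_W_toL2_coe {u : L2 ((G × X) × (G × X))} {f : (G × X) × (G × X) → ℂ}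
    (hu : u =ᵐ[volume] f) :
    (star b.W u : (G × X) × (G × X) → ℂ) =ᵐ[volume] fun p =>
      ((b.D.σ p.1.1 p.2.1 p.2.2)⁻¹ : Circle) * f (b.phi.symm p) := by
  filter_upwards [b.star_W_coe u, b.mp_phi_symm.quasiMeasurePreserving.ae_eq_comp hu] with p h1 h2
  simp only [Function.comp_apply] at h2
  rw [h1, h2]

/-- The matrix coefficients of `W` on continuous compactly supported functions, with an
integrand which is itself continuous and compactly supported. -/
theorem inner_tmul_W (η v ξ w : C_c(G × X, ℂ)) :
    ∃ H : C_c((G × X) × (G × X), ℂ),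
      (∀ p, H p = starRingEnd ℂ (η p.1 * v p.2) *
        ((b.phase p : ℂ) * (ξ (b.phi p).1 * w (b.phi p).2))) ∧
      ⟪tmul (toL2 η) (toL2 v), b.W (tmul (toL2 ξ) (toL2 w))⟫_ℂ = ∫ p, H p := by
  refine ⟨mkCc (fun p => conjCc (tensCc η v) p * twistCc b.phase b.continuous_phase b.phi
      (tensCc ξ w) p) (by
        have h1 := (conjCc (tensCc η v)).continuous
        have h2 := (twistCc b.phase b.continuous_phase b.phi (tensCc ξ w)).continuous
        exact h1.mul h2)
      (HasCompactSupport.mul_right (conjCc (tensCc η v)).hasCompactSupport), fun p => rfl, ?_⟩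
  rw [L2.inner_def]
  refine integral_congr_ae ?_
  filter_upwards [tmul_toL2_coe η v, b.W_toL2_coe (tmul_toL2_coe ξ w)] with p h1 h2
  rw [h1, h2, RCLike.inner_apply, mul_comm]
  rfl

/-- The integrand of the symbol of the slice of `W` by a vector functional. -/
def leftIntegrand (η ξ : C_c(G × X, ℂ)) : C_c((X × G) × X, ℂ) :=
  mkCc (fun p => starRingEnd ℂ (η (b.α p.2 p.1.2, p.1.1)) * ξ (p.1.2, p.1.1 + p.2))
    (by
      have h : Continuous fun p : (X × G) × X => b.α p.2 p.1.2 :=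
        b.continuous_α_comp (by fun_prop) (by fun_prop)
      have h1 := η.continuous
      have h2 := ξ.continuous
      exact (Complex.continuous_conj.comp (h1.comp (h.prodMk (by fun_prop)))).mul
        (h2.comp (by fun_prop)))
    (by
      obtain ⟨K, L, hK, hL, h⟩ := exists_compact_Cc η
      obtain ⟨K', L', hK', hL', h'⟩ := exists_compact_Cc ξ
      refine HasCompactSupport.intro ((hL.prod hK').prod (hL'.add hL.neg)) fun p hp => ?_
      by_contra h0
      have h1 : η (b.α p.2 p.1.2, p.1.1) ≠ 0 := fun h1 => h0 (by rw [h1]; simp)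
      have h2 : ξ (p.1.2, p.1.1 + p.2) ≠ 0 := fun h1 => h0 (by rw [h1]; simp)
      refine hp ⟨⟨(h _ _ h1).2, (h' _ _ h2).1⟩, ?_⟩
      exact ⟨_, (h' _ _ h2).2, _, Set.neg_mem_neg.2 (h _ _ h1).2, by simp⟩)

/-- The symbol `F(t, r') = ∫ conj η(α_{r'} t, r) ξ(t, r + r') dr` of the slice of `W` by the vector
functional of `η` and `ξ`. -/
def leftSymbol (η ξ : C_c(G × X, ℂ)) : C_c(G × X, ℂ) := intFst (b.leftIntegrand η ξ)

theorem leftSymbol_apply (η ξ : C_c(G × X, ℂ)) (t : G) (r' : X) :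
    b.leftSymbol η ξ (t, r') =
      ∫ r, starRingEnd ℂ (η (b.α r' t, r)) * ξ (t, r + r') := rfl

/-- The slice of `W` by a vector functional is the operator `T_F` of its symbol. -/
theorem leftSlice_W (η ξ : C_c(G × X, ℂ)) :
    leftSlice (vec (toL2 η) (toL2 ξ)) b.W = b.leftOp (b.leftSymbol η ξ) := by
  refine ext_inner_toL2 fun v w => ?_
  rw [inner_toL2 v (b.leftOp_coe (b.leftSymbol η ξ) w), leftSlice_vec]
  change ⟪toL2 v, ContinuousLinearMap.adjoint (tensLeft (toL2 η))
    (b.W (tmul (toL2 ξ) (toL2 w)))⟫_ℂ = _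
  rw [ContinuousLinearMap.adjoint_inner_right]
  obtain ⟨H, hH, h⟩ := b.inner_tmul_W η v ξ w
  refine h.trans ?_
  have hi : Integrable H (volume.prod volume) :=
    H.continuous.integrable_of_hasCompactSupport H.hasCompactSupport
  rw [Measure.volume_eq_prod, integral_prod_symm _ hi]
  refine integral_congr_ae (Filter.Eventually.of_forall fun z' => ?_)
  obtain ⟨h', r'⟩ := z'
  obtain ⟨K, L, hK, -, hKL⟩ : ∃ (K L : Set (G × X)), IsCompact K ∧ IsCompact L ∧
      ∀ z z', H (z, z') ≠ 0 → z ∈ K ∧ z' ∈ L := by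
    have hc : IsCompact (tsupport H) := H.hasCompactSupport
    exact ⟨_, _, hc.image continuous_fst, hc.image continuous_snd, fun t x h =>
      ⟨⟨_, subset_tsupport _ h, rfl⟩, ⟨_, subset_tsupport _ h, rfl⟩⟩⟩
  have hi' : Integrable (fun z => H (z, (h', r'))) (volume.prod volume) :=
    (H.continuous.comp (by fun_prop : Continuous fun z : G × X =>
      (z, (h', r')))).integrable_of_hasCompactSupport (HasCompactSupport.intro hK fun z hz => by
        by_contra h0
        exact hz (hKL _ _ h0).1)
  have h1 : ∫ z, H (z, (h', r')) = ∫ h, ∫ r, H ((h, r), (h', r')) := by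
    rw [Measure.volume_eq_prod, integral_prod _ hi']
  have h2 : ∫ h, ∫ r, H ((h, r), (h', r')) = ∫ t, ∫ r, H ((b.α r' t, r), (h', r')) :=
    ((b.mp_α r').integral_comp (b.αHomeo r').measurableEmbedding
      (fun h => ∫ r, H ((h, r), (h', r')))).symm
  refine h1.trans (h2.trans ?_)
  change _ = starRingEnd ℂ (v (h', r')) * ∫ t, b.leftSymbol η ξ (t, r') *
    (b.D.σ t (h' - t) r' : ℂ) * w (h' - t, r')
  rw [← integral_const_mul]
  refine integral_congr_ae (Filter.Eventually.of_forall fun t => ?_)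
  beta_reduce
  rw [leftSymbol_apply, mul_assoc, ← integral_mul_const, ← integral_const_mul]
  refine integral_congr_ae (Filter.Eventually.of_forall fun r => ?_)
  simp only [hH, phase, phi_apply, b.α_neg_α, map_mul]
  ring

/-- Density of the slices: the slice by the functional of `k ⊗ φ` and `F` has the symbol
`∫ φ(r) F(t, r + r') dr`, which tends to `F` as `φ` approximates the delta distribution. -/
theorem leftOp_mem_leftAlg (F : C_c(G × X, ℂ)) : b.leftOp F ∈ leftAlg b.W := by
  obtain ⟨K, L, hK, hL, hF⟩ := exists_compact_Cc F
  have hL1 : IsCompact (Metric.cthickening 1 L) := hL.cthickening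
  have hC : IsCompact (K ×ˢ Metric.cthickening 1 L) := hK.prod hL1
  -- `k` is a cutoff which makes the vector `k ⊗ φ` square integrable
  obtain ⟨k, hk1, hkc, -⟩ := exists_cutoff (hC.image
    (b.continuous_α_comp continuous_snd continuous_fst :
      Continuous fun q : G × X => b.α q.2 q.1))
  rw [leftAlg, Metric.mem_closure_iff]
  intro ε hε
  have hv : 0 ≤ (volume : Measure G).real K := measureReal_nonneg
  obtain ⟨φ, hφc, hφs, hφ1, hφ⟩ := exists_mollifier (V := X) (P := G × X)
    (Φ := fun q => F (q.2.1, q.1 + q.2.2)) (F.continuous.comp (by fun_prop)) hC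
    (ε := ε / ((volume : Measure G).real K + 1)) (by positivity)
  let η : C_c(G × X, ℂ) := mkCc (fun p => ((k p.1 * φ p.2 : ℝ) : ℂ)) (by
    have := k.continuous; fun_prop)
    (HasCompactSupport.intro (K := tsupport k ×ˢ tsupport φ) (IsCompact.prod hkc hφs)
      fun p hp => by
      by_cases h : p.1 ∈ tsupport k
      · have h' : p.2 ∉ tsupport φ := fun h' => hp ⟨h, h'⟩
        rw [image_eq_zero_of_notMem_tsupport h', mul_zero, Complex.ofReal_zero]
      · rw [image_eq_zero_of_notMem_tsupport h, zero_mul, Complex.ofReal_zero])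
  have hs : ∀ t r', b.leftSymbol η F (t, r') =
      (k (b.α r' t) : ℂ) * ∫ r, (φ r : ℂ) * F (t, r + r') := by
    intro t r'
    rw [leftSymbol_apply, ← integral_const_mul]
    refine integral_congr_ae (Filter.Eventually.of_forall fun r => ?_)
    simp only [η, mkCc_apply, map_mul, Complex.conj_ofReal, Complex.ofReal_mul]
    ring
  have hz : ∀ t r', (t, r') ∉ K ×ˢ Metric.cthickening 1 L →
      F (t, r') = 0 ∧ b.leftSymbol η F (t, r') = 0 := by
    intro t r' h
    refine ⟨?_, ?_⟩
    · by_contra h0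
      exact h ⟨(hF _ _ h0).1, Metric.self_subset_cthickening _ (hF _ _ h0).2⟩
    · have h0 : ∀ r, (φ r : ℂ) * F (t, r + r') = 0 := by
        intro r
        by_contra h0
        have h1 : φ r ≠ 0 := fun h1 => h0 (by rw [h1, Complex.ofReal_zero, zero_mul])
        have h2 : F (t, r + r') ≠ 0 := fun h2 => h0 (by rw [h2, mul_zero])
        refine h ⟨(hF _ _ h2).1, Metric.mem_cthickening_of_dist_le _ (r + r') 1 _ (hF _ _ h2).2 ?_⟩
        rw [dist_comm, dist_eq_norm, add_sub_cancel_right]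
        exact (hφ1 r h1).le
      rw [hs]
      simp only [h0, integral_zero, mul_zero]
  refine ⟨_, ⟨vec (toL2 η) (toL2 F), isNormal_vec _ _, rfl⟩, ?_⟩
  rw [b.leftSlice_W, dist_comm, dist_eq_norm, ← b.leftOp_sub]
  refine (norm_crossOp_le b.D _ _ _ hK (L := Metric.cthickening 1 L)
    (ε := ε / ((volume : Measure G).real K + 1)) ?_ (by positivity) ?_).trans_lt ?_
  · intro t r' h
    by_contra h0
    have h0' : (t, r') ∉ K ×ˢ Metric.cthickening 1 L := h0
    refine h ?_
    rw [CompactlySupportedContinuousMap.sub_apply, (hz t r' h0').1, (hz t r' h0').2, sub_zero]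
  · rintro ⟨t, r'⟩
    rw [CompactlySupportedContinuousMap.sub_apply]
    by_cases h : (t, r') ∈ K ×ˢ Metric.cthickening 1 L
    · have h1 := hφ (t, r') h
      simp only [zero_add] at h1
      rw [hs, hk1 _ ⟨(t, r'), h, rfl⟩, Complex.ofReal_one, one_mul]
      exact h1
    · rw [(hz t r' h).1, (hz t r' h).2, sub_zero, norm_zero]
      positivity
  · rw [← mul_div_assoc, div_lt_iff₀ (by positivity)]
    nlinarith

/-- The algebra of the slices `(ω ⊗ id)(W)` is the image of the crossed product `C₀(X) ⋊ G` in its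
regular representation. -/
theorem coe_eq_leftAlg {A : NonUnitalStarSubalgebra ℂ (B (G × X))}
    (hA : (A : Set (B (G × X))) = closure (Set.range b.leftOp)) :
    (A : Set (B (G × X))) = leftAlg b.W := by
  refine eq_leftAlg (hA ▸ isClosed_closure) (fun η ξ => ?_) ?_
  · rw [b.leftSlice_W]
    have h : b.leftOp (b.leftSymbol η ξ) ∈ (A : Set (B (G × X))) :=
      hA ▸ subset_closure (Set.mem_range_self _)
    exact h
  · rw [hA]
    exact closure_minimal (Set.range_subset_iff.2 b.leftOp_mem_leftAlg) isClosed_closure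

/-- The columns of `W` on `𝓚 ⊗ A`: the kernel is a compactly supported function because it is,
up to a phase, the composition of `ξ ⊗ F` with a homeomorphism. -/
theorem hasKernel_W_left (ξ F : C_c(G × X, ℂ)) :
    HasKernel b.D (Homeomorph.refl (G × X)) (b.W ∘L tensLeft (toL2 ξ) ∘L b.leftOp F)
      (twistCc b.phase b.continuous_phase b.phi (tensCc ξ F)) := by
  intro w
  have h1 : (tmul (toL2 ξ) (b.leftOp F (toL2 w)) : (G × X) × (G × X) → ℂ) =ᵐ[volume] fun p =>
      ξ p.1 * ∫ t, F (t, p.2.2) * (b.D.σ t (p.2.1 - t) p.2.2 : ℂ) * w (p.2.1 - t, p.2.2) := by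
    filter_upwards [tmulFun_coe (toL2 ξ) (b.leftOp F (toL2 w)),
      Measure.quasiMeasurePreserving_fst.ae_eq_comp (toL2_coe ξ),
      Measure.quasiMeasurePreserving_snd.ae_eq_comp (b.leftOp_coe F w)] with p h1 h2 h3
    simp only [Function.comp_apply] at h2 h3
    refine h1.trans ?_
    rw [h2, h3]
  filter_upwards [b.W_toL2_coe h1] with p hp
  refine hp.trans ?_
  obtain ⟨⟨h, r⟩, ⟨h', r'⟩⟩ := p
  simp only [phi_apply, phase]
  rw [← mul_assoc, ← integral_const_mul, ← integral_sub_right_eq_self _ (b.α (-r') h)]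
  refine integral_congr_ae (Filter.Eventually.of_forall fun t => ?_)
  have hc := b.D.cocycle (b.α (-r') h) (t - b.α (-r') h) (h' - t) r'
  rw [b.act_eq, add_sub_cancel, sub_add_sub_cancel', ← Circle.coe_inj, Circle.coe_mul,
    Circle.coe_mul] at hc
  simp only [twistCc_apply, phase, phi_apply, tensCc, mkCc_apply, b.regPhase_D, b.act_eq, shiftZ,
    Homeomorph.refl_apply, Homeomorph.refl_symm, id_eq, sub_sub_sub_cancel_right]
  linear_combination -(ξ (b.α (-r') h, r + r') * F (t - b.α (-r') h, r') * w (h' - t, r')) * hc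

theorem hasKernel_star_W_left (ξ F : C_c(G × X, ℂ)) :
    HasKernel b.D (Homeomorph.refl (G × X)) (star b.W ∘L tensLeft (toL2 ξ) ∘L b.leftOp F)
      (twistCc (fun p => (b.D.σ p.1.1 p.2.1 p.2.2)⁻¹)
        (b.continuous_σ_comp (by fun_prop) (by fun_prop) (by fun_prop)).inv b.phi.symm
        (tensCc ξ F)) := by
  intro w
  have h1 : (tmul (toL2 ξ) (b.leftOp F (toL2 w)) : (G × X) × (G × X) → ℂ) =ᵐ[volume] fun p =>
      ξ p.1 * ∫ t, F (t, p.2.2) * (b.D.σ t (p.2.1 - t) p.2.2 : ℂ) * w (p.2.1 - t, p.2.2) := by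
    filter_upwards [tmulFun_coe (toL2 ξ) (b.leftOp F (toL2 w)),
      Measure.quasiMeasurePreserving_fst.ae_eq_comp (toL2_coe ξ),
      Measure.quasiMeasurePreserving_snd.ae_eq_comp (b.leftOp_coe F w)] with p h1 h2 h3
    simp only [Function.comp_apply] at h2 h3
    refine h1.trans ?_
    rw [h2, h3]
  filter_upwards [b.star_W_toL2_coe h1] with p hp
  refine hp.trans ?_
  obtain ⟨⟨h, r⟩, ⟨h', r'⟩⟩ := p
  simp only [phi_symm_apply]
  rw [← mul_assoc, ← integral_const_mul, ← integral_add_right_eq_self _ h]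
  refine integral_congr_ae (Filter.Eventually.of_forall fun t => ?_)
  have hc := b.D.cocycle h t (h' - t) r'
  rw [b.act_eq, add_sub_cancel] at hc
  have hc' : ((b.D.σ h h' r')⁻¹ : Circle) * b.D.σ (h + t) (h' - t) r' =
      (b.D.σ h t r')⁻¹ * b.D.σ t (h' - t) r' := by
    rw [inv_mul_eq_iff_eq_mul, ← mul_assoc, mul_comm _ (b.D.σ h t r')⁻¹, mul_assoc,
      mul_comm (b.D.σ h h' r'), ← hc, inv_mul_cancel_left]
  rw [← Circle.coe_inj, Circle.coe_mul, Circle.coe_mul] at hc'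
  simp only [twistCc_apply, phi_symm_apply, tensCc, mkCc_apply, b.regPhase_D, b.act_eq, shiftZ,
    Homeomorph.refl_apply, Homeomorph.refl_symm, id_eq, add_sub_add_right_eq_sub]
  rw [add_comm t h]
  linear_combination (ξ (b.α r' h, r - r') * F (h + t, r') * w (h' - t, r')) * hc'

end Bicrossed

end QG

end

noncomputable section

namespace QG

/-! ### The right algebra of the multiplicative unitary -/

namespace Bicrossed

set_option linter.unusedSectionVars false

variable {G X : Type} [NormedAddCommGroup G] [NormedSpace ℝ G] [FiniteDimensional ℝ G]
  [MeasureSpace G] [BorelSpace G] [(volume : Measure G).IsAddHaarMeasure]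
  [NormedAddCommGroup X] [NormedSpace ℝ X] [FiniteDimensional ℝ X]
  [MeasureSpace X] [BorelSpace X] [(volume : Measure X).IsAddHaarMeasure]
  (b : Bicrossed G X)

/-- The action `α` of `X` on `G`, without a cocycle. -/
def dual : TwistedSystem X G where
  act := b.α
  act_zero := b.α_zero
  act_add := b.α_add
  continuous_act := b.continuous_α
  σ _ _ _ := 1
  continuous_σ := continuous_const
  σ_zero_left _ _ := rfl
  σ_zero_right _ _ := rfl
  cocycle _ _ _ _ := rfl

/-- The identification `(h, r) ↦ (-r, α_r h)`, which carries the right algebra of `W` to the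
regular representation of the crossed product by `α`. -/
def dualHomeo : G × X ≃ₜ X × G where
  toFun p := (-p.2, b.α p.2 p.1)
  invFun q := (b.α q.1 q.2, -q.1)
  left_inv p := by simp [b.α_neg_α]
  right_inv q := by simp [b.α_neg_α]
  continuous_toFun := by
    have h : Continuous fun p : G × X => b.α p.2 p.1 :=
      b.continuous_α_comp continuous_snd continuous_fst
    fun_prop
  continuous_invFun := by
    have h : Continuous fun q : X × G => b.α q.1 q.2 := b.continuous_α
    fun_prop

theorem mp_dualHomeo : MeasurePreserving b.dualHomeo := by
  have h : MeasurePreserving (fun p : X × G => (-p.1, b.α p.1 p.2))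
      ((volume : Measure X).prod volume) ((volume : Measure X).prod volume) :=
    MeasurePreserving.skew_product (g := fun r h => b.α r h)
      (Measure.measurePreserving_neg volume) b.continuous_α.measurable
      (Filter.Eventually.of_forall fun r => (b.mp_α r).map_eq)
  exact h.comp Measure.measurePreserving_swap

/-- The operators `T_F` in the regular representation of `C₀(G) ⋊ X`. -/
def rightOp (F : C_c(X × G, ℂ)) : B (G × X) := crossOp b.dual b.dualHomeo b.mp_dualHomeo F

theorem rightOp_sub (F F' : C_c(X × G, ℂ)) : b.rightOp (F - F') = b.rightOp F - b.rightOp F' :=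
  crossOp_sub _ _ _ _ _

theorem act_dualHomeo (p : G × X) :
    b.dual.act (b.dualHomeo p).1 (b.dualHomeo p).2 = p.1 := b.α_neg_α p.2 p.1

theorem regPhase_dual (t : X) (q : X × G) : regPhase b.dual t q = 1 := rfl

theorem shiftZ_dualHomeo (t : X) (p : G × X) :
    shiftZ b.dualHomeo t p = (b.α (-t) p.1, p.2 + t) := by
  change (b.α (-p.2 - t) (b.α p.2 p.1), -(-p.2 - t)) = _
  rw [← b.α_add, show -p.2 - t + p.2 = -t by abel, show -(-p.2 - t) = p.2 + t by abel]

theorem rightOp_coe (F : C_c(X × G, ℂ)) (w : C_c(G × X, ℂ)) :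
    (b.rightOp F (toL2 w) : G × X → ℂ) =ᵐ[volume] fun p =>
      ∫ t, F (t, p.1) * w (b.α (-t) p.1, p.2 + t) := by
  filter_upwards [crossOp_toL2_coe b.dual b.dualHomeo b.mp_dualHomeo F w] with p hp
  refine hp.trans (integral_congr_ae (Filter.Eventually.of_forall fun t => ?_))
  simp only [regKernel, regPhase_dual, act_dualHomeo, shiftZ_dualHomeo, Circle.coe_one, mul_one]

/-- The integrand of the symbol of the slice of `W` by a vector functional. -/
def rightIntegrand (η ξ : C_c(G × X, ℂ)) : C_c((G × X) × G, ℂ) :=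
  mkCc (fun p => starRingEnd ℂ (η p.1) *
      (b.D.σ (b.α (-p.1.2) p.2) (p.1.1 - b.α (-p.1.2) p.2) p.1.2 : ℂ) *
      ξ (p.1.1 - b.α (-p.1.2) p.2, p.1.2))
    (by
      have h : Continuous fun p : (G × X) × G => b.α (-p.1.2) p.2 :=
        b.continuous_α_comp (by fun_prop) (by fun_prop)
      have h1 := η.continuous
      have h2 := ξ.continuous
      have h3 : Continuous fun p : (G × X) × G => p.1.1 - b.α (-p.1.2) p.2 := by fun_prop
      exact ((Complex.continuous_conj.comp (h1.comp continuous_fst)).mul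
        (continuous_subtype_val.comp (b.continuous_σ_comp h h3 (by fun_prop)))).mul
        (h2.comp (h3.prodMk (by fun_prop))))
    (by
      obtain ⟨K, L, hK, hL, h⟩ := exists_compact_Cc η
      obtain ⟨K', L', hK', hL', h'⟩ := exists_compact_Cc ξ
      refine HasCompactSupport.intro ((hK.prod hL).prod
        ((hL.prod (hK.add hK'.neg)).image b.continuous_α)) fun p hp => ?_
      by_contra h0
      have h1 : η (p.1.1, p.1.2) ≠ 0 := fun h1 => h0 (by
        change starRingEnd ℂ (η (p.1.1, p.1.2)) * _ * _ = 0
        rw [h1]; simp)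
      have h2 : ξ (p.1.1 - b.α (-p.1.2) p.2, p.1.2) ≠ 0 := fun h1 => h0 (by rw [h1]; simp)
      refine hp ⟨⟨(h _ _ h1).1, (h _ _ h1).2⟩, ?_⟩
      refine ⟨(p.1.2, b.α (-p.1.2) p.2), ⟨(h _ _ h1).2, ?_⟩, b.α_α_neg _ _⟩
      exact ⟨_, (h _ _ h1).1, _, Set.neg_mem_neg.2 (h' _ _ h2).1, by simp⟩)

/-- The symbol `F(t, h) = ∫ conj η(h', t) σ^t(α_{-t} h, h' - α_{-t} h) ξ(h' - α_{-t} h, t) dh'` of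
the slice of `W` by the vector functional of `η` and `ξ`. -/
def rightSymbol (η ξ : C_c(G × X, ℂ)) : C_c(X × G, ℂ) := intFst (b.rightIntegrand η ξ)

theorem rightSymbol_apply (η ξ : C_c(G × X, ℂ)) (t : X) (h : G) :
    b.rightSymbol η ξ (t, h) = ∫ h', starRingEnd ℂ (η (h', t)) *
      (b.D.σ (b.α (-t) h) (h' - b.α (-t) h) t : ℂ) * ξ (h' - b.α (-t) h, t) := rfl

/-- The slice of `W` by a vector functional is the operator `T_F` of its symbol. -/
theorem rightSlice_W (η ξ : C_c(G × X, ℂ)) :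
    rightSlice (vec (toL2 η) (toL2 ξ)) b.W = b.rightOp (b.rightSymbol η ξ) := by
  refine ext_inner_toL2 fun v w => ?_
  rw [inner_toL2 v (b.rightOp_coe (b.rightSymbol η ξ) w), rightSlice_vec]
  change ⟪toL2 v, ContinuousLinearMap.adjoint (tensRight (toL2 η))
    (b.W (tmul (toL2 w) (toL2 ξ)))⟫_ℂ = _
  rw [ContinuousLinearMap.adjoint_inner_right]
  obtain ⟨H, hH, h⟩ := b.inner_tmul_W v η w ξ
  refine h.trans ?_
  have hi : Integrable H (volume.prod volume) :=
    H.continuous.integrable_of_hasCompactSupport H.hasCompactSupport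
  rw [Measure.volume_eq_prod, integral_prod _ hi]
  refine integral_congr_ae (Filter.Eventually.of_forall fun z => ?_)
  obtain ⟨h, r⟩ := z
  obtain ⟨K, L, -, hL, hKL⟩ : ∃ (K L : Set (G × X)), IsCompact K ∧ IsCompact L ∧
      ∀ z z', H (z, z') ≠ 0 → z ∈ K ∧ z' ∈ L := by
    have hc : IsCompact (tsupport H) := H.hasCompactSupport
    exact ⟨_, _, hc.image continuous_fst, hc.image continuous_snd, fun t x h =>
      ⟨⟨_, subset_tsupport _ h, rfl⟩, ⟨_, subset_tsupport _ h, rfl⟩⟩⟩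
  have hi' : Integrable (fun z' => H ((h, r), z')) (volume.prod volume) :=
    (H.continuous.comp (by fun_prop : Continuous fun z' : G × X =>
      ((h, r), z'))).integrable_of_hasCompactSupport (HasCompactSupport.intro hL fun z hz => by
        by_contra h0
        exact hz (hKL _ _ h0).2)
  have h1 : ∫ z', H ((h, r), z') = ∫ t, ∫ h', H ((h, r), (h', t)) := by
    rw [Measure.volume_eq_prod, integral_prod_symm _ hi']
  refine h1.trans ?_
  change _ = starRingEnd ℂ (v (h, r)) * ∫ t, b.rightSymbol η ξ (t, h) * w (b.α (-t) h, r + t)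
  rw [← integral_const_mul]
  refine integral_congr_ae (Filter.Eventually.of_forall fun t => ?_)
  beta_reduce
  rw [rightSymbol_apply, ← integral_mul_const, ← integral_const_mul]
  refine integral_congr_ae (Filter.Eventually.of_forall fun h' => ?_)
  simp only [hH, phase, phi_apply, map_mul]
  ring

/-- Density of the slices: the slice by the functional of `η(h', t) = conj F(t, α_t h')` and
`ξ = φ ⊗ k` has the symbol `∫ φ(s) F(t, α_t s + h) σ^t(α_{-t} h, s) ds` on the support of `F`, and
this tends to `F` as `φ` approximates the delta distribution, because `σ^t(·, 0) = 1`. -/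
theorem rightOp_mem_rightAlg (F : C_c(X × G, ℂ)) : b.rightOp F ∈ rightAlg b.W := by
  obtain ⟨K, L, hK, hL, hF⟩ := exists_compact_Cc F
  obtain ⟨L', hL', hLL'⟩ : ∃ L' : Set G, IsCompact L' ∧
      ∀ t h s, ‖s‖ ≤ 1 → F (t, b.α t s + h) ≠ 0 → t ∈ K ∧ h ∈ L' := by
    refine ⟨_, hL.add ((hK.prod (isCompact_closedBall (0 : G) 1)).image b.continuous_α).neg,
      fun t h s hs h0 => ⟨(hF _ _ h0).1, ?_⟩⟩
    exact ⟨_, (hF _ _ h0).2, _, Set.neg_mem_neg.2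
      ⟨(t, s), ⟨(hF _ _ h0).1, mem_closedBall_zero_iff.2 hs⟩, rfl⟩, by simp⟩
  obtain ⟨k, hk1, hkc, -⟩ := exists_cutoff hK
  rw [rightAlg, Metric.mem_closure_iff]
  intro ε hε
  have hv : 0 ≤ (volume : Measure X).real K := measureReal_nonneg
  have hα : Continuous fun q : G × X × G => b.α q.2.1 q.1 :=
    b.continuous_α_comp (by fun_prop) (by fun_prop)
  have hα' : Continuous fun q : G × X × G => b.α (-q.2.1) q.2.2 :=
    b.continuous_α_comp (by fun_prop) (by fun_prop)
  have hFc := F.continuous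
  obtain ⟨φ, hφc, hφs, hφ1, hφ⟩ := exists_mollifier (V := G) (P := X × G)
    (Φ := fun q => F (q.2.1, b.α q.2.1 q.1 + q.2.2) *
      (b.D.σ (b.α (-q.2.1) q.2.2) q.1 q.2.1 : ℂ))
    ((hFc.comp (by fun_prop)).mul (continuous_subtype_val.comp
      (b.continuous_σ_comp hα' (by fun_prop) (by fun_prop)))) (hK.prod hL')
    (ε := ε / ((volume : Measure X).real K + 1)) (by positivity)
  have hβ : Continuous fun p : G × X => b.α p.2 p.1 :=
    b.continuous_α_comp continuous_snd continuous_fst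
  have hβ' : Continuous fun p : X × G => b.α (-p.1) p.2 :=
    b.continuous_α_comp (by fun_prop) (by fun_prop)
  let η : C_c(G × X, ℂ) := mkCc (fun p => starRingEnd ℂ (F (p.2, b.α p.2 p.1)))
    (Complex.continuous_conj.comp (hFc.comp (continuous_snd.prodMk hβ)))
    (HasCompactSupport.intro (((hK.prod hL).image hβ').prod hK) fun p hp => by
      by_contra h0
      have h1 : F (p.2, b.α p.2 p.1) ≠ 0 := fun h1 => h0 (by rw [h1, map_zero])
      exact hp ⟨⟨(p.2, b.α p.2 p.1), hF _ _ h1, b.α_neg_α _ _⟩, (hF _ _ h1).1⟩)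
  let ξ : C_c(G × X, ℂ) := mkCc (fun p => ((φ p.1 * k p.2 : ℝ) : ℂ)) (by
    have := k.continuous; fun_prop)
    (HasCompactSupport.intro (K := tsupport φ ×ˢ tsupport k) (IsCompact.prod hφs hkc)
      fun p hp => by
      by_cases h : p.1 ∈ tsupport φ
      · have h' : p.2 ∉ tsupport k := fun h' => hp ⟨h, h'⟩
        rw [image_eq_zero_of_notMem_tsupport h', mul_zero, Complex.ofReal_zero]
      · rw [image_eq_zero_of_notMem_tsupport h, zero_mul, Complex.ofReal_zero])
  have hs : ∀ t h, b.rightSymbol η ξ (t, h) =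
      (k t : ℂ) * ∫ s, (φ s : ℂ) * (F (t, b.α t s + h) * (b.D.σ (b.α (-t) h) s t : ℂ)) := by
    intro t h
    rw [rightSymbol_apply, ← integral_const_mul, ← integral_add_right_eq_self _ (b.α (-t) h)]
    refine integral_congr_ae (Filter.Eventually.of_forall fun s => ?_)
    simp only [η, ξ, mkCc_apply, Complex.conj_conj, Complex.ofReal_mul, add_sub_cancel_right,
      b.α_map_add, b.α_α_neg]
    ring
  have hz : ∀ t h, (t, h) ∉ K ×ˢ L' → F (t, h) = 0 ∧ b.rightSymbol η ξ (t, h) = 0 := by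
    intro t h hth
    refine ⟨?_, ?_⟩
    · by_contra h0
      refine hth (hLL' t h 0 (by simp) ?_)
      rwa [b.α_map_zero, zero_add]
    · have h0 : ∀ s, (φ s : ℂ) * (F (t, b.α t s + h) * (b.D.σ (b.α (-t) h) s t : ℂ)) = 0 := by
        intro s
        by_contra h0
        have h1 : φ s ≠ 0 := fun h1 => h0 (by rw [h1, Complex.ofReal_zero, zero_mul])
        have h2 : F (t, b.α t s + h) ≠ 0 := fun h2 => h0 (by rw [h2, zero_mul, mul_zero])
        exact hth (hLL' t h s (hφ1 s h1).le h2)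
      rw [hs]
      simp only [h0, integral_zero, mul_zero]
  refine ⟨_, ⟨vec (toL2 η) (toL2 ξ), isNormal_vec _ _, rfl⟩, ?_⟩
  rw [b.rightSlice_W, dist_comm, dist_eq_norm, ← b.rightOp_sub]
  refine (norm_crossOp_le b.dual _ _ _ hK (L := L')
    (ε := ε / ((volume : Measure X).real K + 1)) ?_ (by positivity) ?_).trans_lt ?_
  · intro t h hth
    by_contra h0
    have h0' : (t, h) ∉ K ×ˢ L' := h0
    refine hth ?_
    rw [CompactlySupportedContinuousMap.sub_apply, (hz t h h0').1, (hz t h h0').2, sub_zero]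
  · rintro ⟨t, h⟩
    rw [CompactlySupportedContinuousMap.sub_apply]
    by_cases hth : (t, h) ∈ K ×ˢ L'
    · have h1 := hφ (t, h) hth
      simp only [b.α_map_zero, zero_add, b.D.σ_zero_right, Circle.coe_one, mul_one] at h1
      rw [hs, hk1 t hth.1, Complex.ofReal_one, one_mul]
      exact h1
    · rw [(hz t h hth).1, (hz t h hth).2, sub_zero, norm_zero]
      positivity
  · rw [← mul_div_assoc, div_lt_iff₀ (by positivity)]
    nlinarith

/-- The algebra of the slices `(id ⊗ ω)(W)` is the image of the crossed product `C₀(G) ⋊ X` in its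
regular representation. -/
theorem coe_eq_rightAlg {A : NonUnitalStarSubalgebra ℂ (B (G × X))}
    (hA : (A : Set (B (G × X))) = closure (Set.range b.rightOp)) :
    (A : Set (B (G × X))) = rightAlg b.W := by
  refine eq_rightAlg (hA ▸ isClosed_closure) (fun η ξ => ?_) ?_
  · rw [b.rightSlice_W]
    have h : b.rightOp (b.rightSymbol η ξ) ∈ (A : Set (B (G × X))) :=
      hA ▸ subset_closure (Set.mem_range_self _)
    exact h
  · rw [hA]
    exact closure_minimal (Set.range_subset_iff.2 b.rightOp_mem_rightAlg) isClosed_closure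

/-- The homeomorphism `(h, r) ↦ (-r, h)`. -/
def flipHomeo (G X : Type) [NormedAddCommGroup G] [NormedAddCommGroup X] : G × X ≃ₜ X × G where
  toFun p := (-p.2, p.1)
  invFun q := (q.2, -q.1)
  left_inv p := by simp
  right_inv q := by simp
  continuous_toFun := by fun_prop
  continuous_invFun := by fun_prop

/-- The homeomorphism `(y, (k, h)) ↦ ((h, -k), y)`. -/
def colHomeo (G X : Type) [NormedAddCommGroup G] [NormedAddCommGroup X] :
    (G × X) × (X × G) ≃ₜ (G × X) × (G × X) :=
  (Homeomorph.prodComm _ _).trans ((flipHomeo G X).symm.prodCongr (Homeomorph.refl _))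

theorem colHomeo_apply (y : G × X) (k : X) (h : G) : colHomeo G X (y, (k, h)) = ((h, -k), y) := rfl

/-- The columns of `W` on `A ⊗ 𝓚`: the kernel is a compactly supported function because it is,
up to a phase, the composition of `F ⊗ ξ` with a homeomorphism. -/
theorem hasKernel_W_right (ξ : C_c(G × X, ℂ)) (F : C_c(X × G, ℂ)) :
    HasKernel b.dual b.dualHomeo
      (compOp (MeasurableEquiv.prodComm : (G × X) × (G × X) ≃ᵐ (G × X) × (G × X)) mp_prodComm ∘L
        b.W ∘L tensRight (toL2 ξ) ∘L b.rightOp F)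
      (twistCc (fun q => b.phase (colHomeo G X q))
        (b.continuous_phase.comp (colHomeo G X).continuous) ((colHomeo G X).trans b.phi)
        (tensCc (twistCc (fun _ => 1) continuous_const (flipHomeo G X) F) ξ)) := by
  intro w
  have h1 : (tmul (b.rightOp F (toL2 w)) (toL2 ξ) : (G × X) × (G × X) → ℂ) =ᵐ[volume] fun p =>
      (∫ t, F (t, p.1.1) * w (b.α (-t) p.1.1, p.1.2 + t)) * ξ p.2 := by
    filter_upwards [tmulFun_coe (b.rightOp F (toL2 w)) (toL2 ξ),
      Measure.quasiMeasurePreserving_fst.ae_eq_comp (b.rightOp_coe F w),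
      Measure.quasiMeasurePreserving_snd.ae_eq_comp (toL2_coe ξ)] with p h1 h2 h3
    simp only [Function.comp_apply] at h2 h3
    refine h1.trans ?_
    rw [h2, h3]
  filter_upwards [compOp_coe MeasurableEquiv.prodComm mp_prodComm
      (b.W (tmul (b.rightOp F (toL2 w)) (toL2 ξ))),
    mp_prodComm.quasiMeasurePreserving.ae_eq_comp (b.W_toL2_coe h1)] with p h2 h3
  refine h2.trans (h3.trans ?_)
  obtain ⟨⟨h', r'⟩, ⟨h, r⟩⟩ := p
  change (b.phase ((h, r), (h', r')) : ℂ) *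
    ((∫ t, F (t, b.α (-r') h) * w (b.α (-t) (b.α (-r') h), r + r' + t)) *
      ξ (h' - b.α (-r') h, r')) = _
  rw [mul_comm (∫ t, F (t, b.α (-r') h) * w (b.α (-t) (b.α (-r') h), r + r' + t)), ← mul_assoc,
    ← integral_const_mul, ← integral_sub_right_eq_self _ r']
  refine integral_congr_ae (Filter.Eventually.of_forall fun k => ?_)
  simp only [twistCc_apply, regPhase_dual, act_dualHomeo, shiftZ_dualHomeo, tensCc, mkCc_apply,
    Homeomorph.trans_apply, colHomeo_apply, phi_apply, phase, Circle.coe_one, mul_one, one_mul]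
  rw [show flipHomeo G X (b.α (-r') h, -k + r') = (k - r', b.α (-r') h) from
    Prod.ext (by change -(-k + r') = k - r'; abel) rfl, ← b.α_add,
    show -(k - r') + -r' = -k by abel, show r + r' + (k - r') = r + k by abel]
  ring

theorem hasKernel_star_W_right (ξ : C_c(G × X, ℂ)) (F : C_c(X × G, ℂ)) :
    HasKernel b.dual b.dualHomeo
      (compOp (MeasurableEquiv.prodComm : (G × X) × (G × X) ≃ᵐ (G × X) × (G × X)) mp_prodComm ∘L
        star b.W ∘L tensRight (toL2 ξ) ∘L b.rightOp F)
      (twistCc (fun q => (b.D.σ q.2.2 q.1.1 q.1.2)⁻¹)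
        (b.continuous_σ_comp (by fun_prop) (by fun_prop) (by fun_prop)).inv
        ((colHomeo G X).trans b.phi.symm)
        (tensCc (twistCc (fun _ => 1) continuous_const (flipHomeo G X) F) ξ)) := by
  intro w
  have h1 : (tmul (b.rightOp F (toL2 w)) (toL2 ξ) : (G × X) × (G × X) → ℂ) =ᵐ[volume] fun p =>
      (∫ t, F (t, p.1.1) * w (b.α (-t) p.1.1, p.1.2 + t)) * ξ p.2 := by
    filter_upwards [tmulFun_coe (b.rightOp F (toL2 w)) (toL2 ξ),
      Measure.quasiMeasurePreserving_fst.ae_eq_comp (b.rightOp_coe F w),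
      Measure.quasiMeasurePreserving_snd.ae_eq_comp (toL2_coe ξ)] with p h1 h2 h3
    simp only [Function.comp_apply] at h2 h3
    refine h1.trans ?_
    rw [h2, h3]
  filter_upwards [compOp_coe MeasurableEquiv.prodComm mp_prodComm
      (star b.W (tmul (b.rightOp F (toL2 w)) (toL2 ξ))),
    mp_prodComm.quasiMeasurePreserving.ae_eq_comp (b.star_W_toL2_coe h1)] with p h2 h3
  refine h2.trans (h3.trans ?_)
  obtain ⟨⟨h', r'⟩, ⟨h, r⟩⟩ := p
  change ((b.D.σ h h' r')⁻¹ : Circle) *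
    ((∫ t, F (t, b.α r' h) * w (b.α (-t) (b.α r' h), r - r' + t)) * ξ (h' + h, r')) = _
  rw [mul_comm (∫ t, F (t, b.α r' h) * w (b.α (-t) (b.α r' h), r - r' + t)), ← mul_assoc,
    ← integral_const_mul, ← integral_add_right_eq_self _ r']
  refine integral_congr_ae (Filter.Eventually.of_forall fun k => ?_)
  simp only [twistCc_apply, regPhase_dual, act_dualHomeo, shiftZ_dualHomeo, tensCc, mkCc_apply,
    Homeomorph.trans_apply, colHomeo_apply, phi_symm_apply, Circle.coe_one, mul_one, one_mul]
  rw [show flipHomeo G X (b.α r' h, -k - r') = (k + r', b.α r' h) from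
    Prod.ext (by change -(-k - r') = k + r'; abel) rfl, ← b.α_add,
    show -(k + r') + r' = -k by abel, show r - r' + (k + r') = r + k by abel]
  ring

/-! ### The bialgebras of the multiplicative unitary -/

/-- The algebra of the slices `(ω ⊗ id)(W)` is isomorphic to the twisted crossed product
`C₀(X) ⋊ G`, and it is a bialgebra. -/
theorem exists_left : ∃ A : NonUnitalStarSubalgebra ℂ (B (G × X)),
    (A : Set (B (G × X))) = leftAlg b.W ∧ StarIsomorphic A (crossedProduct b.D) ∧
    ∃ Δ : A →⋆ₙₐ[ℂ] multiplierAlg (tensorAlg A),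
      (∀ a : A, (Δ a : B ((G × X) × (G × X))) = b.W * legFst (a : B (G × X)) * star b.W) ∧
      IsCStarBialgebra A Δ := by
  obtain ⟨A, hA, h⟩ := exists_starIsomorphic_crossedProduct b.D
    (Homeomorph.refl (G × X)).toMeasurableEquiv (.id _)
  have hA' : (A : Set (B (G × X))) = closure (Set.range b.leftOp) := hA
  refine ⟨A, b.coe_eq_leftAlg hA', h, b.isMultiplicativeUnitary_W.exists_comul_left A
    (b.coe_eq_leftAlg hA') (mul_mem_cspan_compactLeft hA' fun ξ F => ?_)
    (mul_mem_cspan_compactLeft hA' fun ξ F => ?_)⟩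
  · exact (b.hasKernel_W_left ξ F).mem_cspan (.id _)
  · exact (b.hasKernel_star_W_left ξ F).mem_cspan (.id _)

/-- The algebra of the slices `(id ⊗ ω)(W)` is isomorphic to the crossed product `C₀(G) ⋊ X`, and
it is a bialgebra. -/
theorem exists_right : ∃ A : NonUnitalStarSubalgebra ℂ (B (G × X)),
    (A : Set (B (G × X))) = rightAlg b.W ∧ StarIsomorphic A (crossedProduct b.dual) ∧
    ∃ Δ : A →⋆ₙₐ[ℂ] multiplierAlg (tensorAlg A),
      (∀ a : A, (Δ a : B ((G × X) × (G × X))) = star b.W * legSnd (a : B (G × X)) * b.W) ∧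
      IsCStarBialgebra A Δ := by
  obtain ⟨A, hA, h⟩ := exists_starIsomorphic_crossedProduct b.dual
    b.dualHomeo.toMeasurableEquiv b.mp_dualHomeo
  have hA' : (A : Set (B (G × X))) = closure (Set.range b.rightOp) := hA
  refine ⟨A, b.coe_eq_rightAlg hA', h, b.isMultiplicativeUnitary_W.exists_comul_right A
    (b.coe_eq_rightAlg hA') (mul_mem_cspan_compactRight hA' fun ξ F => ?_)
    (mul_mem_cspan_compactRight hA' fun ξ F => ?_)⟩
  · exact (b.hasKernel_W_right ξ F).mem_cspan b.mp_dualHomeo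
  · exact (b.hasKernel_star_W_right ξ F).mem_cspan b.mp_dualHomeo

end Bicrossed

end QG

end

noncomputable section

namespace QG

/-! ### The cocycle identity -/

section Cocycle

variable {Z : Type} [MeasureSpace Z] [SigmaFinite (volume : Measure Z)]

/-- Given the pentagon equation for `V`, the cocycle identity for `Θ` is the pentagon equation for
`V Θ`. -/
theorem isCocycleFor_of_isMultiplicativeUnitary {V Θ : B (Z × Z)}
    (hV : IsMultiplicativeUnitary V) (hΘ : Θ ∈ unitary (B (Z × Z)))
    (h : IsMultiplicativeUnitary (V * Θ)) : IsCocycleFor V Θ := by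
  refine ⟨hΘ, ?_⟩
  have h1 := h.2
  have h0 := hV.2
  rw [leg12_mul, leg13_mul, leg23_mul] at h1
  have u12 : star (leg12 V) * leg12 V = 1 := by
    rw [← leg12_star, ← leg12_mul, (Unitary.mem_iff.1 hV.1).1, leg12_one]
  have u23 : leg23 V * star (leg23 V) = 1 := hV.leg23_mul_star
  have u23' : star (leg23 V) * leg23 V = 1 := hV.star_leg23_mul
  have hs : star (leg13 V * leg23 V) = star (leg12 V) * star (leg23 V) * leg12 V := by
    have h2 : star (leg12 V) * star (leg23 V) = star (leg13 V * leg23 V) * star (leg12 V) := by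
      rw [← star_mul, ← h0, ← star_mul, mul_assoc]
    rw [h2, mul_assoc, u12, mul_one]
  calc star (leg13 V * leg23 V) * leg12 Θ * (leg13 V * leg23 V) *
        (star (leg23 V) * leg13 Θ * leg23 V) * leg23 Θ
      = star (leg13 V * leg23 V) * leg12 Θ * leg13 V * (leg23 V * star (leg23 V)) *
          leg13 Θ * leg23 V * leg23 Θ := by simp only [mul_assoc]
    _ = star (leg12 V) * star (leg23 V) *
          (leg12 V * leg12 Θ * (leg13 V * leg13 Θ) * (leg23 V * leg23 Θ)) := by
        rw [u23, mul_one, hs]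
        simp only [mul_assoc]
    _ = star (leg12 V) * (star (leg23 V) * leg23 V) * leg23 Θ * leg12 V * leg12 Θ := by
        rw [h1]
        simp only [mul_assoc]
    _ = _ := by rw [u23', mul_one]

end Cocycle

/-! ### The Heisenberg group -/

section Heisenberg

variable {n : ℕ}

instance isAddHaarMeasure_HZ : (volume : Measure (HZ n)).IsAddHaarMeasure := by
  exact Measure.prod.instIsAddHaarMeasure (volume : Measure (Fin n → ℝ)) volume

/-- The action `α` of `G₁` on `H/Z`, with the trivial cocycle. -/
def plainData (J : Matrix (Fin n) (Fin n) ℝ) : Bicrossed (HZ n) ℝ where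
  α := alpha J
  α_zero := (alphaSystem J).act_zero
  α_add := (alphaSystem J).act_add
  α_map_add r h h' := by
    refine Prod.ext ?_ rfl
    simp only [alpha, Prod.fst_add, Prod.snd_add, Jvec_add, smul_add]
    abel
  continuous_α := continuous_alpha J
  mp_α := mp_alpha J
  D := gammaSystem n
  act_eq _ _ := rfl
  σ_add _ _ _ _ := (one_mul _).symm

theorem beta_add_smul_Jvec (J : Matrix (Fin n) (Fin n) ℝ) (x y y' : Fin n → ℝ) (s : ℝ) :
    beta (x + s • Jvec J y) y' = beta x y' + s * Jform J y y' := by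
  simp only [beta, Jform, Jvec, Pi.add_apply, Pi.smul_apply, smul_eq_mul, add_mul,
    Finset.sum_add_distrib, Finset.mul_sum, Finset.sum_mul]
  congr 1
  exact Finset.sum_congr rfl fun i _ => Finset.sum_congr rfl fun k _ => by ring

/-- The action `α` of `G₁` on `H/Z`, with the field of cocycles `σ`.  The quadratic term
`r²/2 ∑ J_{ik} y_k y'_i` of `σ^r` makes up for the translation by `α_s` in `σ^{r+s}`. -/
def twistedData (J : Matrix (Fin n) (Fin n) ℝ) : Bicrossed (HZ n) ℝ where
  α := alpha J
  α_zero := (plainData J).α_zero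
  α_add := (plainData J).α_add
  α_map_add := (plainData J).α_map_add
  continuous_α := continuous_alpha J
  mp_α := mp_alpha J
  D := gammaSigmaSystem J
  act_eq _ _ := rfl
  σ_add r s u v := by
    change sigma J (r + s) u v = sigma J r (alpha J s u) (alpha J s v) * sigma J s u v
    simp only [sigma, alpha, beta_add_smul_Jvec, ← eebar_add]
    congr 1
    ring

theorem alpha_alpha (J : Matrix (Fin n) (Fin n) ℝ) (r s : ℝ) (h : HZ n) :
    alpha J r (alpha J s h) = alpha J (r + s) h := ((plainData J).α_add r s h).symm

theorem legFst_wcomp {Z Y : Type} [MeasureSpace Z] [MeasureSpace Y]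
    [SigmaFinite (volume : Measure Z)] [SigmaFinite (volume : Measure Y)] (θ : Z → Circle)
    (hθ : Measurable fun x => (θ x : ℂ)) (φ : Z → Z) (hφ : MeasurePreserving φ) :
    (legFst (wcomp θ hθ φ hφ) : B (Z × Y)) =
      wcomp (fun p : Z × Y => θ p.1) (hθ.comp measurable_fst) (fun p : Z × Y => (φ p.1, p.2))
        (mp_prodMap (X := Z) (Y := Y) (φ := φ) hφ) := by
  refine (leg_wcomp (Z := Z × Y) (X := Z) (Y := Y) (MeasurableEquiv.refl (Z × Y))
    (MeasurePreserving.id (volume : Measure (Z × Y))) θ hθ φ hφ).trans ?_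
  exact wcomp_congr (fun _ => rfl) fun _ => rfl

/-- The leg formula `(Z₁₂ X₂₄ Z₁₂*) Y₁₃` is the multiplicative unitary of the data without
cocycle. -/
theorem opV_eq_W (J : Matrix (Fin n) (Fin n) ℝ) : opV J = (plainData J).W := by
  have hZ : MeasurePreserving (fun p : KK n => ((alpha J (-p.2) p.1, p.2) : KK n)) := by
    have h : MeasurePreserving (fun p : ℝ × HZ n => (p.1, alpha J (-p.1) p.2))
        ((volume : Measure ℝ).prod volume) ((volume : Measure ℝ).prod volume) :=
      MeasurePreserving.skew_product (g := fun r h => alpha J (-r) h) (MeasurePreserving.id _)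
        ((continuous_alpha J).comp (by fun_prop : Continuous fun p : ℝ × HZ n =>
          (-p.1, p.2))).measurable
        (Filter.Eventually.of_forall fun r => (mp_alpha J (-r)).map_eq)
    exact Measure.measurePreserving_swap.comp (h.comp Measure.measurePreserving_swap)
  have hs : star (opZ J) = wcomp (fun _ => 1) measurable_const _ hZ := by
    rw [opZ, compOp_eq_wcomp, star_wcomp _ _ _ _ _ hZ]
    · exact wcomp_congr (fun _ => inv_one) fun _ => rfl
    · intro p
      refine Prod.ext ?_ rfl
      exact (plainData J).α_neg_α p.2 p.1
  rw [opV, ← legFst_star, hs, opZ, opX, opY, compOp_eq_wcomp, compOp_eq_wcomp, compOp_eq_wcomp,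
    legFst_wcomp, legFst_wcomp, leg_wcomp, leg_wcomp, wcomp_mul_wcomp, wcomp_mul_wcomp,
    wcomp_mul_wcomp, Bicrossed.W]
  refine wcomp_congr (fun p => ?_) fun p => ?_
  · change (1 : Circle) * 1 * 1 * 1 = 1
    simp
  · obtain ⟨⟨h, r⟩, ⟨h', r'⟩⟩ := p
    change ((alpha J (-(r + r')) (alpha J r h), r + r'),
      (h' - alpha J (-(r + r')) (alpha J r h), r')) =
      ((alpha J (-r') h, r + r'), (h' - alpha J (-r') h, r'))
    rw [alpha_alpha, show -(r + r') + r = -r' by ring]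

theorem opTheta_mem_unitary (J : Matrix (Fin n) (Fin n) ℝ) :
    opTheta J ∈ unitary (B (KK n × KK n)) := by
  rw [opTheta, mulOp_eq_wcomp]
  exact wcomp_mem_unitary _ _ _ _ (.id _) (.id _) (fun _ => rfl) fun _ => rfl

theorem opVTheta_eq_W (J : Matrix (Fin n) (Fin n) ℝ) : opVTheta J = (twistedData J).W := by
  rw [opVTheta, opV_eq_W, opTheta, mulOp_eq_wcomp, Bicrossed.W, Bicrossed.W, wcomp_mul_wcomp]
  refine wcomp_congr (fun p => ?_) fun p => rfl
  obtain ⟨⟨h, r⟩, ⟨h', r'⟩⟩ := p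
  change (1 : Circle) * (eebar (r' * beta (alpha J (-r') h).1 (h' - alpha J (-r') h).2) *
      eebar (r' ^ 2 / 2 * Jform J (alpha J (-r') h).2 (h' - alpha J (-r') h).2)) =
    sigma J r' (alpha J (-r') h) (h' - alpha J (-r') h)
  rw [one_mul, mul_comm]
  rfl

/-- The phase `σ^{r'}(α_{-r'} h, h' - α_{-r'} h)`: the translation by `-r' J(y)` in the bilinear
term contributes `r'² ∑ J_{ik} y_k (y'_i - y_i)`, which reverses the sign of the quadratic term. -/
theorem phase_twistedData (J : Matrix (Fin n) (Fin n) ℝ) (x y x' y' : Fin n → ℝ) (r r' : ℝ) :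
    (twistedData J).phase (((x, y), r), ((x', y'), r')) =
      ee (r' ^ 2 / 2 * ∑ i, ∑ k, J i k * y k * (y' i - y i)) * eebar (r' * beta x (y' - y)) := by
  change eebar (r' ^ 2 / 2 * Jform J y (y' - y)) *
    eebar (r' * beta (x + (-r') • Jvec J y) (y' - y)) = _
  have h : ∀ t, ee t = eebar (-t) := fun t => by rw [ee, eebar, neg_neg]
  rw [beta_add_smul_Jvec, h, ← eebar_add, ← eebar_add]
  congr 1
  change _ = -(r' ^ 2 / 2 * Jform J y (y' - y)) + r' * beta x (y' - y)
  ring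

theorem opVTheta_coe (J : Matrix (Fin n) (Fin n) ℝ) (ξ : L2 (KK n × KK n)) :
    (opVTheta J ξ : KK n × KK n → ℂ) =ᵐ[volume]
      fun (((x, y), r), ((x', y'), r')) =>
        (ee (r' ^ 2 / 2 * ∑ i, ∑ k, J i k * y k * (y' i - y i)) : ℂ) *
          (eebar (r' * beta x (y' - y)) : ℂ) *
          ξ (((x - r' • Jvec J y, y), r + r'), ((x' - x + r' • Jvec J y, y' - y), r')) := by
  rw [opVTheta_eq_W]
  filter_upwards [(twistedData J).W_coe ξ] with p hp
  rw [hp]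
  obtain ⟨⟨⟨x, y⟩, r⟩, ⟨⟨x', y'⟩, r'⟩⟩ := p
  have h : (twistedData J).phi (((x, y), r), ((x', y'), r')) =
      (((x - r' • Jvec J y, y), r + r'), ((x' - x + r' • Jvec J y, y' - y), r')) := by
    change (((x + (-r') • Jvec J y, y), r + r'), ((x' - (x + (-r') • Jvec J y), y' - y), r')) = _
    rw [show x + (-r') • Jvec J y = x - r' • Jvec J y by rw [neg_smul, sub_eq_add_neg],
      show x' - (x - r' • Jvec J y) = x' - x + r' • Jvec J y by abel]
  rw [h, phase_twistedData, Circle.coe_mul]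

end Heisenberg

end QG

end

set_option maxHeartbeats 1000000 in
theorem mainTheorem3 (n : ℕ) (hn : 2 ≤ n) (J : Matrix (Fin n) (Fin n) ℝ)
    (hJ : ∀ i k, J k i = -J i k) :
    -- the multiplicative unitary of the matched pair
    (IsMultiplicativeUnitary (opV J) ∧
      (∃ A : NonUnitalStarSubalgebra ℂ (B (KK n)),
        (A : Set (B (KK n))) = leftAlg (opV J) ∧
        StarIsomorphic A (crossedProduct (gammaSystem n)) ∧
        ∃ Δ : A →⋆ₙₐ[ℂ] multiplierAlg (tensorAlg A),
          (∀ a : A, (Δ a : B (KK n × KK n)) = opV J * legFst (a : B (KK n)) * star (opV J)) ∧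
          IsCStarBialgebra A Δ) ∧
      (∃ A' : NonUnitalStarSubalgebra ℂ (B (KK n)),
        (A' : Set (B (KK n))) = rightAlg (opV J) ∧
        StarIsomorphic A' (crossedProduct (alphaSystem J)) ∧
        ∃ Δ' : A' →⋆ₙₐ[ℂ] multiplierAlg (tensorAlg A'),
          (∀ b : A', (Δ' b : B (KK n × KK n)) = star (opV J) * legSnd (b : B (KK n)) * opV J) ∧
          IsCStarBialgebra A' Δ') ∧
      AreMutuallyDual (opV J)) ∧
    -- its perturbation by the cocycle
    (IsCocycleFor (opV J) (opTheta J) ∧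
      IsMultiplicativeUnitary (opVTheta J) ∧
      (∀ ξ : L2 (KK n × KK n), (opVTheta J ξ : KK n × KK n → ℂ) =ᵐ[volume]
        fun (((x, y), r), ((x', y'), r')) =>
          (ee (r' ^ 2 / 2 * ∑ i, ∑ k, J i k * y k * (y' i - y i)) : ℂ) *
            (eebar (r' * beta x (y' - y)) : ℂ) *
            ξ (((x - r' • Jvec J y, y), r + r'), ((x' - x + r' • Jvec J y, y' - y), r'))) ∧
      (∃ S : NonUnitalStarSubalgebra ℂ (B (KK n)),
        (S : Set (B (KK n))) = leftAlg (opVTheta J) ∧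
        StarIsomorphic S (crossedProduct (gammaSigmaSystem J)) ∧
        ∃ Δ : S →⋆ₙₐ[ℂ] multiplierAlg (tensorAlg S),
          (∀ a : S, (Δ a : B (KK n × KK n)) =
            opVTheta J * legFst (a : B (KK n)) * star (opVTheta J)) ∧
          IsCStarBialgebra S Δ) ∧
      (∃ S' : NonUnitalStarSubalgebra ℂ (B (KK n)),
        (S' : Set (B (KK n))) = rightAlg (opVTheta J) ∧
        StarIsomorphic S' (crossedProduct (alphaSystem J)) ∧
        ∃ Δ' : S' →⋆ₙₐ[ℂ] multiplierAlg (tensorAlg S'),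
          (∀ b : S', (Δ' b : B (KK n × KK n)) =
            star (opVTheta J) * legSnd (b : B (KK n)) * opVTheta J) ∧
          IsCStarBialgebra S' Δ')) := by
  have hV : IsMultiplicativeUnitary (opV J) := by
    rw [opV_eq_W]
    exact (plainData J).isMultiplicativeUnitary_W
  have hVΘ : IsMultiplicativeUnitary (opVTheta J) := by
    rw [opVTheta_eq_W]
    exact (twistedData J).isMultiplicativeUnitary_W
  refine ⟨⟨hV, ?_, ?_, hV.areMutuallyDual⟩,
    isCocycleFor_of_isMultiplicativeUnitary hV (opTheta_mem_unitary J) hVΘ, hVΘ,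
    opVTheta_coe J, ?_, ?_⟩
  · rw [opV_eq_W]
    exact (plainData J).exists_left
  · rw [opV_eq_W]
    exact (plainData J).exists_right
  · rw [opVTheta_eq_W]
    exact (twistedData J).exists_left
  · rw [opVTheta_eq_W]
    exact (twistedData J).exists_right
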